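/- Let $E$ be a non-empty smooth (Hausdorff) manifold of dimension $n+m$ with a torsion-free (smooth) linear connection $\Gamma$ on $TE$, covariant derivative $\nabla$, and give $\mathbb R^n$ its standard flat connection. Let $J^r(E,n)$ be the manifold of $r$-jets $[L]^r_p$ of embedded $n$-dimensional submanifolds $L\ni p$ of $E$, and $J^r\mathrm{pr}_{\mathbb R^n}$ the manifold of $r$-jets $[s]^r_x$ of local sections of $\mathrm{pr}_{\mathbb R^n}\colon\mathbb R^n\times E\to\mathbb R^n$, i.e. of smooth maps $s$ from neighbourhoods of $x\in\mathbb R^n$ to $E$. Let $\operatorname{Imm}J^r\mathrm{pr}_{\mathbb R^n}$ be the open subset of the jets of immersions, and let $\mathrm{pr}_E^{(r)}\colon\operatorname{Imm}J^r\mathrm{pr}_{\mathbb R^n}\to J^r(E,n)$, $[s]^r_x\mapsto[s(U)]^r_{s(x)}$, where $U$ is a small neighbourhood of $x$. The Cartan distribution of a jet space is spanned, at each point, by the tangent planes of the prolongations $\{[L]^r_p: p\in L\}$ of submanifolds, respectively $\{[s]^r_x\}$ of sections. Let $\mathcal S\subset J^2(E,n)$ be the equation of unparametrized totally geodesic submanifolds: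 $[L]^2_p\in\mathcal S$ iff the second fundamental form $(v,Y)\mapsto\nabla_vY \bmod T_pL$ of $L$ vanishes at $p$. Let $\mathcal S_{\mathrm{pr}_{\mathbb R^n}}\subset\operatorname{Imm}J^2\mathrm{pr}_{\mathbb R^n}$ be the equation of parametrized ones: $[s]^2_x\in\mathcal S_{\mathrm{pr}_{\mathbb R^n}}$ iff $\nabla_v(ds\,Y)-ds(\partial_vY)=0$ at $x$ for all $v\in\mathbb R^n$ and all vector fields $Y$ on $\mathbb R^n$. An affine automorphism $g\in\operatorname{Aff}(\mathbb R^n)$ acts on $J^r\mathrm{pr}_{\mathbb R^n}$ by $[s]^r_x\mapsto[s\circ g^{-1}]^r_{g(x)}$. Then the following hold. 1. $\operatorname{Aff}(\mathbb R^n)$ is a Lie subgroup of the external symmetries of $\mathcal S_{\mathrm{pr}_{\mathbb R^n}}$: this action of the Lie group $\operatorname{Aff}(\mathbb R^n)$ on $J^2\mathrm{pr}_{\mathbb R^n}$ is smooth and effective, and each of its transformations is a diffeomorphism which preserves the Cartan distribution and maps $\mathcal S_{\mathrm{pr}_{\mathbb R^n}}$ onto itself. 2. $\operatorname{Imm}J^1\mathrm{pr}_{\mathbb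 R^n}/\operatorname{Aff}(\mathbb R^n)\simeq J^1(E,n)$: the set $\operatorname{Imm}J^1\mathrm{pr}_{\mathbb R^n}$ is invariant, and $\mathrm{pr}_E^{(1)}$ is a well-defined smooth surjective submersion onto $J^1(E,n)$ whose fibres are exactly the $\operatorname{Aff}(\mathbb R^n)$-orbits. 3. $\mathcal S$ is the quotient of $\mathcal S_{\mathrm{pr}_{\mathbb R^n}}$ by $\operatorname{Aff}(\mathbb R^n)$: the map $\mathrm{pr}_E^{(2)}$ is well defined and restricts to a smooth surjective submersion $\mathcal S_{\mathrm{pr}_{\mathbb R^n}}\to\mathcal S$ whose fibres are exactly the $\operatorname{Aff}(\mathbb R^n)$-orbits, and its tangent map sends, for each $\theta\in\mathcal S_{\mathrm{pr}_{\mathbb R^n}}$, the induced Cartan plane (the intersection of the Cartan plane with the tangent space of the equation) of $\mathcal S_{\mathrm{pr}_{\mathbb R^n}}$ at $\theta$ isomorphically onto that of $\mathcal S$ at $\mathrm{pr}_E^{(2)}(\theta)$. -/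

import Mathlib

open scoped Manifold ContDiff Topology

noncomputable section

namespace GeodesicJets

/-- The Euclidean space `ℝⁿ`. -/
abbrev Rn (n : ℕ) := EuclideanSpace ℝ (Fin n)

/-- The model space `ℝ^{n+m} = ℝⁿ × ℝᵐ` of `E`. -/
abbrev Rnm (n m : ℕ) := Rn n × Rn m

/-- The group of the affine automorphisms of `ℝⁿ` (under composition). -/
abbrev Aff (n : ℕ) := Rn n ≃ᵃ[ℝ] Rn n

/-- The space of the coordinates `(a^λ_ξ, b^λ)` of `Aff(ℝⁿ)`. -/
abbrev AffModel (n : ℕ) := (Rn n →L[ℝ] Rn n) × Rn n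

/-! ### Generalities on manifolds -/

/-- The subspace of the symmetric bilinear maps `V × V → F`. -/
def symBilin (V F : Type*) [NormedAddCommGroup V] [NormedSpace ℝ V]
    [NormedAddCommGroup F] [NormedSpace ℝ F] : Submodule ℝ (V →L[ℝ] V →L[ℝ] F) where
  carrier := {B | ∀ v w, B v w = B w v}
  add_mem' := by
    intro a b ha hb v w
    simp [ha v w, hb v w]
  zero_mem' := by
    intro v w
    simp
  smul_mem' := by
    intro c a ha v w
    simp [ha v w]

section SymBilin

variable (V F : Type*) [NormedAddCommGroup V] [NormedSpace ℝ V]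
  [NormedAddCommGroup F] [NormedSpace ℝ F]

/-- The normed space of the symmetric bilinear maps `V × V → F`. -/
def SymBilin : Type _ := ↥(symBilin V F)

instance : NormedAddCommGroup (SymBilin V F) :=
  inferInstanceAs (NormedAddCommGroup (symBilin V F))

instance : Module ℝ (SymBilin V F) := inferInstanceAs (Module ℝ (symBilin V F))

instance : NormedSpace ℝ (SymBilin V F) where
  norm_smul_le a b := ContinuousLinearMap.opNorm_smul_le a (b : symBilin V F).1

variable {V F}

/-- A symmetric bilinear map, as a bilinear map. -/
def SymBilin.toBilin (B : SymBilin V F) : V →L[ℝ] V →L[ℝ] F := Subtype.val B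

end SymBilin

/-- `X`, with the given topology and charts, is a smooth manifold modelled on the normed space `B`,
and each of the coordinate systems prescribed by `R` is a smooth chart of `X`. When `R i` determines
the domain and the coordinate functions of the `i`-th coordinate system and these domains cover `X`,
this determines the manifold structure (topology and maximal atlas) of `X`. -/
def HasCharts (B : Type*) [NormedAddCommGroup B] [NormedSpace ℝ B] (X : Type*)
    [TopologicalSpace X] [ChartedSpace B X] {ι : Type*}
    (R : ι → OpenPartialHomeomorph X B → Prop) : Prop :=
  IsManifold 𝓘(ℝ, B) ∞ X ∧ ∀ i, ∃ e ∈ IsManifold.maximalAtlas 𝓘(ℝ, B) ∞ X, R i e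

/-- The velocities at `x` of the smooth curves which pass through `x` at time `0` and
remain in `A`. If `A` is a submanifold through `x`, this is its tangent space at `x`. -/
def tangentVectors (B : Type*) [NormedAddCommGroup B] [NormedSpace ℝ B] {X : Type*}
    [TopologicalSpace X] [ChartedSpace B X] (A : Set X) (x : X) :
    Set (TangentSpace 𝓘(ℝ, B) x) :=
  {v | ∃ γ : ℝ → X, ContMDiffAt 𝓘(ℝ, ℝ) 𝓘(ℝ, B) ∞ γ 0 ∧ γ 0 = x ∧ (∀ᶠ t in 𝓝 (0 : ℝ), γ t ∈ A) ∧
    (mfderiv 𝓘(ℝ, ℝ) 𝓘(ℝ, B) γ 0 (1 : ℝ) : B) = (v : B)}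

/-- The vector field `Z` on `E` is smooth at `p`. -/
def VFieldSmoothAt (F : Type*) [NormedAddCommGroup F] [NormedSpace ℝ F] {E : Type*}
    [TopologicalSpace E] [ChartedSpace F E] [IsManifold 𝓘(ℝ, F) ∞ E]
    (Z : ∀ q : E, TangentSpace 𝓘(ℝ, F) q) (p : E) : Prop :=
  ContMDiffAt 𝓘(ℝ, F) 𝓘(ℝ, F).tangent ∞ (fun q => (⟨q, Z q⟩ : TangentBundle 𝓘(ℝ, F) E)) p

/-- Torsion-free (smooth, linear) connections on the tangent bundle of `E`. -/
def IsTorsionFreeConnection {F : Type*} [NormedAddCommGroup F] [NormedSpace ℝ F]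
    [FiniteDimensional ℝ F] [CompleteSpace F] {E : Type*} [TopologicalSpace E] [ChartedSpace F E]
    [IsManifold 𝓘(ℝ, F) ∞ E]
    (Γ : CovariantDerivative 𝓘(ℝ, F) F (TangentSpace 𝓘(ℝ, F) : E → Type _)) : Prop :=
  CovariantDerivative.ContMDiffCovariantDerivative Γ ∞ ∧ Γ.torsion = 0

section Parametrized

/-! ### Jets of local sections of `pr_V : V × E → V`

A local section is identified with its component in `E`, a smooth map defined near a point. -/

variable (V F E : Type*) [NormedAddCommGroup V] [NormedSpace ℝ V]
  [NormedAddCommGroup F] [NormedSpace ℝ F]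
  [TopologicalSpace E] [ChartedSpace F E]

/-- A point `pt` of the parameter space `V`, with a map to `E` that is smooth near `pt`
(its values away from `pt` are irrelevant). -/
@[ext]
structure LocalMap where
  pt : V
  toFun : V → E
  smooth : ∀ᶠ x in 𝓝 pt, ContMDiffAt 𝓘(ℝ, V) 𝓘(ℝ, F) ∞ toFun x

variable {V F E}

/-- Equality of the `1`-jets, in all charts of `E` (equivalently, in one chart). -/
def LocalMap.Contact1 (a b : LocalMap V F E) : Prop :=
  a.pt = b.pt ∧ a.toFun a.pt = b.toFun b.pt ∧
    ∀ φ ∈ IsManifold.maximalAtlas 𝓘(ℝ, F) ∞ E, a.toFun a.pt ∈ φ.source →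
      fderiv ℝ (φ ∘ a.toFun) a.pt = fderiv ℝ (φ ∘ b.toFun) b.pt

/-- Equality of the `2`-jets, in all charts of `E` (equivalently, in one chart). -/
def LocalMap.Contact2 (a b : LocalMap V F E) : Prop :=
  a.Contact1 b ∧
    ∀ φ ∈ IsManifold.maximalAtlas 𝓘(ℝ, F) ∞ E, a.toFun a.pt ∈ φ.source →
      fderiv ℝ (fderiv ℝ (φ ∘ a.toFun)) a.pt = fderiv ℝ (fderiv ℝ (φ ∘ b.toFun)) b.pt

variable (V F E)

def mapSetoid1 : Setoid (LocalMap V F E) where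
  r := LocalMap.Contact1
  iseqv :=
    { refl := fun _ => ⟨rfl, rfl, fun _ _ _ => rfl⟩
      symm := fun h => ⟨h.1.symm, h.2.1.symm, fun φ hφ hm => (h.2.2 φ hφ (h.2.1 ▸ hm)).symm⟩
      trans := fun h k => ⟨h.1.trans k.1, h.2.1.trans k.2.1,
        fun φ hφ hm => (h.2.2 φ hφ hm).trans (k.2.2 φ hφ (h.2.1 ▸ hm))⟩ }

def mapSetoid2 : Setoid (LocalMap V F E) where
  r := LocalMap.Contact2
  iseqv :=
    { refl := fun a => ⟨(mapSetoid1 V F E).refl a, fun _ _ _ => rfl⟩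
      symm := fun h => ⟨(mapSetoid1 V F E).symm h.1,
        fun φ hφ hm => (h.2 φ hφ (h.1.2.1 ▸ hm)).symm⟩
      trans := fun h k => ⟨(mapSetoid1 V F E).trans h.1 k.1,
        fun φ hφ hm => (h.2 φ hφ hm).trans (k.2 φ hφ (h.1.2.1 ▸ hm))⟩ }

/-- `J¹pr_V`, the bundle of `1`-jets of local sections of `V × E → V`. -/
def MapJet1 : Type _ := Quotient (mapSetoid1 V F E)

/-- `J²pr_V`, the bundle of `2`-jets of local sections of `V × E → V`. -/
def MapJet2 : Type _ := Quotient (mapSetoid2 V F E)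

/-- The space of the coordinates `(x, u, u_x)`. -/
abbrev MapModel1 := V × F × (V →L[ℝ] F)

/-- The space of the coordinates `(x, u, u_x, u_xx)`. -/
abbrev MapModel2 := V × F × (V →L[ℝ] F) × SymBilin V F

variable {V F E}

/-- The `1`-jet `[s]¹_x`. -/
def LocalMap.jet1 (a : LocalMap V F E) : MapJet1 V F E := Quotient.mk (mapSetoid1 V F E) a

/-- The `2`-jet `[s]²_x`. -/
def LocalMap.jet2 (a : LocalMap V F E) : MapJet2 V F E := Quotient.mk (mapSetoid2 V F E) a

/-- `s` is an immersion at the marked point. -/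
def LocalMap.IsImmersive (a : LocalMap V F E) : Prop :=
  Function.Injective (mfderiv 𝓘(ℝ, V) 𝓘(ℝ, F) a.toFun a.pt)

variable (V F E)

/-- `Imm J¹pr_V`: the `1`-jets of immersions. -/
def ImmJet1 : Set (MapJet1 V F E) := {θ | ∃ a : LocalMap V F E, a.IsImmersive ∧ a.jet1 = θ}

/-- `Imm J²pr_V`: the `2`-jets of immersions. -/
def ImmJet2 : Set (MapJet2 V F E) := {θ | ∃ a : LocalMap V F E, a.IsImmersive ∧ a.jet2 = θ}

variable {V F E}

/-- `e` is the coordinate system `(x, u, u_x)` on `J¹pr_V` induced by the chart `φ` of `E`. -/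
structure IsMapChart1 [TopologicalSpace (MapJet1 V F E)] (φ : OpenPartialHomeomorph E F)
    (e : OpenPartialHomeomorph (MapJet1 V F E) (MapModel1 V F)) : Prop where
  mem_source : ∀ a : LocalMap V F E, a.jet1 ∈ e.source ↔ a.toFun a.pt ∈ φ.source
  coord : ∀ a : LocalMap V F E, a.toFun a.pt ∈ φ.source →
    e a.jet1 = (a.pt, φ (a.toFun a.pt), fderiv ℝ (φ ∘ a.toFun) a.pt)

/-- `e` is the coordinate system `(x, u, u_x, u_xx)` on `J²pr_V` induced by the chart `φ`
of `E`. -/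
structure IsMapChart2 [TopologicalSpace (MapJet2 V F E)] (φ : OpenPartialHomeomorph E F)
    (e : OpenPartialHomeomorph (MapJet2 V F E) (MapModel2 V F)) : Prop where
  mem_source : ∀ a : LocalMap V F E, a.jet2 ∈ e.source ↔ a.toFun a.pt ∈ φ.source
  coord : ∀ a : LocalMap V F E, a.toFun a.pt ∈ φ.source →
    (e a.jet2).1 = a.pt ∧
    (e a.jet2).2.1 = φ (a.toFun a.pt) ∧
    (e a.jet2).2.2.1 = fderiv ℝ (φ ∘ a.toFun) a.pt ∧
    (e a.jet2).2.2.2.toBilin = fderiv ℝ (fderiv ℝ (φ ∘ a.toFun)) a.pt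

variable (V F E)

/-- The manifold structure of `J¹pr_V`. -/
def IsMapJetManifold1 [TopologicalSpace (MapJet1 V F E)]
    [ChartedSpace (MapModel1 V F) (MapJet1 V F E)] : Prop :=
  HasCharts (MapModel1 V F) (MapJet1 V F E)
    (fun φ : IsManifold.maximalAtlas 𝓘(ℝ, F) ∞ E => IsMapChart1 φ.1)

/-- The manifold structure of `J²pr_V`. -/
def IsMapJetManifold2 [TopologicalSpace (MapJet2 V F E)]
    [ChartedSpace (MapModel2 V F) (MapJet2 V F E)] : Prop :=
  HasCharts (MapModel2 V F) (MapJet2 V F E)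
    (fun φ : IsManifold.maximalAtlas 𝓘(ℝ, F) ∞ E => IsMapChart2 φ.1)

variable {V F E}

/-- The image of the prolongation `x ↦ [s]²_x` of a section. -/
def LocalMap.prolongation2 (a : LocalMap V F E) : Set (MapJet2 V F E) :=
  {θ | ∃ b : LocalMap V F E, b.toFun = a.toFun ∧ b.jet2 = θ}

/-- The Cartan distribution of `J²pr_V`: the span of the tangent planes of the prolongations
of sections. -/
def mapCartan [TopologicalSpace (MapJet2 V F E)] [ChartedSpace (MapModel2 V F) (MapJet2 V F E)]
    (θ : MapJet2 V F E) : Submodule ℝ (TangentSpace 𝓘(ℝ, MapModel2 V F) θ) :=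
  Submodule.span ℝ {v | ∃ a : LocalMap V F E, a.jet2 = θ ∧
    v ∈ tangentVectors (MapModel2 V F) a.prolongation2 θ}

/-- The (classical) external symmetries of an equation `S ⊆ J²pr_V`: the diffeomorphisms of
`J²pr_V` which preserve the Cartan distribution (contact transformations) and map `S` onto `S`. -/
structure IsExternalSymmetry [TopologicalSpace (MapJet2 V F E)]
    [ChartedSpace (MapModel2 V F) (MapJet2 V F E)]
    (S : Set (MapJet2 V F E)) (G : Equiv.Perm (MapJet2 V F E)) : Prop where
  smooth : ContMDiff 𝓘(ℝ, MapModel2 V F) 𝓘(ℝ, MapModel2 V F) ∞ G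
  smooth_symm : ContMDiff 𝓘(ℝ, MapModel2 V F) 𝓘(ℝ, MapModel2 V F) ∞ G.symm
  contact : ∀ θ : MapJet2 V F E, (mapCartan θ).map
    (mfderiv 𝓘(ℝ, MapModel2 V F) 𝓘(ℝ, MapModel2 V F) G θ).toLinearMap = mapCartan (G θ)
  preserves : G '' S = S

/-- The second fundamental form of the parametrized submanifold `s` vanishes at `x`, with respect to
the connection `Γ` on `E` and the flat connection of the parameter space `V`:
`∇_v (ds Y) - ds (∂_v Y) = 0` at `x` for all `v` and all vector fields `Y` on `V`. Here
`∇_v (ds Y)` is the derivative of a vector field along `s`; as `s` is an immersion, it is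
computed with an extension `Z` of `ds Y` to `E`. -/
def LocalMap.IsGeodesic [IsManifold 𝓘(ℝ, F) ∞ E]
    (Γ : CovariantDerivative 𝓘(ℝ, F) F (TangentSpace 𝓘(ℝ, F) : E → Type _))
    (a : LocalMap V F E) : Prop :=
  ∀ (Y : V → V) (Z : ∀ q : E, TangentSpace 𝓘(ℝ, F) q),
    ContDiffAt ℝ ∞ Y a.pt → VFieldSmoothAt F Z (a.toFun a.pt) →
    (∀ᶠ x in 𝓝 a.pt, Z (a.toFun x) = mfderiv 𝓘(ℝ, V) 𝓘(ℝ, F) a.toFun x (Y x)) →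
    ∀ v : V,
      Γ Z (a.toFun a.pt) (mfderiv 𝓘(ℝ, V) 𝓘(ℝ, F) a.toFun a.pt v)
        - mfderiv 𝓘(ℝ, V) 𝓘(ℝ, F) a.toFun a.pt (fderiv ℝ Y a.pt v) = 0

/-- The equation of parametrized totally geodesic submanifolds, a subset of `Imm J²pr_V`. -/
def parametrizedEq (V : Type*) [NormedAddCommGroup V] [NormedSpace ℝ V]
    [IsManifold 𝓘(ℝ, F) ∞ E]
    (Γ : CovariantDerivative 𝓘(ℝ, F) F (TangentSpace 𝓘(ℝ, F) : E → Type _)) :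
    Set (MapJet2 V F E) :=
  {θ | ∃ a : LocalMap V F E, a.IsImmersive ∧ a.IsGeodesic Γ ∧ a.jet2 = θ}

/-! ### The affine group and its action by reparametrization -/

section Affine

variable [FiniteDimensional ℝ V]

/-- The linear part of `g`. -/
def linPart (g : V ≃ᵃ[ℝ] V) : V →L[ℝ] V := LinearMap.toContinuousLinearMap (g.linear : V →ₗ[ℝ] V)

theorem affine_eq (g : V ≃ᵃ[ℝ] V) : (g : V → V) = fun x => linPart g x + g 0 := by
  funext x
  have := (g : V →ᵃ[ℝ] V).map_vadd 0 x
  simpa [linPart] using this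

theorem affine_contDiff (g : V ≃ᵃ[ℝ] V) : ContDiff ℝ ∞ g := by
  rw [affine_eq]
  exact (linPart g).contDiff.add contDiff_const

/-- The action of `g × id` on sections of `V × E → V`: the image of the graph of `s` is the graph
of `s ∘ g⁻¹`. -/
instance : SMul (V ≃ᵃ[ℝ] V) (LocalMap V F E) where
  smul g a :=
    { pt := g a.pt
      toFun := fun x => a.toFun (g.symm x)
      smooth := by
        have hc : Filter.Tendsto g.symm (𝓝 (g a.pt)) (𝓝 a.pt) := by
          have h := (affine_contDiff g.symm).continuous.tendsto (g a.pt)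
          rwa [AffineEquiv.symm_apply_apply] at h
        filter_upwards [hc.eventually a.smooth] with x hx
        exact ContMDiffAt.comp x hx (affine_contDiff g.symm).contMDiff.contMDiffAt }

theorem smul_pt (g : V ≃ᵃ[ℝ] V) (a : LocalMap V F E) : (g • a).pt = g a.pt := rfl

theorem smul_toFun (g : V ≃ᵃ[ℝ] V) (a : LocalMap V F E) :
    (g • a).toFun = a.toFun ∘ g.symm := rfl

instance : MulAction (V ≃ᵃ[ℝ] V) (LocalMap V F E) where
  one_smul _ := LocalMap.ext rfl rfl
  mul_smul _ _ _ := LocalMap.ext rfl rfl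

/-- The coordinates `(a^λ_ξ, b^λ)` of the affine group. -/
structure IsAffChart [TopologicalSpace (V ≃ᵃ[ℝ] V)]
    (e : OpenPartialHomeomorph (V ≃ᵃ[ℝ] V) ((V →L[ℝ] V) × V)) : Prop where
  source : e.source = Set.univ
  coord : ∀ g, e g = (linPart g, g 0)

/-- The manifold structure of the affine group. -/
def IsAffManifold (V : Type*) [NormedAddCommGroup V] [NormedSpace ℝ V] [FiniteDimensional ℝ V]
    [TopologicalSpace (V ≃ᵃ[ℝ] V)] [ChartedSpace ((V →L[ℝ] V) × V) (V ≃ᵃ[ℝ] V)] : Prop :=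
  HasCharts ((V →L[ℝ] V) × V) (V ≃ᵃ[ℝ] V) (fun _ : Unit => IsAffChart)

theorem affine_hasFDerivAt (g : V ≃ᵃ[ℝ] V) (x : V) : HasFDerivAt g (linPart g) x := by
  rw [affine_eq]
  exact (linPart g).hasFDerivAt.add_const _

theorem fderiv_comp_affine (g : V ≃ᵃ[ℝ] V) (h : V → F) (x : V)
    (hh : DifferentiableAt ℝ h (g x)) :
    fderiv ℝ (h ∘ g) x = (fderiv ℝ h (g x)).comp (linPart g) :=
  (hh.hasFDerivAt.comp x (affine_hasFDerivAt g x)).fderiv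

theorem fderiv_fderiv_comp_affine (g : V ≃ᵃ[ℝ] V) (h : V → F) (x : V)
    (hh : ContDiffAt ℝ 2 h (g x)) :
    fderiv ℝ (fderiv ℝ (h ∘ g)) x =
      (((ContinuousLinearMap.compL ℝ V V F).flip (linPart g)).comp
        (fderiv ℝ (fderiv ℝ h) (g x))).comp (linPart g) := by
  have hg : Filter.Tendsto g (𝓝 x) (𝓝 (g x)) := (affine_contDiff g).continuous.tendsto x
  have hev : fderiv ℝ (h ∘ g) =ᶠ[𝓝 x]
      fun y => ((ContinuousLinearMap.compL ℝ V V F).flip (linPart g)) (fderiv ℝ h (g y)) := by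
    have h1 : ∀ᶠ z in 𝓝 (g x), ContDiffAt ℝ 2 h z := hh.eventually (by simp)
    filter_upwards [hg.eventually h1] with y hy
    rw [fderiv_comp_affine g h y (hy.differentiableAt (by simp))]
    rfl
  rw [hev.fderiv_eq]
  have hd : DifferentiableAt ℝ (fderiv ℝ h) (g x) :=
    (hh.fderiv_right (m := 1) (by norm_num)).differentiableAt (by simp)
  have := (((ContinuousLinearMap.compL ℝ V V F).flip (linPart g)).hasFDerivAt.comp x
    (hd.hasFDerivAt.comp x (affine_hasFDerivAt g x))).fderiv
  exact this

theorem chart_comp_contDiffAt (a : LocalMap V F E) {φ : OpenPartialHomeomorph E F}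
    (hφ : φ ∈ IsManifold.maximalAtlas 𝓘(ℝ, F) ∞ E) (hm : a.toFun a.pt ∈ φ.source) :
    ContDiffAt ℝ ∞ (φ ∘ a.toFun) a.pt := by
  rw [← contMDiffAt_iff_contDiffAt]
  exact (contMDiffAt_of_mem_maximalAtlas hφ hm).comp a.pt a.smooth.self_of_nhds

theorem contact1_smul (g : V ≃ᵃ[ℝ] V) {a b : LocalMap V F E} (h : a.Contact1 b) :
    (g • a).Contact1 (g • b) := by
  have hs : ∀ c : LocalMap V F E, (g • c).toFun (g • c).pt = c.toFun c.pt := by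
    intro c
    simp [smul_pt, smul_toFun]
  have hb : ∀ c : LocalMap V F E, g.symm (g • c).pt = c.pt := by
    intro c
    simp [smul_pt]
  refine ⟨congrArg g h.1, by rw [hs, hs]; exact h.2.1, ?_⟩
  intro φ hφ hm
  rw [hs] at hm
  have key : ∀ c : LocalMap V F E, c.toFun c.pt ∈ φ.source →
      fderiv ℝ (φ ∘ (g • c).toFun) (g • c).pt =
        (fderiv ℝ (φ ∘ c.toFun) c.pt).comp (linPart g.symm) := by
    intro c hc
    have hd := chart_comp_contDiffAt c hφ hc
    have := fderiv_comp_affine g.symm (φ ∘ c.toFun) (g • c).pt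
      (by rw [hb]; exact hd.differentiableAt (by simp))
    rw [hb] at this
    exact this
  rw [key a hm, key b (h.2.1 ▸ hm), h.2.2 φ hφ hm]

theorem contact2_smul (g : V ≃ᵃ[ℝ] V) {a b : LocalMap V F E} (h : a.Contact2 b) :
    (g • a).Contact2 (g • b) := by
  have hs : ∀ c : LocalMap V F E, (g • c).toFun (g • c).pt = c.toFun c.pt := by
    intro c
    simp [smul_pt, smul_toFun]
  have hb : ∀ c : LocalMap V F E, g.symm (g • c).pt = c.pt := by
    intro c
    simp [smul_pt]
  refine ⟨contact1_smul g h.1, ?_⟩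
  intro φ hφ hm
  rw [hs] at hm
  have key : ∀ c : LocalMap V F E, c.toFun c.pt ∈ φ.source →
      fderiv ℝ (fderiv ℝ (φ ∘ (g • c).toFun)) (g • c).pt =
        (((ContinuousLinearMap.compL ℝ V V F).flip (linPart g.symm)).comp
          (fderiv ℝ (fderiv ℝ (φ ∘ c.toFun)) c.pt)).comp (linPart g.symm) := by
    intro c hc
    have hd := (chart_comp_contDiffAt c hφ hc).of_le (m := 2) (by norm_cast)
    have := fderiv_fderiv_comp_affine g.symm (φ ∘ c.toFun) (g • c).pt (by rw [hb]; exact hd)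
    rw [hb] at this
    exact this
  rw [key a hm, key b (h.1.2.1 ▸ hm), h.2 φ hφ hm]

/-- The lift `(g × id)^{(1)}` to `J¹pr_V`. -/
instance : MulAction (V ≃ᵃ[ℝ] V) (MapJet1 V F E) where
  smul g := Quotient.map (sa := mapSetoid1 V F E) (sb := mapSetoid1 V F E) (g • ·)
    (fun _ _ h => contact1_smul g h)
  one_smul θ := Quotient.inductionOn θ fun a => congrArg LocalMap.jet1 (one_smul _ a)
  mul_smul g h θ := Quotient.inductionOn θ fun a => congrArg LocalMap.jet1 (mul_smul g h a)

/-- The lift `(g × id)^{(2)}` to `J²pr_V`. -/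
instance : MulAction (V ≃ᵃ[ℝ] V) (MapJet2 V F E) where
  smul g := Quotient.map (sa := mapSetoid2 V F E) (sb := mapSetoid2 V F E) (g • ·)
    (fun _ _ h => contact2_smul g h)
  one_smul θ := Quotient.inductionOn θ fun a => congrArg LocalMap.jet2 (one_smul _ a)
  mul_smul g h θ := Quotient.inductionOn θ fun a => congrArg LocalMap.jet2 (mul_smul g h a)

theorem smul_jet1 (g : V ≃ᵃ[ℝ] V) (a : LocalMap V F E) : g • a.jet1 = (g • a).jet1 := rfl

theorem smul_jet2 (g : V ≃ᵃ[ℝ] V) (a : LocalMap V F E) : g • a.jet2 = (g • a).jet2 := rfl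

end Affine

end Parametrized

section Unparametrized

/-! ### Jets of submanifolds

`E` is modelled on `V × W`, so that every chart of its maximal atlas is a divided chart
`(u^λ, u^i)`; submanifolds have the dimension of `V`. -/

variable (V W E : Type*) [NormedAddCommGroup V] [NormedSpace ℝ V]
  [NormedAddCommGroup W] [NormedSpace ℝ W]
  [TopologicalSpace E] [ChartedSpace (V × W) E]

variable {V W E}

/-- The divided chart `φ` at `p` is concordant to `L`: near `p`, the set `L` is the graph
`u^i = f^i(u^λ)` of a smooth `f`. -/
structure IsGraphAt (φ : OpenPartialHomeomorph E (V × W)) (L : Set E) (p : E) (f : V → W) :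
    Prop where
  mem_source : p ∈ φ.source
  smooth : ∀ᶠ u in 𝓝 (φ p).1, ContDiffAt ℝ ∞ f u
  graph : ∀ᶠ q in 𝓝 p, (q ∈ L ↔ (φ q).2 = f (φ q).1)

variable (V W)

/-- `L` is an embedded submanifold of `E` of dimension `dim V`. -/
def IsSubmanifold (L : Set E) : Prop :=
  ∀ p ∈ L, ∃ φ ∈ IsManifold.maximalAtlas 𝓘(ℝ, V × W) ∞ E, ∃ f : V → W, IsGraphAt φ L p f

variable (E)

/-- An embedded submanifold with a marked point. -/
structure PointedSub where
  carrier : Set E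
  isSub : IsSubmanifold V W carrier
  pt : E
  mem : pt ∈ carrier

variable {V W E}

/-- The pair `(f, Df)` at `p`, where `f` describes `L` near `p` in the divided chart `φ`; this set
has at most one element, and is empty if `φ` is not concordant to `L`. -/
def graphData1 (φ : OpenPartialHomeomorph E (V × W)) (L : Set E) (p : E) : Set (W × (V →L[ℝ] W)) :=
  {d | ∃ f, IsGraphAt φ L p f ∧ d = (f (φ p).1, fderiv ℝ f (φ p).1)}

/-- The triple `(f, Df, D²f)` at `p`, where `f` describes `L` near `p` in the divided chart `φ`. -/
def graphData2 (φ : OpenPartialHomeomorph E (V × W)) (L : Set E) (p : E) :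
    Set (W × (V →L[ℝ] W) × (V →L[ℝ] V →L[ℝ] W)) :=
  {d | ∃ f, IsGraphAt φ L p f ∧
    d = (f (φ p).1, fderiv ℝ f (φ p).1, fderiv ℝ (fderiv ℝ f) (φ p).1)}

variable (V W E)

/-- Contact of order `1` at a point, in all divided charts (equivalently, in one that is concordant
to both submanifolds). -/
def subSetoid1 : Setoid (PointedSub V W E) where
  r a b := a.pt = b.pt ∧ ∀ φ ∈ IsManifold.maximalAtlas 𝓘(ℝ, V × W) ∞ E,
    graphData1 φ a.carrier a.pt = graphData1 φ b.carrier b.pt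
  iseqv :=
    { refl := fun _ => ⟨rfl, fun _ _ => rfl⟩
      symm := fun h => ⟨h.1.symm, fun φ hφ => (h.2 φ hφ).symm⟩
      trans := fun h k => ⟨h.1.trans k.1, fun φ hφ => (h.2 φ hφ).trans (k.2 φ hφ)⟩ }

/-- Contact of order `2` at a point, in all divided charts (equivalently, in one that is concordant
to both submanifolds). -/
def subSetoid2 : Setoid (PointedSub V W E) where
  r a b := a.pt = b.pt ∧ ∀ φ ∈ IsManifold.maximalAtlas 𝓘(ℝ, V × W) ∞ E,
    graphData2 φ a.carrier a.pt = graphData2 φ b.carrier b.pt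
  iseqv :=
    { refl := fun _ => ⟨rfl, fun _ _ => rfl⟩
      symm := fun h => ⟨h.1.symm, fun φ hφ => (h.2 φ hφ).symm⟩
      trans := fun h k => ⟨h.1.trans k.1, fun φ hφ => (h.2 φ hφ).trans (k.2 φ hφ)⟩ }

/-- `J¹(E, n)`, where `n = dim V`. -/
def SubJet1 : Type _ := Quotient (subSetoid1 V W E)

/-- `J²(E, n)`, where `n = dim V`. -/
def SubJet2 : Type _ := Quotient (subSetoid2 V W E)

/-- The space of the coordinates `(u^λ, u^i, u^i_λ)`. -/
abbrev SubModel1 := V × W × (V →L[ℝ] W)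

/-- The space of the coordinates `(u^λ, u^i, u^i_λ, u^i_λξ)`. -/
abbrev SubModel2 := V × W × (V →L[ℝ] W) × SymBilin V W

variable {V W E}

/-- The `1`-jet `[L]¹_p`. -/
def PointedSub.jet1 (a : PointedSub V W E) : SubJet1 V W E := Quotient.mk (subSetoid1 V W E) a

/-- The `2`-jet `[L]²_p`. -/
def PointedSub.jet2 (a : PointedSub V W E) : SubJet2 V W E := Quotient.mk (subSetoid2 V W E) a

/-- `e` is the coordinate system `(u^λ, u^i, u^i_λ)` on `J¹(E, n)` induced by the divided chart `φ`;
its domain consists of the jets of the submanifolds to which `φ` is concordant. -/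
structure IsSubChart1 [TopologicalSpace (SubJet1 V W E)] (φ : OpenPartialHomeomorph E (V × W))
    (e : OpenPartialHomeomorph (SubJet1 V W E) (SubModel1 V W)) : Prop where
  mem_source : ∀ a : PointedSub V W E, a.jet1 ∈ e.source ↔ ∃ f, IsGraphAt φ a.carrier a.pt f
  coord : ∀ (a : PointedSub V W E) (f : V → W), IsGraphAt φ a.carrier a.pt f →
    e a.jet1 = ((φ a.pt).1, f (φ a.pt).1, fderiv ℝ f (φ a.pt).1)

/-- `e` is the coordinate system `(u^λ, u^i, u^i_λ, u^i_λξ)` on `J²(E, n)` induced by the divided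
chart `φ`. -/
structure IsSubChart2 [TopologicalSpace (SubJet2 V W E)] (φ : OpenPartialHomeomorph E (V × W))
    (e : OpenPartialHomeomorph (SubJet2 V W E) (SubModel2 V W)) : Prop where
  mem_source : ∀ a : PointedSub V W E, a.jet2 ∈ e.source ↔ ∃ f, IsGraphAt φ a.carrier a.pt f
  coord : ∀ (a : PointedSub V W E) (f : V → W), IsGraphAt φ a.carrier a.pt f →
    (e a.jet2).1 = (φ a.pt).1 ∧
    (e a.jet2).2.1 = f (φ a.pt).1 ∧
    (e a.jet2).2.2.1 = fderiv ℝ f (φ a.pt).1 ∧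
    (e a.jet2).2.2.2.toBilin = fderiv ℝ (fderiv ℝ f) (φ a.pt).1

variable (V W E)

/-- The manifold structure of `J¹(E, n)`. -/
def IsSubJetManifold1 [TopologicalSpace (SubJet1 V W E)]
    [ChartedSpace (SubModel1 V W) (SubJet1 V W E)] : Prop :=
  HasCharts (SubModel1 V W) (SubJet1 V W E)
    (fun φ : IsManifold.maximalAtlas 𝓘(ℝ, V × W) ∞ E => IsSubChart1 φ.1)

/-- The manifold structure of `J²(E, n)`. -/
def IsSubJetManifold2 [TopologicalSpace (SubJet2 V W E)]
    [ChartedSpace (SubModel2 V W) (SubJet2 V W E)] : Prop :=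
  HasCharts (SubModel2 V W) (SubJet2 V W E)
    (fun φ : IsManifold.maximalAtlas 𝓘(ℝ, V × W) ∞ E => IsSubChart2 φ.1)

variable {V W E}

/-- The prolongation `L^{(2)} = {[L]²_q : q ∈ L}`. -/
def PointedSub.prolongation2 (a : PointedSub V W E) : Set (SubJet2 V W E) :=
  {θ | ∃ b : PointedSub V W E, b.carrier = a.carrier ∧ b.jet2 = θ}

/-- The Cartan distribution of `J²(E, n)`: the span of the tangent planes of the prolongations of
submanifolds. -/
def subCartan [TopologicalSpace (SubJet2 V W E)] [ChartedSpace (SubModel2 V W) (SubJet2 V W E)]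
    (θ : SubJet2 V W E) : Submodule ℝ (TangentSpace 𝓘(ℝ, SubModel2 V W) θ) :=
  Submodule.span ℝ {v | ∃ a : PointedSub V W E, a.jet2 = θ ∧
    v ∈ tangentVectors (SubModel2 V W) a.prolongation2 θ}

/-- The second fundamental form of `L` at the marked point `p` vanishes: `∇_v Y` belongs to `T_p L`
for every `v ∈ T_p L` and every vector field `Y` on `E` which is tangent to `L` along `L`. -/
def PointedSub.IsGeodesic [IsManifold 𝓘(ℝ, V × W) ∞ E]
    (Γ : CovariantDerivative 𝓘(ℝ, V × W) (V × W) (TangentSpace 𝓘(ℝ, V × W) : E → Type _))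
    (a : PointedSub V W E) : Prop :=
  ∀ Y : ∀ q : E, TangentSpace 𝓘(ℝ, V × W) q, VFieldSmoothAt (V × W) Y a.pt →
    (∀ᶠ q in 𝓝 a.pt, q ∈ a.carrier → Y q ∈ tangentVectors (V × W) a.carrier q) →
    ∀ v ∈ tangentVectors (V × W) a.carrier a.pt,
      Γ Y a.pt v ∈ tangentVectors (V × W) a.carrier a.pt

/-- The equation of unparametrized totally geodesic submanifolds. -/
def unparametrizedEq [IsManifold 𝓘(ℝ, V × W) ∞ E]
    (Γ : CovariantDerivative 𝓘(ℝ, V × W) (V × W) (TangentSpace 𝓘(ℝ, V × W) : E → Type _)) :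
    Set (SubJet2 V W E) :=
  {θ | ∃ a : PointedSub V W E, a.IsGeodesic Γ ∧ a.jet2 = θ}

/-! ### The prolongations of the projection `pr_E : V × E → E` -/

/-- The marked point of `b` is `s(x)` and its submanifold is the image `s(U)` of a neighbourhood
`U` of `x` on which `s` is an immersion. -/
def IsImageOf (a : LocalMap V (V × W) E) (b : PointedSub V W E) : Prop :=
  b.pt = a.toFun a.pt ∧ ∃ U : Set V, IsOpen U ∧ a.pt ∈ U ∧ b.carrier = a.toFun '' U ∧
    ∀ x ∈ U, ContMDiffAt 𝓘(ℝ, V) 𝓘(ℝ, V × W) ∞ a.toFun x ∧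
      Function.Injective (mfderiv 𝓘(ℝ, V) 𝓘(ℝ, V × W) a.toFun x)

/-- The graph of `pr_E^{(1)}`, which maps `[s]¹_x` to `[s(U)]¹_{s(x)}`. -/
def Prolongs1 (θ : MapJet1 V (V × W) E) (η : SubJet1 V W E) : Prop :=
  ∃ (a : LocalMap V (V × W) E) (b : PointedSub V W E), IsImageOf a b ∧ a.jet1 = θ ∧ b.jet1 = η

/-- The graph of `pr_E^{(2)}`, which maps `[s]²_x` to `[s(U)]²_{s(x)}`. -/
def Prolongs2 (θ : MapJet2 V (V × W) E) (η : SubJet2 V W E) : Prop :=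
  ∃ (a : LocalMap V (V × W) E) (b : PointedSub V W E), IsImageOf a b ∧ a.jet2 = θ ∧ b.jet2 = η

theorem exists_pointedSub [IsManifold 𝓘(ℝ, V × W) ∞ E] (p : E) : Nonempty (PointedSub V W E) := by
  have hp := mem_chart_source (V × W) p
  refine ⟨{ carrier := {q | q ∈ (chartAt (V × W) p).source ∧
              (chartAt (V × W) p q).2 = (chartAt (V × W) p p).2}
            isSub := ?_
            pt := p
            mem := ⟨hp, rfl⟩ }⟩
  rintro q ⟨hq, -⟩
  refine ⟨chartAt (V × W) p, IsManifold.chart_mem_maximalAtlas p,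
    fun _ => (chartAt (V × W) p p).2, hq, Filter.Eventually.of_forall fun _ => contDiffAt_const, ?_⟩
  filter_upwards [(chartAt (V × W) p).open_source.mem_nhds hq] with r hr
  exact ⟨fun h => h.2, fun h => ⟨hr, h⟩⟩

/-- `pr_E^{(1)} : Imm J¹pr_V → J¹(E, n)`, the map with graph `Prolongs1` (with arbitrary values
outside `Imm J¹pr_V`). -/
def proE1 [IsManifold 𝓘(ℝ, V × W) ∞ E] (θ : MapJet1 V (V × W) E) : SubJet1 V W E :=
  @Classical.epsilon _
    (by
      obtain ⟨a, -⟩ := Quotient.exists_rep θ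
      obtain ⟨b⟩ := exists_pointedSub (V := V) (W := W) (a.toFun a.pt)
      exact ⟨b.jet1⟩) (Prolongs1 θ)

/-- `pr_E^{(2)} : Imm J²pr_V → J²(E, n)`, the map with graph `Prolongs2` (with arbitrary values
outside `Imm J²pr_V`). -/
def proE2 [IsManifold 𝓘(ℝ, V × W) ∞ E] (θ : MapJet2 V (V × W) E) : SubJet2 V W E :=
  @Classical.epsilon _
    (by
      obtain ⟨a, -⟩ := Quotient.exists_rep θ
      obtain ⟨b⟩ := exists_pointedSub (V := V) (W := W) (a.toFun a.pt)
      exact ⟨b.jet2⟩) (Prolongs2 θ)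

end Unparametrized

/-- The submanifold `A ⊆ X` is invariant under `G`, and `P` identifies the quotient `A / G` with the
submanifold `T ⊆ Y`: `P` maps `A` onto `T`, its fibres in `A` are the `G`-orbits, and `P : A → T` is
a smooth submersion, i.e. it is smooth and has smooth local sections through all points of `A`. -/
structure IsSmoothQuotient {G : Type*} [Group G] {BX BY : Type*}
    [NormedAddCommGroup BX] [NormedSpace ℝ BX] [NormedAddCommGroup BY] [NormedSpace ℝ BY]
    {X Y : Type*} [MulAction G X] [TopologicalSpace X] [ChartedSpace BX X]
    [TopologicalSpace Y] [ChartedSpace BY Y]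
    (A : Set X) (T : Set Y) (P : X → Y) : Prop where
  invariant : ∀ (g : G), ∀ x ∈ A, g • x ∈ A
  image : P '' A = T
  fibres : ∀ x ∈ A, ∀ x' ∈ A, P x = P x' ↔ ∃ g : G, g • x = x'
  smooth : ∀ x ∈ A, ContMDiffAt 𝓘(ℝ, BX) 𝓘(ℝ, BY) ∞ P x
  submersion : ∀ x ∈ A, ∃ σ : Y → X, σ (P x) = x ∧
    (∀ᶠ y in 𝓝 (P x), ContMDiffAt 𝓘(ℝ, BY) 𝓘(ℝ, BX) ∞ σ y) ∧
    ∀ᶠ y in 𝓝 (P x), y ∈ T → σ y ∈ A ∧ P (σ y) = y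

end GeodesicJets

end

open GeodesicJets

/-! In a chart of `E` with values in `V × W`, the `2`-jet of a map `s` has the coordinates `(x, u,
A, B)`: a base point, a value, a first derivative `A : V → V × W` with components `A₁, A₂`, and a
symmetric second derivative `B`. If `A₁` is invertible, the image of `s` is a graph over `V` with
first derivative `C = A₂ A₁⁻¹` (`slope`) and second derivative `(B₂ - C B₁)(A₁⁻¹ ·, A₁⁻¹ ·)`
(`curv`). This is the projection `proE2` in coordinates (`graph_derivatives`,
`IsMapChart2.proE2_apply`). A linear change of any chart provides such a chart for each immersion
(`LocalMap.IsImmersive.exists_chart`). The manifold structures are glued from these coordinates by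
`exists_hasCharts`, once it is known that a jet is determined by its coordinates in a single chart.

First jets. An affine map has no second derivative, so `x ↦ M x + b` sends `(x, u, A, B)` to `(M x +
b, u, A M⁻¹, B(M⁻¹ ·, M⁻¹ ·))`. Two first jets with the same `u` and the same slope `C` have `A =
(1, C) A₁` and `A' = (1, C) A₁'`, so they differ by the affine map with linear part `A₁'⁻¹ A₁` and
the translation that matches the base points (`exists_affCoord1_eq`). Local sections of the
projection are obtained by freezing `x` and `A₁`.

Second jets. Let `G` be the Christoffel symbol of the connection. The parametrized equation reads `B
= -G(A ·, A ·)`, and the unparametrized one says that the second derivative of the graph is `-(pr₂ -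
C pr₁) G((1, C) ·, (1, C) ·)` (`LocalMap.isGeodesic_iff`, `PointedSub.isGeodesic_iff`). Vanishing
torsion makes `G` symmetric, so the right-hand sides are admissible second derivatives, and both
equations are graphs over the first jets. Applying `pr₂ - C pr₁` to the first equation gives the
second (`MapGeodesicEq.quotCoord2`). Since a jet in the equation is determined by its first jet
(`MapGeodesicEq.ext`), orbits and sections reduce to the case of first jets.

Cartan planes. A Cartan vector `(p, du, dA, dB)` satisfies `du = A p` and `dA = B p`, and tangency
to the equation determines `dB` from the rest. The induced plane is thus a copy of `V` with the
parameter `p`; the one on the jets of submanifolds is determined in the same way by its first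
coordinate, and the differential of the projection becomes `p ↦ A₁ p`, which is bijective
(`bijOn_mfderiv_proE2`). That each `p ≠ 0` does occur requires a section whose third derivative,
contracted with `p`, is prescribed (`exists_trilinear_apply_eq`). For submanifolds no such
construction is needed, because prolongations of sections project into prolongations of their images
(`mfderiv_proE2_mem_subCartan`). -/

noncomputable section

namespace GeodesicJets

/-! ### Symmetric bilinear maps and symmetrization -/

section SymBilinLemmas

variable {V F : Type*} [NormedAddCommGroup V] [NormedSpace ℝ V]
  [NormedAddCommGroup F] [NormedSpace ℝ F]

theorem SymBilin.symm_apply (B : SymBilin V F) (v w : V) : B.toBilin v w = B.toBilin w v :=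
  Subtype.property B v w

theorem SymBilin.ext' {B C : SymBilin V F} (h : B.toBilin = C.toBilin) : B = C :=
  Subtype.ext h

/-- A continuous linear map, from its properties. -/
def mkCLM {X Y : Type*} [NormedAddCommGroup X] [NormedSpace ℝ X] [NormedAddCommGroup Y]
    [NormedSpace ℝ Y] (f : X → Y) (h₁ : ∀ x y, f (x + y) = f x + f y)
    (h₂ : ∀ (c : ℝ) x, f (c • x) = c • f x) (h : Continuous f) : X →L[ℝ] Y :=
  { toFun := f, map_add' := h₁, map_smul' := h₂, cont := h }

variable (V F) in
/-- The inclusion of the symmetric bilinear maps into the bilinear maps. -/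
def SymBilin.toBilinL :=
  mkCLM (X := SymBilin V F) (Y := V →L[ℝ] V →L[ℝ] F) SymBilin.toBilin (fun _ _ => rfl)
    (fun _ _ => rfl) continuous_subtype_val

variable (V F) in
/-- The symmetrization `½ (B + Bᵀ)`, with values in the bilinear maps. -/
def symmetrizeBilin : (V →L[ℝ] V →L[ℝ] F) →L[ℝ] (V →L[ℝ] V →L[ℝ] F) :=
  (2⁻¹ : ℝ) • (ContinuousLinearMap.id ℝ _ +
    (ContinuousLinearMap.flipₗᵢ ℝ V V F).toContinuousLinearEquiv.toContinuousLinearMap)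

theorem symmetrizeBilin_apply (B : V →L[ℝ] V →L[ℝ] F) (v w : V) :
    symmetrizeBilin V F B v w = (2⁻¹ : ℝ) • (B v w + B w v) := by
  simp [symmetrizeBilin]

variable (V F) in
/-- The symmetrization `½ (B + Bᵀ)`. -/
def SymBilin.symmetrize :=
  mkCLM (X := V →L[ℝ] V →L[ℝ] F) (Y := SymBilin V F)
    (fun B => ⟨symmetrizeBilin V F B, fun v w => by
      rw [symmetrizeBilin_apply, symmetrizeBilin_apply, add_comm]⟩)
    (fun _ _ => Subtype.ext (map_add _ _ _)) (fun _ _ => Subtype.ext (map_smul _ _ _))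
    ((symmetrizeBilin V F).continuous.subtype_mk _)

/-- Symmetrization is a bounded linear retraction onto `SymBilin`. An expression that is smooth as a
bilinear map and happens to be symmetric thereby becomes a smooth `SymBilin`-valued map, with no
argument about subtypes. -/
theorem SymBilin.toBilin_symmetrize {B : V →L[ℝ] V →L[ℝ] F} (hB : ∀ v w, B v w = B w v) :
    (SymBilin.symmetrize V F B).toBilin = B := by
  ext v w
  change symmetrizeBilin V F B v w = _
  rw [symmetrizeBilin_apply, ← hB v w, ← two_smul ℝ, smul_smul]
  norm_num

@[simp]
theorem SymBilin.symmetrize_toBilin (B : SymBilin V F) :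
    SymBilin.symmetrize V F B.toBilin = B :=
  SymBilin.ext' (SymBilin.toBilin_symmetrize B.symm_apply)

end SymBilinLemmas

/-! ### Manifolds glued from coordinate systems -/

section ManifoldOfCharts

variable {B : Type*} [NormedAddCommGroup B] [NormedSpace ℝ B]

/-- A cover by bijections onto open subsets of `B`, with smooth transition functions, defines a
manifold. -/
theorem exists_hasCharts {X ι : Type*} (e : ι → PartialEquiv X B)
    (hcov : ∀ x, ∃ i, x ∈ (e i).source)
    (hopen : ∀ i j, IsOpen ((e i).symm.trans (e j)).source)
    (hsmooth : ∀ i j, ContDiffOn ℝ ∞ ((e i).symm.trans (e j)) ((e i).symm.trans (e j)).source) :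
    ∃ (_ : TopologicalSpace X) (_ : ChartedSpace B X),
      HasCharts B X (fun i (f : OpenPartialHomeomorph X B) => f.toPartialEquiv = e i) := by
  choose k hk using hcov
  let c : ChartedSpaceCore B X :=
    { atlas := Set.range e
      chartAt := fun x => e (k x)
      mem_chart_source := hk
      chart_mem_atlas := fun x => ⟨k x, rfl⟩
      open_source := by
        rintro _ _ ⟨i, rfl⟩ ⟨j, rfl⟩
        exact hopen i j
      continuousOn_toFun := by
        rintro _ _ ⟨i, rfl⟩ ⟨j, rfl⟩
        exact (hsmooth i j).continuousOn }
  let _ := c.toTopologicalSpace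
  let _ := c.toChartedSpace
  have hat : ∀ f : OpenPartialHomeomorph X B, f ∈ atlas B X ↔
      ∃ i, f = c.openPartialHomeomorph (e i) ⟨i, rfl⟩ := by
    intro f
    change f ∈ (⋃ (e' : PartialEquiv X B) (he : e' ∈ c.atlas),
      {c.openPartialHomeomorph e' he}) ↔ _
    simp only [Set.mem_iUnion, Set.mem_singleton_iff]
    constructor
    · rintro ⟨_, ⟨i, rfl⟩, rfl⟩
      exact ⟨i, rfl⟩
    · rintro ⟨i, rfl⟩
      exact ⟨e i, ⟨i, rfl⟩, rfl⟩
  have hM : IsManifold 𝓘(ℝ, B) ∞ X := by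
    apply isManifold_of_contDiffOn
    intro f f' hf hf'
    obtain ⟨i, rfl⟩ := (hat f).1 hf
    obtain ⟨j, rfl⟩ := (hat f').1 hf'
    have := hsmooth i j
    simp only [modelWithCornersSelf_coe, modelWithCornersSelf_coe_symm, Function.comp_id,
      Function.id_comp, Set.preimage_id, Set.range_id, Set.inter_univ]
    exact this
  exact ⟨inferInstance, inferInstance, hM, fun i =>
    ⟨c.openPartialHomeomorph (e i) ⟨i, rfl⟩,
      IsManifold.subset_maximalAtlas ((hat _).2 ⟨i, rfl⟩), rfl⟩⟩

end ManifoldOfCharts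

/-! ### Smoothness and velocities in coordinates -/

section Charts

variable {B : Type*} [NormedAddCommGroup B] [NormedSpace ℝ B] {X : Type*}
  [TopologicalSpace X] [ChartedSpace B X]
  {B' : Type*} [NormedAddCommGroup B'] [NormedSpace ℝ B'] {X' : Type*}
  [TopologicalSpace X'] [ChartedSpace B' X']
  {B'' : Type*} [NormedAddCommGroup B''] [NormedSpace ℝ B''] {X'' : Type*}
  [TopologicalSpace X''] [ChartedSpace B'' X'']

/-- A map with a smooth coordinate expression is smooth. -/
theorem contMDiffAt_of_coord {e : OpenPartialHomeomorph X B}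
    (he : e ∈ IsManifold.maximalAtlas 𝓘(ℝ, B) ∞ X)
    {e' : OpenPartialHomeomorph X' B'} (he' : e' ∈ IsManifold.maximalAtlas 𝓘(ℝ, B') ∞ X')
    {x : X} (hx : x ∈ e.source) {f : X → X'} {Φ : B → B'} (hΦ : ContDiffAt ℝ ∞ Φ (e x))
    (h : ∀ᶠ y in 𝓝 x, f y ∈ e'.source ∧ e' (f y) = Φ (e y)) :
    ContMDiffAt 𝓘(ℝ, B) 𝓘(ℝ, B') ∞ f x := by
  have h1 : f =ᶠ[𝓝 x] e'.symm ∘ Φ ∘ e := by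
    filter_upwards [h] with y hy
    rw [Function.comp_apply, Function.comp_apply, ← hy.2, e'.left_inv hy.1]
  refine ContMDiffAt.congr_of_eventuallyEq ?_ h1
  have h2 := h.self_of_nhds
  have h3 : ContMDiffAt 𝓘(ℝ, B') 𝓘(ℝ, B') ∞ e'.symm (Φ (e x)) := by
    rw [← h2.2]
    exact contMDiffAt_symm_of_mem_maximalAtlas he' (e'.map_source h2.1)
  exact h3.comp x (hΦ.contMDiffAt.comp x (contMDiffAt_of_mem_maximalAtlas he hx))

/-- A map from a product with a smooth coordinate expression is smooth. -/
theorem contMDiffAt_prod_of_coord {e : OpenPartialHomeomorph X B}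
    (he : e ∈ IsManifold.maximalAtlas 𝓘(ℝ, B) ∞ X)
    {e' : OpenPartialHomeomorph X' B'} (he' : e' ∈ IsManifold.maximalAtlas 𝓘(ℝ, B') ∞ X')
    {e'' : OpenPartialHomeomorph X'' B''} (he'' : e'' ∈ IsManifold.maximalAtlas 𝓘(ℝ, B'') ∞ X'')
    {x : X × X'} (hx : x.1 ∈ e.source) (hx' : x.2 ∈ e'.source) {f : X × X' → X''}
    {Φ : B × B' → B''} (hΦ : ContDiffAt ℝ ∞ Φ (e x.1, e' x.2))
    (h : ∀ᶠ y in 𝓝 x, f y ∈ e''.source ∧ e'' (f y) = Φ (e y.1, e' y.2)) :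
    ContMDiffAt (𝓘(ℝ, B).prod 𝓘(ℝ, B')) 𝓘(ℝ, B'') ∞ f x := by
  have h1 : f =ᶠ[𝓝 x] e''.symm ∘ Φ ∘ (fun y => (e y.1, e' y.2)) := by
    filter_upwards [h] with y hy
    rw [Function.comp_apply, Function.comp_apply, ← hy.2, e''.left_inv hy.1]
  refine ContMDiffAt.congr_of_eventuallyEq ?_ h1
  have h2 := h.self_of_nhds
  have h3 : ContMDiffAt 𝓘(ℝ, B'') 𝓘(ℝ, B'') ∞ e''.symm (Φ (e x.1, e' x.2)) := by
    rw [← h2.2]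
    exact contMDiffAt_symm_of_mem_maximalAtlas he'' (e''.map_source h2.1)
  have h4 : ContMDiffAt (𝓘(ℝ, B).prod 𝓘(ℝ, B')) 𝓘(ℝ, B × B') ∞
      (fun y : X × X' => (e y.1, e' y.2)) x :=
    ((contMDiffAt_of_mem_maximalAtlas he hx).comp x contMDiffAt_fst).prodMk_space
      ((contMDiffAt_of_mem_maximalAtlas he' hx').comp x contMDiffAt_snd)
  exact h3.comp x (hΦ.contMDiffAt.comp x h4)

theorem mdifferentiableAt_chart {e : OpenPartialHomeomorph X B}
    (he : e ∈ IsManifold.maximalAtlas 𝓘(ℝ, B) ∞ X) {x : X} (hx : x ∈ e.source) :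
    MDifferentiableAt 𝓘(ℝ, B) 𝓘(ℝ, B) e x :=
  (contMDiffAt_of_mem_maximalAtlas he hx).mdifferentiableAt (by simp)

theorem mdifferentiable_chart_of_mem {e : OpenPartialHomeomorph X B}
    (he : e ∈ IsManifold.maximalAtlas 𝓘(ℝ, B) ∞ X) :
    e.MDifferentiable 𝓘(ℝ, B) 𝓘(ℝ, B) :=
  ⟨(contMDiffOn_of_mem_maximalAtlas he).mdifferentiableOn (by simp),
    (contMDiffOn_symm_of_mem_maximalAtlas he).mdifferentiableOn (by simp)⟩

theorem mfderiv_chart_bijective [IsManifold 𝓘(ℝ, B) ∞ X] {e : OpenPartialHomeomorph X B}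
    (he : e ∈ IsManifold.maximalAtlas 𝓘(ℝ, B) ∞ X) {x : X} (hx : x ∈ e.source) :
    Function.Bijective (mfderiv 𝓘(ℝ, B) 𝓘(ℝ, B) e x) :=
  have : IsManifold 𝓘(ℝ, B) 1 X := .of_le (n := ∞) (by simp)
  (mdifferentiable_chart_of_mem he).mfderiv_bijective hx

/-- The chain rule for the coordinate expression of a map from a normed space. -/
theorem fderiv_chart_comp {e : OpenPartialHomeomorph X' B'}
    (he : e ∈ IsManifold.maximalAtlas 𝓘(ℝ, B') ∞ X') {f : B → X'} {x : B} (hx : f x ∈ e.source)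
    (hf : MDifferentiableAt 𝓘(ℝ, B) 𝓘(ℝ, B') f x) (v : B) :
    fderiv ℝ (e ∘ f) x v =
      mfderiv 𝓘(ℝ, B') 𝓘(ℝ, B') e (f x) (mfderiv 𝓘(ℝ, B) 𝓘(ℝ, B') f x v) := by
  have := mfderiv_comp x (mdifferentiableAt_chart he hx) hf
  rw [mfderiv_eq_fderiv] at this
  rw [this]
  rfl

/-- The velocities of curves in a subset, in a chart. -/
theorem mem_tangentVectors_iff [IsManifold 𝓘(ℝ, B) ∞ X] {e : OpenPartialHomeomorph X B}
    (he : e ∈ IsManifold.maximalAtlas 𝓘(ℝ, B) ∞ X) {A : Set X} {x : X} (hx : x ∈ e.source)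
    (v : TangentSpace 𝓘(ℝ, B) x) :
    v ∈ tangentVectors B A x ↔ ∃ c : ℝ → B, ContDiffAt ℝ ∞ c 0 ∧ c 0 = e x ∧
      (∀ᶠ t in 𝓝 (0 : ℝ), c t ∈ e.target ∧ e.symm (c t) ∈ A) ∧
      HasDerivAt c (mfderiv 𝓘(ℝ, B) 𝓘(ℝ, B) e x v : B) 0 := by
  constructor
  · rintro ⟨γ, hγ, h0, hA, hv⟩
    have hγs : ∀ᶠ t in 𝓝 (0 : ℝ), γ t ∈ e.source :=
      hγ.continuousAt.eventually_mem (e.open_source.mem_nhds (h0 ▸ hx))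
    have hx' : γ 0 ∈ e.source := h0 ▸ hx
    have hc : ContDiffAt ℝ ∞ (e ∘ γ) 0 := by
      rw [← contMDiffAt_iff_contDiffAt]
      exact (contMDiffAt_of_mem_maximalAtlas he hx').comp 0 hγ
    refine ⟨e ∘ γ, hc, by simp [h0], ?_, ?_⟩
    · filter_upwards [hA, hγs] with t ht hts
      exact ⟨e.map_source hts, by simpa [e.left_inv hts] using ht⟩
    · have h1 := (hc.differentiableAt (by simp)).hasFDerivAt.hasDerivAt
      rw [fderiv_chart_comp he hx' (hγ.mdifferentiableAt (by simp))] at h1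
      subst h0
      have hv' : mfderiv 𝓘(ℝ, ℝ) 𝓘(ℝ, B) γ 0 (1 : ℝ) = v := hv
      rw [hv'] at h1
      exact h1
  · rintro ⟨c, hc, h0, hA, hd⟩
    have h0' : e.symm (c 0) = x := by rw [h0, e.left_inv hx]
    have hct : c 0 ∈ e.target := h0 ▸ e.map_source hx
    have hγ : ContMDiffAt 𝓘(ℝ, ℝ) 𝓘(ℝ, B) ∞ (e.symm ∘ c) 0 :=
      (contMDiffAt_symm_of_mem_maximalAtlas he hct).comp 0 hc.contMDiffAt
    refine ⟨e.symm ∘ c, hγ, h0', ?_, ?_⟩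
    · filter_upwards [hA] with t ht using ht.2
    · have hx' : (e.symm ∘ c) 0 ∈ e.source := by simpa [h0'] using hx
      have h1 := fderiv_chart_comp he hx' (hγ.mdifferentiableAt (by simp)) 1
      have h2 : e ∘ e.symm ∘ c =ᶠ[𝓝 0] c := by
        filter_upwards [hA] with t ht
        simp [e.right_inv ht.1]
      rw [h2.fderiv_eq, hd.hasFDerivAt.fderiv] at h1
      have h3 : (e.symm ∘ c) 0 = x := h0'
      -- The curve is generalized so that `x` can be replaced by its value at `0`: the tangent
      -- spaces at these two propositionally equal points are different types.
      clear hγ h2 hA hd hct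
      generalize e.symm ∘ c = γ at *
      subst h3
      exact (mfderiv_chart_bijective he hx).1 (h1.symm.trans (one_smul ℝ _))

end Charts

/-! ### The chain rule for second derivatives -/

section SecondDerivative

variable {V F G : Type*} [NormedAddCommGroup V] [NormedSpace ℝ V]
  [NormedAddCommGroup F] [NormedSpace ℝ F] [NormedAddCommGroup G] [NormedSpace ℝ G]

/-- The product rule for `y ↦ Dτ(k y) ∘ Dk(y)`, which agrees with `D(τ ∘ k)` on a whole
neighbourhood of `x`. -/
theorem fderiv_fderiv_comp {k : V → F} {τ : F → G} {x : V} (hk : ContDiffAt ℝ 2 k x)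
    (hτ : ContDiffAt ℝ 2 τ (k x)) (v w : V) :
    fderiv ℝ (fderiv ℝ (τ ∘ k)) x v w =
      fderiv ℝ (fderiv ℝ τ) (k x) (fderiv ℝ k x v) (fderiv ℝ k x w) +
        fderiv ℝ τ (k x) (fderiv ℝ (fderiv ℝ k) x v w) := by
  have hev : fderiv ℝ (τ ∘ k) =ᶠ[𝓝 x] fun y => (fderiv ℝ τ (k y)).comp (fderiv ℝ k y) := by
    -- `ContDiffAt` of the finite order `2` persists near the point, whereas order `∞` need not;
    -- this is why smoothness is elsewhere assumed eventually.
    filter_upwards [hk.eventually (by simp),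
      hk.continuousAt.eventually (hτ.eventually (by simp))] with y hy hy'
    exact fderiv_comp y (hy'.differentiableAt (by simp)) (hy.differentiableAt (by simp))
  rw [hev.fderiv_eq]
  have h1 : HasFDerivAt (fun y => fderiv ℝ τ (k y))
      ((fderiv ℝ (fderiv ℝ τ) (k x)).comp (fderiv ℝ k x)) x :=
    ((hτ.fderiv_right (m := 1) (by norm_num)).differentiableAt (by simp)).hasFDerivAt.comp x
      (hk.differentiableAt (by simp)).hasFDerivAt
  have h2 := ((hk.fderiv_right (m := 1) (by norm_num)).differentiableAt (by simp)).hasFDerivAt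
  rw [(h1.clm_comp h2).fderiv]
  simp [add_comm]

theorem fderiv_fderiv_symm {k : V → F} {x : V} (hk : ContDiffAt ℝ ∞ k x) (v w : V) :
    fderiv ℝ (fderiv ℝ k) x v w = fderiv ℝ (fderiv ℝ k) x w v :=
  (hk.isSymmSndFDerivAt (by simp only [minSmoothness_of_isRCLikeNormedField]; norm_cast)) v w

end SecondDerivative


/-! ### Pullback and pushforward of bilinear maps -/

section Bilinear

variable {V F G X : Type*} [NormedAddCommGroup V] [NormedSpace ℝ V]
  [NormedAddCommGroup F] [NormedSpace ℝ F] [NormedAddCommGroup G] [NormedSpace ℝ G]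
  [NormedAddCommGroup X] [NormedSpace ℝ X]

/-- The bilinear map `T (A v) (A w)`. -/
def pullBilin (T : F →L[ℝ] F →L[ℝ] G) (A : V →L[ℝ] F) : V →L[ℝ] V →L[ℝ] G :=
  (((ContinuousLinearMap.compL ℝ V F G).flip A).comp T).comp A

/-- The bilinear map `L (B v w)`. -/
def pushBilin (L : F →L[ℝ] G) (B : V →L[ℝ] V →L[ℝ] F) : V →L[ℝ] V →L[ℝ] G :=
  (ContinuousLinearMap.compL ℝ V F G L).comp B

@[simp]
theorem pullBilin_apply (T : F →L[ℝ] F →L[ℝ] G) (A : V →L[ℝ] F) (v w : V) :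
    pullBilin T A v w = T (A v) (A w) := rfl

@[simp]
theorem pushBilin_apply (L : F →L[ℝ] G) (B : V →L[ℝ] V →L[ℝ] F) (v w : V) :
    pushBilin L B v w = L (B v w) := rfl

theorem contDiffAt_pullBilin {T : X → F →L[ℝ] F →L[ℝ] G} {A : X → V →L[ℝ] F} {x : X}
    {n : WithTop ℕ∞} (hT : ContDiffAt ℝ n T x) (hA : ContDiffAt ℝ n A x) :
    ContDiffAt ℝ n (fun y => pullBilin (T y) (A y)) x :=
  ((contDiffAt_const.clm_apply hA).clm_comp hT).clm_comp hA

theorem contDiffAt_pushBilin {L : X → F →L[ℝ] G} {B : X → V →L[ℝ] V →L[ℝ] F} {x : X}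
    {n : WithTop ℕ∞} (hL : ContDiffAt ℝ n L x) (hB : ContDiffAt ℝ n B x) :
    ContDiffAt ℝ n (fun y => pushBilin (L y) (B y)) x :=
  (contDiffAt_const.clm_apply hL).clm_comp hB

theorem fderiv_fderiv_comp_eq {k : V → F} {τ : F → G} {x : V} (hk : ContDiffAt ℝ 2 k x)
    (hτ : ContDiffAt ℝ 2 τ (k x)) :
    fderiv ℝ (fderiv ℝ (τ ∘ k)) x = pullBilin (fderiv ℝ (fderiv ℝ τ) (k x)) (fderiv ℝ k x) +
      pushBilin (fderiv ℝ τ (k x)) (fderiv ℝ (fderiv ℝ k) x) := by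
  ext v w
  simp [fderiv_fderiv_comp hk hτ]

theorem contDiffAt_fderiv {τ : F → G} {u : F} (h : ContDiffAt ℝ ∞ τ u) :
    ContDiffAt ℝ ∞ (fderiv ℝ τ) u :=
  h.fderiv_right (by simp)

theorem ContDiffAt.two_of_infty {τ : F → G} {u : F} (h : ContDiffAt ℝ ∞ τ u) :
    ContDiffAt ℝ 2 τ u :=
  h.of_le (by norm_cast)

end Bilinear

/-! ### Polynomial maps with prescribed derivatives -/

section Taylor

variable {V F : Type*} [NormedAddCommGroup V] [NormedSpace ℝ V]
  [NormedAddCommGroup F] [NormedSpace ℝ F]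

/-- The polynomial map with Taylor coefficients `u, A, B, S` at `x`. -/
def taylor (x : V) (u : F) (A : V →L[ℝ] F) (B : V →L[ℝ] V →L[ℝ] F)
    (S : V →L[ℝ] V →L[ℝ] V →L[ℝ] F) (y : V) : F :=
  u + A (y - x) + (2⁻¹ : ℝ) • B (y - x) (y - x) + (6⁻¹ : ℝ) • S (y - x) (y - x) (y - x)

variable (x : V) (u : F) (A : V →L[ℝ] F) {B : V →L[ℝ] V →L[ℝ] F}
  {S : V →L[ℝ] V →L[ℝ] V →L[ℝ] F}

theorem contDiff_taylor : ContDiff ℝ ∞ (taylor x u A B S) := by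
  unfold taylor
  fun_prop

@[simp]
theorem taylor_self : taylor x u A B S x = u := by
  simp [taylor]

/-- The symmetry of the coefficients makes the two Leibniz terms of the quadratic part and the three
of the cubic part coincide, which turns `1/2` into `1` and `1/6` into `1/2`. -/
theorem fderiv_taylor (hB : ∀ v w, B v w = B w v) (hS : ∀ a b c, S a b c = S b a c)
    (hS' : ∀ a b c, S a b c = S a c b) :
    fderiv ℝ (taylor x u A B S) =
      fun y => A + B (y - x) + (2⁻¹ : ℝ) • S (y - x) (y - x) := by
  funext y
  have hd : HasFDerivAt (fun y : V => y - x) (ContinuousLinearMap.id ℝ V) y :=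
    (hasFDerivAt_id y).sub_const x
  have h1 := (A.hasFDerivAt (x := y - x)).comp y hd
  have h2 := (B.hasFDerivAt (x := y - x)).comp y hd
  have h3 := HasFDerivAt.comp (g := S) (g' := S) y S.hasFDerivAt hd
  have h4 := h2.clm_apply hd
  have h5 := (h3.clm_apply hd).clm_apply hd
  have := (((hasFDerivAt_const u y).add h1).add (h4.const_smul (2⁻¹ : ℝ))).add
    (h5.const_smul (6⁻¹ : ℝ))
  rw [show taylor x u A B S = _ from rfl]
  refine (this.congr_fderiv ?_).fderiv
  ext v
  simp only [add_apply, smul_apply, Function.comp_apply,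
    ContinuousLinearMap.comp_apply, ContinuousLinearMap.flip_apply, ContinuousLinearMap.id_apply,
    zero_add]
  rw [hB v (y - x), hS v (y - x) (y - x), hS' (y - x) v (y - x)]
  module

theorem fderiv_fderiv_taylor (hB : ∀ v w, B v w = B w v) (hS : ∀ a b c, S a b c = S b a c)
    (hS' : ∀ a b c, S a b c = S a c b) :
    fderiv ℝ (fderiv ℝ (taylor x u A B S)) = fun y => B + S (y - x) := by
  rw [fderiv_taylor x u A hB hS hS']
  funext y
  have hd : HasFDerivAt (fun y : V => y - x) (ContinuousLinearMap.id ℝ V) y :=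
    (hasFDerivAt_id y).sub_const x
  have h2 := (B.hasFDerivAt (x := y - x)).comp y hd
  have h3 := HasFDerivAt.comp (g := S) (g' := S) y S.hasFDerivAt hd
  have h5 := h3.clm_apply hd
  have := ((hasFDerivAt_const A y).add h2).add (h5.const_smul (2⁻¹ : ℝ))
  refine (this.congr_fderiv ?_).fderiv
  ext v w
  simp only [add_apply, smul_apply, Function.comp_apply,
    ContinuousLinearMap.comp_apply, ContinuousLinearMap.flip_apply, ContinuousLinearMap.id_apply,
    zero_add]
  rw [hS v (y - x) w]
  module

/-- The quadratic map with Taylor coefficients `u, A, B` at `x`. -/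
def taylor2 (x : V) (u : F) (A : V →L[ℝ] F) (B : SymBilin V F) : V → F :=
  taylor x u A B.toBilin 0

theorem contDiff_taylor2 (B : SymBilin V F) : ContDiff ℝ ∞ (taylor2 x u A B) :=
  contDiff_taylor x u A

@[simp]
theorem taylor2_self (B : SymBilin V F) : taylor2 x u A B x = u := taylor_self x u A

theorem fderiv_taylor2 (B : SymBilin V F) : fderiv ℝ (taylor2 x u A B) x = A := by
  rw [taylor2, fderiv_taylor x u A B.symm_apply (by simp) (by simp)]
  simp

theorem fderiv_fderiv_taylor2 (B : SymBilin V F) :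
    fderiv ℝ (fderiv ℝ (taylor2 x u A B)) x = B.toBilin := by
  rw [taylor2, fderiv_fderiv_taylor x u A B.symm_apply (by simp) (by simp)]
  simp

end Taylor

/-- A map which is a bijection from `s` to `t`, as a partial equivalence. -/
def partialEquivOfCoord {X B : Type*} (f : X → B) (s : Set X) (t : Set B) [Nonempty X]
    (h : Set.BijOn f s t) : PartialEquiv X B where
  toFun := f
  invFun := Function.invFunOn f s
  source := s
  target := t
  map_source' := fun _ hx => h.mapsTo hx
  map_target' := fun _ hy => h.surjOn.mapsTo_invFunOn hy
  left_inv' := fun _ hx => h.invOn_invFunOn.1 hx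
  right_inv' := fun _ hy => h.invOn_invFunOn.2 hy

/-! ### Coordinates and manifold structure on the jets of local maps -/

section MapJets

variable {V F E : Type*} [NormedAddCommGroup V] [NormedSpace ℝ V]
  [NormedAddCommGroup F] [NormedSpace ℝ F] [TopologicalSpace E] [ChartedSpace F E]

theorem contDiffAt_transition {φ ψ : OpenPartialHomeomorph E F}
    (hφ : φ ∈ IsManifold.maximalAtlas 𝓘(ℝ, F) ∞ E) (hψ : ψ ∈ IsManifold.maximalAtlas 𝓘(ℝ, F) ∞ E)
    {u : F} (hu : u ∈ φ.target) (hu' : φ.symm u ∈ ψ.source) : ContDiffAt ℝ ∞ (ψ ∘ φ.symm) u := by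
  rw [← contMDiffAt_iff_contDiffAt]
  exact (contMDiffAt_of_mem_maximalAtlas hψ hu').comp u (contMDiffAt_symm_of_mem_maximalAtlas hφ hu)

theorem LocalMap.contDiffAt (a : LocalMap V F E) {φ : OpenPartialHomeomorph E F}
    (hφ : φ ∈ IsManifold.maximalAtlas 𝓘(ℝ, F) ∞ E) (hm : a.toFun a.pt ∈ φ.source) :
    ContDiffAt ℝ ∞ (φ ∘ a.toFun) a.pt := by
  rw [← contMDiffAt_iff_contDiffAt]
  exact (contMDiffAt_of_mem_maximalAtlas hφ hm).comp a.pt a.smooth.self_of_nhds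

theorem LocalMap.continuousAt (a : LocalMap V F E) : ContinuousAt a.toFun a.pt :=
  a.smooth.self_of_nhds.continuousAt

theorem LocalMap.eventually_mem (a : LocalMap V F E) {φ : OpenPartialHomeomorph E F}
    (hm : a.toFun a.pt ∈ φ.source) : ∀ᶠ y in 𝓝 a.pt, a.toFun y ∈ φ.source :=
  a.continuousAt.eventually_mem (φ.open_source.mem_nhds hm)

theorem LocalMap.transition_eventuallyEq (a : LocalMap V F E) {φ : OpenPartialHomeomorph E F}
    (ψ : OpenPartialHomeomorph E F) (hm : a.toFun a.pt ∈ φ.source) :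
    ψ ∘ a.toFun =ᶠ[𝓝 a.pt] (ψ ∘ φ.symm) ∘ (φ ∘ a.toFun) := by
  filter_upwards [a.eventually_mem hm] with y hy
  simp [φ.left_inv hy]

/-- The coordinates `(x, u, u_x)` of a local map. -/
def LocalMap.coord1 (φ : OpenPartialHomeomorph E F) (a : LocalMap V F E) : MapModel1 V F :=
  (a.pt, φ (a.toFun a.pt), fderiv ℝ (φ ∘ a.toFun) a.pt)

/-- The coordinates `(x, u, u_x, u_xx)` of a local map. -/
def LocalMap.coord2 (φ : OpenPartialHomeomorph E F) (a : LocalMap V F E) : MapModel2 V F :=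
  (a.pt, φ (a.toFun a.pt), fderiv ℝ (φ ∘ a.toFun) a.pt,
    SymBilin.symmetrize V F (fderiv ℝ (fderiv ℝ (φ ∘ a.toFun)) a.pt))

/-- By Schwarz's theorem the second derivative is already symmetric, so the symmetrization in the
definition of the coordinates loses nothing. -/
theorem LocalMap.toBilin_coord2 (a : LocalMap V F E) {φ : OpenPartialHomeomorph E F}
    (hφ : φ ∈ IsManifold.maximalAtlas 𝓘(ℝ, F) ∞ E) (hm : a.toFun a.pt ∈ φ.source) :
    (a.coord2 φ).2.2.2.toBilin = fderiv ℝ (fderiv ℝ (φ ∘ a.toFun)) a.pt :=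
  SymBilin.toBilin_symmetrize fun v w => fderiv_fderiv_symm (a.contDiffAt hφ hm) v w

variable {G : Type*} [NormedAddCommGroup G] [NormedSpace ℝ G]

/-- The prolongation of the coordinate change `τ` to the coordinates `(x, u, u_x)`. -/
def mapTrans1 (τ : F → G) (c : MapModel1 V F) : MapModel1 V G :=
  (c.1, τ c.2.1, (fderiv ℝ τ c.2.1).comp c.2.2)

/-- The prolongation of the coordinate change `τ` to the coordinates `(x, u, u_x, u_xx)`. -/
def mapTrans2 (τ : F → G) (c : MapModel2 V F) : MapModel2 V G :=
  (c.1, τ c.2.1, (fderiv ℝ τ c.2.1).comp c.2.2.1,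
    SymBilin.symmetrize V G (pullBilin (fderiv ℝ (fderiv ℝ τ) c.2.1) c.2.2.1 +
      pushBilin (fderiv ℝ τ c.2.1) c.2.2.2.toBilin))

theorem contDiffAt_mapTrans1 {τ : F → G} {c : MapModel1 V F} (hτ : ContDiffAt ℝ ∞ τ c.2.1) :
    ContDiffAt ℝ ∞ (mapTrans1 (V := V) τ) c := by
  have hu : ContDiffAt ℝ ∞ (fun c : MapModel1 V F => c.2.1) c := by fun_prop
  have hA : ContDiffAt ℝ ∞ (fun c : MapModel1 V F => c.2.2) c := by fun_prop
  exact contDiffAt_fst.prodMk ((hτ.comp c hu).prodMk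
    (((contDiffAt_fderiv hτ).comp c hu).clm_comp hA))

theorem contDiffAt_mapTrans2 {τ : F → G} {c : MapModel2 V F} (hτ : ContDiffAt ℝ ∞ τ c.2.1) :
    ContDiffAt ℝ ∞ (mapTrans2 (V := V) τ) c := by
  have hu : ContDiffAt ℝ ∞ (fun c : MapModel2 V F => c.2.1) c := by fun_prop
  have hA : ContDiffAt ℝ ∞ (fun c : MapModel2 V F => c.2.2.1) c := by fun_prop
  have hB' : ContDiffAt ℝ ∞ (fun c : MapModel2 V F => c.2.2.2) c := by fun_prop
  have hB : ContDiffAt ℝ ∞ (fun c : MapModel2 V F => c.2.2.2.toBilin) c :=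
    (SymBilin.toBilinL V F).contDiff.contDiffAt.comp c hB'
  have h1 := (contDiffAt_fderiv hτ).comp c hu
  have h2 := (contDiffAt_fderiv (contDiffAt_fderiv hτ)).comp c hu
  exact contDiffAt_fst.prodMk ((hτ.comp c hu).prodMk ((h1.clm_comp hA).prodMk
    ((SymBilin.symmetrize V G).contDiff.contDiffAt.comp c
      ((contDiffAt_pullBilin h2 hA).add (contDiffAt_pushBilin h1 hB)))))

theorem LocalMap.fderiv_transition (a : LocalMap V F E) {φ ψ : OpenPartialHomeomorph E F}
    (hφ : φ ∈ IsManifold.maximalAtlas 𝓘(ℝ, F) ∞ E) (hψ : ψ ∈ IsManifold.maximalAtlas 𝓘(ℝ, F) ∞ E)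
    (hm : a.toFun a.pt ∈ φ.source) (hm' : a.toFun a.pt ∈ ψ.source) :
    fderiv ℝ (ψ ∘ a.toFun) a.pt =
      (fderiv ℝ (ψ ∘ φ.symm) (φ (a.toFun a.pt))).comp (fderiv ℝ (φ ∘ a.toFun) a.pt) := by
  rw [(a.transition_eventuallyEq ψ hm).fderiv_eq]
  exact fderiv_comp _ ((contDiffAt_transition hφ hψ (φ.map_source hm)
    (by rwa [φ.left_inv hm])).differentiableAt (by simp))
    ((a.contDiffAt hφ hm).differentiableAt (by simp))

theorem LocalMap.fderiv_fderiv_transition (a : LocalMap V F E) {φ ψ : OpenPartialHomeomorph E F}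
    (hφ : φ ∈ IsManifold.maximalAtlas 𝓘(ℝ, F) ∞ E) (hψ : ψ ∈ IsManifold.maximalAtlas 𝓘(ℝ, F) ∞ E)
    (hm : a.toFun a.pt ∈ φ.source) (hm' : a.toFun a.pt ∈ ψ.source) :
    fderiv ℝ (fderiv ℝ (ψ ∘ a.toFun)) a.pt =
      pullBilin (fderiv ℝ (fderiv ℝ (ψ ∘ φ.symm)) (φ (a.toFun a.pt)))
        (fderiv ℝ (φ ∘ a.toFun) a.pt) +
      pushBilin (fderiv ℝ (ψ ∘ φ.symm) (φ (a.toFun a.pt)))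
        (fderiv ℝ (fderiv ℝ (φ ∘ a.toFun)) a.pt) := by
  rw [(a.transition_eventuallyEq ψ hm).fderiv.fderiv_eq]
  exact fderiv_fderiv_comp_eq (a.contDiffAt hφ hm).two_of_infty
    (contDiffAt_transition hφ hψ (φ.map_source hm) (by rwa [φ.left_inv hm])).two_of_infty

theorem LocalMap.coord1_transition (a : LocalMap V F E) {φ ψ : OpenPartialHomeomorph E F}
    (hφ : φ ∈ IsManifold.maximalAtlas 𝓘(ℝ, F) ∞ E) (hψ : ψ ∈ IsManifold.maximalAtlas 𝓘(ℝ, F) ∞ E)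
    (hm : a.toFun a.pt ∈ φ.source) (hm' : a.toFun a.pt ∈ ψ.source) :
    a.coord1 ψ = mapTrans1 (ψ ∘ φ.symm) (a.coord1 φ) := by
  rw [coord1, a.fderiv_transition hφ hψ hm hm']
  simp [mapTrans1, coord1, φ.left_inv hm]

theorem LocalMap.coord2_transition (a : LocalMap V F E) {φ ψ : OpenPartialHomeomorph E F}
    (hφ : φ ∈ IsManifold.maximalAtlas 𝓘(ℝ, F) ∞ E) (hψ : ψ ∈ IsManifold.maximalAtlas 𝓘(ℝ, F) ∞ E)
    (hm : a.toFun a.pt ∈ φ.source) (hm' : a.toFun a.pt ∈ ψ.source) :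
    a.coord2 ψ = mapTrans2 (ψ ∘ φ.symm) (a.coord2 φ) := by
  rw [mapTrans2, a.toBilin_coord2 hφ hm]
  rw [coord2, a.fderiv_transition hφ hψ hm hm', a.fderiv_fderiv_transition hφ hψ hm hm']
  simp [coord2, φ.left_inv hm]

theorem LocalMap.coord1_eq {a b : LocalMap V F E} (h : a.Contact1 b)
    {φ : OpenPartialHomeomorph E F} (hφ : φ ∈ IsManifold.maximalAtlas 𝓘(ℝ, F) ∞ E)
    (hm : a.toFun a.pt ∈ φ.source) : a.coord1 φ = b.coord1 φ := by
  simp only [coord1, Prod.mk.injEq]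
  exact ⟨h.1, by rw [h.2.1], h.2.2 φ hφ hm⟩

theorem LocalMap.coord2_eq {a b : LocalMap V F E} (h : a.Contact2 b)
    {φ : OpenPartialHomeomorph E F} (hφ : φ ∈ IsManifold.maximalAtlas 𝓘(ℝ, F) ∞ E)
    (hm : a.toFun a.pt ∈ φ.source) : a.coord2 φ = b.coord2 φ := by
  simp only [coord2, Prod.mk.injEq]
  exact ⟨h.1.1, by rw [h.1.2.1], h.1.2.2 φ hφ hm, by rw [h.2 φ hφ hm]⟩

/-- Contact is demanded in all charts. Equal coordinates in `φ` force a common value in `E`, and the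
transition formula carries the equality to every other chart there. -/
theorem LocalMap.contact1_of_coord {a b : LocalMap V F E} {φ : OpenPartialHomeomorph E F}
    (hφ : φ ∈ IsManifold.maximalAtlas 𝓘(ℝ, F) ∞ E) (ha : a.toFun a.pt ∈ φ.source)
    (hb : b.toFun b.pt ∈ φ.source) (h : a.coord1 φ = b.coord1 φ) : a.Contact1 b := by
  have h' := h
  simp only [coord1, Prod.mk.injEq] at h'
  have hp : a.toFun a.pt = b.toFun b.pt := φ.injOn ha hb h'.2.1
  refine ⟨h'.1, hp, fun ψ hψ hm => ?_⟩
  have := a.coord1_transition hφ hψ ha hm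
  rw [h, ← b.coord1_transition hφ hψ hb (hp ▸ hm)] at this
  exact congrArg (fun c => c.2.2) this

theorem LocalMap.contact2_of_coord {a b : LocalMap V F E} {φ : OpenPartialHomeomorph E F}
    (hφ : φ ∈ IsManifold.maximalAtlas 𝓘(ℝ, F) ∞ E) (ha : a.toFun a.pt ∈ φ.source)
    (hb : b.toFun b.pt ∈ φ.source) (h : a.coord2 φ = b.coord2 φ) : a.Contact2 b := by
  have h1 : a.Contact1 b := contact1_of_coord hφ ha hb
    (congrArg (fun c : MapModel2 V F => ((c.1, c.2.1, c.2.2.1) : MapModel1 V F)) h)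
  refine ⟨h1, fun ψ hψ hm => ?_⟩
  have := a.coord2_transition hφ hψ ha hm
  rw [h, ← b.coord2_transition hφ hψ hb (h1.2.1 ▸ hm)] at this
  rw [← a.toBilin_coord2 hψ hm, ← b.toBilin_coord2 hψ (h1.2.1 ▸ hm), this]

/-- The local map with coordinate expression `k` in the chart `φ`. -/
def LocalMap.ofCoord {φ : OpenPartialHomeomorph E F}
    (hφ : φ ∈ IsManifold.maximalAtlas 𝓘(ℝ, F) ∞ E) (x : V) {k : V → F} (hk : ContDiff ℝ ∞ k)
    (hx : k x ∈ φ.target) : LocalMap V F E where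
  pt := x
  toFun := φ.symm ∘ k
  smooth := by
    filter_upwards [hk.continuous.continuousAt.eventually_mem (φ.open_target.mem_nhds hx)] with y hy
    exact (contMDiffAt_symm_of_mem_maximalAtlas hφ hy).comp y hk.contMDiff.contMDiffAt

omit [ChartedSpace F E] in
theorem LocalMap.ofCoord_eventuallyEq {φ : OpenPartialHomeomorph E F} {x : V} {k : V → F}
    (hk : ContDiff ℝ ∞ k) (hx : k x ∈ φ.target) : φ ∘ φ.symm ∘ k =ᶠ[𝓝 x] k := by
  filter_upwards [hk.continuous.continuousAt.eventually_mem (φ.open_target.mem_nhds hx)] with y hy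
  simp [φ.right_inv hy]

theorem LocalMap.ofCoord_mem {φ : OpenPartialHomeomorph E F}
    (hφ : φ ∈ IsManifold.maximalAtlas 𝓘(ℝ, F) ∞ E) {x : V} {k : V → F} (hk : ContDiff ℝ ∞ k)
    (hx : k x ∈ φ.target) : (ofCoord hφ x hk hx).toFun (ofCoord hφ x hk hx).pt ∈ φ.source :=
  φ.map_target hx

theorem LocalMap.coord2_ofCoord {φ : OpenPartialHomeomorph E F}
    (hφ : φ ∈ IsManifold.maximalAtlas 𝓘(ℝ, F) ∞ E) {x : V} {k : V → F} (hk : ContDiff ℝ ∞ k)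
    (hx : k x ∈ φ.target) :
    (ofCoord hφ x hk hx).coord2 φ =
      (x, k x, fderiv ℝ k x, SymBilin.symmetrize V F (fderiv ℝ (fderiv ℝ k) x)) := by
  have h := ofCoord_eventuallyEq (φ := φ) hk hx
  simp only [coord2, Prod.mk.injEq]
  exact ⟨rfl, h.self_of_nhds, h.fderiv_eq, congrArg _ h.fderiv.fderiv_eq⟩

/-- The quadratic polynomial with the coefficients `c`, read back through `φ.symm`. It has to stay
in the target of `φ` only near the marked point, since a local map is unrestricted elsewhere. -/
theorem LocalMap.exists_coord2_eq {φ : OpenPartialHomeomorph E F}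
    (hφ : φ ∈ IsManifold.maximalAtlas 𝓘(ℝ, F) ∞ E) (c : MapModel2 V F) (hc : c.2.1 ∈ φ.target) :
    ∃ a : LocalMap V F E, a.toFun a.pt ∈ φ.source ∧ a.coord2 φ = c := by
  have hx : taylor2 c.1 c.2.1 c.2.2.1 c.2.2.2 c.1 ∈ φ.target := by simpa using hc
  refine ⟨ofCoord hφ c.1 (contDiff_taylor2 c.1 c.2.1 c.2.2.1 c.2.2.2) hx, ofCoord_mem hφ _ hx, ?_⟩
  rw [coord2_ofCoord]
  simp [fderiv_taylor2, fderiv_fderiv_taylor2]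

theorem LocalMap.exists_coord1_eq {φ : OpenPartialHomeomorph E F}
    (hφ : φ ∈ IsManifold.maximalAtlas 𝓘(ℝ, F) ∞ E) (c : MapModel1 V F) (hc : c.2.1 ∈ φ.target) :
    ∃ a : LocalMap V F E, a.toFun a.pt ∈ φ.source ∧ a.coord1 φ = c := by
  -- The second derivatives do not affect the `1`-jet and are set to zero.
  obtain ⟨a, ha, h⟩ := exists_coord2_eq hφ (c.1, c.2.1, c.2.2, 0) hc
  exact ⟨a, ha, congrArg (fun c : MapModel2 V F => ((c.1, c.2.1, c.2.2.1) : MapModel1 V F)) h⟩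

theorem LocalMap.jet1_eq_iff {a b : LocalMap V F E} : a.jet1 = b.jet1 ↔ a.Contact1 b :=
  ⟨fun h => Quotient.exact h, fun h => Quotient.sound (s := mapSetoid1 V F E) h⟩

theorem LocalMap.jet2_eq_iff {a b : LocalMap V F E} : a.jet2 = b.jet2 ↔ a.Contact2 b :=
  ⟨fun h => Quotient.exact h, fun h => Quotient.sound (s := mapSetoid2 V F E) h⟩

theorem MapJet1.exists_rep (θ : MapJet1 V F E) : ∃ a : LocalMap V F E, a.jet1 = θ :=
  Quotient.exists_rep θ

theorem MapJet2.exists_rep (θ : MapJet2 V F E) : ∃ a : LocalMap V F E, a.jet2 = θ :=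
  Quotient.exists_rep θ

/-- A representative of a jet. -/
def MapJet1.out (θ : MapJet1 V F E) : LocalMap V F E := (MapJet1.exists_rep θ).choose

/-- A representative of a jet. -/
def MapJet2.out (θ : MapJet2 V F E) : LocalMap V F E := (MapJet2.exists_rep θ).choose

@[simp]
theorem MapJet1.jet1_out (θ : MapJet1 V F E) : θ.out.jet1 = θ := (MapJet1.exists_rep θ).choose_spec

@[simp]
theorem MapJet2.jet2_out (θ : MapJet2 V F E) : θ.out.jet2 = θ := (MapJet2.exists_rep θ).choose_spec

theorem LocalMap.contact1_out (a : LocalMap V F E) : a.Contact1 a.jet1.out :=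
  jet1_eq_iff.1 (by simp)

theorem LocalMap.contact2_out (a : LocalMap V F E) : a.Contact2 a.jet2.out :=
  jet2_eq_iff.1 (by simp)

/-- Injectivity is the criterion for contact in one chart; surjectivity is the realization of any
coordinates by a polynomial map. -/
theorem bijOn_mapCoord1 {φ : OpenPartialHomeomorph E F}
    (hφ : φ ∈ IsManifold.maximalAtlas 𝓘(ℝ, F) ∞ E) :
    Set.BijOn (fun θ : MapJet1 V F E => θ.out.coord1 φ)
      {θ | θ.out.toFun θ.out.pt ∈ φ.source} {c | c.2.1 ∈ φ.target} := by
  refine ⟨fun θ hθ => φ.map_source hθ, fun θ hθ θ' hθ' h => ?_, fun c hc => ?_⟩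
  · rw [← θ.jet1_out, ← θ'.jet1_out, LocalMap.jet1_eq_iff]
    exact LocalMap.contact1_of_coord hφ hθ hθ' h
  · obtain ⟨a, ha, rfl⟩ := LocalMap.exists_coord1_eq hφ c hc
    have h := a.contact1_out
    exact ⟨a.jet1, by simpa [← h.2.1] using ha, (LocalMap.coord1_eq h hφ ha).symm⟩

theorem bijOn_mapCoord2 {φ : OpenPartialHomeomorph E F}
    (hφ : φ ∈ IsManifold.maximalAtlas 𝓘(ℝ, F) ∞ E) :
    Set.BijOn (fun θ : MapJet2 V F E => θ.out.coord2 φ)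
      {θ | θ.out.toFun θ.out.pt ∈ φ.source} {c | c.2.1 ∈ φ.target} := by
  refine ⟨fun θ hθ => φ.map_source hθ, fun θ hθ θ' hθ' h => ?_, fun c hc => ?_⟩
  · rw [← θ.jet2_out, ← θ'.jet2_out, LocalMap.jet2_eq_iff]
    exact LocalMap.contact2_of_coord hφ hθ hθ' h
  · obtain ⟨a, ha, rfl⟩ := LocalMap.exists_coord2_eq hφ c hc
    have h := a.contact2_out
    exact ⟨a.jet2, by simpa [← h.1.2.1] using ha, (LocalMap.coord2_eq h hφ ha).symm⟩

omit [NormedSpace ℝ F] [ChartedSpace F E] in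
theorem isOpen_transition_domain {φ ψ : OpenPartialHomeomorph E F} :
    IsOpen {u | u ∈ φ.target ∧ φ.symm u ∈ ψ.source} :=
  φ.symm.isOpen_inter_preimage ψ.open_source

variable (V F E)

/-- The transition between the coordinates of `φ` and `ψ` is the prolongation of the transition of
`E`. Its domain restricts only the coordinate `u`, so it is open, and the coordinate systems can be
glued. -/
theorem exists_isMapJetManifold1 [Nonempty E] [IsManifold 𝓘(ℝ, F) ∞ E] :
    ∃ (_ : TopologicalSpace (MapJet1 V F E))
      (_ : ChartedSpace (MapModel1 V F) (MapJet1 V F E)), IsMapJetManifold1 V F E := by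
  -- The total inverse of a coordinate bijection needs default values; the jet of a constant map
  -- serves.
  have : Nonempty (MapJet1 V F E) :=
    ⟨LocalMap.jet1 ⟨0, fun _ => Classical.arbitrary E, .of_forall fun _ => contMDiffAt_const⟩⟩
  let e : IsManifold.maximalAtlas 𝓘(ℝ, F) ∞ E → PartialEquiv (MapJet1 V F E) (MapModel1 V F) :=
    fun φ => partialEquivOfCoord _ _ _ (bijOn_mapCoord1 φ.2)
  have hsrc : ∀ (φ) (a : LocalMap V F E), a.jet1 ∈ (e φ).source ↔ a.toFun a.pt ∈ φ.1.source := by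
    intro φ a
    rw [a.contact1_out.2.1]
    rfl
  have hcoord : ∀ (φ) (a : LocalMap V F E), a.toFun a.pt ∈ φ.1.source →
      e φ a.jet1 = a.coord1 φ.1 := fun φ a ha => (LocalMap.coord1_eq a.contact1_out φ.2 ha).symm
  have htr : ∀ φ ψ (c : MapModel1 V F), c ∈ ((e φ).symm.trans (e ψ)).source ↔
      c.2.1 ∈ {u | u ∈ φ.1.target ∧ φ.1.symm u ∈ ψ.1.source} := by
    intro φ ψ c
    rw [PartialEquiv.trans_source, PartialEquiv.symm_source, Set.mem_inter_iff]
    refine and_congr_right fun hc => ?_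
    obtain ⟨a, ha, rfl⟩ := LocalMap.exists_coord1_eq φ.2 c hc
    rw [← hcoord φ a ha, Set.mem_preimage, (e φ).left_inv ((hsrc φ a).2 ha), hsrc, hcoord φ a ha]
    simp [LocalMap.coord1, φ.1.left_inv ha]
  have htrans : ∀ φ ψ, Set.EqOn ((e φ).symm.trans (e ψ)) (mapTrans1 (ψ.1 ∘ φ.1.symm))
      ((e φ).symm.trans (e ψ)).source := by
    intro φ ψ c hc
    have hc' := (htr φ ψ c).1 hc
    obtain ⟨a, ha, rfl⟩ := LocalMap.exists_coord1_eq φ.2 c hc'.1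
    have ha' : a.toFun a.pt ∈ ψ.1.source := by simpa [LocalMap.coord1, φ.1.left_inv ha] using hc'.2
    rw [PartialEquiv.coe_trans, Function.comp_apply, ← hcoord φ a ha,
      (e φ).left_inv ((hsrc φ a).2 ha), hcoord φ a ha, hcoord ψ a ha']
    exact a.coord1_transition φ.2 ψ.2 ha ha'
  obtain ⟨i1, i2, hM, h⟩ := exists_hasCharts e
    (fun θ => by
      obtain ⟨a, rfl⟩ := MapJet1.exists_rep θ
      exact ⟨⟨chartAt F (a.toFun a.pt), IsManifold.chart_mem_maximalAtlas _⟩,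
        (hsrc _ a).2 (mem_chart_source F _)⟩)
    (fun φ ψ => by
      rw [show ((e φ).symm.trans (e ψ)).source = _ from Set.ext (htr φ ψ)]
      exact isOpen_transition_domain.preimage (f := fun c : MapModel1 V F => c.2.1) (by fun_prop))
    (fun φ ψ => by
      refine ContDiffOn.congr (fun c hc => ContDiffAt.contDiffWithinAt ?_) (htrans φ ψ)
      have hc' := (htr φ ψ c).1 hc
      exact contDiffAt_mapTrans1 (contDiffAt_transition φ.2 ψ.2 hc'.1 hc'.2))
  refine ⟨i1, i2, hM, fun φ => ?_⟩
  obtain ⟨f, hf, hfe⟩ := h φ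
  refine ⟨f, hf, fun a => ?_, fun a ha => ?_⟩
  · rw [← hsrc, ← hfe]
  · rw [← OpenPartialHomeomorph.coe_toPartialEquiv, hfe]
    exact hcoord φ a ha

theorem exists_isMapJetManifold2 [Nonempty E] [IsManifold 𝓘(ℝ, F) ∞ E] :
    ∃ (_ : TopologicalSpace (MapJet2 V F E))
      (_ : ChartedSpace (MapModel2 V F) (MapJet2 V F E)), IsMapJetManifold2 V F E := by
  have : Nonempty (MapJet2 V F E) :=
    ⟨LocalMap.jet2 ⟨0, fun _ => Classical.arbitrary E, .of_forall fun _ => contMDiffAt_const⟩⟩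
  let e : IsManifold.maximalAtlas 𝓘(ℝ, F) ∞ E → PartialEquiv (MapJet2 V F E) (MapModel2 V F) :=
    fun φ => partialEquivOfCoord _ _ _ (bijOn_mapCoord2 φ.2)
  have hsrc : ∀ (φ) (a : LocalMap V F E), a.jet2 ∈ (e φ).source ↔ a.toFun a.pt ∈ φ.1.source := by
    intro φ a
    rw [a.contact2_out.1.2.1]
    rfl
  have hcoord : ∀ (φ) (a : LocalMap V F E), a.toFun a.pt ∈ φ.1.source →
      e φ a.jet2 = a.coord2 φ.1 := fun φ a ha => (LocalMap.coord2_eq a.contact2_out φ.2 ha).symm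
  have htr : ∀ φ ψ (c : MapModel2 V F), c ∈ ((e φ).symm.trans (e ψ)).source ↔
      c.2.1 ∈ {u | u ∈ φ.1.target ∧ φ.1.symm u ∈ ψ.1.source} := by
    intro φ ψ c
    rw [PartialEquiv.trans_source, PartialEquiv.symm_source, Set.mem_inter_iff]
    refine and_congr_right fun hc => ?_
    obtain ⟨a, ha, rfl⟩ := LocalMap.exists_coord2_eq φ.2 c hc
    rw [← hcoord φ a ha, Set.mem_preimage, (e φ).left_inv ((hsrc φ a).2 ha), hsrc, hcoord φ a ha]
    simp [LocalMap.coord2, φ.1.left_inv ha]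
  have htrans : ∀ φ ψ, Set.EqOn ((e φ).symm.trans (e ψ)) (mapTrans2 (ψ.1 ∘ φ.1.symm))
      ((e φ).symm.trans (e ψ)).source := by
    intro φ ψ c hc
    have hc' := (htr φ ψ c).1 hc
    obtain ⟨a, ha, rfl⟩ := LocalMap.exists_coord2_eq φ.2 c hc'.1
    have ha' : a.toFun a.pt ∈ ψ.1.source := by simpa [LocalMap.coord2, φ.1.left_inv ha] using hc'.2
    rw [PartialEquiv.coe_trans, Function.comp_apply, ← hcoord φ a ha,
      (e φ).left_inv ((hsrc φ a).2 ha), hcoord φ a ha, hcoord ψ a ha']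
    exact a.coord2_transition φ.2 ψ.2 ha ha'
  obtain ⟨i1, i2, hM, h⟩ := exists_hasCharts e
    (fun θ => by
      obtain ⟨a, rfl⟩ := MapJet2.exists_rep θ
      exact ⟨⟨chartAt F (a.toFun a.pt), IsManifold.chart_mem_maximalAtlas _⟩,
        (hsrc _ a).2 (mem_chart_source F _)⟩)
    (fun φ ψ => by
      rw [show ((e φ).symm.trans (e ψ)).source = _ from Set.ext (htr φ ψ)]
      exact isOpen_transition_domain.preimage (f := fun c : MapModel2 V F => c.2.1) (by fun_prop))
    (fun φ ψ => by
      refine ContDiffOn.congr (fun c hc => ContDiffAt.contDiffWithinAt ?_) (htrans φ ψ)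
      have hc' := (htr φ ψ c).1 hc
      exact contDiffAt_mapTrans2 (contDiffAt_transition φ.2 ψ.2 hc'.1 hc'.2))
  refine ⟨i1, i2, hM, fun φ => ?_⟩
  obtain ⟨f, hf, hfe⟩ := h φ
  refine ⟨f, hf, fun a => ?_, fun a ha => ?_⟩
  · rw [← hsrc, ← hfe]
  · have h1 : f a.jet2 = a.coord2 φ.1 := by
      rw [← OpenPartialHomeomorph.coe_toPartialEquiv, hfe]
      exact hcoord φ a ha
    refine ⟨by rw [h1]; rfl, by rw [h1]; rfl, by rw [h1]; rfl, ?_⟩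
    rw [h1]
    exact a.toBilin_coord2 φ.2 ha

end MapJets


/-! ### Slope and second derivative of a parametrized graph -/

section LinearAlgebra

variable {V W F : Type*} [NormedAddCommGroup V] [NormedSpace ℝ V]
  [NormedAddCommGroup W] [NormedSpace ℝ W] [NormedAddCommGroup F] [NormedSpace ℝ F]

theorem isInvertible_of_injective [FiniteDimensional ℝ V] {H : V →L[ℝ] V}
    (h : Function.Injective H) : H.IsInvertible :=
  ⟨(LinearEquiv.ofInjectiveEndo (H : V →ₗ[ℝ] V) h).toContinuousLinearEquiv, by ext; rfl⟩

theorem isOpen_setOf_isInvertible [CompleteSpace V] :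
    IsOpen {H : V →L[ℝ] F | H.IsInvertible} :=
  ContinuousLinearEquiv.isOpen

/-- The inverse function theorem, restricted to an open set on which `h` is smooth with invertible
derivative. Without this restriction the inverse would be known to be smooth only at the image of
`x`. -/
theorem exists_localInverse [CompleteSpace V] {h : V → F} {x : V}
    (hh : ∀ᶠ y in 𝓝 x, ContDiffAt ℝ ∞ h y) (hi : (fderiv ℝ h x).IsInvertible) :
    ∃ H : OpenPartialHomeomorph V F, (H : V → F) = h ∧ x ∈ H.source ∧
      ∀ u ∈ H.target, ContDiffAt ℝ ∞ H.symm u := by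
  obtain ⟨M, hM⟩ := hi
  have hd : HasFDerivAt h (M : V →L[ℝ] F) x := by
    rw [hM]
    exact (hh.self_of_nhds.differentiableAt (by simp)).hasFDerivAt
  have hinv : ∀ᶠ y in 𝓝 x, ContDiffAt ℝ ∞ h y ∧ (fderiv ℝ h y).IsInvertible := by
    refine hh.and ?_
    have hc : ContinuousAt (fderiv ℝ h) x := (contDiffAt_fderiv hh.self_of_nhds).continuousAt
    exact hc.eventually_mem (isOpen_setOf_isInvertible.mem_nhds ⟨M, hM⟩)
  obtain ⟨U, hU, hUo, hxU⟩ := eventually_nhds_iff.1 hinv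
  let H := hh.self_of_nhds.toOpenPartialHomeomorph h hd (by simp)
  refine ⟨H.restrOpen U hUo, rfl,
    ⟨hh.self_of_nhds.mem_toOpenPartialHomeomorph_source hd (by simp), hxU⟩, fun u hu => ?_⟩
  have hs := (H.restrOpen U hUo).map_target hu
  obtain ⟨h1, M', hM'⟩ := hU _ hs.2
  refine (H.restrOpen U hUo).contDiffAt_symm (f₀' := M') hu ?_ h1
  rw [hM']
  exact (h1.differentiableAt (by simp)).hasFDerivAt

/-- The slope of the image of `A : V → V × W`, as a graph over `V`. -/
def slope (A : V →L[ℝ] V × W) : V →L[ℝ] W :=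
  ((ContinuousLinearMap.snd ℝ V W).comp A).comp ((ContinuousLinearMap.fst ℝ V W).comp A).inverse

/-- The second derivative of the function whose graph is parametrized by a map with the derivatives
`A` and `B`. -/
def curv (A : V →L[ℝ] V × W) (B : V →L[ℝ] V →L[ℝ] V × W) : V →L[ℝ] V →L[ℝ] W :=
  pullBilin (pushBilin (ContinuousLinearMap.snd ℝ V W -
    (slope A).comp (ContinuousLinearMap.fst ℝ V W)) B)
    ((ContinuousLinearMap.fst ℝ V W).comp A).inverse

theorem slope_eq {A : V →L[ℝ] V × W} {C : V →L[ℝ] W}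
    (hA : ((ContinuousLinearMap.fst ℝ V W).comp A).IsInvertible)
    (h : ∀ v, (A v).2 = C (A v).1) : slope A = C := by
  ext v
  have := h (((ContinuousLinearMap.fst ℝ V W).comp A).inverse v)
  have h2 : (A (((ContinuousLinearMap.fst ℝ V W).comp A).inverse v)).1 = v :=
    hA.self_apply_inverse v
  rw [h2] at this
  exact this

theorem slope_apply {A : V →L[ℝ] V × W}
    (hA : ((ContinuousLinearMap.fst ℝ V W).comp A).IsInvertible) (v : V) :
    slope A (A v).1 = (A v).2 := by
  have := hA.inverse_apply_self v
  simp only [ContinuousLinearMap.comp_apply, ContinuousLinearMap.coe_fst'] at this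
  simp [slope, this]

theorem curv_apply {A : V →L[ℝ] V × W}
    (hA : ((ContinuousLinearMap.fst ℝ V W).comp A).IsInvertible) (B : V →L[ℝ] V →L[ℝ] V × W)
    (v w : V) : curv A B (A v).1 (A w).1 = (B v w).2 - slope A (B v w).1 := by
  have h := fun v => hA.inverse_apply_self v
  simp only [ContinuousLinearMap.comp_apply, ContinuousLinearMap.coe_fst'] at h
  simp [curv, h]

/-- As `A₁` is onto, a bilinear map on `V` is determined by its values on the pairs `A₁ v, A₁ w`,
and there `curv_apply` gives the value. -/
theorem curv_eq {A : V →L[ℝ] V × W} {B : V →L[ℝ] V →L[ℝ] V × W} {D : V →L[ℝ] V →L[ℝ] W}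
    (hA : ((ContinuousLinearMap.fst ℝ V W).comp A).IsInvertible)
    (h : ∀ v w, (B v w).2 = D (A v).1 (A w).1 + slope A (B v w).1) : curv A B = D := by
  ext v w
  obtain ⟨v, rfl⟩ := hA.surjective v
  obtain ⟨w, rfl⟩ := hA.surjective w
  have := curv_apply hA B v w
  simp only [ContinuousLinearMap.comp_apply, ContinuousLinearMap.coe_fst']
  rw [this, h]
  abel

theorem contDiffAt_slope [CompleteSpace V] {A : V →L[ℝ] V × W}
    (hA : ((ContinuousLinearMap.fst ℝ V W).comp A).IsInvertible) :
    ContDiffAt ℝ ∞ (slope (V := V) (W := W)) A := by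
  have h1 : ContDiffAt ℝ ∞ (fun A : V →L[ℝ] V × W => (ContinuousLinearMap.fst ℝ V W).comp A) A :=
    contDiffAt_const.clm_comp contDiffAt_id
  exact (contDiffAt_const.clm_comp contDiffAt_id).clm_comp (hA.contDiffAt_map_inverse.comp A h1)

theorem contDiffAt_curv [CompleteSpace V]
    {c : (V →L[ℝ] V × W) × (V →L[ℝ] V →L[ℝ] V × W)}
    (hA : ((ContinuousLinearMap.fst ℝ V W).comp c.1).IsInvertible) :
    ContDiffAt ℝ ∞ (fun c : (V →L[ℝ] V × W) × (V →L[ℝ] V →L[ℝ] V × W) => curv c.1 c.2) c := by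
  have h1 : ContDiffAt ℝ ∞ (fun c : (V →L[ℝ] V × W) × (V →L[ℝ] V →L[ℝ] V × W) =>
      (ContinuousLinearMap.fst ℝ V W).comp c.1) c :=
    contDiffAt_const.clm_comp contDiffAt_fst
  have h2 : ContDiffAt ℝ ∞ (fun c : (V →L[ℝ] V × W) × (V →L[ℝ] V →L[ℝ] V × W) => slope c.1) c :=
    (contDiffAt_slope hA).comp c contDiffAt_fst
  exact contDiffAt_pullBilin
    (contDiffAt_pushBilin (contDiffAt_const.sub (h2.clm_comp contDiffAt_const)) contDiffAt_snd)
    (ContDiffAt.comp (g := ContinuousLinearMap.inverse) c hA.contDiffAt_map_inverse h1)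

theorem fderiv_continuousLinearMap_comp {G : Type*} [NormedAddCommGroup G] [NormedSpace ℝ G]
    (L : F →L[ℝ] G) {k : V → F} {x : V} (hk : ContDiffAt ℝ ∞ k x) :
    fderiv ℝ (fun y => L (k y)) x = L.comp (fderiv ℝ k x) :=
  (L.hasFDerivAt.comp x (hk.differentiableAt (by simp)).hasFDerivAt).fderiv

theorem fderiv_fderiv_continuousLinearMap_comp {G : Type*} [NormedAddCommGroup G]
    [NormedSpace ℝ G] (L : F →L[ℝ] G) {k : V → F} {x : V} (hk : ContDiffAt ℝ ∞ k x) :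
    fderiv ℝ (fderiv ℝ (fun y => L (k y))) x = pushBilin L (fderiv ℝ (fderiv ℝ k) x) := by
  have h := fderiv_fderiv_comp_eq (τ := L) hk.two_of_infty L.contDiff.contDiffAt
  have h0 : fderiv ℝ (fderiv ℝ L) (k x) = 0 := by
    rw [show fderiv ℝ L = fun _ => L from funext fun y => L.fderiv]
    simp
  rw [h0, L.fderiv] at h
  refine h.trans ?_
  ext v w
  simp

/-- The derivatives of the function whose graph is parametrized by `k`. -/
theorem graph_derivatives {k : V → V × W} {x : V} {f : V → W} (hk : ContDiffAt ℝ ∞ k x)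
    (hf : ContDiffAt ℝ ∞ f (k x).1) (hkf : ∀ᶠ y in 𝓝 x, (k y).2 = f (k y).1)
    (hA : ((ContinuousLinearMap.fst ℝ V W).comp (fderiv ℝ k x)).IsInvertible) :
    fderiv ℝ f (k x).1 = slope (fderiv ℝ k x) ∧
      fderiv ℝ (fderiv ℝ f) (k x).1 = curv (fderiv ℝ k x) (fderiv ℝ (fderiv ℝ k) x) := by
  -- Both assertions come from the identity `k₂ = f ∘ k₁` of germs: differentiating once gives the
  -- slope, and differentiating twice gives the second derivative.
  have he : (fun y => (ContinuousLinearMap.snd ℝ V W) (k y)) =ᶠ[𝓝 x]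
    f ∘ (fun y => ContinuousLinearMap.fst ℝ V W (k y)) := hkf
  have hk1 : ContDiffAt ℝ ∞ (fun y => ContinuousLinearMap.fst ℝ V W (k y)) x := hk.fst
  have h1 := he.fderiv_eq (𝕜 := ℝ)
  rw [fderiv_continuousLinearMap_comp (ContinuousLinearMap.snd ℝ V W) hk, fderiv_comp x
    (hf.differentiableAt (by simp)) (hk1.differentiableAt (by simp)),
    fderiv_continuousLinearMap_comp (ContinuousLinearMap.fst ℝ V W) hk] at h1
  have hs : slope (fderiv ℝ k x) = fderiv ℝ f (k x).1 :=
    slope_eq hA fun v => by simpa using congrArg (fun L : V →L[ℝ] W => L v) h1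
  refine ⟨hs.symm, (curv_eq hA fun v w => ?_).symm⟩
  have h2 := (he.fderiv (𝕜 := ℝ)).fderiv_eq (𝕜 := ℝ)
  rw [fderiv_fderiv_continuousLinearMap_comp _ hk,
    fderiv_fderiv_comp_eq hk1.two_of_infty hf.two_of_infty,
    fderiv_fderiv_continuousLinearMap_comp _ hk, fderiv_continuousLinearMap_comp _ hk] at h2
  rw [hs]
  simpa using congrArg (fun L : V →L[ℝ] V →L[ℝ] W => L v w) h2

end LinearAlgebra

/-! ### Submanifolds as graphs and as images of immersions -/

section Submanifolds

variable {V W E : Type*} [NormedAddCommGroup V] [NormedSpace ℝ V]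
  [NormedAddCommGroup W] [NormedSpace ℝ W]
  [TopologicalSpace E] [ChartedSpace (V × W) E]

/-- The local map `a` parametrizes `L` near its marked point. -/
def LocalMap.Parametrizes {F : Type*} [NormedAddCommGroup F] [NormedSpace ℝ F]
    [ChartedSpace F E] (a : LocalMap V F E) (L : Set E) : Prop :=
  Filter.map a.toFun (𝓝 a.pt) = 𝓝[L] (a.toFun a.pt)

theorem LocalMap.Parametrizes.eventually_mem {a : LocalMap V (V × W) E} {L : Set E}
    (h : a.Parametrizes L) : ∀ᶠ y in 𝓝 a.pt, a.toFun y ∈ L := by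
  have h1 : L ∈ Filter.map a.toFun (𝓝 a.pt) := by
    rw [LocalMap.Parametrizes] at h
    rw [h]
    exact self_mem_nhdsWithin
  exact h1

/-- Since `a ∘ r` is the identity on `L` near the point, `𝓝[L]` is its own image under `a ∘ r`, and
`r` tends to the marked point. So `a` covers a neighbourhood in `L`; the other inequality is
continuity. -/
theorem LocalMap.parametrizes_of_leftInverse {a : LocalMap V (V × W) E} {L : Set E}
    (h : ∀ᶠ y in 𝓝 a.pt, a.toFun y ∈ L) {r : E → V}
    (hr : Filter.Tendsto r (𝓝[L] (a.toFun a.pt)) (𝓝 a.pt))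
    (hs : ∀ᶠ q in 𝓝[L] (a.toFun a.pt), a.toFun (r q) = q) : a.Parametrizes L := by
  refine le_antisymm (tendsto_nhdsWithin_iff.2 ⟨a.continuousAt, h⟩) ?_
  calc 𝓝[L] (a.toFun a.pt) = Filter.map (fun q => a.toFun (r q)) (𝓝[L] (a.toFun a.pt)) := by
        rw [Filter.map_congr (show (fun q => a.toFun (r q)) =ᶠ[𝓝[L] (a.toFun a.pt)] id from hs),
          Filter.map_id]
    _ = Filter.map a.toFun (Filter.map r (𝓝[L] (a.toFun a.pt))) := by
        rw [Filter.map_map]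
        rfl
    _ ≤ Filter.map a.toFun (𝓝 a.pt) := Filter.map_mono hr

omit [ChartedSpace (V × W) E] in
theorem IsGraphAt.snd_eq {φ : OpenPartialHomeomorph E (V × W)} {L : Set E} {p : E} {f : V → W}
    (h : IsGraphAt φ L p f) (hp : p ∈ L) : (φ p).2 = f (φ p).1 :=
  h.graph.self_of_nhds.1 hp

omit [ChartedSpace (V × W) E] in
theorem IsGraphAt.graph_mem {φ : OpenPartialHomeomorph E (V × W)} {L : Set E} {p : E} {f : V → W}
    (h : IsGraphAt φ L p f) (hp : p ∈ L) :
    ∀ᶠ u in 𝓝 (φ p).1, (u, f u) ∈ φ.target ∧ φ.symm (u, f u) ∈ L := by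
  have hc : ContinuousAt (fun u => (u, f u)) (φ p).1 :=
    continuousAt_id.prodMk h.smooth.self_of_nhds.continuousAt
  have hφp : ((φ p).1, f (φ p).1) = φ p := by rw [← h.snd_eq hp]
  have hc' : Filter.Tendsto (fun u => (u, f u)) (𝓝 (φ p).1) (𝓝 (φ p)) := by
    have := hc.tendsto
    rwa [hφp] at this
  have ht : ∀ᶠ u in 𝓝 (φ p).1, (u, f u) ∈ φ.target :=
    hc'.eventually (φ.open_target.mem_nhds (φ.map_source h.mem_source))
  have hs : Filter.Tendsto φ.symm (𝓝 (φ p)) (𝓝 p) := by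
    have := φ.continuousAt_symm (φ.map_source h.mem_source)
    rwa [ContinuousAt, φ.left_inv h.mem_source] at this
  filter_upwards [ht, (hs.comp hc').eventually h.graph] with u hu hg
  exact ⟨hu, hg.2 (by simp [φ.right_inv hu])⟩

omit [ChartedSpace (V × W) E] in
-- The germ of the describing function is unique: the points `φ.symm (u, f u)` lie in `L`, so their
-- second coordinate is also `g u`.
theorem IsGraphAt.eventuallyEq {φ : OpenPartialHomeomorph E (V × W)} {L : Set E} {p : E}
    {f g : V → W} (h : IsGraphAt φ L p f) (h' : IsGraphAt φ L p g) (hp : p ∈ L) :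
    f =ᶠ[𝓝 (φ p).1] g := by
  have hc : ContinuousAt (fun u => (u, f u)) (φ p).1 :=
    continuousAt_id.prodMk h.smooth.self_of_nhds.continuousAt
  have hφp : ((φ p).1, f (φ p).1) = φ p := by rw [← h.snd_eq hp]
  have hc' : Filter.Tendsto (fun u => (u, f u)) (𝓝 (φ p).1) (𝓝 (φ p)) := by
    have := hc.tendsto
    rwa [hφp] at this
  have hs : Filter.Tendsto φ.symm (𝓝 (φ p)) (𝓝 p) := by
    have := φ.continuousAt_symm (φ.map_source h.mem_source)
    rwa [ContinuousAt, φ.left_inv h.mem_source] at this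
  filter_upwards [h.graph_mem hp, (hs.comp hc').eventually h'.graph] with u hu hg
  have := hg.1 hu.2
  simpa [φ.right_inv hu.1] using this

/-- The parametrization `u ↦ (u, f u)` of a graph. -/
def IsGraphAt.localMap {φ : OpenPartialHomeomorph E (V × W)} {L : Set E} {p : E} {f : V → W}
    (h : IsGraphAt φ L p f) (hp : p ∈ L) (hφ : φ ∈ IsManifold.maximalAtlas 𝓘(ℝ, V × W) ∞ E) :
    LocalMap V (V × W) E where
  pt := (φ p).1
  toFun u := φ.symm (u, f u)
  smooth := by
    filter_upwards [h.smooth, h.graph_mem hp] with u hu hm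
    exact (contMDiffAt_symm_of_mem_maximalAtlas hφ hm.1).comp u
      (contDiffAt_id.prodMk hu).contMDiffAt

section GraphLocalMap

variable {φ : OpenPartialHomeomorph E (V × W)} {L : Set E} {p : E} {f : V → W}
  (h : IsGraphAt φ L p f) (hp : p ∈ L) (hφ : φ ∈ IsManifold.maximalAtlas 𝓘(ℝ, V × W) ∞ E)

theorem IsGraphAt.localMap_pt : (h.localMap hp hφ).toFun (h.localMap hp hφ).pt = p := by
  change φ.symm ((φ p).1, f (φ p).1) = p
  rw [← h.snd_eq hp]
  exact φ.left_inv h.mem_source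

theorem IsGraphAt.localMap_eventuallyEq :
    φ ∘ (h.localMap hp hφ).toFun =ᶠ[𝓝 (φ p).1] fun u => (u, f u) := by
  filter_upwards [h.graph_mem hp] with u hu
  exact φ.right_inv hu.1

theorem IsGraphAt.localMap_parametrizes : (h.localMap hp hφ).Parametrizes L := by
  have hpt := h.localMap_pt hp hφ
  refine LocalMap.parametrizes_of_leftInverse (r := fun q => (φ q).1) ?_ ?_ ?_
  · filter_upwards [h.graph_mem hp] with u hu using hu.2
  · rw [hpt]
    exact (continuous_fst.continuousAt.comp (φ.continuousAt h.mem_source)).mono_left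
      nhdsWithin_le_nhds
  · rw [hpt]
    filter_upwards [nhdsWithin_le_nhds h.graph, self_mem_nhdsWithin,
      nhdsWithin_le_nhds (φ.open_source.mem_nhds h.mem_source)] with q hq hqL hqs
    change φ.symm ((φ q).1, f (φ q).1) = q
    rw [← hq.1 hqL]
    exact φ.left_inv hqs

theorem IsGraphAt.fderiv_localMap : fderiv ℝ (φ ∘ (h.localMap hp hφ).toFun) (φ p).1 =
    (ContinuousLinearMap.id ℝ V).prod (fderiv ℝ f (φ p).1) := by
  rw [(h.localMap_eventuallyEq hp hφ).fderiv_eq]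
  exact ((hasFDerivAt_id _).prodMk
    (h.smooth.self_of_nhds.differentiableAt (by simp)).hasFDerivAt).fderiv

theorem IsGraphAt.fderiv_fderiv_localMap :
    fderiv ℝ (fderiv ℝ (φ ∘ (h.localMap hp hφ).toFun)) (φ p).1 =
      pushBilin (ContinuousLinearMap.inr ℝ V W) (fderiv ℝ (fderiv ℝ f) (φ p).1) := by
  have he : fderiv ℝ (fun u => (u, f u)) =ᶠ[𝓝 (φ p).1]
      fun u => ContinuousLinearMap.inl ℝ V W +
        (ContinuousLinearMap.compL ℝ V W (V × W) (ContinuousLinearMap.inr ℝ V W))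
          (fderiv ℝ f u) := by
    filter_upwards [h.smooth] with u hu
    refine (((hasFDerivAt_id _).prodMk
      (hu.differentiableAt (by simp)).hasFDerivAt).congr_fderiv ?_).fderiv
    ext v <;> simp
  rw [(h.localMap_eventuallyEq hp hφ).fderiv.fderiv_eq, he.fderiv_eq, fderiv_const_add]
  exact ((ContinuousLinearMap.hasFDerivAt _).comp _ ((contDiffAt_fderiv
    h.smooth.self_of_nhds).differentiableAt (by simp)).hasFDerivAt).fderiv

end GraphLocalMap

variable [IsManifold 𝓘(ℝ, V × W) ∞ E]

theorem LocalMap.isImmersive_iff {F : Type*} [NormedAddCommGroup F] [NormedSpace ℝ F]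
    [ChartedSpace F E] [IsManifold 𝓘(ℝ, F) ∞ E] (a : LocalMap V F E)
    {φ : OpenPartialHomeomorph E F}
    (hφ : φ ∈ IsManifold.maximalAtlas 𝓘(ℝ, F) ∞ E) (hm : a.toFun a.pt ∈ φ.source) :
    a.IsImmersive ↔ Function.Injective (fderiv ℝ (φ ∘ a.toFun) a.pt) := by
  have h1 : (fderiv ℝ (φ ∘ a.toFun) a.pt : V → F) =
      mfderiv 𝓘(ℝ, F) 𝓘(ℝ, F) φ (a.toFun a.pt) ∘ mfderiv 𝓘(ℝ, V) 𝓘(ℝ, F) a.toFun a.pt :=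
    funext fun v => fderiv_chart_comp hφ hm (a.smooth.self_of_nhds.mdifferentiableAt (by simp)) v
  rw [h1, LocalMap.IsImmersive]
  exact ((mfderiv_chart_bijective hφ hm).1.of_comp_iff _).symm

variable [FiniteDimensional ℝ V]

/-- Where `L` is the graph of `f`, the second component of `φ ∘ a` is `f` of the first. A vector
killed by the first component of the derivative is then killed by the second too, so immersivity
makes the first component injective, hence invertible because `V` has finite dimension. -/
theorem LocalMap.graph_of_immersive {a : LocalMap V (V × W) E} (ha : a.IsImmersive) {L : Set E}
    (hL : ∀ᶠ y in 𝓝 a.pt, a.toFun y ∈ L) {φ : OpenPartialHomeomorph E (V × W)}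
    (hφ : φ ∈ IsManifold.maximalAtlas 𝓘(ℝ, V × W) ∞ E) {f : V → W}
    (h : IsGraphAt φ L (a.toFun a.pt) f) :
    (∀ᶠ y in 𝓝 a.pt, (φ (a.toFun y)).2 = f (φ (a.toFun y)).1) ∧
      ((ContinuousLinearMap.fst ℝ V W).comp (fderiv ℝ (φ ∘ a.toFun) a.pt)).IsInvertible := by
  have h1 : ∀ᶠ y in 𝓝 a.pt, (φ (a.toFun y)).2 = f (φ (a.toFun y)).1 := by
    filter_upwards [hL, a.continuousAt.eventually h.graph] with y hy hg using hg.1 hy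
  refine ⟨h1, isInvertible_of_injective ?_⟩
  have hk := a.contDiffAt hφ h.mem_source
  have he : (fun y => ContinuousLinearMap.snd ℝ V W ((φ ∘ a.toFun) y)) =ᶠ[𝓝 a.pt]
    f ∘ (fun y => ContinuousLinearMap.fst ℝ V W ((φ ∘ a.toFun) y)) := h1
  have hk1 : ContDiffAt ℝ ∞ (fun y => ContinuousLinearMap.fst ℝ V W ((φ ∘ a.toFun) y)) a.pt :=
    hk.fst
  have h2 := he.fderiv_eq (𝕜 := ℝ)
  rw [fderiv_continuousLinearMap_comp (ContinuousLinearMap.snd ℝ V W) hk, fderiv_comp a.pt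
    (h.smooth.self_of_nhds.differentiableAt (by simp)) (hk1.differentiableAt (by simp)),
    fderiv_continuousLinearMap_comp (ContinuousLinearMap.fst ℝ V W) hk] at h2
  rw [injective_iff_map_eq_zero]
  intro v hv
  have h3 := congrArg (fun L : V →L[ℝ] W => L v) h2
  simp only [ContinuousLinearMap.comp_apply] at h3 hv
  rw [hv, map_zero] at h3
  exact (injective_iff_map_eq_zero _).1 ((a.isImmersive_iff hφ h.mem_source).1 ha) v
    (Prod.ext hv h3)

/-- The first component of `φ ∘ a` is a local diffeomorphism of `V`, and `a` is the graph
parametrization composed with it, so both have the same image filter. -/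
theorem LocalMap.parametrizes_of_immersive {a : LocalMap V (V × W) E} (ha : a.IsImmersive)
    {L : Set E} (hp : a.toFun a.pt ∈ L)
    (hL : ∀ᶠ y in 𝓝 a.pt, a.toFun y ∈ L) {φ : OpenPartialHomeomorph E (V × W)}
    (hφ : φ ∈ IsManifold.maximalAtlas 𝓘(ℝ, V × W) ∞ E) {f : V → W}
    (h : IsGraphAt φ L (a.toFun a.pt) f) : a.Parametrizes L := by
  have : CompleteSpace V := FiniteDimensional.complete ℝ V
  obtain ⟨h1, M, hM⟩ := graph_of_immersive ha hL hφ h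
  have hk := a.contDiffAt hφ h.mem_source
  have hk1 : ContDiffAt ℝ ∞ (fun y => (φ (a.toFun y)).1) a.pt := hk.fst
  have hmap : Filter.map (fun y => (φ (a.toFun y)).1) (𝓝 a.pt) = 𝓝 (φ (a.toFun a.pt)).1 := by
    refine (hk1.hasStrictFDerivAt' (f' := (M : V →L[ℝ] V)) ?_ (by simp)).map_nhds_eq_of_equiv
    rw [hM, ← fderiv_continuousLinearMap_comp _ hk]
    exact (hk1.differentiableAt (by simp)).hasFDerivAt
  have hs : a.toFun =ᶠ[𝓝 a.pt] (h.localMap hp hφ).toFun ∘ fun y => (φ (a.toFun y)).1 := by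
    filter_upwards [h1, a.eventually_mem h.mem_source] with y hy hys
    change _ = φ.symm ((φ (a.toFun y)).1, f (φ (a.toFun y)).1)
    rw [← hy]
    exact (φ.left_inv hys).symm
  rw [Parametrizes, Filter.map_congr hs, ← Filter.map_map, hmap]
  have := h.localMap_parametrizes hp hφ
  rw [Parametrizes, h.localMap_pt hp hφ] at this
  exact this

omit [IsManifold 𝓘(ℝ, V × W) ∞ E] in
-- The function is `φ₂ ∘ a ∘ (φ₁ ∘ a)⁻¹`, with the local inverse of the first component. The filter
-- equality in `Parametrizes` ensures that all points of `L` near the marked point come from nearby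
-- parameters, so that no other sheet of `L` interferes.
theorem LocalMap.Parametrizes.exists_graph {a : LocalMap V (V × W) E} {L : Set E}
    (h : a.Parametrizes L) {φ : OpenPartialHomeomorph E (V × W)}
    (hφ : φ ∈ IsManifold.maximalAtlas 𝓘(ℝ, V × W) ∞ E) (hm : a.toFun a.pt ∈ φ.source)
    (hA : ((ContinuousLinearMap.fst ℝ V W).comp (fderiv ℝ (φ ∘ a.toFun) a.pt)).IsInvertible) :
    ∃ f, IsGraphAt φ L (a.toFun a.pt) f := by
  have : CompleteSpace V := FiniteDimensional.complete ℝ V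
  have hsm : ∀ᶠ y in 𝓝 a.pt, ContDiffAt ℝ ∞ (φ ∘ a.toFun) y := by
    filter_upwards [a.smooth, a.eventually_mem hm] with y hy hys
    rw [← contMDiffAt_iff_contDiffAt]
    exact (contMDiffAt_of_mem_maximalAtlas hφ hys).comp y hy
  have hsm1 : ∀ᶠ y in 𝓝 a.pt, ContDiffAt ℝ ∞ (fun y => (φ (a.toFun y)).1) y :=
    hsm.mono fun y hy => hy.fst
  rw [← fderiv_continuousLinearMap_comp _ (a.contDiffAt hφ hm)] at hA
  obtain ⟨H, hH, hx, hHs⟩ := exists_localInverse hsm1 hA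
  have hHx : H a.pt = (φ (a.toFun a.pt)).1 := by rw [hH]
  have hHa : ∀ y, (φ (a.toFun y)).1 = H y := fun y => by rw [hH]
  have hHt : H.symm (φ (a.toFun a.pt)).1 = a.pt := by rw [← hHx, H.left_inv hx]
  have htend : Filter.Tendsto H.symm (𝓝 (φ (a.toFun a.pt)).1) (𝓝 a.pt) := by
    have := H.continuousAt_symm (H.map_source hx)
    rwa [ContinuousAt, H.left_inv hx, hHx] at this
  have htgt : ∀ᶠ u in 𝓝 (φ (a.toFun a.pt)).1, u ∈ H.target :=
    H.open_target.mem_nhds (hHx ▸ H.map_source hx)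
  refine ⟨fun u => (φ (a.toFun (H.symm u))).2, hm, ?_, ?_⟩
  · filter_upwards [htgt, htend.eventually hsm] with u hu hu'
    exact hu'.snd.comp u (hHs u hu)
  · have h1 : ∀ᶠ q in 𝓝 (a.toFun a.pt), q ∈ L →
        (φ q).2 = (φ (a.toFun (H.symm (φ q).1))).2 := by
      have : ∀ᶠ q in 𝓝[L] (a.toFun a.pt), (φ q).2 = (φ (a.toFun (H.symm (φ q).1))).2 := by
        rw [← show Filter.map a.toFun (𝓝 a.pt) = 𝓝[L] (a.toFun a.pt) from h, Filter.eventually_map]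
        filter_upwards [H.open_source.mem_nhds hx] with y hy
        rw [hHa, H.left_inv hy]
      exact eventually_nhdsWithin_iff.1 this
    have hφc : Filter.Tendsto (fun q => (φ q).1) (𝓝 (a.toFun a.pt)) (𝓝 (φ (a.toFun a.pt)).1) :=
      continuous_fst.continuousAt.comp (φ.continuousAt hm)
    filter_upwards [h1, hφc.eventually htgt, φ.open_source.mem_nhds hm,
      (htend.comp hφc).eventually h.eventually_mem,
      (htend.comp hφc).eventually (a.eventually_mem hm)] with q hq hqt hqs hqL hqs'
    refine ⟨hq, fun hq' => ?_⟩
    have : a.toFun (H.symm (φ q).1) = q := by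
      refine φ.injOn hqs' hqs (Prod.ext ?_ hq'.symm)
      rw [Function.comp_apply, hHa, H.right_inv hqt]
    rw [← this]
    exact hqL

end Submanifolds


/-! ### Contact and coordinates for the jets of submanifolds -/

section SubJets

variable {V W E : Type*} [NormedAddCommGroup V] [NormedSpace ℝ V]
  [NormedAddCommGroup W] [NormedSpace ℝ W]
  [TopologicalSpace E] [ChartedSpace (V × W) E]

/-- A complement of the range of `A` has the dimension of `W`. Identifying the range with `V`
through `A`, and the complement with `W`, gives an automorphism that turns `A v` into `(v, 0)`. -/
theorem exists_equiv_fst_isInvertible [FiniteDimensional ℝ V] [FiniteDimensional ℝ W]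
    {A : V →L[ℝ] V × W} (hA : Function.Injective A) :
    ∃ L : (V × W) ≃L[ℝ] (V × W),
      ((ContinuousLinearMap.fst ℝ V W).comp ((L : V × W →L[ℝ] V × W).comp A)).IsInvertible := by
  let A' : V →ₗ[ℝ] V × W := A
  have hA' : Function.Injective A' := hA
  obtain ⟨Q, hQ⟩ := Submodule.exists_isCompl (LinearMap.range A')
  have hd : Module.finrank ℝ Q = Module.finrank ℝ W := by
    have h1 := Submodule.finrank_add_eq_of_isCompl hQ
    have h2 := LinearMap.finrank_range_of_inj hA'
    rw [Module.finrank_prod] at h1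
    omega
  let e₁ : V ≃ₗ[ℝ] LinearMap.range A' := LinearEquiv.ofInjective A' hA'
  let e₂ : Q ≃ₗ[ℝ] W := LinearEquiv.ofFinrankEq _ _ hd
  let e₃ := Submodule.prodEquivOfIsCompl _ Q hQ
  refine ⟨(e₃.symm.trans (e₁.symm.prodCongr e₂)).toContinuousLinearEquiv,
    isInvertible_of_injective ?_⟩
  rw [injective_iff_map_eq_zero]
  intro v hv
  have h1 : e₃.symm (A' v) = (e₁ v, 0) := by
    rw [LinearEquiv.symm_apply_eq]
    simp [e₃, e₁]
  have h2 : (e₁.symm (e₃.symm (A' v)).1 : V) = 0 := hv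
  rw [h1] at h2
  simpa using h2

theorem trans_linearEquiv_mem_maximalAtlas {F : Type*} [NormedAddCommGroup F] [NormedSpace ℝ F]
    [ChartedSpace F E] [IsManifold 𝓘(ℝ, F) ∞ E] {φ : OpenPartialHomeomorph E F}
    (hφ : φ ∈ IsManifold.maximalAtlas 𝓘(ℝ, F) ∞ E) (L : F ≃L[ℝ] F) :
    φ.transHomeomorph L.toHomeomorph ∈ IsManifold.maximalAtlas 𝓘(ℝ, F) ∞ E := by
  refine OpenPartialHomeomorph.mem_maximalAtlas_of_contMDiffOn _ ?_ ?_
  · exact L.contDiff.contMDiff.comp_contMDiffOn (contMDiffOn_of_mem_maximalAtlas hφ)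
  · exact (contMDiffOn_symm_of_mem_maximalAtlas hφ).comp
      L.symm.contDiff.contMDiff.contMDiffOn fun x hx => hx

variable [IsManifold 𝓘(ℝ, V × W) ∞ E] [FiniteDimensional ℝ V]

/-- Around the image of an immersive local map there is a divided chart which is concordant to it.
-/
theorem LocalMap.IsImmersive.exists_chart [FiniteDimensional ℝ W] {a : LocalMap V (V × W) E}
    (ha : a.IsImmersive) : ∃ φ ∈ IsManifold.maximalAtlas 𝓘(ℝ, V × W) ∞ E,
      a.toFun a.pt ∈ φ.source ∧
      ((ContinuousLinearMap.fst ℝ V W).comp (fderiv ℝ (φ ∘ a.toFun) a.pt)).IsInvertible := by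
  have hφ := IsManifold.chart_mem_maximalAtlas (I := 𝓘(ℝ, V × W)) (n := ∞) (a.toFun a.pt)
  have hm := mem_chart_source (V × W) (a.toFun a.pt)
  obtain ⟨L, hL⟩ := exists_equiv_fst_isInvertible ((a.isImmersive_iff hφ hm).1 ha)
  refine ⟨_, trans_linearEquiv_mem_maximalAtlas hφ L, hm, ?_⟩
  rw [← fderiv_continuousLinearMap_comp (L : V × W →L[ℝ] V × W) (a.contDiffAt hφ hm)] at hL
  exact hL

/-- The local map `a` is an immersion which parametrizes the submanifold `b` near its marked point.
-/
structure Represents (a : LocalMap V (V × W) E) (b : PointedSub V W E) : Prop where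
  pt_eq : b.pt = a.toFun a.pt
  immersive : a.IsImmersive
  parametrizes : a.Parametrizes b.carrier

omit [FiniteDimensional ℝ V] [IsManifold 𝓘(ℝ, V × W) ∞ E] in
theorem LocalMap.isImmersive_of_injective_fst [IsManifold 𝓘(ℝ, V × W) ∞ E]
    {a : LocalMap V (V × W) E} {φ : OpenPartialHomeomorph E (V × W)}
    (hφ : φ ∈ IsManifold.maximalAtlas 𝓘(ℝ, V × W) ∞ E) (hm : a.toFun a.pt ∈ φ.source)
    (hA : Function.Injective
      ((ContinuousLinearMap.fst ℝ V W).comp (fderiv ℝ (φ ∘ a.toFun) a.pt))) : a.IsImmersive :=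
  (a.isImmersive_iff hφ hm).2 (Function.Injective.of_comp (f := Prod.fst) hA)

omit [FiniteDimensional ℝ V] in
theorem IsGraphAt.represents {φ : OpenPartialHomeomorph E (V × W)} {b : PointedSub V W E}
    {f : V → W} (h : IsGraphAt φ b.carrier b.pt f)
    (hφ : φ ∈ IsManifold.maximalAtlas 𝓘(ℝ, V × W) ∞ E) :
    Represents (h.localMap b.mem hφ) b where
  pt_eq := (h.localMap_pt b.mem hφ).symm
  immersive := by
    refine LocalMap.isImmersive_of_injective_fst hφ ?_ ?_
    · rw [h.localMap_pt b.mem hφ]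
      exact h.mem_source
    · have := h.fderiv_localMap b.mem hφ
      rw [show (h.localMap b.mem hφ).pt = (φ b.pt).1 from rfl, this]
      intro v w hvw
      exact hvw
  parametrizes := h.localMap_parametrizes b.mem hφ

/-- That the carrier is a submanifold is part of `b`, so a concordant chart exists and
`parametrizes_of_immersive` applies; injectivity of `s` on `U` is not required. -/
theorem IsImageOf.represents {a : LocalMap V (V × W) E} {b : PointedSub V W E}
    (h : IsImageOf a b) : Represents a b := by
  obtain ⟨hp, U, hU, hx, hb, hs⟩ := h
  have hL : ∀ᶠ y in 𝓝 a.pt, a.toFun y ∈ b.carrier := by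
    filter_upwards [hU.mem_nhds hx] with y hy
    rw [hb]
    exact ⟨y, hy, rfl⟩
  obtain ⟨φ, hφ, f, hf⟩ := b.isSub b.pt b.mem
  have ha : a.IsImmersive := (hs _ hx).2
  exact ⟨hp, ha, LocalMap.parametrizes_of_immersive ha (hp ▸ b.mem) hL hφ (hp ▸ hf)⟩

section Represents

variable {a a' : LocalMap V (V × W) E} {b b' : PointedSub V W E}
  {φ : OpenPartialHomeomorph E (V × W)}

theorem Represents.derivatives (h : Represents a b)
    (hφ : φ ∈ IsManifold.maximalAtlas 𝓘(ℝ, V × W) ∞ E) {f : V → W}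
    (hf : IsGraphAt φ b.carrier b.pt f) :
    ((ContinuousLinearMap.fst ℝ V W).comp (fderiv ℝ (φ ∘ a.toFun) a.pt)).IsInvertible ∧
      fderiv ℝ f (φ b.pt).1 = slope (fderiv ℝ (φ ∘ a.toFun) a.pt) ∧
      fderiv ℝ (fderiv ℝ f) (φ b.pt).1 = curv (fderiv ℝ (φ ∘ a.toFun) a.pt)
        (fderiv ℝ (fderiv ℝ (φ ∘ a.toFun)) a.pt) := by
  rw [h.pt_eq] at hf ⊢
  obtain ⟨h1, h2⟩ := LocalMap.graph_of_immersive h.immersive h.parametrizes.eventually_mem hφ hf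
  exact ⟨h2, graph_derivatives (a.contDiffAt hφ hf.mem_source) hf.smooth.self_of_nhds h1 h2⟩

/-- Whether a chart is concordant to the submanifold can thus be read from the `1`-jet of any
immersion that parametrizes it. -/
theorem Represents.exists_graph_iff (h : Represents a b)
    (hφ : φ ∈ IsManifold.maximalAtlas 𝓘(ℝ, V × W) ∞ E) :
    (∃ f, IsGraphAt φ b.carrier b.pt f) ↔ a.toFun a.pt ∈ φ.source ∧
      ((ContinuousLinearMap.fst ℝ V W).comp (fderiv ℝ (φ ∘ a.toFun) a.pt)).IsInvertible := by
  constructor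
  · rintro ⟨f, hf⟩
    exact ⟨h.pt_eq ▸ hf.mem_source, (h.derivatives hφ hf).1⟩
  · rintro ⟨h1, h2⟩
    rw [h.pt_eq]
    exact h.parametrizes.exists_graph hφ h1 h2

/-- Concordance and the derivative of the describing function are both expressed by the value and
the derivative of `φ ∘ a` at the marked point. Contact of the parametrizations therefore gives
contact of the images, in every chart at once. -/
theorem Represents.graphData1_subset (h : Represents a b) (h' : Represents a' b')
    (hc : a.Contact1 a') (hφ : φ ∈ IsManifold.maximalAtlas 𝓘(ℝ, V × W) ∞ E) :
    graphData1 φ b.carrier b.pt ⊆ graphData1 φ b'.carrier b'.pt := by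
  rintro _ ⟨f, hf, rfl⟩
  obtain ⟨h1, h2, -⟩ := h.derivatives hφ hf
  have hm : a.toFun a.pt ∈ φ.source := h.pt_eq ▸ hf.mem_source
  have hA := hc.2.2 φ hφ hm
  obtain ⟨f', hf'⟩ := (h'.exists_graph_iff hφ).2 ⟨hc.2.1 ▸ hm, hA ▸ h1⟩
  have hpt : b.pt = b'.pt := by rw [h.pt_eq, h'.pt_eq, hc.2.1]
  refine ⟨f', hf', ?_⟩
  rw [h2, (h'.derivatives hφ hf').2.1, ← hf.snd_eq b.mem, ← hf'.snd_eq b'.mem, hpt, hA]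

theorem Represents.graphData2_subset (h : Represents a b) (h' : Represents a' b')
    (hc : a.Contact2 a') (hφ : φ ∈ IsManifold.maximalAtlas 𝓘(ℝ, V × W) ∞ E) :
    graphData2 φ b.carrier b.pt ⊆ graphData2 φ b'.carrier b'.pt := by
  rintro _ ⟨f, hf, rfl⟩
  obtain ⟨h1, h2, h3⟩ := h.derivatives hφ hf
  have hm : a.toFun a.pt ∈ φ.source := h.pt_eq ▸ hf.mem_source
  have hA := hc.1.2.2 φ hφ hm
  obtain ⟨f', hf'⟩ := (h'.exists_graph_iff hφ).2 ⟨hc.1.2.1 ▸ hm, hA ▸ h1⟩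
  have hpt : b.pt = b'.pt := by rw [h.pt_eq, h'.pt_eq, hc.1.2.1]
  refine ⟨f', hf', ?_⟩
  obtain ⟨-, h2', h3'⟩ := h'.derivatives hφ hf'
  rw [h2, h3, h2', h3', ← hf.snd_eq b.mem, ← hf'.snd_eq b'.mem, hpt, hA, hc.2 φ hφ hm]

omit [IsManifold 𝓘(ℝ, V × W) ∞ E] [FiniteDimensional ℝ V] in
theorem PointedSub.jet1_eq_iff : b.jet1 = b'.jet1 ↔ (subSetoid1 V W E).r b b' :=
  ⟨fun h => Quotient.exact h, fun h => Quotient.sound (s := subSetoid1 V W E) h⟩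

omit [IsManifold 𝓘(ℝ, V × W) ∞ E] [FiniteDimensional ℝ V] in
theorem PointedSub.jet2_eq_iff : b.jet2 = b'.jet2 ↔ (subSetoid2 V W E).r b b' :=
  ⟨fun h => Quotient.exact h, fun h => Quotient.sound (s := subSetoid2 V W E) h⟩

omit [IsManifold 𝓘(ℝ, V × W) ∞ E] [FiniteDimensional ℝ V] in
theorem LocalMap.Contact1.symm (hc : a.Contact1 a') : a'.Contact1 a :=
  (mapSetoid1 V (V × W) E).symm hc

omit [IsManifold 𝓘(ℝ, V × W) ∞ E] [FiniteDimensional ℝ V] in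
theorem LocalMap.Contact2.symm (hc : a.Contact2 a') : a'.Contact2 a :=
  (mapSetoid2 V (V × W) E).symm hc

theorem Represents.jet1_eq (h : Represents a b) (h' : Represents a' b') (hc : a.Contact1 a') :
    b.jet1 = b'.jet1 :=
  PointedSub.jet1_eq_iff.2 ⟨by rw [h.pt_eq, h'.pt_eq, hc.2.1], fun _ hφ =>
    (h.graphData1_subset h' hc hφ).antisymm (h'.graphData1_subset h hc.symm hφ)⟩

theorem Represents.jet2_eq (h : Represents a b) (h' : Represents a' b') (hc : a.Contact2 a') :
    b.jet2 = b'.jet2 :=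
  PointedSub.jet2_eq_iff.2 ⟨by rw [h.pt_eq, h'.pt_eq, hc.1.2.1], fun _ hφ =>
    (h.graphData2_subset h' hc hφ).antisymm (h'.graphData2_subset h hc.symm hφ)⟩

/-- A small piece of an immersion has a submanifold as its image. -/
theorem LocalMap.IsImmersive.exists_isImageOf [FiniteDimensional ℝ W] (ha : a.IsImmersive) :
    ∃ b : PointedSub V W E, IsImageOf a b := by
  have : CompleteSpace V := FiniteDimensional.complete ℝ V
  obtain ⟨φ, hφ, hm, hA⟩ := ha.exists_chart
  have hk : ∀ᶠ y in 𝓝 a.pt, ContDiffAt ℝ ∞ (φ ∘ a.toFun) y := by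
    filter_upwards [a.smooth, a.eventually_mem hm] with y hy hys
    rw [← contMDiffAt_iff_contDiffAt]
    exact (contMDiffAt_of_mem_maximalAtlas hφ hys).comp y hy
  have hk1 : ∀ᶠ y in 𝓝 a.pt, ContDiffAt ℝ ∞ (fun y => (φ (a.toFun y)).1) y :=
    hk.mono fun y hy => hy.fst
  have hinv : ∀ᶠ y in 𝓝 a.pt,
      ((ContinuousLinearMap.fst ℝ V W).comp (fderiv ℝ (φ ∘ a.toFun) y)).IsInvertible := by
    have hc : ContinuousAt
        (fun y => (ContinuousLinearMap.fst ℝ V W).comp (fderiv ℝ (φ ∘ a.toFun) y)) a.pt :=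
      (contDiffAt_const.clm_comp (contDiffAt_fderiv (a.contDiffAt hφ hm))).continuousAt
    exact hc.eventually_mem (isOpen_setOf_isInvertible.mem_nhds hA)
  have hA' := hA
  rw [← fderiv_continuousLinearMap_comp _ (a.contDiffAt hφ hm)] at hA'
  obtain ⟨H, hH, hx, hHs⟩ := exists_localInverse hk1 hA'
  have hHa : ∀ y, (φ (a.toFun y)).1 = H y := fun y => by rw [hH]
  -- On `U` the map is smooth, stays in the chart, and has a first component that is injective with
  -- invertible derivative. So the image of `U` is a graph near each of its points, not only near
  -- the marked one.
  obtain ⟨U, hU, hUo, hxU⟩ := eventually_nhds_iff.1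
    ((a.smooth.and (a.eventually_mem hm)).and (hinv.and (H.open_source.mem_nhds hx)))
  have hsub : ∀ y, y ∈ U → ∃ f, IsGraphAt φ (a.toFun '' U) (a.toFun y) f := by
    intro y hy
    have hys := (hU y hy).1.2
    let a' : LocalMap V (V × W) E :=
      ⟨y, a.toFun, Filter.mem_of_superset (hUo.mem_nhds hy) fun z hz => (hU z hz).1.1⟩
    have hpar : a'.Parametrizes (a.toFun '' U) := by
      refine LocalMap.parametrizes_of_leftInverse (r := fun q => H.symm (φ q).1) ?_ ?_ ?_
      · filter_upwards [hUo.mem_nhds hy] with z hz using ⟨z, hz, rfl⟩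
      · have h1 : Filter.Tendsto H.symm (𝓝 (φ (a.toFun y)).1) (𝓝 y) := by
          rw [hHa]
          have := H.continuousAt_symm (H.map_source (hU y hy).2.2)
          rwa [ContinuousAt, H.left_inv (hU y hy).2.2] at this
        exact (h1.comp (continuous_fst.continuousAt.comp (φ.continuousAt hys))).mono_left
          nhdsWithin_le_nhds
      · filter_upwards [self_mem_nhdsWithin] with q hq
        obtain ⟨z, hz, rfl⟩ := hq
        change a.toFun (H.symm (φ (a.toFun z)).1) = a.toFun z
        rw [hHa, H.left_inv (hU z hz).2.2]
    exact hpar.exists_graph hφ hys (hU y hy).2.1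
  refine ⟨⟨a.toFun '' U, ?_, a.toFun a.pt, ⟨a.pt, hxU, rfl⟩⟩, rfl, U, hUo, hxU, rfl, ?_⟩
  · rintro _ ⟨y, hy, rfl⟩
    exact ⟨φ, hφ, hsub y hy⟩
  · intro y hy
    refine ⟨(hU y hy).1.1, ?_⟩
    let a' : LocalMap V (V × W) E :=
      ⟨y, a.toFun, Filter.mem_of_superset (hUo.mem_nhds hy) fun z hz => (hU z hz).1.1⟩
    exact LocalMap.isImmersive_of_injective_fst (a := a') hφ (hU y hy).1.2 (hU y hy).2.1.injective

end Represents

/-! ### Coordinates on the jets of submanifolds -/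

/-- The function which describes `b` near its marked point in the chart `φ`. -/
def PointedSub.graphFun (φ : OpenPartialHomeomorph E (V × W)) (b : PointedSub V W E) : V → W :=
  Classical.epsilon (IsGraphAt φ b.carrier b.pt)

/-- The coordinates `(u^λ, u^i, u^i_λ)` of a submanifold. -/
def PointedSub.coord1 (φ : OpenPartialHomeomorph E (V × W)) (b : PointedSub V W E) :
    SubModel1 V W :=
  ((φ b.pt).1, b.graphFun φ (φ b.pt).1, fderiv ℝ (b.graphFun φ) (φ b.pt).1)

/-- The coordinates `(u^λ, u^i, u^i_λ, u^i_λξ)` of a submanifold. -/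
def PointedSub.coord2 (φ : OpenPartialHomeomorph E (V × W)) (b : PointedSub V W E) :
    SubModel2 V W :=
  ((φ b.pt).1, b.graphFun φ (φ b.pt).1, fderiv ℝ (b.graphFun φ) (φ b.pt).1,
    SymBilin.symmetrize V W (fderiv ℝ (fderiv ℝ (b.graphFun φ)) (φ b.pt).1))

/-- The coordinates of the `1`-jet of the image of an immersion. -/
def quotCoord1 (c : MapModel1 V (V × W)) : SubModel1 V W :=
  (c.2.1.1, c.2.1.2, slope c.2.2)

/-- The coordinates of the `2`-jet of the image of an immersion. -/
def quotCoord2 (c : MapModel2 V (V × W)) : SubModel2 V W :=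
  (c.2.1.1, c.2.1.2, slope c.2.2.1,
    SymBilin.symmetrize V W (curv c.2.2.1 c.2.2.2.toBilin))

/-- The coordinates of the `1`-jet of the parametrization of a graph by its first coordinate. -/
def paramCoord1 (d : SubModel1 V W) : MapModel1 V (V × W) :=
  (d.1, (d.1, d.2.1), (ContinuousLinearMap.id ℝ V).prod d.2.2)

/-- The coordinates of the `2`-jet of the parametrization of a graph by its first coordinate. -/
def paramCoord2 (d : SubModel2 V W) : MapModel2 V (V × W) :=
  (d.1, (d.1, d.2.1), (ContinuousLinearMap.id ℝ V).prod d.2.2.1,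
    SymBilin.symmetrize V (V × W) (pushBilin (ContinuousLinearMap.inr ℝ V W) d.2.2.2.toBilin))

theorem contDiffAt_quotCoord1 {c : MapModel1 V (V × W)}
    (hc : ((ContinuousLinearMap.fst ℝ V W).comp c.2.2).IsInvertible) :
    ContDiffAt ℝ ∞ (quotCoord1 (V := V) (W := W)) c := by
  have : CompleteSpace V := FiniteDimensional.complete ℝ V
  have hA : ContDiffAt ℝ ∞ (fun c : MapModel1 V (V × W) => c.2.2) c := by fun_prop
  have h1 : ContDiffAt ℝ ∞ (fun c : MapModel1 V (V × W) => c.2.1.1) c := by fun_prop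
  have h2 : ContDiffAt ℝ ∞ (fun c : MapModel1 V (V × W) => c.2.1.2) c := by fun_prop
  exact h1.prodMk (h2.prodMk (ContDiffAt.comp (g := slope) c (contDiffAt_slope hc) hA))

theorem contDiffAt_quotCoord2 {c : MapModel2 V (V × W)}
    (hc : ((ContinuousLinearMap.fst ℝ V W).comp c.2.2.1).IsInvertible) :
    ContDiffAt ℝ ∞ (quotCoord2 (V := V) (W := W)) c := by
  have : CompleteSpace V := FiniteDimensional.complete ℝ V
  have hA : ContDiffAt ℝ ∞ (fun c : MapModel2 V (V × W) => c.2.2.1) c := by fun_prop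
  have hB' : ContDiffAt ℝ ∞ (fun c : MapModel2 V (V × W) => c.2.2.2) c := by fun_prop
  have hB : ContDiffAt ℝ ∞ (fun c : MapModel2 V (V × W) => c.2.2.2.toBilin) c :=
    (SymBilin.toBilinL V (V × W)).contDiff.contDiffAt.comp c hB'
  have h1 : ContDiffAt ℝ ∞ (fun c : MapModel2 V (V × W) => c.2.1.1) c := by fun_prop
  have h2 : ContDiffAt ℝ ∞ (fun c : MapModel2 V (V × W) => c.2.1.2) c := by fun_prop
  exact h1.prodMk (h2.prodMk ((ContDiffAt.comp (g := slope) c (contDiffAt_slope hc) hA).prodMk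
    ((SymBilin.symmetrize V W).contDiff.contDiffAt.comp c
      (ContDiffAt.comp (g := fun d : (V →L[ℝ] V × W) × (V →L[ℝ] V →L[ℝ] V × W) => curv d.1 d.2)
        (f := fun c : MapModel2 V (V × W) => (c.2.2.1, c.2.2.2.toBilin)) c
        (contDiffAt_curv hc) (hA.prodMk hB)))))

omit [FiniteDimensional ℝ V] in
theorem contDiff_prod_id :
    ContDiff ℝ ∞ (fun C : V →L[ℝ] W => (ContinuousLinearMap.id ℝ V).prod C) := by
  have : (fun C : V →L[ℝ] W => (ContinuousLinearMap.id ℝ V).prod C) = fun C =>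
      ContinuousLinearMap.inl ℝ V W + (ContinuousLinearMap.inr ℝ V W).comp C := by
    funext C
    ext v <;> simp
  rw [this]
  exact contDiff_const.add (contDiff_const.clm_comp contDiff_id)

omit [FiniteDimensional ℝ V] in
theorem contDiff_paramCoord1 : ContDiff ℝ ∞ (paramCoord1 (V := V) (W := W)) :=
  contDiff_fst.prodMk ((contDiff_fst.prodMk contDiff_snd.fst).prodMk
    ((contDiff_prod_id (V := V) (W := W)).comp contDiff_snd.snd))

omit [FiniteDimensional ℝ V] in
theorem contDiff_paramCoord2 : ContDiff ℝ ∞ (paramCoord2 (V := V) (W := W)) := by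
  have hB' : ContDiff ℝ ∞ (fun d : SubModel2 V W => d.2.2.2) := contDiff_snd.snd.snd
  have hB : ContDiff ℝ ∞ (fun d : SubModel2 V W => d.2.2.2.toBilin) :=
    (SymBilin.toBilinL V W).contDiff.comp hB'
  exact contDiff_fst.prodMk ((contDiff_fst.prodMk contDiff_snd.fst).prodMk
    (((contDiff_prod_id (V := V) (W := W)).comp contDiff_snd.snd.fst).prodMk
      ((SymBilin.symmetrize V (V × W)).contDiff.comp
        (contDiff_iff_contDiffAt.2 fun _ =>
          contDiffAt_pushBilin contDiffAt_const hB.contDiffAt))))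

section Coord

variable {b b' : PointedSub V W E} {φ : OpenPartialHomeomorph E (V × W)}

omit [IsManifold 𝓘(ℝ, V × W) ∞ E] [FiniteDimensional ℝ V]

theorem PointedSub.isGraphAt_graphFun (h : ∃ f, IsGraphAt φ b.carrier b.pt f) :
    IsGraphAt φ b.carrier b.pt (b.graphFun φ) :=
  Classical.epsilon_spec h

theorem PointedSub.coord1_eq_of_graph {f : V → W} (h : IsGraphAt φ b.carrier b.pt f) :
    b.coord1 φ = ((φ b.pt).1, f (φ b.pt).1, fderiv ℝ f (φ b.pt).1) := by
  have he := (isGraphAt_graphFun ⟨f, h⟩).eventuallyEq h b.mem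
  rw [coord1, he.self_of_nhds, he.fderiv_eq]

theorem PointedSub.coord2_eq_of_graph {f : V → W} (h : IsGraphAt φ b.carrier b.pt f) :
    b.coord2 φ = ((φ b.pt).1, f (φ b.pt).1, fderiv ℝ f (φ b.pt).1,
      SymBilin.symmetrize V W (fderiv ℝ (fderiv ℝ f) (φ b.pt).1)) := by
  have he := (isGraphAt_graphFun ⟨f, h⟩).eventuallyEq h b.mem
  rw [coord2, he.self_of_nhds, he.fderiv_eq, he.fderiv.fderiv_eq]

theorem PointedSub.toBilin_coord2 {f : V → W} (h : IsGraphAt φ b.carrier b.pt f) :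
    (b.coord2 φ).2.2.2.toBilin = fderiv ℝ (fderiv ℝ f) (φ b.pt).1 := by
  rw [coord2_eq_of_graph h]
  exact SymBilin.toBilin_symmetrize fun v w => fderiv_fderiv_symm h.smooth.self_of_nhds v w

/-- Concordance is nonemptiness of `graphData1`, which by definition depends only on the jet. -/
theorem PointedSub.exists_graph_iff_of_jet1_eq (h : b.jet1 = b'.jet1)
    (hφ : φ ∈ IsManifold.maximalAtlas 𝓘(ℝ, V × W) ∞ E) :
    (∃ f, IsGraphAt φ b.carrier b.pt f) ↔ ∃ f, IsGraphAt φ b'.carrier b'.pt f := by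
  have hd := (Quotient.exact h : (subSetoid1 V W E).r b b').2 φ hφ
  have key : ∀ c : PointedSub V W E, (∃ f, IsGraphAt φ c.carrier c.pt f) ↔
      (graphData1 φ c.carrier c.pt).Nonempty :=
    fun c => ⟨fun ⟨f, hf⟩ => ⟨_, f, hf, rfl⟩, fun ⟨_, f, hf, _⟩ => ⟨f, hf⟩⟩
  rw [key, key, hd]

theorem PointedSub.exists_graph_iff_of_jet2_eq (h : b.jet2 = b'.jet2)
    (hφ : φ ∈ IsManifold.maximalAtlas 𝓘(ℝ, V × W) ∞ E) :
    (∃ f, IsGraphAt φ b.carrier b.pt f) ↔ ∃ f, IsGraphAt φ b'.carrier b'.pt f := by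
  have hd := (Quotient.exact h : (subSetoid2 V W E).r b b').2 φ hφ
  have key : ∀ c : PointedSub V W E, (∃ f, IsGraphAt φ c.carrier c.pt f) ↔
      (graphData2 φ c.carrier c.pt).Nonempty :=
    fun c => ⟨fun ⟨f, hf⟩ => ⟨_, f, hf, rfl⟩, fun ⟨_, f, hf, _⟩ => ⟨f, hf⟩⟩
  rw [key, key, hd]

theorem PointedSub.coord1_eq_of_jet1_eq (h : b.jet1 = b'.jet1)
    (hφ : φ ∈ IsManifold.maximalAtlas 𝓘(ℝ, V × W) ∞ E)
    (hf : ∃ f, IsGraphAt φ b.carrier b.pt f) : b.coord1 φ = b'.coord1 φ := by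
  obtain ⟨f, hf⟩ := hf
  obtain ⟨hp, hd⟩ : (subSetoid1 V W E).r b b' := Quotient.exact h
  have hm : (f (φ b.pt).1, fderiv ℝ f (φ b.pt).1) ∈ graphData1 φ b.carrier b.pt := ⟨f, hf, rfl⟩
  rw [hd φ hφ] at hm
  obtain ⟨g, hg, he⟩ := hm
  rw [coord1_eq_of_graph hf, coord1_eq_of_graph hg, he, hp]

theorem PointedSub.coord2_eq_of_jet2_eq (h : b.jet2 = b'.jet2)
    (hφ : φ ∈ IsManifold.maximalAtlas 𝓘(ℝ, V × W) ∞ E)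
    (hf : ∃ f, IsGraphAt φ b.carrier b.pt f) : b.coord2 φ = b'.coord2 φ := by
  obtain ⟨f, hf⟩ := hf
  obtain ⟨hp, hd⟩ : (subSetoid2 V W E).r b b' := Quotient.exact h
  have hm : (f (φ b.pt).1, fderiv ℝ f (φ b.pt).1, fderiv ℝ (fderiv ℝ f) (φ b.pt).1) ∈
    graphData2 φ b.carrier b.pt := ⟨f, hf, rfl⟩
  rw [hd φ hφ] at hm
  obtain ⟨g, hg, he⟩ := hm
  simp only [Prod.mk.injEq] at he
  rw [coord2_eq_of_graph hf, coord2_eq_of_graph hg, he.1, he.2.1, he.2.2, hp]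

theorem IsGraphAt.coord1_localMap {f : V → W} (h : IsGraphAt φ b.carrier b.pt f)
    (hφ : φ ∈ IsManifold.maximalAtlas 𝓘(ℝ, V × W) ∞ E) :
    (h.localMap b.mem hφ).coord1 φ = paramCoord1 (b.coord1 φ) := by
  rw [PointedSub.coord1_eq_of_graph h, paramCoord1, LocalMap.coord1, h.localMap_pt b.mem hφ]
  rw [show (h.localMap b.mem hφ).pt = (φ b.pt).1 from rfl, h.fderiv_localMap b.mem hφ,
    ← h.snd_eq b.mem]

theorem IsGraphAt.coord2_localMap {f : V → W} (h : IsGraphAt φ b.carrier b.pt f)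
    (hφ : φ ∈ IsManifold.maximalAtlas 𝓘(ℝ, V × W) ∞ E) :
    (h.localMap b.mem hφ).coord2 φ = paramCoord2 (b.coord2 φ) := by
  rw [paramCoord2, PointedSub.toBilin_coord2 h, PointedSub.coord2_eq_of_graph h,
    LocalMap.coord2, h.localMap_pt b.mem hφ]
  rw [show (h.localMap b.mem hφ).pt = (φ b.pt).1 from rfl, h.fderiv_localMap b.mem hφ,
    h.fderiv_fderiv_localMap b.mem hφ, ← h.snd_eq b.mem]

/-- The submanifold which is the graph of `k` in the chart `φ`. -/
def PointedSub.ofCoord (hφ : φ ∈ IsManifold.maximalAtlas 𝓘(ℝ, V × W) ∞ E) (u : V) {k : V → W}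
    (hk : ContDiff ℝ ∞ k) (hu : (u, k u) ∈ φ.target) : PointedSub V W E where
  carrier := {q | q ∈ φ.source ∧ (φ q).2 = k (φ q).1}
  isSub := by
    rintro q ⟨hq, -⟩
    refine ⟨φ, hφ, k, hq, .of_forall fun _ => hk.contDiffAt, ?_⟩
    filter_upwards [φ.open_source.mem_nhds hq] with r hr
    exact ⟨fun h => h.2, fun h => ⟨hr, h⟩⟩
  pt := φ.symm (u, k u)
  mem := ⟨φ.map_target hu, by rw [φ.right_inv hu]⟩

theorem PointedSub.isGraphAt_ofCoord (hφ : φ ∈ IsManifold.maximalAtlas 𝓘(ℝ, V × W) ∞ E) (u : V)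
    {k : V → W} (hk : ContDiff ℝ ∞ k) (hu : (u, k u) ∈ φ.target) :
    IsGraphAt φ (ofCoord hφ u hk hu).carrier (ofCoord hφ u hk hu).pt k := by
  refine ⟨φ.map_target hu, .of_forall fun _ => hk.contDiffAt, ?_⟩
  filter_upwards [φ.open_source.mem_nhds (φ.map_target hu)] with r hr
  exact ⟨fun h => h.2, fun h => ⟨hr, h⟩⟩

theorem PointedSub.exists_coord2_eq (hφ : φ ∈ IsManifold.maximalAtlas 𝓘(ℝ, V × W) ∞ E)
    (c : SubModel2 V W) (hc : (c.1, c.2.1) ∈ φ.target) :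
    ∃ b : PointedSub V W E, (∃ f, IsGraphAt φ b.carrier b.pt f) ∧ b.coord2 φ = c := by
  have hu : (c.1, taylor2 c.1 c.2.1 c.2.2.1 c.2.2.2 c.1) ∈ φ.target := by simpa using hc
  have hg := isGraphAt_ofCoord hφ c.1 (contDiff_taylor2 c.1 c.2.1 c.2.2.1 c.2.2.2) hu
  refine ⟨_, ⟨_, hg⟩, ?_⟩
  rw [coord2_eq_of_graph hg]
  have h1 : (φ (ofCoord hφ c.1 (contDiff_taylor2 c.1 c.2.1 c.2.2.1 c.2.2.2) hu).pt).1 = c.1 := by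
    simp only [ofCoord]
    rw [φ.right_inv hu]
  rw [h1]
  simp [fderiv_taylor2, fderiv_fderiv_taylor2]

theorem PointedSub.exists_coord1_eq (hφ : φ ∈ IsManifold.maximalAtlas 𝓘(ℝ, V × W) ∞ E)
    (c : SubModel1 V W) (hc : (c.1, c.2.1) ∈ φ.target) :
    ∃ b : PointedSub V W E, (∃ f, IsGraphAt φ b.carrier b.pt f) ∧ b.coord1 φ = c := by
  obtain ⟨b, hb, h⟩ := exists_coord2_eq hφ (c.1, c.2.1, c.2.2, 0) hc
  exact ⟨b, hb, congrArg (fun c : SubModel2 V W => ((c.1, c.2.1, c.2.2.1) : SubModel1 V W)) h⟩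

end Coord

section Represented

variable {a : LocalMap V (V × W) E} {b b' : PointedSub V W E}
  {φ : OpenPartialHomeomorph E (V × W)}

theorem Represents.coord1_eq (h : Represents a b)
    (hφ : φ ∈ IsManifold.maximalAtlas 𝓘(ℝ, V × W) ∞ E)
    (hf : ∃ f, IsGraphAt φ b.carrier b.pt f) : b.coord1 φ = quotCoord1 (a.coord1 φ) := by
  obtain ⟨f, hf⟩ := hf
  rw [PointedSub.coord1_eq_of_graph hf, (h.derivatives hφ hf).2.1, ← hf.snd_eq b.mem, h.pt_eq]
  rfl

theorem Represents.coord2_eq (h : Represents a b)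
    (hφ : φ ∈ IsManifold.maximalAtlas 𝓘(ℝ, V × W) ∞ E)
    (hf : ∃ f, IsGraphAt φ b.carrier b.pt f) : b.coord2 φ = quotCoord2 (a.coord2 φ) := by
  obtain ⟨f, hf⟩ := hf
  rw [quotCoord2, a.toBilin_coord2 hφ (h.pt_eq ▸ hf.mem_source),
    PointedSub.coord2_eq_of_graph hf, (h.derivatives hφ hf).2.1, (h.derivatives hφ hf).2.2,
    ← hf.snd_eq b.mem, h.pt_eq]
  rfl

/-- The coordinates of a submanifold determine those of its graph parametrization. Equality in one
chart thus spreads to all charts through the corresponding fact for local maps. -/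
theorem PointedSub.jet1_eq_of_coord (hφ : φ ∈ IsManifold.maximalAtlas 𝓘(ℝ, V × W) ∞ E)
    (hf : ∃ f, IsGraphAt φ b.carrier b.pt f) (hf' : ∃ f, IsGraphAt φ b'.carrier b'.pt f)
    (h : b.coord1 φ = b'.coord1 φ) : b.jet1 = b'.jet1 := by
  obtain ⟨f, hf⟩ := hf
  obtain ⟨f', hf'⟩ := hf'
  refine (hf.represents hφ).jet1_eq (hf'.represents hφ)
    (LocalMap.contact1_of_coord hφ ?_ ?_ ?_)
  · rw [hf.localMap_pt]
    exact hf.mem_source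
  · rw [hf'.localMap_pt]
    exact hf'.mem_source
  · rw [hf.coord1_localMap, hf'.coord1_localMap, h]

theorem PointedSub.jet2_eq_of_coord (hφ : φ ∈ IsManifold.maximalAtlas 𝓘(ℝ, V × W) ∞ E)
    (hf : ∃ f, IsGraphAt φ b.carrier b.pt f) (hf' : ∃ f, IsGraphAt φ b'.carrier b'.pt f)
    (h : b.coord2 φ = b'.coord2 φ) : b.jet2 = b'.jet2 := by
  obtain ⟨f, hf⟩ := hf
  obtain ⟨f', hf'⟩ := hf'
  refine (hf.represents hφ).jet2_eq (hf'.represents hφ)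
    (LocalMap.contact2_of_coord hφ ?_ ?_ ?_)
  · rw [hf.localMap_pt]
    exact hf.mem_source
  · rw [hf'.localMap_pt]
    exact hf'.mem_source
  · rw [hf.coord2_localMap, hf'.coord2_localMap, h]

end Represented

end SubJets


/-! ### Manifold structure on the jets of submanifolds -/

section SubManifolds

variable {V W E : Type*} [NormedAddCommGroup V] [NormedSpace ℝ V]
  [NormedAddCommGroup W] [NormedSpace ℝ W]
  [TopologicalSpace E] [ChartedSpace (V × W) E]

theorem SubJet1.exists_rep (η : SubJet1 V W E) : ∃ b : PointedSub V W E, b.jet1 = η :=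
  Quotient.exists_rep η

/-- A representative of a jet. -/
def SubJet1.out (η : SubJet1 V W E) : PointedSub V W E := (SubJet1.exists_rep η).choose

@[simp]
theorem SubJet1.jet1_out (η : SubJet1 V W E) : η.out.jet1 = η := (SubJet1.exists_rep η).choose_spec

/-- The change of the coordinates of `1`-jets of submanifolds. -/
def subTrans1 (τ : V × W → V × W) (c : SubModel1 V W) : SubModel1 V W :=
  quotCoord1 (mapTrans1 τ (paramCoord1 c))

/-- The domain of the change of the coordinates of `1`-jets of submanifolds. -/
def subDomain1 (φ ψ : OpenPartialHomeomorph E (V × W)) : Set (SubModel1 V W) :=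
  {c | ((c.1, c.2.1) ∈ {u | u ∈ φ.target ∧ φ.symm u ∈ ψ.source}) ∧
    ((ContinuousLinearMap.fst ℝ V W).comp
      (mapTrans1 (ψ ∘ φ.symm) (paramCoord1 c)).2.2).IsInvertible}

theorem isOpen_subDomain1 [CompleteSpace V] {φ ψ : OpenPartialHomeomorph E (V × W)}
    (hφ : φ ∈ IsManifold.maximalAtlas 𝓘(ℝ, V × W) ∞ E)
    (hψ : ψ ∈ IsManifold.maximalAtlas 𝓘(ℝ, V × W) ∞ E) : IsOpen (subDomain1 φ ψ) := by
  have h1 : IsOpen {c : SubModel1 V W |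
      (c.1, c.2.1) ∈ {u | u ∈ φ.target ∧ φ.symm u ∈ ψ.source}} :=
    isOpen_transition_domain.preimage (f := fun c : SubModel1 V W => (c.1, c.2.1)) (by fun_prop)
  have h2 : ContinuousOn (fun c : SubModel1 V W => (ContinuousLinearMap.fst ℝ V W).comp
      (mapTrans1 (ψ ∘ φ.symm) (paramCoord1 c)).2.2) {c : SubModel1 V W |
      (c.1, c.2.1) ∈ {u | u ∈ φ.target ∧ φ.symm u ∈ ψ.source}} := by
    intro c hc
    have h3 : ContDiffAt ℝ ∞ (mapTrans1 (V := V) (ψ ∘ φ.symm)) (paramCoord1 c) :=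
      contDiffAt_mapTrans1 (contDiffAt_transition hφ hψ hc.1 hc.2)
    have h4 := h3.comp c contDiff_paramCoord1.contDiffAt
    exact (contDiffAt_const.clm_comp h4.snd.snd).continuousAt.continuousWithinAt
  exact h2.isOpen_inter_preimage h1 isOpen_setOf_isInvertible

/-- The change of coordinates is never expanded: it parametrizes the graph by its first coordinate,
changes the chart of `E`, and projects back. The last factor is smooth where the new first component
is invertible, which is the condition in `subDomain1`. -/
theorem contDiffOn_subTrans1 [FiniteDimensional ℝ V] {φ ψ : OpenPartialHomeomorph E (V × W)}
    (hφ : φ ∈ IsManifold.maximalAtlas 𝓘(ℝ, V × W) ∞ E)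
    (hψ : ψ ∈ IsManifold.maximalAtlas 𝓘(ℝ, V × W) ∞ E) :
    ContDiffOn ℝ ∞ (subTrans1 (ψ ∘ φ.symm)) (subDomain1 φ ψ) := by
  intro c hc
  have h3 : ContDiffAt ℝ ∞ (mapTrans1 (V := V) (ψ ∘ φ.symm)) (paramCoord1 c) :=
    contDiffAt_mapTrans1 (contDiffAt_transition hφ hψ hc.1.1 hc.1.2)
  exact (ContDiffAt.comp (g := quotCoord1) c (contDiffAt_quotCoord1 hc.2)
    (h3.comp c contDiff_paramCoord1.contDiffAt)).contDiffWithinAt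

theorem SubJet2.exists_rep (η : SubJet2 V W E) : ∃ b : PointedSub V W E, b.jet2 = η :=
  Quotient.exists_rep η

/-- A representative of a jet. -/
def SubJet2.out (η : SubJet2 V W E) : PointedSub V W E := (SubJet2.exists_rep η).choose

@[simp]
theorem SubJet2.jet2_out (η : SubJet2 V W E) : η.out.jet2 = η := (SubJet2.exists_rep η).choose_spec

/-- The change of the coordinates of `2`-jets of submanifolds. -/
def subTrans2 (τ : V × W → V × W) (c : SubModel2 V W) : SubModel2 V W :=
  quotCoord2 (mapTrans2 τ (paramCoord2 c))

/-- The domain of the change of the coordinates of `2`-jets of submanifolds. -/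
def subDomain2 (φ ψ : OpenPartialHomeomorph E (V × W)) : Set (SubModel2 V W) :=
  {c | ((c.1, c.2.1) ∈ {u | u ∈ φ.target ∧ φ.symm u ∈ ψ.source}) ∧
    ((ContinuousLinearMap.fst ℝ V W).comp
      (mapTrans2 (ψ ∘ φ.symm) (paramCoord2 c)).2.2.1).IsInvertible}

theorem isOpen_subDomain2 [CompleteSpace V] {φ ψ : OpenPartialHomeomorph E (V × W)}
    (hφ : φ ∈ IsManifold.maximalAtlas 𝓘(ℝ, V × W) ∞ E)
    (hψ : ψ ∈ IsManifold.maximalAtlas 𝓘(ℝ, V × W) ∞ E) : IsOpen (subDomain2 φ ψ) := by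
  have h1 : IsOpen {c : SubModel2 V W |
      (c.1, c.2.1) ∈ {u | u ∈ φ.target ∧ φ.symm u ∈ ψ.source}} :=
    isOpen_transition_domain.preimage (f := fun c : SubModel2 V W => (c.1, c.2.1)) (by fun_prop)
  have h2 : ContinuousOn (fun c : SubModel2 V W => (ContinuousLinearMap.fst ℝ V W).comp
      (mapTrans2 (ψ ∘ φ.symm) (paramCoord2 c)).2.2.1) {c : SubModel2 V W |
      (c.1, c.2.1) ∈ {u | u ∈ φ.target ∧ φ.symm u ∈ ψ.source}} := by
    intro c hc
    have h3 : ContDiffAt ℝ ∞ (mapTrans2 (V := V) (ψ ∘ φ.symm)) (paramCoord2 c) :=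
      contDiffAt_mapTrans2 (contDiffAt_transition hφ hψ hc.1 hc.2)
    have h4 := h3.comp c contDiff_paramCoord2.contDiffAt
    exact (contDiffAt_const.clm_comp h4.snd.snd.fst).continuousAt.continuousWithinAt
  exact h2.isOpen_inter_preimage h1 isOpen_setOf_isInvertible

theorem contDiffOn_subTrans2 [FiniteDimensional ℝ V] {φ ψ : OpenPartialHomeomorph E (V × W)}
    (hφ : φ ∈ IsManifold.maximalAtlas 𝓘(ℝ, V × W) ∞ E)
    (hψ : ψ ∈ IsManifold.maximalAtlas 𝓘(ℝ, V × W) ∞ E) :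
    ContDiffOn ℝ ∞ (subTrans2 (ψ ∘ φ.symm)) (subDomain2 φ ψ) := by
  intro c hc
  have h3 : ContDiffAt ℝ ∞ (mapTrans2 (V := V) (ψ ∘ φ.symm)) (paramCoord2 c) :=
    contDiffAt_mapTrans2 (contDiffAt_transition hφ hψ hc.1.1 hc.1.2)
  exact (ContDiffAt.comp (g := quotCoord2) c (contDiffAt_quotCoord2 hc.2)
    (h3.comp c contDiff_paramCoord2.contDiffAt)).contDiffWithinAt

variable [IsManifold 𝓘(ℝ, V × W) ∞ E] [FiniteDimensional ℝ V]

/-- The criterion `Represents.exists_graph_iff` for the graph parametrization in `φ`, whose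
coordinates are `paramCoord1` of those of `b`. -/
theorem PointedSub.exists_graph_iff_coord1 {b : PointedSub V W E}
    {φ ψ : OpenPartialHomeomorph E (V × W)} (hφ : φ ∈ IsManifold.maximalAtlas 𝓘(ℝ, V × W) ∞ E)
    (hψ : ψ ∈ IsManifold.maximalAtlas 𝓘(ℝ, V × W) ∞ E)
    (hf : ∃ f, IsGraphAt φ b.carrier b.pt f) :
    (∃ f, IsGraphAt ψ b.carrier b.pt f) ↔ b.coord1 φ ∈ subDomain1 φ ψ := by
  obtain ⟨f, hf⟩ := hf
  have hpt := hf.localMap_pt b.mem hφ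
  have hφs : (hf.localMap b.mem hφ).toFun (hf.localMap b.mem hφ).pt ∈ φ.source := by
    rw [hpt]
    exact hf.mem_source
  have hc1 : ((b.coord1 φ).1, (b.coord1 φ).2.1) = φ b.pt := by
    rw [coord1_eq_of_graph hf, ← hf.snd_eq b.mem]
  have hd : ((b.coord1 φ).1, (b.coord1 φ).2.1) ∈ {u | u ∈ φ.target ∧ φ.symm u ∈ ψ.source} ↔
      b.pt ∈ ψ.source := by
    rw [hc1]
    simp [hf.mem_source, φ.left_inv hf.mem_source]
  rw [(hf.represents hφ).exists_graph_iff hψ, subDomain1, Set.mem_ofPred_eq, hd, hpt]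
  refine and_congr_right fun hs => ?_
  rw [← hf.coord1_localMap hφ, ← LocalMap.coord1_transition _ hφ hψ hφs (by rwa [hpt])]
  rfl

theorem PointedSub.coord1_transition {b : PointedSub V W E}
    {φ ψ : OpenPartialHomeomorph E (V × W)} (hφ : φ ∈ IsManifold.maximalAtlas 𝓘(ℝ, V × W) ∞ E)
    (hψ : ψ ∈ IsManifold.maximalAtlas 𝓘(ℝ, V × W) ∞ E)
    (hf : ∃ f, IsGraphAt φ b.carrier b.pt f) (hg : ∃ f, IsGraphAt ψ b.carrier b.pt f) :
    b.coord1 ψ = subTrans1 (ψ ∘ φ.symm) (b.coord1 φ) := by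
  obtain ⟨f, hf⟩ := hf
  have hpt := hf.localMap_pt b.mem hφ
  rw [(hf.represents hφ).coord1_eq hψ hg, subTrans1, ← hf.coord1_localMap hφ,
    ← LocalMap.coord1_transition _ hφ hψ (by rw [hpt]; exact hf.mem_source)
      (by obtain ⟨g, hg⟩ := hg; rw [hpt]; exact hg.mem_source)]

theorem bijOn_subCoord1 {φ : OpenPartialHomeomorph E (V × W)}
    (hφ : φ ∈ IsManifold.maximalAtlas 𝓘(ℝ, V × W) ∞ E) :
    Set.BijOn (fun η : SubJet1 V W E => η.out.coord1 φ)
      {η | ∃ f, IsGraphAt φ η.out.carrier η.out.pt f} {c | (c.1, c.2.1) ∈ φ.target} := by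
  refine ⟨fun η hη => ?_, fun η hη η' hη' h => ?_, fun c hc => ?_⟩
  · obtain ⟨f, hf⟩ := hη
    simp only [Set.mem_ofPred_eq]
    rw [PointedSub.coord1_eq_of_graph hf, ← hf.snd_eq η.out.mem]
    exact φ.map_source hf.mem_source
  · rw [← η.jet1_out, ← η'.jet1_out]
    exact PointedSub.jet1_eq_of_coord hφ hη hη' h
  · obtain ⟨b, hb, rfl⟩ := PointedSub.exists_coord1_eq hφ c hc
    have h : b.jet1 = b.jet1.out.jet1 := by simp
    exact ⟨b.jet1, (PointedSub.exists_graph_iff_of_jet1_eq h hφ).1 hb,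
      (PointedSub.coord1_eq_of_jet1_eq h hφ hb).symm⟩

variable (V W E) in
theorem exists_isSubJetManifold1 [Nonempty E] :
    ∃ (_ : TopologicalSpace (SubJet1 V W E))
      (_ : ChartedSpace (SubModel1 V W) (SubJet1 V W E)), IsSubJetManifold1 V W E := by
  have : CompleteSpace V := FiniteDimensional.complete ℝ V
  have : Nonempty (SubJet1 V W E) :=
    ⟨(exists_pointedSub (V := V) (W := W) (Classical.arbitrary E)).some.jet1⟩
  let e : IsManifold.maximalAtlas 𝓘(ℝ, V × W) ∞ E →
      PartialEquiv (SubJet1 V W E) (SubModel1 V W) :=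
    fun φ => partialEquivOfCoord _ _ _ (bijOn_subCoord1 φ.2)
  have hout : ∀ b : PointedSub V W E, b.jet1 = b.jet1.out.jet1 := fun b => by simp
  have hsrc : ∀ (φ) (b : PointedSub V W E), b.jet1 ∈ (e φ).source ↔
      ∃ f, IsGraphAt φ.1 b.carrier b.pt f := fun φ b =>
    (PointedSub.exists_graph_iff_of_jet1_eq (hout b) φ.2).symm
  have hcoord : ∀ (φ) (b : PointedSub V W E), (∃ f, IsGraphAt φ.1 b.carrier b.pt f) →
      e φ b.jet1 = b.coord1 φ.1 := fun φ b hb =>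
    (PointedSub.coord1_eq_of_jet1_eq (hout b) φ.2 hb).symm
  have htr : ∀ φ ψ (c : SubModel1 V W), c ∈ ((e φ).symm.trans (e ψ)).source ↔
      c ∈ subDomain1 φ.1 ψ.1 := by
    intro φ ψ c
    rw [PartialEquiv.trans_source, PartialEquiv.symm_source, Set.mem_inter_iff]
    rw [show c ∈ subDomain1 φ.1 ψ.1 ↔ c ∈ (e φ).target ∧ c ∈ subDomain1 φ.1 ψ.1 from
      ⟨fun h => ⟨h.1.1, h⟩, fun h => h.2⟩]
    refine and_congr_right fun hc => ?_
    obtain ⟨b, hb, rfl⟩ := PointedSub.exists_coord1_eq φ.2 c hc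
    rw [← PointedSub.exists_graph_iff_coord1 φ.2 ψ.2 hb, ← hcoord φ b hb, Set.mem_preimage,
      (e φ).left_inv ((hsrc φ b).2 hb), hsrc]
  have htrans : ∀ φ ψ, Set.EqOn ((e φ).symm.trans (e ψ)) (subTrans1 (ψ.1 ∘ φ.1.symm))
      ((e φ).symm.trans (e ψ)).source := by
    intro φ ψ c hc
    have hc' := (htr φ ψ c).1 hc
    obtain ⟨b, hb, rfl⟩ := PointedSub.exists_coord1_eq φ.2 c hc'.1.1
    have hb' := (PointedSub.exists_graph_iff_coord1 φ.2 ψ.2 hb).2 hc'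
    rw [PartialEquiv.coe_trans, Function.comp_apply, ← hcoord φ b hb,
      (e φ).left_inv ((hsrc φ b).2 hb), hcoord φ b hb, hcoord ψ b hb']
    exact PointedSub.coord1_transition φ.2 ψ.2 hb hb'
  obtain ⟨i1, i2, hM, h⟩ := exists_hasCharts e
    (fun η => by
      obtain ⟨b, rfl⟩ := SubJet1.exists_rep η
      -- An arbitrary chart at the marked point need not be concordant to `b`; the one from `isSub`
      -- is.
      obtain ⟨φ, hφ, hf⟩ := b.isSub b.pt b.mem
      exact ⟨⟨φ, hφ⟩, (hsrc _ b).2 hf⟩)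
    (fun φ ψ => by
      rw [show ((e φ).symm.trans (e ψ)).source = _ from Set.ext (htr φ ψ)]
      exact isOpen_subDomain1 φ.2 ψ.2)
    (fun φ ψ => by
      refine ContDiffOn.congr ?_ (htrans φ ψ)
      rw [show ((e φ).symm.trans (e ψ)).source = _ from Set.ext (htr φ ψ)]
      exact contDiffOn_subTrans1 φ.2 ψ.2)
  refine ⟨i1, i2, hM, fun φ => ?_⟩
  obtain ⟨g, hg, hge⟩ := h φ
  refine ⟨g, hg, fun b => ?_, fun b f hf => ?_⟩
  · rw [← hsrc, ← hge]
  · have h1 : g b.jet1 = b.coord1 φ.1 := by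
      rw [← OpenPartialHomeomorph.coe_toPartialEquiv, hge]
      exact hcoord φ b ⟨f, hf⟩
    rw [h1, PointedSub.coord1_eq_of_graph hf]

theorem PointedSub.exists_graph_iff_coord2 {b : PointedSub V W E}
    {φ ψ : OpenPartialHomeomorph E (V × W)} (hφ : φ ∈ IsManifold.maximalAtlas 𝓘(ℝ, V × W) ∞ E)
    (hψ : ψ ∈ IsManifold.maximalAtlas 𝓘(ℝ, V × W) ∞ E)
    (hf : ∃ f, IsGraphAt φ b.carrier b.pt f) :
    (∃ f, IsGraphAt ψ b.carrier b.pt f) ↔ b.coord2 φ ∈ subDomain2 φ ψ := by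
  obtain ⟨f, hf⟩ := hf
  have hpt := hf.localMap_pt b.mem hφ
  have hφs : (hf.localMap b.mem hφ).toFun (hf.localMap b.mem hφ).pt ∈ φ.source := by
    rw [hpt]
    exact hf.mem_source
  have hc1 : ((b.coord2 φ).1, (b.coord2 φ).2.1) = φ b.pt := by
    rw [coord2_eq_of_graph hf, ← hf.snd_eq b.mem]
  have hd : ((b.coord2 φ).1, (b.coord2 φ).2.1) ∈ {u | u ∈ φ.target ∧ φ.symm u ∈ ψ.source} ↔
      b.pt ∈ ψ.source := by
    rw [hc1]
    simp [hf.mem_source, φ.left_inv hf.mem_source]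
  rw [(hf.represents hφ).exists_graph_iff hψ, subDomain2, Set.mem_ofPred_eq, hd, hpt]
  refine and_congr_right fun hs => ?_
  rw [← hf.coord2_localMap hφ, ← LocalMap.coord2_transition _ hφ hψ hφs (by rwa [hpt])]
  rfl

theorem PointedSub.coord2_transition {b : PointedSub V W E}
    {φ ψ : OpenPartialHomeomorph E (V × W)} (hφ : φ ∈ IsManifold.maximalAtlas 𝓘(ℝ, V × W) ∞ E)
    (hψ : ψ ∈ IsManifold.maximalAtlas 𝓘(ℝ, V × W) ∞ E)
    (hf : ∃ f, IsGraphAt φ b.carrier b.pt f) (hg : ∃ f, IsGraphAt ψ b.carrier b.pt f) :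
    b.coord2 ψ = subTrans2 (ψ ∘ φ.symm) (b.coord2 φ) := by
  obtain ⟨f, hf⟩ := hf
  have hpt := hf.localMap_pt b.mem hφ
  rw [(hf.represents hφ).coord2_eq hψ hg, subTrans2, ← hf.coord2_localMap hφ,
    ← LocalMap.coord2_transition _ hφ hψ (by rw [hpt]; exact hf.mem_source)
      (by obtain ⟨g, hg⟩ := hg; rw [hpt]; exact hg.mem_source)]

theorem bijOn_subCoord2 {φ : OpenPartialHomeomorph E (V × W)}
    (hφ : φ ∈ IsManifold.maximalAtlas 𝓘(ℝ, V × W) ∞ E) :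
    Set.BijOn (fun η : SubJet2 V W E => η.out.coord2 φ)
      {η | ∃ f, IsGraphAt φ η.out.carrier η.out.pt f} {c | (c.1, c.2.1) ∈ φ.target} := by
  refine ⟨fun η hη => ?_, fun η hη η' hη' h => ?_, fun c hc => ?_⟩
  · obtain ⟨f, hf⟩ := hη
    simp only [Set.mem_ofPred_eq]
    rw [PointedSub.coord2_eq_of_graph hf, ← hf.snd_eq η.out.mem]
    exact φ.map_source hf.mem_source
  · rw [← η.jet2_out, ← η'.jet2_out]
    exact PointedSub.jet2_eq_of_coord hφ hη hη' h
  · obtain ⟨b, hb, rfl⟩ := PointedSub.exists_coord2_eq hφ c hc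
    have h : b.jet2 = b.jet2.out.jet2 := by simp
    exact ⟨b.jet2, (PointedSub.exists_graph_iff_of_jet2_eq h hφ).1 hb,
      (PointedSub.coord2_eq_of_jet2_eq h hφ hb).symm⟩

variable (V W E) in
theorem exists_isSubJetManifold2 [Nonempty E] :
    ∃ (_ : TopologicalSpace (SubJet2 V W E))
      (_ : ChartedSpace (SubModel2 V W) (SubJet2 V W E)), IsSubJetManifold2 V W E := by
  have : CompleteSpace V := FiniteDimensional.complete ℝ V
  have : Nonempty (SubJet2 V W E) :=
    ⟨(exists_pointedSub (V := V) (W := W) (Classical.arbitrary E)).some.jet2⟩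
  let e : IsManifold.maximalAtlas 𝓘(ℝ, V × W) ∞ E →
      PartialEquiv (SubJet2 V W E) (SubModel2 V W) :=
    fun φ => partialEquivOfCoord _ _ _ (bijOn_subCoord2 φ.2)
  have hout : ∀ b : PointedSub V W E, b.jet2 = b.jet2.out.jet2 := fun b => by simp
  have hsrc : ∀ (φ) (b : PointedSub V W E), b.jet2 ∈ (e φ).source ↔
      ∃ f, IsGraphAt φ.1 b.carrier b.pt f := fun φ b =>
    (PointedSub.exists_graph_iff_of_jet2_eq (hout b) φ.2).symm
  have hcoord : ∀ (φ) (b : PointedSub V W E), (∃ f, IsGraphAt φ.1 b.carrier b.pt f) →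
      e φ b.jet2 = b.coord2 φ.1 := fun φ b hb =>
    (PointedSub.coord2_eq_of_jet2_eq (hout b) φ.2 hb).symm
  have htr : ∀ φ ψ (c : SubModel2 V W), c ∈ ((e φ).symm.trans (e ψ)).source ↔
      c ∈ subDomain2 φ.1 ψ.1 := by
    intro φ ψ c
    rw [PartialEquiv.trans_source, PartialEquiv.symm_source, Set.mem_inter_iff]
    rw [show c ∈ subDomain2 φ.1 ψ.1 ↔ c ∈ (e φ).target ∧ c ∈ subDomain2 φ.1 ψ.1 from
      ⟨fun h => ⟨h.1.1, h⟩, fun h => h.2⟩]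
    refine and_congr_right fun hc => ?_
    obtain ⟨b, hb, rfl⟩ := PointedSub.exists_coord2_eq φ.2 c hc
    rw [← PointedSub.exists_graph_iff_coord2 φ.2 ψ.2 hb, ← hcoord φ b hb, Set.mem_preimage,
      (e φ).left_inv ((hsrc φ b).2 hb), hsrc]
  have htrans : ∀ φ ψ, Set.EqOn ((e φ).symm.trans (e ψ)) (subTrans2 (ψ.1 ∘ φ.1.symm))
      ((e φ).symm.trans (e ψ)).source := by
    intro φ ψ c hc
    have hc' := (htr φ ψ c).1 hc
    obtain ⟨b, hb, rfl⟩ := PointedSub.exists_coord2_eq φ.2 c hc'.1.1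
    have hb' := (PointedSub.exists_graph_iff_coord2 φ.2 ψ.2 hb).2 hc'
    rw [PartialEquiv.coe_trans, Function.comp_apply, ← hcoord φ b hb,
      (e φ).left_inv ((hsrc φ b).2 hb), hcoord φ b hb, hcoord ψ b hb']
    exact PointedSub.coord2_transition φ.2 ψ.2 hb hb'
  obtain ⟨i1, i2, hM, h⟩ := exists_hasCharts e
    (fun η => by
      obtain ⟨b, rfl⟩ := SubJet2.exists_rep η
      obtain ⟨φ, hφ, hf⟩ := b.isSub b.pt b.mem
      exact ⟨⟨φ, hφ⟩, (hsrc _ b).2 hf⟩)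
    (fun φ ψ => by
      rw [show ((e φ).symm.trans (e ψ)).source = _ from Set.ext (htr φ ψ)]
      exact isOpen_subDomain2 φ.2 ψ.2)
    (fun φ ψ => by
      refine ContDiffOn.congr ?_ (htrans φ ψ)
      rw [show ((e φ).symm.trans (e ψ)).source = _ from Set.ext (htr φ ψ)]
      exact contDiffOn_subTrans2 φ.2 ψ.2)
  refine ⟨i1, i2, hM, fun φ => ?_⟩
  obtain ⟨g, hg, hge⟩ := h φ
  refine ⟨g, hg, fun b => ?_, fun b f hf => ?_⟩
  · rw [← hsrc, ← hge]
  · have h1 : g b.jet2 = b.coord2 φ.1 := by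
      rw [← OpenPartialHomeomorph.coe_toPartialEquiv, hge]
      exact hcoord φ b ⟨f, hf⟩
    refine ⟨by rw [h1]; rfl, ?_, ?_, by rw [h1]; exact PointedSub.toBilin_coord2 hf⟩
    · rw [h1, PointedSub.coord2_eq_of_graph hf]
    · rw [h1, PointedSub.coord2_eq_of_graph hf]

end SubManifolds


/-! ### The projections from jets of immersions to jets of submanifolds -/

section ProE

variable {V W F E : Type*} [NormedAddCommGroup V] [NormedSpace ℝ V]
  [NormedAddCommGroup W] [NormedSpace ℝ W] [NormedAddCommGroup F] [NormedSpace ℝ F]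
  [TopologicalSpace E]

theorem IsMapChart1.apply_eq [ChartedSpace F E] [TopologicalSpace (MapJet1 V F E)]
    {φ : OpenPartialHomeomorph E F}
    {e : OpenPartialHomeomorph (MapJet1 V F E) (MapModel1 V F)} (he : IsMapChart1 φ e)
    {a : LocalMap V F E} (ha : a.toFun a.pt ∈ φ.source) : e a.jet1 = a.coord1 φ :=
  he.coord a ha

theorem IsMapChart2.apply_eq [ChartedSpace F E] [TopologicalSpace (MapJet2 V F E)]
    {φ : OpenPartialHomeomorph E F} (hφ : φ ∈ IsManifold.maximalAtlas 𝓘(ℝ, F) ∞ E)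
    {e : OpenPartialHomeomorph (MapJet2 V F E) (MapModel2 V F)} (he : IsMapChart2 φ e)
    {a : LocalMap V F E} (ha : a.toFun a.pt ∈ φ.source) : e a.jet2 = a.coord2 φ := by
  obtain ⟨h1, h2, h3, h4⟩ := he.coord a ha
  refine Prod.ext h1 (Prod.ext h2 (Prod.ext h3 (SymBilin.ext' ?_)))
  rw [h4, a.toBilin_coord2 hφ ha]

theorem IsSubChart1.apply_eq [ChartedSpace (V × W) E] [TopologicalSpace (SubJet1 V W E)]
    {φ : OpenPartialHomeomorph E (V × W)}
    {e : OpenPartialHomeomorph (SubJet1 V W E) (SubModel1 V W)} (he : IsSubChart1 φ e)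
    {b : PointedSub V W E} (hb : ∃ f, IsGraphAt φ b.carrier b.pt f) : e b.jet1 = b.coord1 φ :=
  he.coord b _ (PointedSub.isGraphAt_graphFun hb)

theorem IsSubChart2.apply_eq [ChartedSpace (V × W) E] [TopologicalSpace (SubJet2 V W E)]
    {φ : OpenPartialHomeomorph E (V × W)}
    {e : OpenPartialHomeomorph (SubJet2 V W E) (SubModel2 V W)} (he : IsSubChart2 φ e)
    {b : PointedSub V W E} (hb : ∃ f, IsGraphAt φ b.carrier b.pt f) : e b.jet2 = b.coord2 φ := by
  have hf := PointedSub.isGraphAt_graphFun hb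
  obtain ⟨h1, h2, h3, h4⟩ := he.coord b _ hf
  refine Prod.ext h1 (Prod.ext h2 (Prod.ext h3 (SymBilin.ext' ?_)))
  rw [h4, PointedSub.toBilin_coord2 hf]

theorem IsMapChart1.target_iff [ChartedSpace F E] [TopologicalSpace (MapJet1 V F E)]
    {φ : OpenPartialHomeomorph E F} (hφ : φ ∈ IsManifold.maximalAtlas 𝓘(ℝ, F) ∞ E)
    {e : OpenPartialHomeomorph (MapJet1 V F E) (MapModel1 V F)} (he : IsMapChart1 φ e)
    {c : MapModel1 V F} : c ∈ e.target ↔ c.2.1 ∈ φ.target := by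
  constructor
  · intro hc
    obtain ⟨a, ha⟩ := MapJet1.exists_rep (e.symm c)
    have hs := (he.mem_source a).1 (ha ▸ e.map_target hc)
    rw [← e.right_inv hc, ← ha, he.apply_eq hs]
    exact φ.map_source hs
  · intro hc
    obtain ⟨a, ha, rfl⟩ := LocalMap.exists_coord1_eq hφ c hc
    rw [← he.apply_eq ha]
    exact e.map_source ((he.mem_source a).2 ha)

theorem IsMapChart2.target_iff [ChartedSpace F E] [TopologicalSpace (MapJet2 V F E)]
    {φ : OpenPartialHomeomorph E F} (hφ : φ ∈ IsManifold.maximalAtlas 𝓘(ℝ, F) ∞ E)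
    {e : OpenPartialHomeomorph (MapJet2 V F E) (MapModel2 V F)} (he : IsMapChart2 φ e)
    {c : MapModel2 V F} : c ∈ e.target ↔ c.2.1 ∈ φ.target := by
  constructor
  · intro hc
    obtain ⟨a, ha⟩ := MapJet2.exists_rep (e.symm c)
    have hs := (he.mem_source a).1 (ha ▸ e.map_target hc)
    rw [← e.right_inv hc, ← ha, he.apply_eq hφ hs]
    exact φ.map_source hs
  · intro hc
    obtain ⟨a, ha, rfl⟩ := LocalMap.exists_coord2_eq hφ c hc
    rw [← he.apply_eq hφ ha]
    exact e.map_source ((he.mem_source a).2 ha)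

theorem LocalMap.isImmersive_congr [ChartedSpace F E] [IsManifold 𝓘(ℝ, F) ∞ E]
    {a a' : LocalMap V F E} (h : a.Contact1 a') : a.IsImmersive ↔ a'.IsImmersive := by
  have hφ := IsManifold.chart_mem_maximalAtlas (I := 𝓘(ℝ, F)) (n := ∞) (a.toFun a.pt)
  have hm := mem_chart_source F (a.toFun a.pt)
  rw [a.isImmersive_iff hφ hm, a'.isImmersive_iff hφ (by rw [← h.2.1]; exact hm), h.2.2 _ hφ hm]

theorem LocalMap.jet1_mem_immJet1 [ChartedSpace F E] [IsManifold 𝓘(ℝ, F) ∞ E]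
    {a : LocalMap V F E} : a.jet1 ∈ ImmJet1 V F E ↔ a.IsImmersive :=
  ⟨fun ⟨_, h, h'⟩ => (isImmersive_congr (jet1_eq_iff.1 h')).1 h, fun h => ⟨a, h, rfl⟩⟩

theorem LocalMap.jet2_mem_immJet2 [ChartedSpace F E] [IsManifold 𝓘(ℝ, F) ∞ E]
    {a : LocalMap V F E} : a.jet2 ∈ ImmJet2 V F E ↔ a.IsImmersive :=
  ⟨fun ⟨_, h, h'⟩ => (isImmersive_congr (jet2_eq_iff.1 h').1).1 h, fun h => ⟨a, h, rfl⟩⟩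

variable [ChartedSpace (V × W) E] [IsManifold 𝓘(ℝ, V × W) ∞ E] [FiniteDimensional ℝ V]

section

/-! ### The projection of `1`-jets -/

theorem Prolongs1.unique {θ : MapJet1 V (V × W) E} {η η' : SubJet1 V W E} (h : Prolongs1 θ η)
    (h' : Prolongs1 θ η') : η = η' := by
  obtain ⟨a, b, hab, rfl, rfl⟩ := h
  obtain ⟨a', b', hab', hc, rfl⟩ := h'
  exact hab.represents.jet1_eq hab'.represents (LocalMap.jet1_eq_iff.1 hc.symm)

/-- Some image submanifold exists for each immersive germ, and its jet depends on the jet of the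
germ alone. The choice in `proE1` is therefore forced. -/
theorem prolongs1_iff [FiniteDimensional ℝ W] {θ : MapJet1 V (V × W) E}
    (hθ : θ ∈ ImmJet1 V (V × W) E) (η : SubJet1 V W E) : Prolongs1 θ η ↔ proE1 θ = η := by
  obtain ⟨a, ha, rfl⟩ := hθ
  obtain ⟨b, hb⟩ := ha.exists_isImageOf
  have h : Prolongs1 a.jet1 (proE1 a.jet1) :=
    Classical.epsilon_spec (p := Prolongs1 a.jet1) ⟨b.jet1, a, b, hb, rfl, rfl⟩
  exact ⟨fun h' => h.unique h', fun h' => h' ▸ h⟩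

theorem IsImageOf.proE1_eq [FiniteDimensional ℝ W] {a : LocalMap V (V × W) E}
    {b : PointedSub V W E} (h : IsImageOf a b) : proE1 a.jet1 = b.jet1 :=
  (prolongs1_iff (LocalMap.jet1_mem_immJet1.2 h.represents.immersive) _).1 ⟨a, b, h, rfl, rfl⟩

theorem Represents.proE1_eq [FiniteDimensional ℝ W] {a : LocalMap V (V × W) E}
    {b : PointedSub V W E} (h : Represents a b) : proE1 a.jet1 = b.jet1 := by
  obtain ⟨b', hb'⟩ := h.immersive.exists_isImageOf
  rw [hb'.proE1_eq]
  exact hb'.represents.jet1_eq h (LocalMap.jet1_eq_iff.1 rfl)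

section Charts

variable [FiniteDimensional ℝ W] [TopologicalSpace (MapJet1 V (V × W) E)]
  [TopologicalSpace (SubJet1 V W E)] {φ : OpenPartialHomeomorph E (V × W)}
  {e : OpenPartialHomeomorph (MapJet1 V (V × W) E) (MapModel1 V (V × W))}
  {e' : OpenPartialHomeomorph (SubJet1 V W E) (SubModel1 V W)}

omit [FiniteDimensional ℝ V] [TopologicalSpace (SubJet1 V W E)] [FiniteDimensional ℝ W] in
theorem IsMapChart1.mem_immJet1 (hφ : φ ∈ IsManifold.maximalAtlas 𝓘(ℝ, V × W) ∞ E)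
    (he : IsMapChart1 φ e) {θ : MapJet1 V (V × W) E} (hθ : θ ∈ e.source)
    (hA : ((ContinuousLinearMap.fst ℝ V W).comp (e θ).2.2).IsInvertible) :
    θ ∈ ImmJet1 V (V × W) E := by
  obtain ⟨a, rfl⟩ := MapJet1.exists_rep θ
  have hm := (he.mem_source a).1 hθ
  rw [he.apply_eq hm] at hA
  exact LocalMap.jet1_mem_immJet1.2 (LocalMap.isImmersive_of_injective_fst hφ hm hA.injective)

/-- With the coordinates on both jet spaces induced by the same chart of `E`, the projection is an
explicit map, smooth because inversion of operators is. -/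
theorem IsMapChart1.proE1_apply (hφ : φ ∈ IsManifold.maximalAtlas 𝓘(ℝ, V × W) ∞ E)
    (he : IsMapChart1 φ e) (he' : IsSubChart1 φ e') {θ : MapJet1 V (V × W) E} (hθ : θ ∈ e.source)
    (hA : ((ContinuousLinearMap.fst ℝ V W).comp (e θ).2.2).IsInvertible) :
    proE1 θ ∈ e'.source ∧ e' (proE1 θ) = quotCoord1 (e θ) := by
  have hi := he.mem_immJet1 hφ hθ hA
  obtain ⟨a, rfl⟩ := MapJet1.exists_rep θ
  have hm := (he.mem_source a).1 hθ
  rw [he.apply_eq hm] at hA ⊢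
  obtain ⟨b, hb⟩ := (LocalMap.jet1_mem_immJet1.1 hi).exists_isImageOf
  have hg := (hb.represents.exists_graph_iff hφ).2 ⟨hm, hA⟩
  rw [hb.proE1_eq, he'.mem_source, he'.apply_eq hg]
  exact ⟨hg, hb.represents.coord1_eq hφ hg⟩

omit [TopologicalSpace (SubJet1 V W E)] in
theorem exists_chart_of_mem_immJet1 {θ : MapJet1 V (V × W) E} (hθ : θ ∈ ImmJet1 V (V × W) E) :
    ∃ φ : OpenPartialHomeomorph E (V × W), φ ∈ IsManifold.maximalAtlas 𝓘(ℝ, V × W) ∞ E ∧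
      ∀ e : OpenPartialHomeomorph (MapJet1 V (V × W) E) (MapModel1 V (V × W)), IsMapChart1 φ e →
        θ ∈ e.source ∧ ((ContinuousLinearMap.fst ℝ V W).comp (e θ).2.2).IsInvertible := by
  obtain ⟨a, ha, rfl⟩ := hθ
  obtain ⟨φ, hφ, hm, hA⟩ := ha.exists_chart
  refine ⟨φ, hφ, fun e he => ⟨(he.mem_source a).2 hm, ?_⟩⟩
  rw [he.apply_eq hm]
  exact hA

omit [TopologicalSpace (SubJet1 V W E)] [FiniteDimensional ℝ W]
  [IsManifold 𝓘(ℝ, V × W) ∞ E] in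
theorem eventually_isInvertible_chart1 {θ : MapJet1 V (V × W) E} (hθ : θ ∈ e.source)
    (hA : ((ContinuousLinearMap.fst ℝ V W).comp (e θ).2.2).IsInvertible) :
    ∀ᶠ θ' in 𝓝 θ, θ' ∈ e.source ∧
      ((ContinuousLinearMap.fst ℝ V W).comp (e θ').2.2).IsInvertible := by
  have : CompleteSpace V := FiniteDimensional.complete ℝ V
  have hc : ContinuousAt (fun θ' => (ContinuousLinearMap.fst ℝ V W).comp (e θ').2.2) θ := by
    have h1 : Continuous fun c : MapModel1 V (V × W) =>
        (ContinuousLinearMap.fst ℝ V W).comp c.2.2 :=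
      (contDiff_const.clm_comp contDiff_snd.snd : ContDiff ℝ ∞ _).continuous
    exact h1.continuousAt.comp (e.continuousAt hθ)
  have ho : ∀ᶠ θ' in 𝓝 θ, θ' ∈ e.source := e.open_source.mem_nhds hθ
  exact ho.and (hc.eventually_mem (isOpen_setOf_isInvertible.mem_nhds hA))

end Charts

variable [FiniteDimensional ℝ W] [TopologicalSpace (MapJet1 V (V × W) E)]
  [ChartedSpace (MapModel1 V (V × W)) (MapJet1 V (V × W) E)]
  [TopologicalSpace (SubJet1 V W E)] [ChartedSpace (SubModel1 V W) (SubJet1 V W E)]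

omit [TopologicalSpace (SubJet1 V W E)] [ChartedSpace (SubModel1 V W) (SubJet1 V W E)] in
-- Invertibility of the first component of the derivative is an open condition that implies
-- immersivity, and each immersive jet satisfies it in a suitable chart.
theorem isOpen_immJet1 (hM : IsMapJetManifold1 V (V × W) E) : IsOpen (ImmJet1 V (V × W) E) := by
  refine isOpen_iff_mem_nhds.2 fun θ hθ => ?_
  obtain ⟨φ, hφ, h⟩ := exists_chart_of_mem_immJet1 hθ
  obtain ⟨e, -, hec⟩ := hM.2 ⟨φ, hφ⟩
  filter_upwards [eventually_isInvertible_chart1 (h e hec).1 (h e hec).2] with θ' hθ'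
  exact hec.mem_immJet1 hφ hθ'.1 hθ'.2

theorem contMDiffAt_proE1 (hM : IsMapJetManifold1 V (V × W) E) (hS : IsSubJetManifold1 V W E)
    {θ : MapJet1 V (V × W) E} (hθ : θ ∈ ImmJet1 V (V × W) E) :
    ContMDiffAt 𝓘(ℝ, MapModel1 V (V × W)) 𝓘(ℝ, SubModel1 V W) ∞ proE1 θ := by
  obtain ⟨φ, hφ, h⟩ := exists_chart_of_mem_immJet1 hθ
  obtain ⟨e, he, hec⟩ := hM.2 ⟨φ, hφ⟩
  obtain ⟨e', he', hec'⟩ := hS.2 ⟨φ, hφ⟩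
  refine contMDiffAt_of_coord he he' (h e hec).1 (contDiffAt_quotCoord1 (h e hec).2) ?_
  filter_upwards [eventually_isInvertible_chart1 (h e hec).1 (h e hec).2] with θ' hθ'
  exact hec.proE1_apply hφ hec' hθ'.1 hθ'.2

end

section

/-! ### The projection of `2`-jets -/

theorem Prolongs2.unique {θ : MapJet2 V (V × W) E} {η η' : SubJet2 V W E} (h : Prolongs2 θ η)
    (h' : Prolongs2 θ η') : η = η' := by
  obtain ⟨a, b, hab, rfl, rfl⟩ := h
  obtain ⟨a', b', hab', hc, rfl⟩ := h'
  exact hab.represents.jet2_eq hab'.represents (LocalMap.jet2_eq_iff.1 hc.symm)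

theorem prolongs2_iff [FiniteDimensional ℝ W] {θ : MapJet2 V (V × W) E}
    (hθ : θ ∈ ImmJet2 V (V × W) E) (η : SubJet2 V W E) : Prolongs2 θ η ↔ proE2 θ = η := by
  obtain ⟨a, ha, rfl⟩ := hθ
  obtain ⟨b, hb⟩ := ha.exists_isImageOf
  have h : Prolongs2 a.jet2 (proE2 a.jet2) :=
    Classical.epsilon_spec (p := Prolongs2 a.jet2) ⟨b.jet2, a, b, hb, rfl, rfl⟩
  exact ⟨fun h' => h.unique h', fun h' => h' ▸ h⟩

theorem IsImageOf.proE2_eq [FiniteDimensional ℝ W] {a : LocalMap V (V × W) E}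
    {b : PointedSub V W E} (h : IsImageOf a b) : proE2 a.jet2 = b.jet2 :=
  (prolongs2_iff (LocalMap.jet2_mem_immJet2.2 h.represents.immersive) _).1 ⟨a, b, h, rfl, rfl⟩

section Charts

variable [FiniteDimensional ℝ W] [TopologicalSpace (MapJet2 V (V × W) E)]
  [TopologicalSpace (SubJet2 V W E)] {φ : OpenPartialHomeomorph E (V × W)}
  {e : OpenPartialHomeomorph (MapJet2 V (V × W) E) (MapModel2 V (V × W))}
  {e' : OpenPartialHomeomorph (SubJet2 V W E) (SubModel2 V W)}

omit [FiniteDimensional ℝ V] [TopologicalSpace (SubJet2 V W E)] [FiniteDimensional ℝ W] in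
theorem IsMapChart2.mem_immJet2 (hφ : φ ∈ IsManifold.maximalAtlas 𝓘(ℝ, V × W) ∞ E)
    (he : IsMapChart2 φ e) {θ : MapJet2 V (V × W) E} (hθ : θ ∈ e.source)
    (hA : ((ContinuousLinearMap.fst ℝ V W).comp (e θ).2.2.1).IsInvertible) :
    θ ∈ ImmJet2 V (V × W) E := by
  obtain ⟨a, rfl⟩ := MapJet2.exists_rep θ
  have hm := (he.mem_source a).1 hθ
  rw [he.apply_eq hφ hm] at hA
  exact LocalMap.jet2_mem_immJet2.2 (LocalMap.isImmersive_of_injective_fst hφ hm hA.injective)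

theorem IsMapChart2.proE2_apply (hφ : φ ∈ IsManifold.maximalAtlas 𝓘(ℝ, V × W) ∞ E)
    (he : IsMapChart2 φ e) (he' : IsSubChart2 φ e') {θ : MapJet2 V (V × W) E} (hθ : θ ∈ e.source)
    (hA : ((ContinuousLinearMap.fst ℝ V W).comp (e θ).2.2.1).IsInvertible) :
    proE2 θ ∈ e'.source ∧ e' (proE2 θ) = quotCoord2 (e θ) := by
  have hi := he.mem_immJet2 hφ hθ hA
  obtain ⟨a, rfl⟩ := MapJet2.exists_rep θ
  have hm := (he.mem_source a).1 hθ
  rw [he.apply_eq hφ hm] at hA ⊢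
  obtain ⟨b, hb⟩ := (LocalMap.jet2_mem_immJet2.1 hi).exists_isImageOf
  have hg := (hb.represents.exists_graph_iff hφ).2 ⟨hm, hA⟩
  rw [hb.proE2_eq, he'.mem_source, he'.apply_eq hg]
  exact ⟨hg, hb.represents.coord2_eq hφ hg⟩

omit [TopologicalSpace (SubJet2 V W E)] in
theorem exists_chart_of_mem_immJet2 {θ : MapJet2 V (V × W) E} (hθ : θ ∈ ImmJet2 V (V × W) E) :
    ∃ φ : OpenPartialHomeomorph E (V × W), φ ∈ IsManifold.maximalAtlas 𝓘(ℝ, V × W) ∞ E ∧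
      ∀ e : OpenPartialHomeomorph (MapJet2 V (V × W) E) (MapModel2 V (V × W)), IsMapChart2 φ e →
        θ ∈ e.source ∧ ((ContinuousLinearMap.fst ℝ V W).comp (e θ).2.2.1).IsInvertible := by
  obtain ⟨a, ha, rfl⟩ := hθ
  obtain ⟨φ, hφ, hm, hA⟩ := ha.exists_chart
  refine ⟨φ, hφ, fun e he => ⟨(he.mem_source a).2 hm, ?_⟩⟩
  rw [he.apply_eq hφ hm]
  exact hA

omit [TopologicalSpace (SubJet2 V W E)] [FiniteDimensional ℝ W]
  [IsManifold 𝓘(ℝ, V × W) ∞ E] in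
theorem eventually_isInvertible_chart2 {θ : MapJet2 V (V × W) E} (hθ : θ ∈ e.source)
    (hA : ((ContinuousLinearMap.fst ℝ V W).comp (e θ).2.2.1).IsInvertible) :
    ∀ᶠ θ' in 𝓝 θ, θ' ∈ e.source ∧
      ((ContinuousLinearMap.fst ℝ V W).comp (e θ').2.2.1).IsInvertible := by
  have : CompleteSpace V := FiniteDimensional.complete ℝ V
  have hc : ContinuousAt (fun θ' => (ContinuousLinearMap.fst ℝ V W).comp (e θ').2.2.1) θ := by
    have h1 : Continuous fun c : MapModel2 V (V × W) =>
        (ContinuousLinearMap.fst ℝ V W).comp c.2.2.1 :=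
      (contDiff_const.clm_comp contDiff_snd.snd.fst : ContDiff ℝ ∞ _).continuous
    exact h1.continuousAt.comp (e.continuousAt hθ)
  have ho : ∀ᶠ θ' in 𝓝 θ, θ' ∈ e.source := e.open_source.mem_nhds hθ
  exact ho.and (hc.eventually_mem (isOpen_setOf_isInvertible.mem_nhds hA))

end Charts

variable [FiniteDimensional ℝ W] [TopologicalSpace (MapJet2 V (V × W) E)]
  [ChartedSpace (MapModel2 V (V × W)) (MapJet2 V (V × W) E)]
  [TopologicalSpace (SubJet2 V W E)] [ChartedSpace (SubModel2 V W) (SubJet2 V W E)]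

omit [TopologicalSpace (SubJet2 V W E)] [ChartedSpace (SubModel2 V W) (SubJet2 V W E)] in
theorem isOpen_immJet2 (hM : IsMapJetManifold2 V (V × W) E) : IsOpen (ImmJet2 V (V × W) E) := by
  refine isOpen_iff_mem_nhds.2 fun θ hθ => ?_
  obtain ⟨φ, hφ, h⟩ := exists_chart_of_mem_immJet2 hθ
  obtain ⟨e, -, hec⟩ := hM.2 ⟨φ, hφ⟩
  filter_upwards [eventually_isInvertible_chart2 (h e hec).1 (h e hec).2] with θ' hθ'
  exact hec.mem_immJet2 hφ hθ'.1 hθ'.2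

theorem contMDiffAt_proE2 (hM : IsMapJetManifold2 V (V × W) E) (hS : IsSubJetManifold2 V W E)
    {θ : MapJet2 V (V × W) E} (hθ : θ ∈ ImmJet2 V (V × W) E) :
    ContMDiffAt 𝓘(ℝ, MapModel2 V (V × W)) 𝓘(ℝ, SubModel2 V W) ∞ proE2 θ := by
  obtain ⟨φ, hφ, h⟩ := exists_chart_of_mem_immJet2 hθ
  obtain ⟨e, he, hec⟩ := hM.2 ⟨φ, hφ⟩
  obtain ⟨e', he', hec'⟩ := hS.2 ⟨φ, hφ⟩
  refine contMDiffAt_of_coord he he' (h e hec).1 (contDiffAt_quotCoord2 (h e hec).2) ?_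
  filter_upwards [eventually_isInvertible_chart2 (h e hec).1 (h e hec).2] with θ' hθ'
  exact hec.proE2_apply hφ hec' hθ'.1 hθ'.2

end

end ProE


/-! ### The affine group and its action on jets -/

section Affine

variable {V : Type*} [NormedAddCommGroup V] [NormedSpace ℝ V] [FiniteDimensional ℝ V]

theorem affine_apply (g : V ≃ᵃ[ℝ] V) (x : V) : g x = linPart g x + g 0 :=
  congrFun (affine_eq g) x

theorem affine_ext {g h : V ≃ᵃ[ℝ] V} (h1 : linPart g = linPart h) (h2 : g 0 = h 0) : g = h := by
  ext x
  rw [affine_apply, affine_apply h, h1, h2]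

theorem linPart_mul (g h : V ≃ᵃ[ℝ] V) : linPart (g * h) = (linPart g).comp (linPart h) := rfl

theorem linPart_comp_symm (g : V ≃ᵃ[ℝ] V) : (linPart g).comp (linPart g.symm) = .id ℝ V := by
  ext x
  exact g.linear.apply_symm_apply x

theorem linPart_symm_comp (g : V ≃ᵃ[ℝ] V) : (linPart g.symm).comp (linPart g) = .id ℝ V := by
  ext x
  exact g.linear.symm_apply_apply x

theorem linPart_isInvertible (g : V ≃ᵃ[ℝ] V) : (linPart g).IsInvertible :=
  .of_inverse (linPart_comp_symm g) (linPart_symm_comp g)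

theorem linPart_symm (g : V ≃ᵃ[ℝ] V) : linPart g.symm = (linPart g).inverse :=
  (ContinuousLinearMap.inverse_eq (linPart_comp_symm g) (linPart_symm_comp g)).symm

theorem _root_.ContDiffAt.clm_inverse {X : Type*} [NormedAddCommGroup X] [NormedSpace ℝ X]
    {f : X → V →L[ℝ] V} {x : X} {n : WithTop ℕ∞} (hf : ContDiffAt ℝ n f x)
    (h : (f x).IsInvertible) : ContDiffAt ℝ n (fun y => (f y).inverse) x :=
  have : CompleteSpace V := FiniteDimensional.complete ℝ V
  h.contDiffAt_map_inverse.comp x hf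

/-- The affine automorphism `x ↦ M x + b`. -/
def affineOf (M : V ≃L[ℝ] V) (b : V) : V ≃ᵃ[ℝ] V :=
  M.toLinearEquiv.toAffineEquiv.trans (AffineEquiv.constVAdd ℝ V b)

omit [FiniteDimensional ℝ V] in
theorem affineOf_apply (M : V ≃L[ℝ] V) (b x : V) : affineOf M b x = b + M x := rfl

theorem linPart_affineOf (M : V ≃L[ℝ] V) (b : V) : linPart (affineOf M b) = M := rfl

theorem bijOn_affCoord : Set.BijOn (fun g : V ≃ᵃ[ℝ] V => (linPart g, g 0)) Set.univ
    {c | c.1.IsInvertible} := by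
  refine ⟨fun g _ => linPart_isInvertible g, fun g _ h _ hgh => ?_, ?_⟩
  · exact affine_ext (Prod.mk.inj hgh).1 (Prod.mk.inj hgh).2
  · rintro ⟨_, b⟩ ⟨M, rfl⟩
    exact ⟨affineOf M b, trivial, Prod.ext (linPart_affineOf M b) (by simp [affineOf_apply])⟩

variable (V) in
-- One global coordinate system suffices, with the open set of the pairs `(M, b)`, `M` invertible,
-- as its image.
theorem exists_isAffManifold : ∃ (_ : TopologicalSpace (V ≃ᵃ[ℝ] V))
    (_ : ChartedSpace ((V →L[ℝ] V) × V) (V ≃ᵃ[ℝ] V)), IsAffManifold V := by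
  have : CompleteSpace V := FiniteDimensional.complete ℝ V
  let e : Unit → PartialEquiv (V ≃ᵃ[ℝ] V) ((V →L[ℝ] V) × V) :=
    fun _ => partialEquivOfCoord _ _ _ bijOn_affCoord
  have htarget : ∀ i, (e i).target = {c | c.1.IsInvertible} := fun _ => rfl
  have hsource : ∀ i j, ((e i).symm.trans (e j)).source = {c | c.1.IsInvertible} := by
    intro i j
    ext c
    simp only [PartialEquiv.trans_source, PartialEquiv.symm_source, htarget]
    exact ⟨fun h => h.1, fun h => ⟨h, trivial⟩⟩
  have heq : ∀ i j, Set.EqOn ((e i).symm.trans (e j)) id {c | c.1.IsInvertible} :=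
    fun i j c hc => (e i).right_inv hc
  obtain ⟨t, c, hM, h⟩ := exists_hasCharts e (fun x => ⟨(), trivial⟩)
    (fun i j => by
      rw [hsource i j]
      exact isOpen_setOf_isInvertible.preimage continuous_fst)
    (fun i j => by
      rw [hsource i j]
      exact contDiffOn_id.congr (heq i j))
  refine ⟨t, c, hM, fun i => ?_⟩
  obtain ⟨f, hf, hfe⟩ := h i
  refine ⟨f, hf, ?_, fun g => ?_⟩
  · exact congrArg PartialEquiv.source hfe
  · exact congrFun (congrArg PartialEquiv.toFun hfe) g

section LieGroup

variable [TopologicalSpace (V ≃ᵃ[ℝ] V)] [ChartedSpace ((V →L[ℝ] V) × V) (V ≃ᵃ[ℝ] V)]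

/-- In the global chart, `(M, b)(M', b') = (M M', M b' + b)` and `(M, b)⁻¹ = (M⁻¹, -M⁻¹ b)`. -/
theorem IsAffManifold.lieGroup (h : IsAffManifold V) :
    LieGroup 𝓘(ℝ, (V →L[ℝ] V) × V) ∞ (V ≃ᵃ[ℝ] V) := by
  have : CompleteSpace V := FiniteDimensional.complete ℝ V
  obtain ⟨hM, hc⟩ := h
  obtain ⟨e, he, hs, hcoord⟩ := hc ()
  have hmem : ∀ g, g ∈ e.source := fun g => hs ▸ trivial
  have hmul : ContMDiff (𝓘(ℝ, (V →L[ℝ] V) × V).prod 𝓘(ℝ, (V →L[ℝ] V) × V))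
      𝓘(ℝ, (V →L[ℝ] V) × V) ∞ fun p : (V ≃ᵃ[ℝ] V) × (V ≃ᵃ[ℝ] V) => p.1 * p.2 := by
    intro p
    refine contMDiffAt_prod_of_coord he he he (hmem _) (hmem _)
      (Φ := fun q => (q.1.1.comp q.2.1, q.1.1 q.2.2 + q.1.2)) ?_ (.of_forall fun q => ⟨hmem _, ?_⟩)
    · exact (contDiffAt_fst.fst.clm_comp contDiffAt_snd.fst).prodMk
        ((contDiffAt_fst.fst.clm_apply contDiffAt_snd.snd).add contDiffAt_fst.snd)
    · simp only [hcoord]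
      exact Prod.ext (linPart_mul _ _) (affine_apply q.1 (q.2 0))
  have hinv : ContMDiff 𝓘(ℝ, (V →L[ℝ] V) × V) 𝓘(ℝ, (V →L[ℝ] V) × V) ∞
      fun g : V ≃ᵃ[ℝ] V => g⁻¹ := by
    intro g
    refine contMDiffAt_of_coord he he (hmem _)
      (Φ := fun c => (c.1.inverse, -c.1.inverse c.2)) ?_ (.of_forall fun q => ⟨hmem _, ?_⟩)
    · have hi : ContDiffAt ℝ ∞ (fun c : (V →L[ℝ] V) × V => c.1.inverse) (e g) := by
        rw [hcoord]
        exact contDiffAt_fst.clm_inverse (linPart_isInvertible g)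
      exact hi.prodMk (hi.clm_apply contDiffAt_snd).neg
    · simp only [hcoord]
      refine Prod.ext (linPart_symm q) ?_
      have h1 := affine_apply q.symm (q 0)
      rw [q.symm_apply_apply, linPart_symm] at h1
      exact (neg_eq_of_add_eq_zero_right h1.symm).symm
  exact { contMDiff_mul := hmul, contMDiff_inv := hinv }

end LieGroup

variable {F E : Type*} [NormedAddCommGroup F] [NormedSpace ℝ F] [TopologicalSpace E]
  [ChartedSpace F E]

theorem smul_apply_pt (g : V ≃ᵃ[ℝ] V) (a : LocalMap V F E) :
    (g • a).toFun (g • a).pt = a.toFun a.pt := by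
  rw [smul_toFun, smul_pt, Function.comp_apply, g.symm_apply_apply]

/-- The action of the affine automorphism with the coordinates `d` in the coordinates
`(x, u, u_x)`. -/
def affCoord1 (d : (V →L[ℝ] V) × V) (c : MapModel1 V F) : MapModel1 V F :=
  (d.1 c.1 + d.2, c.2.1, c.2.2.comp d.1.inverse)

/-- The action of the affine automorphism with the coordinates `d` in the coordinates
`(x, u, u_x, u_xx)`. -/
def affCoord2 (d : (V →L[ℝ] V) × V) (c : MapModel2 V F) : MapModel2 V F :=
  (d.1 c.1 + d.2, c.2.1, c.2.2.1.comp d.1.inverse,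
    SymBilin.symmetrize V F (pullBilin c.2.2.2.toBilin d.1.inverse))

theorem contDiffAt_affCoord1 {d : ((V →L[ℝ] V) × V) × MapModel1 V F} (hd : d.1.1.IsInvertible) :
    ContDiffAt ℝ ∞ (fun d : ((V →L[ℝ] V) × V) × MapModel1 V F => affCoord1 d.1 d.2) d := by
  have hi : ContDiffAt ℝ ∞ (fun d : ((V →L[ℝ] V) × V) × MapModel1 V F => d.1.1.inverse) d :=
    contDiffAt_fst.fst.clm_inverse hd
  exact ((contDiffAt_fst.fst.clm_apply contDiffAt_snd.fst).add contDiffAt_fst.snd).prodMk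
    (contDiffAt_snd.snd.fst.prodMk (contDiffAt_snd.snd.snd.clm_comp hi))

theorem contDiffAt_affCoord2 {d : ((V →L[ℝ] V) × V) × MapModel2 V F} (hd : d.1.1.IsInvertible) :
    ContDiffAt ℝ ∞ (fun d : ((V →L[ℝ] V) × V) × MapModel2 V F => affCoord2 d.1 d.2) d := by
  have hi : ContDiffAt ℝ ∞ (fun d : ((V →L[ℝ] V) × V) × MapModel2 V F => d.1.1.inverse) d :=
    contDiffAt_fst.fst.clm_inverse hd
  have hB' : ContDiffAt ℝ ∞ (fun d : ((V →L[ℝ] V) × V) × MapModel2 V F => d.2.2.2.2) d :=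
    contDiffAt_snd.snd.snd.snd
  have hB : ContDiffAt ℝ ∞
      (fun d : ((V →L[ℝ] V) × V) × MapModel2 V F => d.2.2.2.2.toBilin) d :=
    (SymBilin.toBilinL V F).contDiff.contDiffAt.comp d hB'
  exact ((contDiffAt_fst.fst.clm_apply contDiffAt_snd.fst).add contDiffAt_fst.snd).prodMk
    (contDiffAt_snd.snd.fst.prodMk ((contDiffAt_snd.snd.snd.fst.clm_comp hi).prodMk
      ((SymBilin.symmetrize V F).contDiff.contDiffAt.comp d (contDiffAt_pullBilin hB hi))))

theorem coord1_smul (g : V ≃ᵃ[ℝ] V) (a : LocalMap V F E) {φ : OpenPartialHomeomorph E F}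
    (hφ : φ ∈ IsManifold.maximalAtlas 𝓘(ℝ, F) ∞ E) (hm : a.toFun a.pt ∈ φ.source) :
    (g • a).coord1 φ = affCoord1 (linPart g, g 0) (a.coord1 φ) := by
  have hp : g.symm (g • a).pt = a.pt := g.symm_apply_apply _
  have h1 := fderiv_comp_affine g.symm (φ ∘ a.toFun) (g • a).pt
    (by rw [hp]; exact (a.contDiffAt hφ hm).differentiableAt (by simp))
  rw [hp] at h1
  refine Prod.ext (affine_apply g a.pt) (Prod.ext (congrArg φ (smul_apply_pt g a)) ?_)
  rw [affCoord1, ← linPart_symm]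
  exact h1

/-- The second derivative of the affine map `g⁻¹` vanishes, so `u_xx` is pulled back without a
correction by `u_x`. This is why affine reparametrizations preserve the parametrized equation. -/
theorem coord2_smul (g : V ≃ᵃ[ℝ] V) (a : LocalMap V F E) {φ : OpenPartialHomeomorph E F}
    (hφ : φ ∈ IsManifold.maximalAtlas 𝓘(ℝ, F) ∞ E) (hm : a.toFun a.pt ∈ φ.source) :
    (g • a).coord2 φ = affCoord2 (linPart g, g 0) (a.coord2 φ) := by
  have hp : g.symm (g • a).pt = a.pt := g.symm_apply_apply _
  have h := coord1_smul g a hφ hm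
  have h1 := fderiv_fderiv_comp_affine g.symm (φ ∘ a.toFun) (g • a).pt
    (by rw [hp]; exact (a.contDiffAt hφ hm).two_of_infty)
  rw [hp] at h1
  refine Prod.ext (affine_apply g a.pt) (Prod.ext (congrArg φ (smul_apply_pt g a))
    (Prod.ext (congrArg (fun c : MapModel1 V F => c.2.2) h) ?_))
  rw [affCoord2, ← linPart_symm, a.toBilin_coord2 hφ hm]
  exact congrArg (SymBilin.symmetrize V F) h1

section Smooth

variable [TopologicalSpace (V ≃ᵃ[ℝ] V)] [ChartedSpace ((V →L[ℝ] V) × V) (V ≃ᵃ[ℝ] V)]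

theorem IsMapJetManifold1.contMDiffSMul [TopologicalSpace (MapJet1 V F E)]
    [ChartedSpace (MapModel1 V F) (MapJet1 V F E)] (hM : IsMapJetManifold1 V F E)
    [IsManifold 𝓘(ℝ, F) ∞ E] (h : IsAffManifold V) :
    ContMDiffSMul 𝓘(ℝ, (V →L[ℝ] V) × V) 𝓘(ℝ, MapModel1 V F) ∞ (V ≃ᵃ[ℝ] V) (MapJet1 V F E) where
  contMDiff_smul := by
    rintro ⟨g, θ⟩
    obtain ⟨d, hd, hs, hcoord⟩ := h.2 ()
    have hmem : ∀ g, g ∈ d.source := fun g => hs ▸ trivial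
    obtain ⟨a, rfl⟩ := MapJet1.exists_rep θ
    have hφ := IsManifold.chart_mem_maximalAtlas (I := 𝓘(ℝ, F)) (n := ∞) (a.toFun a.pt)
    obtain ⟨e, he, hec⟩ := hM.2 ⟨_, hφ⟩
    have hm : a.jet1 ∈ e.source := (hec.mem_source a).2 (mem_chart_source F (a.toFun a.pt))
    refine contMDiffAt_prod_of_coord hd he he (hmem _) hm
      (Φ := fun q => affCoord1 q.1 q.2) ?_ ?_
    · exact contDiffAt_affCoord1 (by rw [hcoord]; exact linPart_isInvertible g)
    · filter_upwards [continuous_snd.continuousAt.eventually_mem (e.open_source.mem_nhds hm)]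
      rintro ⟨g', θ'⟩ hθ'
      obtain ⟨a', rfl⟩ := MapJet1.exists_rep θ'
      have hm' := (hec.mem_source a').1 hθ'
      have hm'' : (g' • a').toFun (g' • a').pt ∈ (chartAt F (a.toFun a.pt)).source := by
        rwa [smul_apply_pt]
      rw [smul_jet1, hec.mem_source, hec.apply_eq hm'', hec.apply_eq hm', hcoord]
      exact ⟨hm'', coord1_smul g' a' hφ hm'⟩

theorem IsMapJetManifold2.contMDiffSMul [TopologicalSpace (MapJet2 V F E)]
    [ChartedSpace (MapModel2 V F) (MapJet2 V F E)] (hM : IsMapJetManifold2 V F E)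
    [IsManifold 𝓘(ℝ, F) ∞ E] (h : IsAffManifold V) :
    ContMDiffSMul 𝓘(ℝ, (V →L[ℝ] V) × V) 𝓘(ℝ, MapModel2 V F) ∞ (V ≃ᵃ[ℝ] V) (MapJet2 V F E) where
  contMDiff_smul := by
    rintro ⟨g, θ⟩
    obtain ⟨d, hd, hs, hcoord⟩ := h.2 ()
    have hmem : ∀ g, g ∈ d.source := fun g => hs ▸ trivial
    obtain ⟨a, rfl⟩ := MapJet2.exists_rep θ
    have hφ := IsManifold.chart_mem_maximalAtlas (I := 𝓘(ℝ, F)) (n := ∞) (a.toFun a.pt)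
    obtain ⟨e, he, hec⟩ := hM.2 ⟨_, hφ⟩
    have hm : a.jet2 ∈ e.source := (hec.mem_source a).2 (mem_chart_source F (a.toFun a.pt))
    refine contMDiffAt_prod_of_coord hd he he (hmem _) hm
      (Φ := fun q => affCoord2 q.1 q.2) ?_ ?_
    · exact contDiffAt_affCoord2 (by rw [hcoord]; exact linPart_isInvertible g)
    · filter_upwards [continuous_snd.continuousAt.eventually_mem (e.open_source.mem_nhds hm)]
      rintro ⟨g', θ'⟩ hθ'
      obtain ⟨a', rfl⟩ := MapJet2.exists_rep θ'
      have hm' := (hec.mem_source a').1 hθ'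
      have hm'' : (g' • a').toFun (g' • a').pt ∈ (chartAt F (a.toFun a.pt)).source := by
        rwa [smul_apply_pt]
      rw [smul_jet2, hec.mem_source, hec.apply_eq hφ hm'', hec.apply_eq hφ hm', hcoord]
      exact ⟨hm'', coord2_smul g' a' hφ hm'⟩

end Smooth

/-- The base point of a jet moves by `g` itself, so the jets of a constant map at all base points
already tell affine maps apart. -/
theorem toPermHom_mapJet2_injective [Nonempty E] :
    Function.Injective (MulAction.toPermHom (V ≃ᵃ[ℝ] V) (MapJet2 V F E)) := by
  intro g h hgh
  ext x
  let a : LocalMap V F E := ⟨x, fun _ => Classical.arbitrary E, .of_forall fun _ => contMDiffAt_const⟩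
  have h1 : g • a.jet2 = h • a.jet2 := DFunLike.congr_fun hgh a.jet2
  exact (LocalMap.jet2_eq_iff.1 h1).1.1

end Affine


/-! ### First jets: orbits and local sections of the projection -/

section Quotient

variable {V W E : Type*} [NormedAddCommGroup V] [NormedSpace ℝ V] [FiniteDimensional ℝ V]
  [NormedAddCommGroup W] [NormedSpace ℝ W] [FiniteDimensional ℝ W]
  [TopologicalSpace E] [ChartedSpace (V × W) E]

omit [FiniteDimensional ℝ W] in
-- Reparametrization does not change the image once `U` is replaced by its image under `g`; hence
-- the projection is constant on orbits.
theorem IsImageOf.smul (g : V ≃ᵃ[ℝ] V) {a : LocalMap V (V × W) E} {b : PointedSub V W E}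
    (h : IsImageOf a b) : IsImageOf (g • a) b := by
  obtain ⟨hp, U, hU, hx, hb, hs⟩ := h
  have hg : ContMDiff 𝓘(ℝ, V) 𝓘(ℝ, V) ∞ g.symm := (affine_contDiff g.symm).contMDiff
  refine ⟨by rw [hp, smul_apply_pt], g.symm ⁻¹' U, hU.preimage hg.continuous, ?_, ?_, ?_⟩
  · rwa [Set.mem_preimage, smul_pt, g.symm_apply_apply]
  · rw [hb, smul_toFun, Set.image_comp, Set.image_preimage_eq _ g.symm.surjective]
  · intro x hx
    obtain ⟨h1, h2⟩ := hs _ hx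
    refine ⟨h1.comp x hg.contMDiffAt, ?_⟩
    rw [smul_toFun, mfderiv_comp x (h1.mdifferentiableAt (by simp))
      (hg.mdifferentiableAt (by simp)), mfderiv_eq_fderiv, (affine_hasFDerivAt g.symm x).fderiv]
    exact h2.comp (linPart_isInvertible g.symm).injective

omit [FiniteDimensional ℝ W] in
-- With the common slope `C`, both derivatives factor as `(1, C)` after their first components, so
-- they differ only by an automorphism of `V`.
theorem exists_affCoord1_eq {c c' : MapModel1 V (V × W)}
    (hc : ((ContinuousLinearMap.fst ℝ V W).comp c.2.2).IsInvertible)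
    (hc' : ((ContinuousLinearMap.fst ℝ V W).comp c'.2.2).IsInvertible)
    (h : quotCoord1 c = quotCoord1 c') :
    ∃ g : V ≃ᵃ[ℝ] V, affCoord1 (linPart g, g 0) c = c' := by
  have hs := slope_apply hc
  have hs' := slope_apply hc'
  have hA := hc'.self_apply_inverse
  obtain ⟨h1, h2, h3⟩ : c.2.1.1 = c'.2.1.1 ∧ c.2.1.2 = c'.2.1.2 ∧ slope c.2.2 = slope c'.2.2 := by
    simpa [quotCoord1] using h
  obtain ⟨M, hM⟩ := hc
  obtain ⟨M', hM'⟩ := hc'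
  have hM1 : ∀ v, M v = (c.2.2 v).1 := fun v => congrArg (fun L : V →L[ℝ] V => L v) hM
  have hM1' : ∀ v, M' v = (c'.2.2 v).1 := fun v => congrArg (fun L : V →L[ℝ] V => L v) hM'
  -- `N = A₁'⁻¹ A₁` satisfies `A N⁻¹ = (1, C) A₁' = A'`; the translation part then moves the base
  -- point to that of `c'`.
  let N : V ≃L[ℝ] V := M.trans M'.symm
  refine ⟨affineOf N (c'.1 - N c.1), Prod.ext ?_ (Prod.ext (Prod.ext h1 h2) ?_)⟩
  · rw [linPart_affineOf]
    simp [affCoord1, affineOf_apply]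
  · rw [linPart_affineOf]
    simp only [affCoord1, ContinuousLinearMap.inverse_equiv]
    ext v
    · change (c.2.2 (M.symm (M' v))).1 = _
      rw [← hM1, M.apply_symm_apply, hM1']
    · change (c.2.2 (M.symm (M' v))).2 = (c'.2.2 v).2
      rw [← hs, ← hs', h3, ← hM1, M.apply_symm_apply, hM1']

variable [IsManifold 𝓘(ℝ, V × W) ∞ E]

omit [FiniteDimensional ℝ V] [FiniteDimensional ℝ W] in
theorem PointedSub.exists_represents (b : PointedSub V W E) :
    ∃ a : LocalMap V (V × W) E, Represents a b := by
  obtain ⟨φ, hφ, f, hf⟩ := b.isSub b.pt b.mem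
  exact ⟨_, hf.represents hφ⟩

omit [FiniteDimensional ℝ W] in
theorem isImmersive_smul {F : Type*} [NormedAddCommGroup F] [NormedSpace ℝ F]
    [ChartedSpace F E] (g : V ≃ᵃ[ℝ] V) {a : LocalMap V F E}
    (h : a.IsImmersive) : (g • a).IsImmersive := by
  have hg := affine_hasFDerivAt g.symm (g • a).pt
  have hp : g.symm (g • a).pt = a.pt := g.symm_apply_apply _
  have ha : MDifferentiableAt 𝓘(ℝ, V) 𝓘(ℝ, F) a.toFun (g.symm (g • a).pt) := by
    rw [hp]
    exact a.smooth.self_of_nhds.mdifferentiableAt (by simp)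
  rw [LocalMap.IsImmersive, smul_toFun, mfderiv_comp _ ha
    hg.differentiableAt.mdifferentiableAt, mfderiv_eq_fderiv, hg.fderiv]
  have h' : Function.Injective (mfderiv 𝓘(ℝ, V) 𝓘(ℝ, F) a.toFun (g.symm (g • a).pt)) := by
    rw [hp]
    exact h
  exact h'.comp (linPart_isInvertible g.symm).injective

/-- The section `d ↦ (x, u, (1, C) ∘ H)` of the projection, in coordinates. -/
def secCoord1 (x : V) (H : V →L[ℝ] V) (d : SubModel1 V W) : MapModel1 V (V × W) :=
  (x, (d.1, d.2.1), ((ContinuousLinearMap.id ℝ V).prod d.2.2).comp H)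

omit [FiniteDimensional ℝ V] [FiniteDimensional ℝ W] in
theorem contDiff_secCoord1 (x : V) (H : V →L[ℝ] V) :
    ContDiff ℝ ∞ (secCoord1 (W := W) x H) :=
  contDiff_const.prodMk ((contDiff_fst.prodMk contDiff_snd.fst).prodMk
    (((contDiff_prod_id (V := V) (W := W)).comp contDiff_snd.snd).clm_comp contDiff_const))

omit [FiniteDimensional ℝ V] [FiniteDimensional ℝ W] in
theorem quotCoord1_secCoord1 {x : V} {H : V →L[ℝ] V} (hH : H.IsInvertible) (d : SubModel1 V W) :
    quotCoord1 (secCoord1 x H d) = d :=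
  Prod.ext rfl (Prod.ext rfl (slope_eq hH fun _ => rfl))

omit [FiniteDimensional ℝ V] [FiniteDimensional ℝ W] in
theorem secCoord1_quotCoord1 {c : MapModel1 V (V × W)}
    (hc : ((ContinuousLinearMap.fst ℝ V W).comp c.2.2).IsInvertible) :
    secCoord1 c.1 ((ContinuousLinearMap.fst ℝ V W).comp c.2.2) (quotCoord1 c) = c := by
  refine Prod.ext rfl (Prod.ext rfl ?_)
  ext v
  · rfl
  · exact slope_apply hc v

section

theorem proE1_smul (g : V ≃ᵃ[ℝ] V) {θ : MapJet1 V (V × W) E} (hθ : θ ∈ ImmJet1 V (V × W) E) :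
    proE1 (g • θ) = proE1 θ := by
  obtain ⟨a, ha, rfl⟩ := hθ
  obtain ⟨b, hb⟩ := ha.exists_isImageOf
  rw [hb.proE1_eq, smul_jet1, (hb.smul g).proE1_eq]

variable {φ : OpenPartialHomeomorph E (V × W)}
  [TopologicalSpace (MapJet1 V (V × W) E)] [TopologicalSpace (SubJet1 V W E)]
  {e : OpenPartialHomeomorph (MapJet1 V (V × W) E) (MapModel1 V (V × W))}
  {e' : OpenPartialHomeomorph (SubJet1 V W E) (SubModel1 V W)}

/-- Concordance of the chart is visible on the projected jet. Two jets with the same projection can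
therefore be compared in the same chart. -/
theorem IsMapChart1.mem_source_of_proE1_mem (hφ : φ ∈ IsManifold.maximalAtlas 𝓘(ℝ, V × W) ∞ E)
    (he : IsMapChart1 φ e) (he' : IsSubChart1 φ e') {θ : MapJet1 V (V × W) E}
    (hθ : θ ∈ ImmJet1 V (V × W) E) (h : proE1 θ ∈ e'.source) :
    θ ∈ e.source ∧ ((ContinuousLinearMap.fst ℝ V W).comp (e θ).2.2).IsInvertible := by
  obtain ⟨a, ha, rfl⟩ := hθ
  obtain ⟨b, hb⟩ := ha.exists_isImageOf
  rw [hb.proE1_eq, he'.mem_source, hb.represents.exists_graph_iff hφ] at h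
  rw [he.mem_source, he.apply_eq h.1]
  exact h

omit [FiniteDimensional ℝ V] [FiniteDimensional ℝ W] [IsManifold 𝓘(ℝ, V × W) ∞ E]
  [TopologicalSpace (MapJet1 V (V × W) E)] in
theorem IsSubChart1.mem_target (he' : IsSubChart1 φ e') {η : SubJet1 V W E}
    (h : η ∈ e'.source) : ((e' η).1, (e' η).2.1) ∈ φ.target := by
  obtain ⟨b, rfl⟩ := SubJet1.exists_rep η
  have hg := (he'.mem_source b).1 h
  rw [he'.apply_eq hg]
  obtain ⟨f, hf⟩ := hg
  rw [PointedSub.coord1_eq_of_graph hf]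
  rw [show ((φ b.pt).1, f (φ b.pt).1) = φ b.pt from Prod.ext rfl (hf.snd_eq b.mem).symm]
  exact φ.map_source hf.mem_source

omit [FiniteDimensional ℝ V] [FiniteDimensional ℝ W] [IsManifold 𝓘(ℝ, V × W) ∞ E] in
theorem symm_sec1_mem (hφ : φ ∈ IsManifold.maximalAtlas 𝓘(ℝ, V × W) ∞ E)
    (he : IsMapChart1 φ e) (he' : IsSubChart1 φ e') {Ψ : SubModel1 V W → MapModel1 V (V × W)}
    (hΨ : ∀ d, (Ψ d).2.1 = (d.1, d.2.1)) {η : SubJet1 V W E} (h : η ∈ e'.source) :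
    e.symm (Ψ (e' η)) ∈ e.source ∧ e (e.symm (Ψ (e' η))) = Ψ (e' η) := by
  have h1 : Ψ (e' η) ∈ e.target := by
    rw [he.target_iff hφ, hΨ]
    exact he'.mem_target h
  exact ⟨e.map_target h1, e.right_inv h1⟩

omit [FiniteDimensional ℝ V] [FiniteDimensional ℝ W] [IsManifold 𝓘(ℝ, V × W) ∞ E] in
theorem contMDiffAt_sec1 [ChartedSpace (MapModel1 V (V × W)) (MapJet1 V (V × W) E)]
    [ChartedSpace (SubModel1 V W) (SubJet1 V W E)]
    (hφ : φ ∈ IsManifold.maximalAtlas 𝓘(ℝ, V × W) ∞ E)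
    (hM : e ∈ IsManifold.maximalAtlas 𝓘(ℝ, MapModel1 V (V × W)) ∞ (MapJet1 V (V × W) E))
    (hM' : e' ∈ IsManifold.maximalAtlas 𝓘(ℝ, SubModel1 V W) ∞ (SubJet1 V W E))
    (he : IsMapChart1 φ e) (he' : IsSubChart1 φ e') {Ψ : SubModel1 V W → MapModel1 V (V × W)}
    (hΨ : ∀ d, (Ψ d).2.1 = (d.1, d.2.1)) {η : SubJet1 V W E} (h : η ∈ e'.source)
    (hs : ContDiffAt ℝ ∞ Ψ (e' η)) :
    ContMDiffAt 𝓘(ℝ, SubModel1 V W) 𝓘(ℝ, MapModel1 V (V × W)) ∞ (e.symm ∘ Ψ ∘ e') η := by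
  refine contMDiffAt_of_coord hM' hM h hs ?_
  filter_upwards [e'.open_source.mem_nhds h] with η' hη'
  exact symm_sec1_mem hφ he he' hΨ hη'

theorem proE1_symm_sec1 (hφ : φ ∈ IsManifold.maximalAtlas 𝓘(ℝ, V × W) ∞ E)
    (he : IsMapChart1 φ e) (he' : IsSubChart1 φ e') {Ψ : SubModel1 V W → MapModel1 V (V × W)}
    (hΨ : ∀ d, (Ψ d).2.1 = (d.1, d.2.1)) {η : SubJet1 V W E} (h : η ∈ e'.source)
    (hi : ((ContinuousLinearMap.fst ℝ V W).comp (Ψ (e' η)).2.2).IsInvertible)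
    (hq : quotCoord1 (Ψ (e' η)) = e' η) : proE1 (e.symm (Ψ (e' η))) = η := by
  obtain ⟨h1, h2⟩ := symm_sec1_mem hφ he he' hΨ h
  obtain ⟨h3, h4⟩ := he.proE1_apply hφ he' h1 (by rw [h2]; exact hi)
  exact e'.injOn h3 h (by rw [h4, h2, hq])

end

section

theorem proE2_smul (g : V ≃ᵃ[ℝ] V) {θ : MapJet2 V (V × W) E} (hθ : θ ∈ ImmJet2 V (V × W) E) :
    proE2 (g • θ) = proE2 θ := by
  obtain ⟨a, ha, rfl⟩ := hθ
  obtain ⟨b, hb⟩ := ha.exists_isImageOf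
  rw [hb.proE2_eq, smul_jet2, (hb.smul g).proE2_eq]

variable {φ : OpenPartialHomeomorph E (V × W)}
  [TopologicalSpace (MapJet2 V (V × W) E)] [TopologicalSpace (SubJet2 V W E)]
  {e : OpenPartialHomeomorph (MapJet2 V (V × W) E) (MapModel2 V (V × W))}
  {e' : OpenPartialHomeomorph (SubJet2 V W E) (SubModel2 V W)}

theorem IsMapChart2.mem_source_of_proE2_mem (hφ : φ ∈ IsManifold.maximalAtlas 𝓘(ℝ, V × W) ∞ E)
    (he : IsMapChart2 φ e) (he' : IsSubChart2 φ e') {θ : MapJet2 V (V × W) E}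
    (hθ : θ ∈ ImmJet2 V (V × W) E) (h : proE2 θ ∈ e'.source) :
    θ ∈ e.source ∧ ((ContinuousLinearMap.fst ℝ V W).comp (e θ).2.2.1).IsInvertible := by
  obtain ⟨a, ha, rfl⟩ := hθ
  obtain ⟨b, hb⟩ := ha.exists_isImageOf
  rw [hb.proE2_eq, he'.mem_source, hb.represents.exists_graph_iff hφ] at h
  rw [he.mem_source, he.apply_eq hφ h.1]
  exact h

omit [FiniteDimensional ℝ V] [FiniteDimensional ℝ W] [IsManifold 𝓘(ℝ, V × W) ∞ E]
  [TopologicalSpace (MapJet2 V (V × W) E)] in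
theorem IsSubChart2.mem_target (he' : IsSubChart2 φ e') {η : SubJet2 V W E}
    (h : η ∈ e'.source) : ((e' η).1, (e' η).2.1) ∈ φ.target := by
  obtain ⟨b, rfl⟩ := SubJet2.exists_rep η
  have hg := (he'.mem_source b).1 h
  rw [he'.apply_eq hg]
  obtain ⟨f, hf⟩ := hg
  rw [PointedSub.coord2_eq_of_graph hf]
  rw [show ((φ b.pt).1, f (φ b.pt).1) = φ b.pt from Prod.ext rfl (hf.snd_eq b.mem).symm]
  exact φ.map_source hf.mem_source

omit [FiniteDimensional ℝ V] [FiniteDimensional ℝ W] [IsManifold 𝓘(ℝ, V × W) ∞ E] in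
theorem symm_sec2_mem (hφ : φ ∈ IsManifold.maximalAtlas 𝓘(ℝ, V × W) ∞ E)
    (he : IsMapChart2 φ e) (he' : IsSubChart2 φ e') {Ψ : SubModel2 V W → MapModel2 V (V × W)}
    (hΨ : ∀ d, (Ψ d).2.1 = (d.1, d.2.1)) {η : SubJet2 V W E} (h : η ∈ e'.source) :
    e.symm (Ψ (e' η)) ∈ e.source ∧ e (e.symm (Ψ (e' η))) = Ψ (e' η) := by
  have h1 : Ψ (e' η) ∈ e.target := by
    rw [he.target_iff hφ, hΨ]
    exact he'.mem_target h
  exact ⟨e.map_target h1, e.right_inv h1⟩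

omit [FiniteDimensional ℝ V] [FiniteDimensional ℝ W] [IsManifold 𝓘(ℝ, V × W) ∞ E] in
theorem contMDiffAt_sec2 [ChartedSpace (MapModel2 V (V × W)) (MapJet2 V (V × W) E)]
    [ChartedSpace (SubModel2 V W) (SubJet2 V W E)]
    (hφ : φ ∈ IsManifold.maximalAtlas 𝓘(ℝ, V × W) ∞ E)
    (hM : e ∈ IsManifold.maximalAtlas 𝓘(ℝ, MapModel2 V (V × W)) ∞ (MapJet2 V (V × W) E))
    (hM' : e' ∈ IsManifold.maximalAtlas 𝓘(ℝ, SubModel2 V W) ∞ (SubJet2 V W E))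
    (he : IsMapChart2 φ e) (he' : IsSubChart2 φ e') {Ψ : SubModel2 V W → MapModel2 V (V × W)}
    (hΨ : ∀ d, (Ψ d).2.1 = (d.1, d.2.1)) {η : SubJet2 V W E} (h : η ∈ e'.source)
    (hs : ContDiffAt ℝ ∞ Ψ (e' η)) :
    ContMDiffAt 𝓘(ℝ, SubModel2 V W) 𝓘(ℝ, MapModel2 V (V × W)) ∞ (e.symm ∘ Ψ ∘ e') η := by
  refine contMDiffAt_of_coord hM' hM h hs ?_
  filter_upwards [e'.open_source.mem_nhds h] with η' hη'
  exact symm_sec2_mem hφ he he' hΨ hη'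

theorem proE2_symm_sec2 (hφ : φ ∈ IsManifold.maximalAtlas 𝓘(ℝ, V × W) ∞ E)
    (he : IsMapChart2 φ e) (he' : IsSubChart2 φ e') {Ψ : SubModel2 V W → MapModel2 V (V × W)}
    (hΨ : ∀ d, (Ψ d).2.1 = (d.1, d.2.1)) {η : SubJet2 V W E} (h : η ∈ e'.source)
    (hi : ((ContinuousLinearMap.fst ℝ V W).comp (Ψ (e' η)).2.2.1).IsInvertible)
    (hq : quotCoord2 (Ψ (e' η)) = e' η) : proE2 (e.symm (Ψ (e' η))) = η := by
  obtain ⟨h1, h2⟩ := symm_sec2_mem hφ he he' hΨ h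
  obtain ⟨h3, h4⟩ := he.proE2_apply hφ he' h1 (by rw [h2]; exact hi)
  exact e'.injOn h3 h (by rw [h4, h2, hq])

end

section JetOne

variable [TopologicalSpace (MapJet1 V (V × W) E)]
  [ChartedSpace (MapModel1 V (V × W)) (MapJet1 V (V × W) E)]
  [TopologicalSpace (SubJet1 V W E)] [ChartedSpace (SubModel1 V W) (SubJet1 V W E)]

theorem isSmoothQuotient_proE1 (hM : IsMapJetManifold1 V (V × W) E)
    (hS : IsSubJetManifold1 V W E) :
    IsSmoothQuotient (G := V ≃ᵃ[ℝ] V) (BX := MapModel1 V (V × W)) (BY := SubModel1 V W)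
      (ImmJet1 V (V × W) E) (Set.univ : Set (SubJet1 V W E)) proE1 where
  invariant := by
    rintro g _ ⟨a, ha, rfl⟩
    exact ⟨g • a, isImmersive_smul g ha, rfl⟩
  image := by
    refine Set.eq_univ_of_forall fun η => ?_
    obtain ⟨b, rfl⟩ := SubJet1.exists_rep η
    obtain ⟨a, ha⟩ := b.exists_represents
    exact ⟨a.jet1, ⟨a, ha.immersive, rfl⟩, ha.proE1_eq⟩
  fibres := by
    intro θ hθ θ' hθ'
    constructor
    · intro h
      obtain ⟨φ, hφ, hφe⟩ := exists_chart_of_mem_immJet1 hθ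
      obtain ⟨e, he, hec⟩ := hM.2 ⟨φ, hφ⟩
      obtain ⟨e', he', hec'⟩ := hS.2 ⟨φ, hφ⟩
      obtain ⟨hs, hA⟩ := hφe e hec
      obtain ⟨hs1, h1⟩ := hec.proE1_apply hφ hec' hs hA
      obtain ⟨hs', hA'⟩ := hec.mem_source_of_proE1_mem hφ hec' hθ' (h ▸ hs1)
      obtain ⟨-, h1'⟩ := hec.proE1_apply hφ hec' hs' hA'
      obtain ⟨g, hg⟩ := exists_affCoord1_eq hA hA' (by rw [← h1, ← h1', h])
      refine ⟨g, ?_⟩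
      obtain ⟨a, rfl⟩ := MapJet1.exists_rep θ
      have hm := (hec.mem_source a).1 hs
      have hm' : (g • a).toFun (g • a).pt ∈ φ.source := by rwa [smul_apply_pt]
      refine e.injOn ((hec.mem_source _).2 hm') hs' ?_
      rw [← hg, hec.apply_eq hm]
      exact (hec.apply_eq hm').trans (coord1_smul g a hφ hm)
    · rintro ⟨g, rfl⟩
      exact (proE1_smul g hθ).symm
  smooth := fun θ hθ => contMDiffAt_proE1 hM hS hθ
  submersion := by
    intro θ hθ
    obtain ⟨φ, hφ, hφe⟩ := exists_chart_of_mem_immJet1 hθ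
    obtain ⟨e, he, hec⟩ := hM.2 ⟨φ, hφ⟩
    obtain ⟨e', he', hec'⟩ := hS.2 ⟨φ, hφ⟩
    obtain ⟨hs, hA⟩ := hφe e hec
    obtain ⟨hs', h1⟩ := hec.proE1_apply hφ hec' hs hA
    have hΨ : ∀ d : SubModel1 V W, (secCoord1 (e θ).1
        ((ContinuousLinearMap.fst ℝ V W).comp (e θ).2.2) d).2.1 = (d.1, d.2.1) := fun _ => rfl
    have hnhds : ∀ᶠ η in 𝓝 (proE1 θ), η ∈ e'.source := e'.open_source.mem_nhds hs'
    -- The base point and the first component of `u_x` are frozen at their values for `θ`, so that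
    -- the section passes through `θ`.
    refine ⟨e.symm ∘ secCoord1 (e θ).1 ((ContinuousLinearMap.fst ℝ V W).comp (e θ).2.2) ∘ e',
      ?_, ?_, ?_⟩
    · rw [Function.comp_apply, Function.comp_apply, h1, secCoord1_quotCoord1 hA, e.left_inv hs]
    · filter_upwards [hnhds] with η hη
      exact contMDiffAt_sec1 hφ he he' hec hec' hΨ hη (contDiff_secCoord1 _ _).contDiffAt
    · filter_upwards [hnhds] with η hη _
      obtain ⟨h2, h3⟩ := symm_sec1_mem hφ hec hec' hΨ hη
      exact ⟨hec.mem_immJet1 hφ h2 (by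
          rw [Function.comp_apply, Function.comp_apply, h3]; exact hA),
        proE1_symm_sec1 hφ hec hec' hΨ hη hA (quotCoord1_secCoord1 hA _)⟩

end JetOne

end Quotient


/-! ### Vector fields and the flat connection of a chart -/

section VectorFields

open VectorField

variable {F : Type*} [NormedAddCommGroup F] [NormedSpace ℝ F] {E : Type*} [TopologicalSpace E]
  [ChartedSpace F E]

omit [TopologicalSpace E] [ChartedSpace F E] in
theorem mlieBracket_const {V W : ∀ y : F, TangentSpace 𝓘(ℝ, F) y} {a b y : F} (hV : V = fun _ => a)
    (hW : W = fun _ => b) : mlieBracket 𝓘(ℝ, F) V W y = 0 := by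
  rw [← mlieBracketWithin_univ, mlieBracketWithin_eq_lieBracketWithin]
  subst hV hW
  simp only [lieBracketWithin]
  exact (by simp : fderivWithin ℝ (fun _ : F => b) Set.univ y a -
    fderivWithin ℝ (fun _ : F => a) Set.univ y b = 0)

/-- The derivative of the chart `φ`, with values in the model space. -/
def dchart (φ : OpenPartialHomeomorph E F) (q : E) : TangentSpace 𝓘(ℝ, F) q →L[ℝ] F :=
  mfderiv 𝓘(ℝ, F) 𝓘(ℝ, F) φ q

/-- The components of a vector field in the chart `φ`. -/
def vfRep (φ : OpenPartialHomeomorph E F) (Z : ∀ q : E, TangentSpace 𝓘(ℝ, F) q) (y : F) : F :=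
  dchart φ (φ.symm y) (Z (φ.symm y))

/-- The vector field with the components `k` in the chart `φ`. -/
def chartField (φ : OpenPartialHomeomorph E F) (k : F → F) : ∀ q : E, TangentSpace 𝓘(ℝ, F) q :=
  fun q => (dchart φ q).inverse (k (φ q))

theorem vfRep_apply {φ : OpenPartialHomeomorph E F} {Z : ∀ q : E, TangentSpace 𝓘(ℝ, F) q} {q : E}
    (hq : q ∈ φ.source) : vfRep φ Z (φ q) = dchart φ q (Z q) := by
  rw [vfRep, φ.left_inv hq]

theorem differentiableAt_of_mdifferentiableAt_vectorField {Z : ∀ y : F, TangentSpace 𝓘(ℝ, F) y}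
    {y : F} (hZ : MDifferentiableAt 𝓘(ℝ, F) 𝓘(ℝ, F).tangent
      (fun y => (⟨y, Z y⟩ : TangentBundle 𝓘(ℝ, F) F)) y) :
    DifferentiableAt (E := F) (F := F) ℝ Z y :=
  (((contMDiff_snd_tangentBundle_modelSpace (n := 1) F 𝓘(ℝ, F)).contMDiffAt.mdifferentiableAt
    one_ne_zero).comp y hZ).differentiableAt

variable [IsManifold 𝓘(ℝ, F) ∞ E] {φ : OpenPartialHomeomorph E F}
  (hφ : φ ∈ IsManifold.maximalAtlas 𝓘(ℝ, F) ∞ E)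

include hφ

omit [IsManifold 𝓘(ℝ, F) ∞ E] in
theorem dchart_isInvertible {q : E} (hq : q ∈ φ.source) : (dchart φ q).IsInvertible :=
  ⟨(mdifferentiable_chart_of_mem hφ).mfderiv hq, rfl⟩

omit [IsManifold 𝓘(ℝ, F) ∞ E] in
theorem dchart_chartField {k : F → F} {q : E} (hq : q ∈ φ.source) :
    dchart φ q (chartField φ k q) = k (φ q) :=
  (dchart_isInvertible hφ hq).self_apply_inverse _

omit [IsManifold 𝓘(ℝ, F) ∞ E] in
theorem mfderiv_chart_symm_isInvertible {y : F} (hy : y ∈ φ.target) :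
    (mfderiv 𝓘(ℝ, F) 𝓘(ℝ, F) φ.symm y).IsInvertible :=
  ⟨(mdifferentiable_chart_of_mem hφ).symm.mfderiv (x := y) hy, rfl⟩

omit [IsManifold 𝓘(ℝ, F) ∞ E] in
-- The components of a field in a chart are its pullback along `φ.symm`, so regularity of pullbacks
-- gives regularity of the components.
theorem vfRep_eq_mpullback {Z : ∀ q : E, TangentSpace 𝓘(ℝ, F) q} {y : F} (hy : y ∈ φ.target) :
    vfRep φ Z y = mpullback 𝓘(ℝ, F) 𝓘(ℝ, F) φ.symm Z y := by
  have h1 := mfderiv_chart_symm_isInvertible hφ hy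
  refine h1.injective ?_
  rw [mpullback_apply, h1.self_apply_inverse]
  have := (mdifferentiable_chart_of_mem hφ).symm_comp_deriv (φ.map_target hy)
  rw [φ.right_inv hy] at this
  exact congrArg (fun L : TangentSpace 𝓘(ℝ, F) (φ.symm y) →L[ℝ] _ => L (Z (φ.symm y))) this

variable [CompleteSpace F]

theorem contMDiffAt_chartField {k : F → F} {q : E} (hq : q ∈ φ.source)
    (hk : ContDiffAt ℝ ∞ k (φ q)) : VFieldSmoothAt F (chartField φ k) q :=
  ContMDiffAt.mpullback_vectorField_preimage (contMDiffAt_vectorSpace_iff_contDiffAt.2 hk)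
    (contMDiffAt_of_mem_maximalAtlas hφ hq) (dchart_isInvertible hφ hq) (by simp)

theorem contDiffAt_vfRep {Z : ∀ q : E, TangentSpace 𝓘(ℝ, F) q} {q : E} (hq : q ∈ φ.source)
    (hZ : VFieldSmoothAt F Z q) : ContDiffAt ℝ ∞ (vfRep φ Z) (φ q) := by
  have h1 := φ.map_source hq
  have h2 : ContDiffAt ℝ ∞ (mpullback 𝓘(ℝ, F) 𝓘(ℝ, F) φ.symm Z) (φ q) :=
    contMDiffAt_vectorSpace_iff_contDiffAt.1
      (ContMDiffAt.mpullback_vectorField_preimage (n := ∞) (m := ∞)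
        (by rw [φ.left_inv hq]; exact hZ)
        (contMDiffAt_symm_of_mem_maximalAtlas hφ h1) (mfderiv_chart_symm_isInvertible hφ h1)
        (by simp))
  refine h2.congr_of_eventuallyEq ?_
  filter_upwards [φ.open_target.mem_nhds h1] with y hy using vfRep_eq_mpullback hφ hy

theorem differentiableAt_vfRep {Z : ∀ q : E, TangentSpace 𝓘(ℝ, F) q} {q : E} (hq : q ∈ φ.source)
    (hZ : MDifferentiableAt 𝓘(ℝ, F) 𝓘(ℝ, F).tangent
      (fun q => (⟨q, Z q⟩ : TangentBundle 𝓘(ℝ, F) E)) q) :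
    DifferentiableAt ℝ (vfRep φ Z) (φ q) := by
  have h1 := φ.map_source hq
  have h2 : DifferentiableAt ℝ (mpullback 𝓘(ℝ, F) 𝓘(ℝ, F) φ.symm Z) (φ q) :=
    differentiableAt_of_mdifferentiableAt_vectorField
      (MDifferentiableAt.mpullback_vectorField (n := ∞)
        (by rw [φ.left_inv hq]; exact hZ)
        (contMDiffAt_symm_of_mem_maximalAtlas hφ h1) (mfderiv_chart_symm_isInvertible hφ h1)
        (by norm_cast))
  refine h2.congr_of_eventuallyEq ?_
  filter_upwards [φ.open_target.mem_nhds h1] with y hy using vfRep_eq_mpullback hφ hy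

omit hφ [CompleteSpace F] in
theorem VFieldSmoothAt.mdifferentiableAt {Z : ∀ q : E, TangentSpace 𝓘(ℝ, F) q} {q : E}
    (h : VFieldSmoothAt F Z q) : MDifferentiableAt 𝓘(ℝ, F) 𝓘(ℝ, F).tangent
      (fun q => (⟨q, Z q⟩ : TangentBundle 𝓘(ℝ, F) E)) q :=
  ContMDiffAt.mdifferentiableAt h (by simp)

omit hφ in
/-- The flat connection of a chart. -/
def flatDeriv (φ : OpenPartialHomeomorph E F) (Z : ∀ q : E, TangentSpace 𝓘(ℝ, F) q) (q : E) :
    TangentSpace 𝓘(ℝ, F) q →L[ℝ] TangentSpace 𝓘(ℝ, F) q :=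
  (dchart φ q).inverse.comp ((fderiv ℝ (vfRep φ Z) (φ q)).comp (dchart φ q))

omit [CompleteSpace F] [IsManifold 𝓘(ℝ, F) ∞ E] in
theorem dchart_flatDeriv {Z : ∀ q : E, TangentSpace 𝓘(ℝ, F) q} {q : E} (hq : q ∈ φ.source)
    (v : TangentSpace 𝓘(ℝ, F) q) :
    dchart φ q (flatDeriv φ Z q v) = fderiv ℝ (vfRep φ Z) (φ q) (dchart φ q v) :=
  (dchart_isInvertible hφ hq).self_apply_inverse _

/-- The connection to compare with: its difference with the given one is a tensor, whose components
are the Christoffel symbol. The axioms are checked after applying the injective map `dchart`, where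
they become rules for ordinary derivatives. -/
theorem isCovariantDerivativeOn_flatDeriv :
    IsCovariantDerivativeOn F (flatDeriv φ (E := E)) φ.source where
  add {Z Z' q} hZ hZ' hq := by
    ext v
    refine (dchart_isInvertible hφ hq).injective ?_
    have h : vfRep φ (Z + Z') = vfRep φ Z + vfRep φ Z' := by
      funext y
      exact map_add _ _ _
    rw [add_apply, map_add, dchart_flatDeriv hφ hq, dchart_flatDeriv hφ hq, dchart_flatDeriv hφ hq,
      h, fderiv_add (differentiableAt_vfRep hφ hq hZ) (differentiableAt_vfRep hφ hq hZ'), add_apply]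
  leibniz {Z g q} hZ hg hq := by
    ext v
    refine (dchart_isInvertible hφ hq).injective ?_
    have h : vfRep φ (g • Z) = fun y => (g ∘ φ.symm) y • vfRep φ Z y := by
      funext y
      exact map_smul _ _ _
    have hg' : MDifferentiableAt 𝓘(ℝ, F) 𝓘(ℝ, ℝ) (g ∘ φ.symm) (φ q) := by
      refine MDifferentiableAt.comp (φ q) ?_
        ((mdifferentiable_chart_of_mem hφ).mdifferentiableAt_symm (φ.map_source hq))
      rw [φ.left_inv hq]
      exact hg
    have hgv : mvfderiv 𝓘(ℝ, F) g q v = fderiv ℝ (g ∘ φ.symm) (φ q) (dchart φ q v) := by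
      have h1 : g =ᶠ[𝓝 q] (g ∘ φ.symm) ∘ φ := by
        filter_upwards [φ.open_source.mem_nhds hq] with r hr
        simp [φ.left_inv hr]
      have h2 : mfderiv 𝓘(ℝ, F) 𝓘(ℝ, ℝ) g q = _ := h1.mfderiv_eq
      rw [mfderiv_comp q hg' (mdifferentiableAt_chart hφ hq), mfderiv_eq_fderiv] at h2
      exact congrArg (fun L : TangentSpace 𝓘(ℝ, F) q →L[ℝ] ℝ => L v) h2
    simp only [add_apply, smul_apply, map_add, map_smul, ContinuousLinearMap.smulRight_apply]
    rw [dchart_flatDeriv hφ hq, dchart_flatDeriv hφ hq, h,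
      fderiv_fun_smul hg'.differentiableAt (differentiableAt_vfRep hφ hq hZ), hgv]
    simp only [add_apply, smul_apply, ContinuousLinearMap.smulRight_apply]
    rw [vfRep_apply hq, Function.comp_apply, φ.left_inv hq]

end VectorFields

/-! ### Christoffel symbols of a torsion-free connection -/

section Christoffel

open VectorField

variable {F : Type*} [NormedAddCommGroup F] [NormedSpace ℝ F] {E : Type*} [TopologicalSpace E]
  [ChartedSpace F E] [IsManifold 𝓘(ℝ, F) ∞ E]

/-- `G` is the Christoffel symbol of the torsion-free connection `Γ` in the chart `φ`. -/
structure IsChristoffel (Γ : CovariantDerivative 𝓘(ℝ, F) F (TangentSpace 𝓘(ℝ, F) : E → Type _))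
    (φ : OpenPartialHomeomorph E F) (G : F → F →L[ℝ] F →L[ℝ] F) : Prop where
  smooth : ContDiffOn ℝ ∞ G φ.target
  symm : ∀ y ∈ φ.target, ∀ a b, G y a b = G y b a
  cov : ∀ q ∈ φ.source, ∀ Z : ∀ q : E, TangentSpace 𝓘(ℝ, F) q,
    MDifferentiableAt 𝓘(ℝ, F) 𝓘(ℝ, F).tangent (fun q => (⟨q, Z q⟩ : TangentBundle 𝓘(ℝ, F) E)) q →
    ∀ v : TangentSpace 𝓘(ℝ, F) q, dchart φ q (Γ Z q v) =
      fderiv ℝ (vfRep φ Z) (φ q) (dchart φ q v) + G (φ q) (dchart φ q v) (dchart φ q (Z q))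

variable [FiniteDimensional ℝ F] {φ : OpenPartialHomeomorph E F}
  (hφ : φ ∈ IsManifold.maximalAtlas 𝓘(ℝ, F) ∞ E)
  (Γ : CovariantDerivative 𝓘(ℝ, F) F (TangentSpace 𝓘(ℝ, F) : E → Type _))

include hφ

/-- Two covariant derivatives on the domain of the chart differ by a tensor, which is transported to
the model space by `dchart`. -/
theorem exists_christoffel :
    ∃ G : F → F →L[ℝ] F →L[ℝ] F, ∀ q ∈ φ.source, ∀ Z : ∀ q : E, TangentSpace 𝓘(ℝ, F) q,
      MDifferentiableAt 𝓘(ℝ, F) 𝓘(ℝ, F).tangent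
        (fun q => (⟨q, Z q⟩ : TangentBundle 𝓘(ℝ, F) E)) q →
      ∀ v : TangentSpace 𝓘(ℝ, F) q, dchart φ q (Γ Z q v) =
        fderiv ℝ (vfRep φ Z) (φ q) (dchart φ q v) + G (φ q) (dchart φ q v) (dchart φ q (Z q)) := by
  have : CompleteSpace F := FiniteDimensional.complete ℝ F
  have hflat := isCovariantDerivativeOn_flatDeriv hφ
  have hΓ := Γ.isCovariantDerivativeOn (s := φ.source)
  let D : E → F →L[ℝ] F →L[ℝ] F := fun q => IsCovariantDerivativeOn.difference hΓ hflat q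
  have hD : ∀ q ∈ φ.source, ∀ Z : ∀ q : E, TangentSpace 𝓘(ℝ, F) q,
      MDifferentiableAt 𝓘(ℝ, F) 𝓘(ℝ, F).tangent
        (fun q => (⟨q, Z q⟩ : TangentBundle 𝓘(ℝ, F) E)) q →
      ∀ v : TangentSpace 𝓘(ℝ, F) q,
        (D q (Z q) v : TangentSpace 𝓘(ℝ, F) q) = Γ Z q v - flatDeriv φ Z q v := by
    intro q hq Z hZ v
    exact congrArg (fun L : TangentSpace 𝓘(ℝ, F) q →L[ℝ] TangentSpace 𝓘(ℝ, F) q => L v)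
      (IsCovariantDerivativeOn.difference_apply hΓ hflat hq hZ)
  let A : E → F →L[ℝ] F := fun q => dchart φ q
  let R : E → F →L[ℝ] F := fun q => (dchart φ q).inverse
  -- The difference tensor takes the field first and the direction second, whereas `G` takes the
  -- direction first; hence the `flip`.
  refine ⟨fun y => pushBilin (A (φ.symm y)) (pullBilin (D (φ.symm y)).flip (R (φ.symm y))),
    fun q hq Z hZ v => ?_⟩
  have hR : ∀ w : TangentSpace 𝓘(ℝ, F) q, R q (dchart φ q w) = w :=
    (dchart_isInvertible hφ hq).inverse_apply_self
  beta_reduce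
  rw [← dchart_flatDeriv hφ hq, φ.left_inv hq, pushBilin_apply, pullBilin_apply, hR, hR]
  change _ = _ + dchart φ q (D q (Z q) v)
  rw [hD q hq Z hZ, map_sub]
  abel

/-- The smoothness of the connection is applied to fields that are smooth on all of `E`, so a
constant field of the chart is cut off by a bump function supported in the chart domain. -/
theorem exists_smooth_field_eventuallyEq [T2Space E] {q : E} (hq : q ∈ φ.source) (b : F) :
    ∃ Z : ∀ q : E, TangentSpace 𝓘(ℝ, F) q, (∀ r, VFieldSmoothAt F Z r) ∧
      ∀ᶠ r in 𝓝 q, Z r = chartField φ (fun _ => b) r := by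
  have : CompleteSpace F := FiniteDimensional.complete ℝ F
  obtain ⟨f, -, hf⟩ := (SmoothBumpFunction.nhds_basis_tsupport (I := 𝓘(ℝ, F)) q).mem_iff.1
    (φ.open_source.mem_nhds hq)
  refine ⟨(f : E → ℝ) • chartField φ (fun _ => b), fun r => ?_, ?_⟩
  · by_cases hr : r ∈ φ.source
    · exact (f.contMDiff r).smul_section (contMDiffAt_chartField hφ hr contDiffAt_const)
    · have h0 : (f : E → ℝ) =ᶠ[𝓝 r] 0 :=
        notMem_tsupport_iff_eventuallyEq.1 fun h => hr (hf h)
      refine ContMDiffAt.congr_of_eventuallyEq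
        (Bundle.contMDiff_zeroSection ℝ (TangentSpace 𝓘(ℝ, F) : E → Type _) r) ?_
      filter_upwards [h0] with s hs
      simp [Bundle.zeroSection, hs]
  · filter_upwards [f.eventuallyEq_one] with r hr
    simp [hr]

/-- Constant fields of the chart detect `G`: `G(a, b)` consists of the components of the derivative
of the field `b` along the field `a`. Smoothness of the connection gives smoothness of `G`; as
constant fields commute, vanishing torsion gives its symmetry. -/
theorem exists_isChristoffel [T2Space E] [CompleteSpace F] (hΓ : IsTorsionFreeConnection Γ) :
    ∃ G, IsChristoffel Γ φ G := by
  obtain ⟨G, hG⟩ := exists_christoffel hφ Γ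
  -- Agreement with the constant field near `q` is enough, so this covers both the cut-off fields
  -- used for smoothness and the plain chart fields used for symmetry.
  have hconst : ∀ (b : F) (Z : ∀ q : E, TangentSpace 𝓘(ℝ, F) q) (q : E), q ∈ φ.source →
      (∀ᶠ r in 𝓝 q, Z r = chartField φ (fun _ => b) r) → VFieldSmoothAt F Z q →
      ∀ a : F, dchart φ q (Γ Z q (chartField φ (fun _ => a) q)) = G (φ q) a b := by
    intro b Z q hq hZ hZs a
    have h1 : vfRep φ Z =ᶠ[𝓝 (φ q)] fun _ => b := by
      have h2 : ∀ᶠ y in 𝓝 (φ q), Z (φ.symm y) = chartField φ (fun _ => b) (φ.symm y) := by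
        have := φ.continuousAt_symm (φ.map_source hq)
        rw [ContinuousAt, φ.left_inv hq] at this
        exact this.eventually hZ
      filter_upwards [h2, φ.open_target.mem_nhds (φ.map_source hq)] with y hy hyt
      rw [vfRep, hy, dchart_chartField hφ (φ.map_target hyt)]
    rw [hG q hq Z hZs.mdifferentiableAt, h1.fderiv_eq (𝕜 := ℝ), dchart_chartField hφ hq,
      hZ.self_of_nhds, dchart_chartField hφ hq]
    simp
  refine ⟨G, ?_, ?_, hG⟩
  · refine contDiffOn_clm_apply.2 fun a => contDiffOn_clm_apply.2 fun b => fun y hy => ?_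
    refine ContDiffAt.contDiffWithinAt ?_
    have hq := φ.map_target hy
    obtain ⟨Z, hZ, hZe⟩ := exists_smooth_field_eventuallyEq hφ hq b
    have hs : VFieldSmoothAt F (fun q => Γ Z q (chartField φ (fun _ => a) q)) (φ.symm y) :=
      ContMDiffAt.clm_bundle_apply
        ((hΓ.1.contMDiff.contMDiff (σ := Z) (fun r _ => (hZ r).contMDiffWithinAt)).contMDiffAt
          Filter.univ_mem)
        (contMDiffAt_chartField hφ hq contDiffAt_const)
    have hr := contDiffAt_vfRep hφ hq hs
    rw [φ.right_inv hy] at hr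
    refine hr.congr_of_eventuallyEq ?_
    have h2 : ∀ᶠ y' in 𝓝 y, ∀ᶠ r in 𝓝 (φ.symm y'), Z r = chartField φ (fun _ => b) r :=
      (φ.continuousAt_symm hy).eventually hZe.eventually_nhds
    filter_upwards [h2, φ.open_target.mem_nhds hy] with y' hy' hyt
    rw [vfRep, hconst b Z _ (φ.map_target hyt) hy' (hZ _), φ.right_inv hyt]
  · intro y hy a b
    have hq := φ.map_target hy
    have hs : ∀ c : F, VFieldSmoothAt F (chartField φ fun _ => c) (φ.symm y) :=
      fun c => contMDiffAt_chartField hφ hq contDiffAt_const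
    have h1 := CovariantDerivative.torsion_eq_zero_iff Γ |>.1 hΓ.2
      (hs a).mdifferentiableAt (hs b).mdifferentiableAt
    have h2 : mlieBracket 𝓘(ℝ, F) (chartField φ fun _ => a) (chartField φ fun _ => b)
        (φ.symm y) = 0 := by
      have : IsManifold 𝓘(ℝ, F) (minSmoothness ℝ 2) E := .of_le (n := ∞)
        (by simp only [minSmoothness_of_isRCLikeNormedField]; norm_cast)
      have h3 := mpullback_mlieBracket (n := ∞) (f := φ) (x₀ := φ.symm y) (V := fun _ : F => a)
        (W := fun _ : F => b)
        (contMDiffAt_vectorSpace_iff_contDiffAt.2 contDiffAt_const |>.mdifferentiableAt one_ne_zero)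
        (contMDiffAt_vectorSpace_iff_contDiffAt.2 contDiffAt_const |>.mdifferentiableAt one_ne_zero)
        (contMDiffAt_of_mem_maximalAtlas hφ hq)
        (by simp only [minSmoothness_of_isRCLikeNormedField]; norm_cast)
      refine h3.symm.trans ?_
      rw [mpullback_apply, mlieBracket_const rfl rfl]
      exact map_zero _
    rw [h2, sub_eq_zero] at h1
    have h4 := congrArg (dchart φ (φ.symm y)) h1
    rwa [hconst b _ _ hq (.of_forall fun _ => rfl) (hs b),
      hconst a _ _ hq (.of_forall fun _ => rfl) (hs a), φ.right_inv hy] at h4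

end Christoffel


/-! ### The parametrized equation in coordinates -/

section MapGeodesic

variable {V F E : Type*} [NormedAddCommGroup V] [NormedSpace ℝ V] [NormedAddCommGroup F]
  [NormedSpace ℝ F] [TopologicalSpace E] [ChartedSpace F E]

theorem LocalMap.eventually_contDiffAt (a : LocalMap V F E) {φ : OpenPartialHomeomorph E F}
    (hφ : φ ∈ IsManifold.maximalAtlas 𝓘(ℝ, F) ∞ E) (hm : a.toFun a.pt ∈ φ.source) :
    ∀ᶠ x in 𝓝 a.pt, ContDiffAt ℝ ∞ (φ ∘ a.toFun) x := by
  filter_upwards [a.smooth, a.eventually_mem hm] with x hx hxs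
  rw [← contMDiffAt_iff_contDiffAt]
  exact (contMDiffAt_of_mem_maximalAtlas hφ hxs).comp x hx

/-- The equation of parametrized totally geodesic submanifolds in coordinates. -/
def MapGeodesicEq (G : F → F →L[ℝ] F →L[ℝ] F) (c : MapModel2 V F) : Prop :=
  ∀ v w, c.2.2.2.toBilin v w + G c.2.1 (c.2.2.1 v) (c.2.2.1 w) = 0

variable [IsManifold 𝓘(ℝ, F) ∞ E]
  {Γ : CovariantDerivative 𝓘(ℝ, F) F (TangentSpace 𝓘(ℝ, F) : E → Type _)}
  {φ : OpenPartialHomeomorph E F} {G : F → F →L[ℝ] F →L[ℝ] F}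

omit [IsManifold 𝓘(ℝ, F) ∞ E] in
theorem LocalMap.fderiv_chart_apply (a : LocalMap V F E)
    (hφ : φ ∈ IsManifold.maximalAtlas 𝓘(ℝ, F) ∞ E) (hm : a.toFun a.pt ∈ φ.source) :
    ∀ᶠ x in 𝓝 a.pt, ∀ v : V, fderiv ℝ (φ ∘ a.toFun) x v =
      dchart φ (a.toFun x) (mfderiv 𝓘(ℝ, V) 𝓘(ℝ, F) a.toFun x v) := by
  filter_upwards [a.smooth, a.eventually_mem hm] with x hx hxs v
  exact fderiv_chart_comp hφ hxs (hx.mdifferentiableAt (by simp)) v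

/-- Along `a` the components of `Z` are `Dk(Y)` with `k = φ ∘ a`. Their derivative along `v` is
`D²k(v, Y) + Dk(∂_v Y)`, and the subtracted term cancels the second summand. What remains involves
`Y` only through its value at the marked point. -/
theorem LocalMap.dchart_covariantDerivative [CompleteSpace F] (a : LocalMap V F E)
    (hφ : φ ∈ IsManifold.maximalAtlas 𝓘(ℝ, F) ∞ E) (hm : a.toFun a.pt ∈ φ.source)
    (hG : IsChristoffel Γ φ G) {Y : V → V} {Z : ∀ q : E, TangentSpace 𝓘(ℝ, F) q}
    (hY : ContDiffAt ℝ ∞ Y a.pt) (hZ : VFieldSmoothAt F Z (a.toFun a.pt))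
    (hYZ : ∀ᶠ x in 𝓝 a.pt, Z (a.toFun x) = mfderiv 𝓘(ℝ, V) 𝓘(ℝ, F) a.toFun x (Y x)) (v : V) :
    dchart φ (a.toFun a.pt) (Γ Z (a.toFun a.pt) (mfderiv 𝓘(ℝ, V) 𝓘(ℝ, F) a.toFun a.pt v)
      - mfderiv 𝓘(ℝ, V) 𝓘(ℝ, F) a.toFun a.pt (fderiv ℝ Y a.pt v)) =
    fderiv ℝ (fderiv ℝ (φ ∘ a.toFun)) a.pt v (Y a.pt) +
      G (φ (a.toFun a.pt)) (fderiv ℝ (φ ∘ a.toFun) a.pt v)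
        (fderiv ℝ (φ ∘ a.toFun) a.pt (Y a.pt)) := by
  have hk := a.contDiffAt hφ hm
  have hd := a.fderiv_chart_apply hφ hm
  have hd0 := hd.self_of_nhds
  have h1 : vfRep φ Z ∘ (φ ∘ a.toFun) =ᶠ[𝓝 a.pt] fun x => fderiv ℝ (φ ∘ a.toFun) x (Y x) := by
    filter_upwards [hYZ, hd, a.eventually_mem hm] with x hx hdx hxs
    rw [Function.comp_apply, Function.comp_apply, vfRep_apply hxs, hx, hdx]
  have h2 : HasFDerivAt (fun x => fderiv ℝ (φ ∘ a.toFun) x (Y x)) _ a.pt :=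
    ((contDiffAt_fderiv hk).differentiableAt (by simp)).hasFDerivAt.clm_apply
      (hY.differentiableAt (by simp)).hasFDerivAt
  have h3 : HasFDerivAt (vfRep φ Z ∘ (φ ∘ a.toFun)) _ a.pt :=
    ((contDiffAt_vfRep hφ hm hZ).differentiableAt (by simp)).hasFDerivAt.comp a.pt
      (hk.differentiableAt (by simp)).hasFDerivAt
  have h4 := congrArg (fun L : V →L[ℝ] F => L v) (h3.unique (h2.congr_of_eventuallyEq h1))
  simp only [ContinuousLinearMap.comp_apply, add_apply, ContinuousLinearMap.flip_apply] at h4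
  rw [map_sub, hG.cov _ hm Z hZ.mdifferentiableAt, ← hd0, ← hd0, hYZ.self_of_nhds, ← hd0, h4]
  abel

/-- For a left inverse `l` of the derivative of `φ ∘ a`, the map `l ∘ φ ∘ a` is a local
diffeomorphism `H` of `V`. Then `H⁻¹ ∘ l` recovers the parameter from a point of the image and
extends the field along `a` to a neighbourhood in `E`. -/
theorem LocalMap.exists_field [FiniteDimensional ℝ V] [CompleteSpace F] {a : LocalMap V F E}
    (ha : a.IsImmersive) (hφ : φ ∈ IsManifold.maximalAtlas 𝓘(ℝ, F) ∞ E)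
    (hm : a.toFun a.pt ∈ φ.source) [FiniteDimensional ℝ F] (w : V) :
    ∃ Z : ∀ q : E, TangentSpace 𝓘(ℝ, F) q, VFieldSmoothAt F Z (a.toFun a.pt) ∧
      ∀ᶠ x in 𝓝 a.pt, Z (a.toFun x) = mfderiv 𝓘(ℝ, V) 𝓘(ℝ, F) a.toFun x w := by
  have : CompleteSpace V := FiniteDimensional.complete ℝ V
  have hk := a.contDiffAt hφ hm
  have hA := (a.isImmersive_iff hφ hm).1 ha
  obtain ⟨l', hl'⟩ := LinearMap.exists_leftInverse_of_injective
    ((fderiv ℝ (φ ∘ a.toFun) a.pt : V →L[ℝ] F) : V →ₗ[ℝ] F) (LinearMap.ker_eq_bot.2 hA)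
  let l : F →L[ℝ] V := LinearMap.toContinuousLinearMap l'
  have hl : l.comp (fderiv ℝ (φ ∘ a.toFun) a.pt) = .id ℝ V := by
    ext v
    exact LinearMap.congr_fun hl' v
  obtain ⟨H, hH, hHs, hHt⟩ := exists_localInverse (h := fun x => l ((φ ∘ a.toFun) x)) (x := a.pt)
    ((a.eventually_contDiffAt hφ hm).mono fun x hx => l.contDiff.contDiffAt.comp x hx)
    (by rw [fderiv_continuousLinearMap_comp l hk, hl]; exact ⟨.refl ℝ V, rfl⟩)
  have hHx : ∀ x, H x = l (φ (a.toFun x)) := fun x => congrFun hH x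
  have h1 : H.symm (l (φ (a.toFun a.pt))) = a.pt := by rw [← hHx, H.left_inv hHs]
  have hmt : l (φ (a.toFun a.pt)) ∈ H.target := hHx a.pt ▸ H.map_source hHs
  refine ⟨chartField φ fun y => fderiv ℝ (φ ∘ a.toFun) (H.symm (l y)) w,
    contMDiffAt_chartField hφ hm ?_, ?_⟩
  · have h2 : ContDiffAt ℝ ∞ (fun y => H.symm (l y)) (φ (a.toFun a.pt)) :=
      (hHt _ hmt).comp _ l.contDiff.contDiffAt
    have h3 : ContDiffAt ℝ ∞ (fderiv ℝ (φ ∘ a.toFun)) (H.symm (l (φ (a.toFun a.pt)))) := by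
      rw [h1]
      exact contDiffAt_fderiv hk
    exact (ContDiffAt.comp (g := fderiv ℝ (φ ∘ a.toFun)) (φ (a.toFun a.pt)) h3 h2).clm_apply
      contDiffAt_const
  · filter_upwards [a.fderiv_chart_apply hφ hm, a.eventually_mem hm, H.open_source.mem_nhds hHs]
      with x hdx hxs hxH
    refine (dchart_isInvertible hφ hxs).injective ?_
    rw [dchart_chartField hφ hxs, ← hHx, H.left_inv hxH, hdx]

/-- Since the second fundamental form is tensorial in `Y`, the constant fields `Y = w` suffice, and
for an immersion they do have extensions to `E`. -/
theorem LocalMap.isGeodesic_iff [FiniteDimensional ℝ V] [FiniteDimensional ℝ F] [CompleteSpace F]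
    {a : LocalMap V F E} (ha : a.IsImmersive) (hφ : φ ∈ IsManifold.maximalAtlas 𝓘(ℝ, F) ∞ E)
    (hm : a.toFun a.pt ∈ φ.source) (hG : IsChristoffel Γ φ G) :
    a.IsGeodesic Γ ↔ MapGeodesicEq G (a.coord2 φ) := by
  rw [MapGeodesicEq, a.toBilin_coord2 hφ hm]
  constructor
  · intro h v w
    obtain ⟨Z, hZ, hYZ⟩ := LocalMap.exists_field ha hφ hm w
    have h1 := a.dchart_covariantDerivative hφ hm hG (Y := fun _ => w) contDiffAt_const hZ hYZ v
    rw [h (fun _ => w) Z contDiffAt_const hZ hYZ v, map_zero] at h1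
    exact h1.symm
  · intro h Y Z hY hZ hYZ v
    refine (dchart_isInvertible hφ hm).injective ?_
    rw [a.dchart_covariantDerivative hφ hm hG hY hZ hYZ v, map_zero]
    exact h v (Y a.pt)

theorem LocalMap.jet2_mem_parametrizedEq [FiniteDimensional ℝ V] [FiniteDimensional ℝ F]
    [CompleteSpace F] {a : LocalMap V F E} (hφ : φ ∈ IsManifold.maximalAtlas 𝓘(ℝ, F) ∞ E)
    (hm : a.toFun a.pt ∈ φ.source) (hG : IsChristoffel Γ φ G) :
    a.jet2 ∈ parametrizedEq V Γ ↔ a.IsImmersive ∧ MapGeodesicEq G (a.coord2 φ) := by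
  constructor
  · rintro ⟨a', h1, h2, h3⟩
    have hc := LocalMap.jet2_eq_iff.1 h3
    have hm' : a'.toFun a'.pt ∈ φ.source := by rwa [hc.1.2.1]
    rw [LocalMap.isGeodesic_iff h1 hφ hm' hG, LocalMap.coord2_eq hc hφ hm'] at h2
    exact ⟨(LocalMap.isImmersive_congr hc.1).1 h1, h2⟩
  · rintro ⟨h1, h2⟩
    exact ⟨a, h1, (LocalMap.isGeodesic_iff h1 hφ hm hG).2 h2, rfl⟩

theorem IsMapChart2.mem_parametrizedEq_iff [FiniteDimensional ℝ V] [FiniteDimensional ℝ F]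
    [CompleteSpace F] [TopologicalSpace (MapJet2 V F E)]
    {e : OpenPartialHomeomorph (MapJet2 V F E) (MapModel2 V F)}
    (hφ : φ ∈ IsManifold.maximalAtlas 𝓘(ℝ, F) ∞ E) (he : IsMapChart2 φ e)
    (hG : IsChristoffel Γ φ G) {θ : MapJet2 V F E} (hθ : θ ∈ e.source) :
    θ ∈ parametrizedEq V Γ ↔ Function.Injective (e θ).2.2.1 ∧ MapGeodesicEq G (e θ) := by
  obtain ⟨a, rfl⟩ := MapJet2.exists_rep θ
  have hm := (he.mem_source a).1 hθ
  rw [LocalMap.jet2_mem_parametrizedEq hφ hm hG, he.apply_eq hφ hm, a.isImmersive_iff hφ hm]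
  rfl

end MapGeodesic

/-! ### The unparametrized equation in coordinates -/

section SubGeodesic

variable {V W E : Type*} [NormedAddCommGroup V] [NormedSpace ℝ V]
  [NormedAddCommGroup W] [NormedSpace ℝ W] [TopologicalSpace E] [ChartedSpace (V × W) E]

/-- The equation of unparametrized totally geodesic submanifolds in coordinates. -/
def SubGeodesicEq (G : V × W → V × W →L[ℝ] V × W →L[ℝ] V × W) (d : SubModel2 V W) : Prop :=
  ∀ v w, d.2.2.2.toBilin v w + ((G (d.1, d.2.1) (v, d.2.2.1 v) (w, d.2.2.1 w)).2 -
    d.2.2.1 (G (d.1, d.2.1) (v, d.2.2.1 v) (w, d.2.2.1 w)).1) = 0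

variable {φ : OpenPartialHomeomorph E (V × W)} {L : Set E} {p : E} {f : V → W}

omit [ChartedSpace (V × W) E] in
theorem IsGraphAt.eventually (h : IsGraphAt φ L p f) : ∀ᶠ q in 𝓝 p, IsGraphAt φ L q f := by
  have hc : ContinuousAt (fun q => (φ q).1) p :=
    continuous_fst.continuousAt.comp (φ.continuousAt h.mem_source)
  filter_upwards [φ.open_source.mem_nhds h.mem_source, hc.eventually h.smooth.eventually_nhds,
    h.graph.eventually_nhds] with q h1 h2 h3
  exact ⟨h1, h2, h3⟩

variable [IsManifold 𝓘(ℝ, V × W) ∞ E]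
  {Γ : CovariantDerivative 𝓘(ℝ, V × W) (V × W) (TangentSpace 𝓘(ℝ, V × W) : E → Type _)}
  {G : V × W → V × W →L[ℝ] V × W →L[ℝ] V × W}
  (hφ : φ ∈ IsManifold.maximalAtlas 𝓘(ℝ, V × W) ∞ E)

include hφ

/-- A curve in `L` satisfies `c₂ = f(c₁)`, which is differentiated at `0`; conversely a straight
line in `V` is lifted to the graph. -/
theorem IsGraphAt.mem_tangentVectors_iff (h : IsGraphAt φ L p f) (hp : p ∈ L)
    (v : TangentSpace 𝓘(ℝ, V × W) p) :
    v ∈ tangentVectors (V × W) L p ↔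
      (dchart φ p v).2 = fderiv ℝ f (φ p).1 (dchart φ p v).1 := by
  have hf := (h.smooth.self_of_nhds.differentiableAt (by simp)).hasFDerivAt
  rw [GeodesicJets.mem_tangentVectors_iff hφ h.mem_source]
  change (∃ c : ℝ → V × W, _ ∧ _ ∧ _ ∧ HasDerivAt c (dchart φ p v) 0) ↔ _
  constructor
  · rintro ⟨c, hc, h0, hct, hd⟩
    have h1 : ∀ᶠ t in 𝓝 (0 : ℝ), (c t).2 = f (c t).1 := by
      have h2 : Filter.Tendsto (fun t => φ.symm (c t)) (𝓝 0) (𝓝 p) := by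
        have h3 := φ.continuousAt_symm (φ.map_source h.mem_source)
        rw [ContinuousAt, φ.left_inv h.mem_source, ← h0] at h3
        exact h3.comp hc.continuousAt
      filter_upwards [hct, h2.eventually h.graph] with t ht htg
      have := htg.1 ht.2
      rwa [φ.right_inv ht.1] at this
    have h4 : HasDerivAt (fun t => (c t).2) (dchart φ p v).2 0 := hd.snd
    have h5 : HasDerivAt (fun t => (c t).1) (dchart φ p v).1 0 := hd.fst
    rw [← h0] at hf
    have h6 := hf.comp_hasDerivAt (0 : ℝ) h5
    rw [h0] at h6
    exact h4.unique (h6.congr_of_eventuallyEq h1)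
  · intro hv
    have h1 : HasDerivAt (fun t : ℝ => (φ p).1 + t • (dchart φ p v).1) (dchart φ p v).1 0 := by
      simpa using ((hasDerivAt_id (0 : ℝ)).smul_const (dchart φ p v).1).const_add (φ p).1
    have h2 : ContDiff ℝ ∞ (fun t : ℝ => (φ p).1 + t • (dchart φ p v).1) := by fun_prop
    have h3 : (φ p).1 + (0 : ℝ) • (dchart φ p v).1 = (φ p).1 := by simp
    refine ⟨fun t => ((φ p).1 + t • (dchart φ p v).1, f ((φ p).1 + t • (dchart φ p v).1)),
      h2.contDiffAt.prodMk (ContDiffAt.comp (0 : ℝ) (by rw [h3]; exact h.smooth.self_of_nhds)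
        h2.contDiffAt), ?_, ?_, ?_⟩
    · simp only [h3]
      rw [← h.snd_eq hp]
    · have h4 : Filter.Tendsto (fun t : ℝ => (φ p).1 + t • (dchart φ p v).1) (𝓝 0)
          (𝓝 (φ p).1) := by
        have := h2.continuous.tendsto 0
        rwa [h3] at this
      exact h4.eventually (h.graph_mem hp)
    · rw [← h3] at hf
      have h5 := hf.comp_hasDerivAt (0 : ℝ) h1
      rw [h3, ← hv] at h5
      exact h1.prodMk h5

/-- Tangency of `Y` along `L` means `Y₂ = Df(Y₁)` on the graph. Differentiating this along `v` gives
`D²f(v, Y₁) + Df(∂_v Y₁)` for the derivative of `Y₂`, so the derivatives of `Y` drop out of the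
normal component of `∇_v Y`. -/
theorem IsGraphAt.dchart_covariantDerivative [CompleteSpace V] [CompleteSpace W]
    (h : IsGraphAt φ L p f) (hp : p ∈ L) (hG : IsChristoffel Γ φ G)
    {Y : ∀ q : E, TangentSpace 𝓘(ℝ, V × W) q} (hY : VFieldSmoothAt (V × W) Y p)
    (hYL : ∀ᶠ q in 𝓝 p, q ∈ L → Y q ∈ tangentVectors (V × W) L q)
    {v : TangentSpace 𝓘(ℝ, V × W) p} (hv : v ∈ tangentVectors (V × W) L p) :
    Γ Y p v ∈ tangentVectors (V × W) L p ↔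
      fderiv ℝ (fderiv ℝ f) (φ p).1 (dchart φ p v).1 (dchart φ p (Y p)).1 +
        ((G (φ p) (dchart φ p v) (dchart φ p (Y p))).2 -
          fderiv ℝ f (φ p).1 (G (φ p) (dchart φ p v) (dchart φ p (Y p))).1) = 0 := by
  have hf := h.smooth.self_of_nhds
  rw [h.mem_tangentVectors_iff hφ hp] at hv
  rw [h.mem_tangentVectors_iff hφ hp, hG.cov p h.mem_source Y hY.mdifferentiableAt]
  have hK : HasFDerivAt (fun u => (u, f u))
      ((ContinuousLinearMap.id ℝ V).prod (fderiv ℝ f (φ p).1)) (φ p).1 :=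
    (hasFDerivAt_id _).prodMk (hf.differentiableAt (by simp)).hasFDerivAt
  have hKp : ((φ p).1, f (φ p).1) = φ p := Prod.ext rfl (h.snd_eq hp).symm
  have hR := ((contDiffAt_vfRep hφ h.mem_source hY).differentiableAt (by simp)).hasFDerivAt
  have hy : HasFDerivAt (fun u => vfRep φ Y (u, f u)) _ (φ p).1 :=
    HasFDerivAt.comp (g := vfRep φ Y) (φ p).1 (by rw [hKp]; exact hR) hK
  have hev : ∀ᶠ u in 𝓝 (φ p).1,
      (vfRep φ Y (u, f u)).2 = fderiv ℝ f u (vfRep φ Y (u, f u)).1 := by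
    have ht : Filter.Tendsto (fun u => φ.symm (u, f u)) (𝓝 (φ p).1) (𝓝 p) := by
      have h3 := φ.continuousAt_symm (φ.map_source h.mem_source)
      rw [ContinuousAt, φ.left_inv h.mem_source, ← hKp] at h3
      exact h3.comp hK.continuousAt
    filter_upwards [h.graph_mem hp, ht.eventually h.eventually, ht.eventually hYL] with u h1 h2 h3
    have h4 := (h2.mem_tangentVectors_iff hφ h1.2 _).1 (h3 h1.2)
    rw [φ.right_inv h1.1] at h4
    exact h4
  have h5 : HasFDerivAt (fun u => fderiv ℝ f u (vfRep φ Y (u, f u)).1) _ (φ p).1 :=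
    ((contDiffAt_fderiv hf).differentiableAt (by simp)).hasFDerivAt.clm_apply hy.fst
  have h6 := congrArg (fun L : V →L[ℝ] W => L (dchart φ p v).1)
    (hy.snd.unique (h5.congr_of_eventuallyEq hev))
  have hvv : ((dchart φ p v).1, fderiv ℝ f (φ p).1 (dchart φ p v).1) = dchart φ p v :=
    Prod.ext rfl hv.symm
  simp only [ContinuousLinearMap.comp_apply, add_apply, ContinuousLinearMap.flip_apply,
    ContinuousLinearMap.coe_fst', ContinuousLinearMap.coe_snd', ContinuousLinearMap.prod_apply,
    ContinuousLinearMap.id_apply, hvv, hKp, vfRep_apply h.mem_source] at h6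
  rw [Prod.snd_add, Prod.fst_add, map_add, h6, ← sub_eq_zero]
  constructor <;> intro h7 <;> rw [← h7] <;> abel

theorem PointedSub.isGeodesic_iff [CompleteSpace V] [CompleteSpace W] {b : PointedSub V W E}
    (h : IsGraphAt φ b.carrier b.pt f) (hG : IsChristoffel Γ φ G) :
    b.IsGeodesic Γ ↔ SubGeodesicEq G (b.coord2 φ) := by
  rw [SubGeodesicEq, PointedSub.toBilin_coord2 h, PointedSub.coord2_eq_of_graph h]
  have hKp : ((φ b.pt).1, f (φ b.pt).1) = φ b.pt := Prod.ext rfl (h.snd_eq b.mem).symm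
  simp only [hKp]
  have hs := h.mem_source
  constructor
  · intro hb v w
    let X : TangentSpace 𝓘(ℝ, V × W) b.pt :=
      (dchart φ b.pt).inverse (v, fderiv ℝ f (φ b.pt).1 v)
    have hX : dchart φ b.pt X = (v, fderiv ℝ f (φ b.pt).1 v) :=
      (dchart_isInvertible hφ hs).self_apply_inverse _
    have hXL : X ∈ tangentVectors (V × W) b.carrier b.pt := by
      rw [h.mem_tangentVectors_iff hφ b.mem, hX]
    -- The field with the constant first component `w`, completed so as to be tangent to the graph
    -- and extended independently of the second coordinate.
    let k : V × W → V × W := fun y => (w, fderiv ℝ f y.1 w)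
    have hk : ContDiffAt ℝ ∞ k (φ b.pt) :=
      contDiffAt_const.prodMk (((contDiffAt_fderiv h.smooth.self_of_nhds).comp (φ b.pt)
        contDiffAt_fst).clm_apply contDiffAt_const)
    have hY := contMDiffAt_chartField hφ hs hk
    have hYL : ∀ᶠ q in 𝓝 b.pt, q ∈ b.carrier →
        chartField φ k q ∈ tangentVectors (V × W) b.carrier q := by
      filter_upwards [h.eventually] with q hq hqL
      rw [hq.mem_tangentVectors_iff hφ hqL, dchart_chartField hφ hq.mem_source]
    have h1 := (h.dchart_covariantDerivative hφ b.mem hG hY hYL hXL).1 (hb _ hY hYL X hXL)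
    rwa [hX, dchart_chartField hφ hs] at h1
  · intro hb Y hY hYL X hX
    rw [h.dchart_covariantDerivative hφ b.mem hG hY hYL hX]
    have h1 := (h.mem_tangentVectors_iff hφ b.mem X).1 hX
    have h2 := (h.mem_tangentVectors_iff hφ b.mem _).1 (hYL.self_of_nhds b.mem)
    have h3 := hb (dchart φ b.pt X).1 (dchart φ b.pt (Y b.pt)).1
    rwa [← h1, ← h2] at h3

theorem PointedSub.jet2_mem_unparametrizedEq [CompleteSpace V] [CompleteSpace W]
    {b : PointedSub V W E} (h : ∃ f, IsGraphAt φ b.carrier b.pt f) (hG : IsChristoffel Γ φ G) :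
    b.jet2 ∈ unparametrizedEq Γ ↔ SubGeodesicEq G (b.coord2 φ) := by
  constructor
  · rintro ⟨b', h1, h2⟩
    obtain ⟨f, hf⟩ := (PointedSub.exists_graph_iff_of_jet2_eq h2 hφ).2 h
    rw [PointedSub.isGeodesic_iff hφ hf hG, PointedSub.coord2_eq_of_jet2_eq h2 hφ ⟨f, hf⟩] at h1
    exact h1
  · intro h1
    obtain ⟨f, hf⟩ := h
    exact ⟨b, (PointedSub.isGeodesic_iff hφ hf hG).2 h1, rfl⟩

theorem IsSubChart2.mem_unparametrizedEq_iff [CompleteSpace V] [CompleteSpace W]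
    [TopologicalSpace (SubJet2 V W E)]
    {e : OpenPartialHomeomorph (SubJet2 V W E) (SubModel2 V W)} (he : IsSubChart2 φ e)
    (hG : IsChristoffel Γ φ G) {η : SubJet2 V W E} (hη : η ∈ e.source) :
    η ∈ unparametrizedEq Γ ↔ SubGeodesicEq G (e η) := by
  obtain ⟨b, rfl⟩ := SubJet2.exists_rep η
  have h := (he.mem_source b).1 hη
  rw [PointedSub.jet2_mem_unparametrizedEq hφ h hG, he.apply_eq h]

end SubGeodesic


/-! ### The two equations and the projection in coordinates -/

section Coordinates

variable {V F W : Type*} [NormedAddCommGroup V] [NormedSpace ℝ V]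
  [NormedAddCommGroup F] [NormedSpace ℝ F] [NormedAddCommGroup W] [NormedSpace ℝ W]

/-- The value `u` is unchanged, and both terms of the equation are pulled back by the same linear
map. -/
theorem mapGeodesicEq_affCoord2 {G : F → F →L[ℝ] F →L[ℝ] F} {c : MapModel2 V F}
    (h : MapGeodesicEq G c) (d : (V →L[ℝ] V) × V) : MapGeodesicEq G (affCoord2 d c) := by
  intro v w
  rw [affCoord2, SymBilin.toBilin_symmetrize fun v w => by
    rw [pullBilin_apply, pullBilin_apply, SymBilin.symm_apply]]
  exact h _ _

theorem MapGeodesicEq.toBilin_eq {G : F → F →L[ℝ] F →L[ℝ] F} {c : MapModel2 V F}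
    (h : MapGeodesicEq G c) : c.2.2.2.toBilin = -pullBilin (G c.2.1) c.2.2.1 := by
  ext v w
  exact eq_neg_of_add_eq_zero_left (h v w)

/-- The equation expresses `u_xx` through `u` and `u_x`, so its points are determined by their first
jets. This reduces the fibres of `proE2` on the equation to those of `proE1`. -/
theorem MapGeodesicEq.ext {G : F → F →L[ℝ] F →L[ℝ] F} {c c' : MapModel2 V F}
    (h : MapGeodesicEq G c) (h' : MapGeodesicEq G c')
    (hc : (c.1, c.2.1, c.2.2.1) = (c'.1, c'.2.1, c'.2.2.1)) : c = c' := by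
  obtain ⟨x, u, A, B⟩ := c
  obtain ⟨x', u', A', B'⟩ := c'
  obtain ⟨rfl, rfl, rfl⟩ : x = x' ∧ u = u' ∧ A = A' := by simpa using hc
  have := SymBilin.ext' (h.toBilin_eq.trans h'.toBilin_eq.symm)
  simp only at this
  rw [this]

variable {G : V × W → V × W →L[ℝ] V × W →L[ℝ] V × W}

theorem toBilin_quotCoord2 {c : MapModel2 V (V × W)} :
    (quotCoord2 c).2.2.2.toBilin = curv c.2.2.1 c.2.2.2.toBilin :=
  SymBilin.toBilin_symmetrize fun v w => by
    simp only [curv, pullBilin_apply, pushBilin_apply]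
    rw [SymBilin.symm_apply]

/-- The operator `pr₂ - C pr₁`, with `C` the slope, is applied to `B = -G(A ·, A ·)`. The arguments
may be taken of the form `A₁ v`, because `A₁` is onto and `A v = (A₁ v, C (A₁ v))`. -/
theorem MapGeodesicEq.quotCoord2 {c : MapModel2 V (V × W)} (h : MapGeodesicEq G c)
    (hc : ((ContinuousLinearMap.fst ℝ V W).comp c.2.2.1).IsInvertible) :
    SubGeodesicEq G (quotCoord2 c) := by
  intro v w
  obtain ⟨v, rfl⟩ := hc.surjective v
  obtain ⟨w, rfl⟩ := hc.surjective w
  have h1 : ∀ v, ((c.2.2.1 v).1, slope c.2.2.1 (c.2.2.1 v).1) = c.2.2.1 v :=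
    fun v => Prod.ext rfl (slope_apply hc v)
  rw [toBilin_quotCoord2]
  simp only [GeodesicJets.quotCoord2, ContinuousLinearMap.comp_apply, ContinuousLinearMap.coe_fst']
  rw [curv_apply hc, h1, h1, eq_neg_of_add_eq_zero_left (h v w), Prod.snd_neg, Prod.fst_neg,
    map_neg]
  abel

/-- The section of the projection, in coordinates, which is determined by the equation of
parametrized totally geodesic submanifolds. -/
def secCoord2 (G : V × W → V × W →L[ℝ] V × W →L[ℝ] V × W) (x : V) (H : V →L[ℝ] V)
    (d : SubModel2 V W) : MapModel2 V (V × W) :=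
  (x, (d.1, d.2.1), ((ContinuousLinearMap.id ℝ V).prod d.2.2.1).comp H,
    SymBilin.symmetrize V (V × W) (-pullBilin (G (d.1, d.2.1))
      (((ContinuousLinearMap.id ℝ V).prod d.2.2.1).comp H)))

theorem contDiffAt_secCoord2 (x : V) (H : V →L[ℝ] V) {d : SubModel2 V W}
    (hG : ContDiffAt ℝ ∞ G (d.1, d.2.1)) : ContDiffAt ℝ ∞ (secCoord2 G x H) d := by
  have hb : ContDiffAt ℝ ∞ (fun d : SubModel2 V W => (d.1, d.2.1)) d := by fun_prop
  have hC : ContDiffAt ℝ ∞ (fun d : SubModel2 V W => d.2.2.1) d := by fun_prop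
  have hA : ContDiffAt ℝ ∞
      (fun d : SubModel2 V W => ((ContinuousLinearMap.id ℝ V).prod d.2.2.1).comp H) d :=
    (((contDiff_prod_id (V := V) (W := W)).contDiffAt).comp d hC).clm_comp contDiffAt_const
  have hG' : ContDiffAt ℝ ∞ (fun d : SubModel2 V W => G (d.1, d.2.1)) d :=
    ContDiffAt.comp (g := G) d hG hb
  exact contDiffAt_const.prodMk (hb.prodMk (hA.prodMk
    ((SymBilin.symmetrize V (V × W)).contDiff.contDiffAt.comp d (contDiffAt_pullBilin hG' hA).neg)))

/-- The symmetry of `G` matters here: only then is `-G(A ·, A ·)` an admissible `u_xx`, unchanged by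
symmetrization. -/
theorem mapGeodesicEq_secCoord2 {d : SubModel2 V W} (hG : ∀ v w, G (d.1, d.2.1) v w =
    G (d.1, d.2.1) w v) (x : V) (H : V →L[ℝ] V) : MapGeodesicEq G (secCoord2 G x H d) := by
  intro v w
  rw [secCoord2, SymBilin.toBilin_symmetrize fun v w => by
    rw [neg_apply, neg_apply, neg_apply, neg_apply, pullBilin_apply, pullBilin_apply, hG]]
  exact neg_add_cancel _

/-- No second derivative is computed: both sides satisfy the unparametrized equation and have the
same first jet, which determines the rest. -/
theorem quotCoord2_secCoord2 {d : SubModel2 V W} (hG : ∀ v w, G (d.1, d.2.1) v w =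
    G (d.1, d.2.1) w v) (hd : SubGeodesicEq G d) (x : V) {H : V →L[ℝ] V} (hH : H.IsInvertible) :
    quotCoord2 (secCoord2 G x H d) = d := by
  have h1 : slope (secCoord2 G x H d).2.2.1 = d.2.2.1 := slope_eq hH fun _ => rfl
  have h2 := (mapGeodesicEq_secCoord2 hG x H).quotCoord2 hH
  refine Prod.ext rfl (Prod.ext rfl (Prod.ext h1 (SymBilin.ext' ?_)))
  ext v w
  have h3 := h2 v w
  rw [show (quotCoord2 (secCoord2 G x H d)).2.2.1 = d.2.2.1 from h1] at h3
  exact (eq_neg_of_add_eq_zero_left h3).trans (eq_neg_of_add_eq_zero_left (hd v w)).symm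

theorem secCoord2_quotCoord2 {c : MapModel2 V (V × W)}
    (hc : ((ContinuousLinearMap.fst ℝ V W).comp c.2.2.1).IsInvertible)
    (hG : ∀ v w, G c.2.1 v w = G c.2.1 w v) (h : MapGeodesicEq G c) :
    secCoord2 G c.1 ((ContinuousLinearMap.fst ℝ V W).comp c.2.2.1) (quotCoord2 c) = c :=
  (mapGeodesicEq_secCoord2 hG _ _).ext h
    (secCoord1_quotCoord1 (c := (c.1, c.2.1, c.2.2.1)) hc)

end Coordinates

/-! ### Invariance of the parametrized equation -/

section Invariance

variable {V F E : Type*} [NormedAddCommGroup V] [NormedSpace ℝ V] [FiniteDimensional ℝ V]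
  [NormedAddCommGroup F] [NormedSpace ℝ F] [TopologicalSpace E] [ChartedSpace F E]

theorem IsMapChart2.apply_smul [TopologicalSpace (MapJet2 V F E)] {φ : OpenPartialHomeomorph E F}
    {e : OpenPartialHomeomorph (MapJet2 V F E) (MapModel2 V F)}
    (hφ : φ ∈ IsManifold.maximalAtlas 𝓘(ℝ, F) ∞ E) (he : IsMapChart2 φ e) (g : V ≃ᵃ[ℝ] V)
    {θ : MapJet2 V F E} (hθ : θ ∈ e.source) :
    g • θ ∈ e.source ∧ e (g • θ) = affCoord2 (linPart g, g 0) (e θ) := by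
  obtain ⟨a, rfl⟩ := MapJet2.exists_rep θ
  have hm := (he.mem_source a).1 hθ
  have hm' : (g • a).toFun (g • a).pt ∈ φ.source := by rwa [smul_apply_pt]
  rw [smul_jet2, he.mem_source, he.apply_eq hφ hm, he.apply_eq hφ hm']
  exact ⟨hm', coord2_smul g a hφ hm⟩

variable [FiniteDimensional ℝ F] [CompleteSpace F] [IsManifold 𝓘(ℝ, F) ∞ E] [T2Space E]
  {Γ : CovariantDerivative 𝓘(ℝ, F) F (TangentSpace 𝓘(ℝ, F) : E → Type _)}

theorem smul_mem_parametrizedEq (hΓ : IsTorsionFreeConnection Γ) (g : V ≃ᵃ[ℝ] V)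
    {θ : MapJet2 V F E} (hθ : θ ∈ parametrizedEq V Γ) : g • θ ∈ parametrizedEq V Γ := by
  obtain ⟨a, rfl⟩ := MapJet2.exists_rep θ
  have hφ := IsManifold.chart_mem_maximalAtlas (I := 𝓘(ℝ, F)) (n := ∞) (a.toFun a.pt)
  have hm := mem_chart_source F (a.toFun a.pt)
  have hm' : (g • a).toFun (g • a).pt ∈ (chartAt F (a.toFun a.pt)).source := by
    rwa [smul_apply_pt]
  obtain ⟨G, hG⟩ := exists_isChristoffel hφ Γ hΓ
  rw [LocalMap.jet2_mem_parametrizedEq hφ hm hG] at hθ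
  rw [smul_jet2, LocalMap.jet2_mem_parametrizedEq hφ hm' hG, coord2_smul g a hφ hm]
  exact ⟨isImmersive_smul g hθ.1, mapGeodesicEq_affCoord2 hθ.2 _⟩

end Invariance

theorem parametrizedEq_subset_immJet2 {V F E : Type*} [NormedAddCommGroup V] [NormedSpace ℝ V]
    [NormedAddCommGroup F] [NormedSpace ℝ F] [TopologicalSpace E] [ChartedSpace F E]
    [IsManifold 𝓘(ℝ, F) ∞ E]
    {Γ : CovariantDerivative 𝓘(ℝ, F) F (TangentSpace 𝓘(ℝ, F) : E → Type _)} :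
    parametrizedEq V Γ ⊆ ImmJet2 V F E := by
  rintro _ ⟨a, ha, -, rfl⟩
  exact ⟨a, ha, rfl⟩

/-! ### The quotient of the parametrized equation -/

section Quotient

variable {V W E : Type*} [NormedAddCommGroup V] [NormedSpace ℝ V] [FiniteDimensional ℝ V]
  [NormedAddCommGroup W] [NormedSpace ℝ W] [FiniteDimensional ℝ W]
  [TopologicalSpace E] [T2Space E] [ChartedSpace (V × W) E] [IsManifold 𝓘(ℝ, V × W) ∞ E]
  [TopologicalSpace (MapJet2 V (V × W) E)]
  [TopologicalSpace (SubJet2 V W E)]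

omit [FiniteDimensional ℝ W] [TopologicalSpace E] [T2Space E] [ChartedSpace (V × W) E]
  [IsManifold 𝓘(ℝ, V × W) ∞ E] [TopologicalSpace (MapJet2 V (V × W) E)]
  [TopologicalSpace (SubJet2 V W E)] [FiniteDimensional ℝ V] in
theorem injective_of_isInvertible_fst_comp {A : V →L[ℝ] V × W}
    (hA : ((ContinuousLinearMap.fst ℝ V W).comp A).IsInvertible) : Function.Injective A :=
  fun _ _ h => hA.injective (congrArg Prod.fst h)

variable [CompleteSpace (V × W)] [CompleteSpace V] [CompleteSpace W]
  {Γ : CovariantDerivative 𝓘(ℝ, V × W) (V × W) (TangentSpace 𝓘(ℝ, V × W) : E → Type _)}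
  {φ : OpenPartialHomeomorph E (V × W)}
  {e : OpenPartialHomeomorph (MapJet2 V (V × W) E) (MapModel2 V (V × W))}
  {e' : OpenPartialHomeomorph (SubJet2 V W E) (SubModel2 V W)}
  {G : V × W → V × W →L[ℝ] V × W →L[ℝ] V × W}

omit [T2Space E] in
/-- The section of the projection in the coordinates `e` and `e'` takes values in the equation of
parametrized totally geodesic submanifolds. -/
theorem symm_secCoord2_mem (hφ : φ ∈ IsManifold.maximalAtlas 𝓘(ℝ, V × W) ∞ E)
    (he : IsMapChart2 φ e) (he' : IsSubChart2 φ e') (hG : IsChristoffel Γ φ G) (x : V)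
    {H : V →L[ℝ] V} (hH : H.IsInvertible) {η : SubJet2 V W E} (hη : η ∈ e'.source)
    (h : η ∈ unparametrizedEq Γ) :
    e.symm (secCoord2 G x H (e' η)) ∈ parametrizedEq V Γ ∧
      proE2 (e.symm (secCoord2 G x H (e' η))) = η := by
  have hsymm := hG.symm _ (he'.mem_target hη)
  obtain ⟨h1, h2⟩ := symm_sec2_mem (Ψ := secCoord2 G x H) hφ he he' (fun _ => rfl) hη
  rw [he'.mem_unparametrizedEq_iff hφ hG hη] at h
  refine ⟨(he.mem_parametrizedEq_iff hφ hG h1).2 ?_,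
    proE2_symm_sec2 (Ψ := secCoord2 G x H) hφ he he' (fun _ => rfl) hη hH
      (quotCoord2_secCoord2 hsymm h x hH)⟩
  rw [h2]
  exact ⟨injective_of_isInvertible_fst_comp (A := (secCoord2 G x H (e' η)).2.2.1) hH,
    mapGeodesicEq_secCoord2 hsymm x H⟩

variable [ChartedSpace (MapModel2 V (V × W)) (MapJet2 V (V × W) E)]
  [ChartedSpace (SubModel2 V W) (SubJet2 V W E)]

theorem isSmoothQuotient_proE2 (hM : IsMapJetManifold2 V (V × W) E)
    (hS : IsSubJetManifold2 V W E) (hΓ : IsTorsionFreeConnection Γ) :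
    IsSmoothQuotient (G := V ≃ᵃ[ℝ] V) (BX := MapModel2 V (V × W)) (BY := SubModel2 V W)
      (parametrizedEq V Γ) (unparametrizedEq Γ) proE2 where
  invariant := fun g θ hθ => smul_mem_parametrizedEq hΓ g hθ
  image := by
    refine Set.Subset.antisymm ?_ fun η hη => ?_
    · rintro _ ⟨θ, hθ, rfl⟩
      obtain ⟨φ, hφ, hφe⟩ := exists_chart_of_mem_immJet2 (parametrizedEq_subset_immJet2 hθ)
      obtain ⟨e, he, hec⟩ := hM.2 ⟨φ, hφ⟩
      obtain ⟨e', he', hec'⟩ := hS.2 ⟨φ, hφ⟩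
      obtain ⟨G, hG⟩ := exists_isChristoffel hφ Γ hΓ
      obtain ⟨hs, hA⟩ := hφe e hec
      obtain ⟨hs1, h1⟩ := hec.proE2_apply hφ hec' hs hA
      rw [hec'.mem_unparametrizedEq_iff hφ hG hs1, h1]
      exact ((hec.mem_parametrizedEq_iff hφ hG hs).1 hθ).2.quotCoord2 hA
    · obtain ⟨b, rfl⟩ := SubJet2.exists_rep η
      obtain ⟨φ, hφ, hf⟩ := b.isSub b.pt b.mem
      obtain ⟨e, he, hec⟩ := hM.2 ⟨φ, hφ⟩
      obtain ⟨e', he', hec'⟩ := hS.2 ⟨φ, hφ⟩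
      obtain ⟨G, hG⟩ := exists_isChristoffel hφ Γ hΓ
      have hH : (ContinuousLinearMap.id ℝ V).IsInvertible := ⟨.refl ℝ V, rfl⟩
      -- Any base point and any invertible first component would do; `0` and the identity are the
      -- simplest.
      have h := symm_secCoord2_mem hφ hec hec' hG 0 hH ((hec'.mem_source b).2 hf) hη
      exact ⟨_, h.1, h.2⟩
  fibres := by
    intro θ hθ θ' hθ'
    have hi := parametrizedEq_subset_immJet2 hθ
    constructor
    · intro h
      obtain ⟨φ, hφ, hφe⟩ := exists_chart_of_mem_immJet2 hi
      obtain ⟨e, he, hec⟩ := hM.2 ⟨φ, hφ⟩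
      obtain ⟨e', he', hec'⟩ := hS.2 ⟨φ, hφ⟩
      obtain ⟨G, hG⟩ := exists_isChristoffel hφ Γ hΓ
      obtain ⟨hs, hA⟩ := hφe e hec
      obtain ⟨hs1, h1⟩ := hec.proE2_apply hφ hec' hs hA
      obtain ⟨hs', hA'⟩ := hec.mem_source_of_proE2_mem hφ hec'
        (parametrizedEq_subset_immJet2 hθ') (h ▸ hs1)
      obtain ⟨-, h1'⟩ := hec.proE2_apply hφ hec' hs' hA'
      have hq : quotCoord2 (e θ) = quotCoord2 (e θ') := by rw [← h1, ← h1', h]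
      -- The affine map is found for the underlying first jets. It matches the second jets as well,
      -- since both `g • θ` and `θ'` lie in the equation.
      obtain ⟨g, hg⟩ := exists_affCoord1_eq (c := ((e θ).1, (e θ).2.1, (e θ).2.2.1))
        (c' := ((e θ').1, (e θ').2.1, (e θ').2.2.1)) hA hA'
        (congrArg (fun d : SubModel2 V W => (d.1, d.2.1, d.2.2.1)) hq)
      obtain ⟨h2, h3⟩ := hec.apply_smul hφ g hs
      refine ⟨g, e.injOn h2 hs' ?_⟩
      rw [h3]
      exact (mapGeodesicEq_affCoord2 ((hec.mem_parametrizedEq_iff hφ hG hs).1 hθ).2 _).ext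
        ((hec.mem_parametrizedEq_iff hφ hG hs').1 hθ').2 hg
    · rintro ⟨g, rfl⟩
      exact (proE2_smul g hi).symm
  smooth := fun θ hθ => contMDiffAt_proE2 hM hS (parametrizedEq_subset_immJet2 hθ)
  submersion := by
    intro θ hθ
    obtain ⟨φ, hφ, hφe⟩ := exists_chart_of_mem_immJet2 (parametrizedEq_subset_immJet2 hθ)
    obtain ⟨e, he, hec⟩ := hM.2 ⟨φ, hφ⟩
    obtain ⟨e', he', hec'⟩ := hS.2 ⟨φ, hφ⟩
    obtain ⟨G, hG⟩ := exists_isChristoffel hφ Γ hΓ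
    obtain ⟨hs, hA⟩ := hφe e hec
    obtain ⟨hs', h1⟩ := hec.proE2_apply hφ hec' hs hA
    have hnhds : ∀ᶠ η in 𝓝 (proE2 θ), η ∈ e'.source := e'.open_source.mem_nhds hs'
    refine ⟨e.symm ∘ secCoord2 G (e θ).1 ((ContinuousLinearMap.fst ℝ V W).comp (e θ).2.2.1) ∘ e',
      ?_, ?_, ?_⟩
    · rw [Function.comp_apply, Function.comp_apply, h1, secCoord2_quotCoord2 hA
        (hG.symm _ ((hec.target_iff hφ).1 (e.map_source hs)))
        ((hec.mem_parametrizedEq_iff hφ hG hs).1 hθ).2, e.left_inv hs]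
    · filter_upwards [hnhds] with η hη
      exact contMDiffAt_sec2 hφ he he' hec hec' (fun _ => rfl) hη (contDiffAt_secCoord2 _ _
        (hG.smooth.contDiffAt (φ.open_target.mem_nhds (hec'.mem_target hη))))
    · filter_upwards [hnhds] with η hη h
      exact symm_secCoord2_mem hφ hec hec' hG _ hA hη h

end Quotient


/-! ### Tangent vectors: pushing forward, lifting, and graphs -/

section TangentVectors

variable {B B' X X' : Type*} [NormedAddCommGroup B] [NormedSpace ℝ B] [NormedAddCommGroup B']
  [NormedSpace ℝ B'] [TopologicalSpace X] [ChartedSpace B X] [TopologicalSpace X']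
  [ChartedSpace B' X'] {f : X → X'} {x : X} {A : Set X} {A' : Set X'}

theorem mfderiv_velocity {γ : ℝ → X} (hf : ContMDiffAt 𝓘(ℝ, B) 𝓘(ℝ, B') ∞ f x)
    (hγ : ContMDiffAt 𝓘(ℝ, ℝ) 𝓘(ℝ, B) ∞ γ 0) (h0 : γ 0 = x) {v : TangentSpace 𝓘(ℝ, B) x}
    (hv : (mfderiv 𝓘(ℝ, ℝ) 𝓘(ℝ, B) γ 0 (1 : ℝ) : B) = (v : B)) :
    (mfderiv 𝓘(ℝ, ℝ) 𝓘(ℝ, B') (f ∘ γ) 0 (1 : ℝ) : B') =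
      (mfderiv 𝓘(ℝ, B) 𝓘(ℝ, B') f x v : B') := by
  subst h0
  have h := mfderiv_comp (0 : ℝ) (hf.mdifferentiableAt (by simp)) (hγ.mdifferentiableAt (by simp))
  rw [h]
  exact congrArg (mfderiv 𝓘(ℝ, B) 𝓘(ℝ, B') f (γ 0)) hv

theorem mfderiv_mem_tangentVectors (hf : ContMDiffAt 𝓘(ℝ, B) 𝓘(ℝ, B') ∞ f x)
    (h : ∀ᶠ y in 𝓝 x, y ∈ A → f y ∈ A') {v : TangentSpace 𝓘(ℝ, B) x}
    (hv : v ∈ tangentVectors B A x) :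
    mfderiv 𝓘(ℝ, B) 𝓘(ℝ, B') f x v ∈ tangentVectors B' A' (f x) := by
  obtain ⟨γ, hγ, h0, hA, hv⟩ := hv
  refine ⟨f ∘ γ, ContMDiffAt.comp (0 : ℝ) (by rw [h0]; exact hf) hγ, congrArg f h0, ?_,
    mfderiv_velocity hf hγ h0 hv⟩
  have hc := hγ.continuousAt
  rw [ContinuousAt, h0] at hc
  filter_upwards [hA, hc.eventually h] with t h1 h2
  exact h2 h1

/-- Tangent vectors lift along a map with a smooth local section. -/
theorem exists_mem_tangentVectors_mfderiv_eq {σ : X' → X}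
    (hf : ContMDiffAt 𝓘(ℝ, B) 𝓘(ℝ, B') ∞ f x) (hσ : ContMDiffAt 𝓘(ℝ, B') 𝓘(ℝ, B) ∞ σ (f x))
    (hx : σ (f x) = x) (h : ∀ᶠ y in 𝓝 (f x), y ∈ A' → σ y ∈ A ∧ f (σ y) = y)
    {w : TangentSpace 𝓘(ℝ, B') (f x)} (hw : w ∈ tangentVectors B' A' (f x)) :
    ∃ v ∈ tangentVectors B A x, mfderiv 𝓘(ℝ, B) 𝓘(ℝ, B') f x v = w := by
  obtain ⟨γ, hγ, h0, hA, hw⟩ := hw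
  have hc := hγ.continuousAt
  rw [ContinuousAt, h0] at hc
  have h1 : (σ ∘ γ) 0 = x := by rw [Function.comp_apply, h0, hx]
  have h2 : ContMDiffAt 𝓘(ℝ, ℝ) 𝓘(ℝ, B) ∞ (σ ∘ γ) 0 :=
    ContMDiffAt.comp (0 : ℝ) (by rw [h0]; exact hσ) hγ
  have h3 : ∀ᶠ t in 𝓝 (0 : ℝ), σ (γ t) ∈ A ∧ f (σ (γ t)) = γ t := by
    filter_upwards [hA, hc.eventually h] with t h4 h5
    exact h5 h4
  refine ⟨(mfderiv 𝓘(ℝ, ℝ) 𝓘(ℝ, B) (σ ∘ γ) 0 (1 : ℝ) : B),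
    ⟨σ ∘ γ, h2, h1, h3.mono fun t ht => ht.1, rfl⟩, ?_⟩
  have h4 : f ∘ (σ ∘ γ) =ᶠ[𝓝 0] γ := h3.mono fun t ht => ht.2
  refine (mfderiv_velocity hf h2 h1 rfl).symm.trans (Eq.trans ?_ hw)
  have h5 := h4.mfderiv_eq (I := 𝓘(ℝ, ℝ)) (I' := 𝓘(ℝ, B'))
  exact congrArg (fun L : ℝ →L[ℝ] B' => L 1) h5

variable {e : OpenPartialHomeomorph X B} (he : e ∈ IsManifold.maximalAtlas 𝓘(ℝ, B) ∞ X)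
  (hx : x ∈ e.source)

include he hx

/-- The chain rule for the coordinate expression of a map. -/
theorem dchart_mfderiv {e' : OpenPartialHomeomorph X' B'}
    (he' : e' ∈ IsManifold.maximalAtlas 𝓘(ℝ, B') ∞ X') {Φ : B → B'}
    (hΦ : ContDiffAt ℝ ∞ Φ (e x)) (h : ∀ᶠ y in 𝓝 x, f y ∈ e'.source ∧ e' (f y) = Φ (e y))
    (v : TangentSpace 𝓘(ℝ, B) x) :
    dchart e' (f x) (mfderiv 𝓘(ℝ, B) 𝓘(ℝ, B') f x v) = fderiv ℝ Φ (e x) (dchart e x v) := by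
  have hf := contMDiffAt_of_coord he he' hx hΦ h
  have h1 : e' ∘ f =ᶠ[𝓝 x] Φ ∘ e := h.mono fun y hy => hy.2
  have h2 := h1.mfderiv_eq (I := 𝓘(ℝ, B)) (I' := 𝓘(ℝ, B'))
  have h3 : mfderiv 𝓘(ℝ, B) 𝓘(ℝ, B') (e' ∘ f) x =
      (mfderiv 𝓘(ℝ, B') 𝓘(ℝ, B') e' (f x)).comp (mfderiv 𝓘(ℝ, B) 𝓘(ℝ, B') f x) :=
    mfderiv_comp x (mdifferentiableAt_chart he' h.self_of_nhds.1) (hf.mdifferentiableAt (by simp))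
  have h4 : mfderiv 𝓘(ℝ, B) 𝓘(ℝ, B') (Φ ∘ e) x =
      (mfderiv 𝓘(ℝ, B) 𝓘(ℝ, B') Φ (e x)).comp (mfderiv 𝓘(ℝ, B) 𝓘(ℝ, B) e x) :=
    mfderiv_comp x (hΦ.contMDiffAt.mdifferentiableAt (by simp)) (mdifferentiableAt_chart he hx)
  rw [mfderiv_eq_fderiv] at h4
  have h5 := h3.symm.trans (h2.trans h4)
  exact congrArg (fun L : TangentSpace 𝓘(ℝ, B) x →L[ℝ] B' => L v) h5

variable {B₁ : Type*} [NormedAddCommGroup B₁] [NormedSpace ℝ B₁] {π : B →L[ℝ] B₁} {J : B₁ → B}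
  [IsManifold 𝓘(ℝ, B) ∞ X]

/-- The tangent vectors of a subset of a graph. -/
theorem dchart_eq_of_mem_tangentVectors (hJ : ContDiffAt ℝ ∞ J (π (e x)))
    (h : ∀ᶠ y in 𝓝 x, y ∈ A → e y = J (π (e y))) {v : TangentSpace 𝓘(ℝ, B) x}
    (hv : v ∈ tangentVectors B A x) :
    dchart e x v = fderiv ℝ J (π (e x)) (π (dchart e x v)) := by
  obtain ⟨c, hc, h0, hA, hd⟩ := (mem_tangentVectors_iff he hx v).1 hv
  change HasDerivAt c (dchart e x v) 0 at hd
  have h1 : c =ᶠ[𝓝 0] fun t => J (π (c t)) := by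
    have h2 : Filter.Tendsto (fun t => e.symm (c t)) (𝓝 0) (𝓝 x) := by
      have h3 := e.continuousAt_symm (e.map_source hx)
      rw [ContinuousAt, e.left_inv hx, ← h0] at h3
      exact h3.comp hc.continuousAt
    filter_upwards [hA, h2.eventually h] with t ht htA
    have := htA ht.2
    rwa [e.right_inv ht.1] at this
  have h2 : HasDerivAt (fun t => π (c t)) (π (dchart e x v)) 0 :=
    π.hasFDerivAt.comp_hasDerivAt (0 : ℝ) hd
  have h3 : HasFDerivAt J (fderiv ℝ J (π (e x))) (π (c 0)) := by
    rw [h0]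
    exact (hJ.differentiableAt (by simp)).hasFDerivAt
  exact hd.unique ((h3.comp_hasDerivAt (0 : ℝ) h2).congr_of_eventuallyEq h1)

/-- The tangent vectors of a set which contains a graph. -/
theorem mem_tangentVectors_of_dchart_eq (hJ : ContDiffAt ℝ ∞ J (π (e x)))
    (hJx : J (π (e x)) = e x) (h : ∀ᶠ u in 𝓝 (π (e x)), J u ∈ e.target ∧ e.symm (J u) ∈ A)
    {v : TangentSpace 𝓘(ℝ, B) x}
    (hv : dchart e x v = fderiv ℝ J (π (e x)) (π (dchart e x v))) : v ∈ tangentVectors B A x := by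
  rw [mem_tangentVectors_iff he hx]
  change ∃ c : ℝ → B, _ ∧ _ ∧ _ ∧ HasDerivAt c (dchart e x v) 0
  -- The line with velocity `π (dchart e x v)` in the base of the graph; its lift by `J` is the
  -- required curve.
  let l : ℝ → B₁ := fun t => π (e x) + t • π (dchart e x v)
  have h1 : HasDerivAt l (π (dchart e x v)) 0 := by
    simpa [l] using ((hasDerivAt_id (0 : ℝ)).smul_const (π (dchart e x v))).const_add (π (e x))
  have h2 : ContDiff ℝ ∞ l := by fun_prop
  have h3 : l 0 = π (e x) := by simp [l]
  have h4 : HasFDerivAt J (fderiv ℝ J (π (e x))) (l 0) := by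
    rw [h3]
    exact (hJ.differentiableAt (by simp)).hasFDerivAt
  refine ⟨J ∘ l, ContDiffAt.comp (0 : ℝ) (by rw [h3]; exact hJ) h2.contDiffAt,
    by rw [Function.comp_apply, h3, hJx], ?_, ?_⟩
  · have h5 := h2.continuous.tendsto 0
    rw [h3] at h5
    exact h5.eventually h
  · have h5 := h4.comp_hasDerivAt (0 : ℝ) h1
    rwa [← hv] at h5

end TangentVectors

/-! ### Symmetric trilinear maps with a prescribed contraction -/

section CubicForm

variable {V F : Type*} [NormedAddCommGroup V] [NormedSpace ℝ V] [NormedAddCommGroup F]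
  [NormedSpace ℝ F]

/-- A symmetric trilinear map with a prescribed contraction with a nonzero vector. -/
theorem exists_trilinear_apply_eq {v : V} (hv : v ≠ 0) (T : SymBilin V F) :
    ∃ S : V →L[ℝ] V →L[ℝ] V →L[ℝ] F, (∀ a b c, S a b c = S b a c) ∧
      (∀ a b c, S a b c = S a c b) ∧ S v = T.toBilin := by
  obtain ⟨α, hα⟩ := SeparatingDual.exists_eq_one (R := ℝ) hv
  let m := ContinuousLinearMap.smulRightL ℝ V F α
  let m' := ContinuousLinearMap.smulRightL ℝ V (V →L[ℝ] F) α
  let t := T.toBilin v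
  -- Inclusion–exclusion over the three slots, with a functional `α` such that `α v = 1`. For `a =
  -- v` the first term is `T(b, c)`, and the remaining ones cancel in pairs.
  let S : V →L[ℝ] V →L[ℝ] V →L[ℝ] F :=
    α.smulRight T.toBilin + m'.comp T.toBilin + pushBilin m T.toBilin
      - α.smulRight (α.smulRight t) - α.smulRight (m.comp t) - m'.comp (m.comp t)
      + α.smulRight (α.smulRight (α.smulRight (t v)))
  have hS : ∀ a b c, S a b c = α a • T.toBilin b c + α b • T.toBilin a c + α c • T.toBilin a b
      - (α a * α b) • t c - (α a * α c) • t b - (α b * α c) • t a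
      + (α a * α b * α c) • t v := by
    intro a b c
    simp [S, m, m', smul_smul, mul_assoc]
  refine ⟨S, fun a b c => ?_, fun a b c => ?_, ?_⟩
  · rw [hS, hS, T.symm_apply a b, mul_comm (α a) (α b)]
    abel
  · rw [hS, hS, T.symm_apply b c, mul_comm (α b) (α c), mul_right_comm (α a) (α b)]
    abel
  · ext b c
    rw [hS, hα]
    simp only [t, one_mul, one_smul]
    module

end CubicForm

/-! ### Prolongations of maps between normed spaces -/

section JetExtension

variable {V F : Type*} [NormedAddCommGroup V] [NormedSpace ℝ V] [NormedAddCommGroup F]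
  [NormedSpace ℝ F]

/-- The `2`-jet prolongation of a map between normed spaces. -/
def jetExt (k : V → F) (x : V) : MapModel2 V F :=
  (x, k x, fderiv ℝ k x, SymBilin.symmetrize V F (fderiv ℝ (fderiv ℝ k) x))

theorem contDiffAt_jetExt {k : V → F} {x : V} (hk : ContDiffAt ℝ ∞ k x) :
    ContDiffAt ℝ ∞ (jetExt k) x :=
  contDiffAt_id.prodMk (hk.prodMk ((contDiffAt_fderiv hk).prodMk
    ((SymBilin.symmetrize V F).contDiff.contDiffAt.comp x
      (contDiffAt_fderiv (contDiffAt_fderiv hk)))))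

theorem hasFDerivAt_of_smooth {k : V → F} {x : V} (hk : ContDiffAt ℝ ∞ k x) :
    HasFDerivAt k (fderiv ℝ k x) x :=
  (hk.differentiableAt (by simp)).hasFDerivAt

/-- The components exhibit the contact relations `du = u_x dx` and `du_x = u_xx dx`. Only the last
one involves third derivatives, which are not determined by the `2`-jet. -/
theorem fderiv_jetExt {k : V → F} {x : V} (hk : ContDiffAt ℝ ∞ k x) (v : V) :
    fderiv ℝ (jetExt k) x v = (v, fderiv ℝ k x v, fderiv ℝ (fderiv ℝ k) x v,
      SymBilin.symmetrize V F (fderiv ℝ (fderiv ℝ (fderiv ℝ k)) x v)) := by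
  have hk' := contDiffAt_fderiv hk
  have h1 : HasFDerivAt (jetExt k) _ x :=
    (hasFDerivAt_id x).prodMk ((hasFDerivAt_of_smooth hk).prodMk ((hasFDerivAt_of_smooth hk').prodMk
      ((SymBilin.symmetrize V F).hasFDerivAt.comp x (hasFDerivAt_of_smooth (contDiffAt_fderiv hk')))))
  rw [h1.fderiv]
  rfl

end JetExtension


/-! ### The Cartan distribution of parametrized jets -/

section MapCartan

variable {V F E : Type*} [NormedAddCommGroup V] [NormedSpace ℝ V]
  [NormedAddCommGroup F] [NormedSpace ℝ F] [TopologicalSpace E] [ChartedSpace F E]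
  [TopologicalSpace (MapJet2 V F E)] [ChartedSpace (MapModel2 V F) (MapJet2 V F E)]
  [IsManifold 𝓘(ℝ, MapModel2 V F) ∞ (MapJet2 V F E)]
  {φ : OpenPartialHomeomorph E F} (hφ : φ ∈ IsManifold.maximalAtlas 𝓘(ℝ, F) ∞ E)
  {e : OpenPartialHomeomorph (MapJet2 V F E) (MapModel2 V F)}
  (hM : e ∈ IsManifold.maximalAtlas 𝓘(ℝ, MapModel2 V F) ∞ (MapJet2 V F E))
  (he : IsMapChart2 φ e) {θ : MapJet2 V F E} (hθ : θ ∈ e.source)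

include hφ he hθ

omit [ChartedSpace (MapModel2 V F) (MapJet2 V F E)]
  [IsManifold 𝓘(ℝ, MapModel2 V F) ∞ (MapJet2 V F E)] in
theorem IsMapChart2.apply_eq_jetExt {a : LocalMap V F E} (h : θ ∈ a.prolongation2) :
    e θ = jetExt (φ ∘ a.toFun) (e θ).1 := by
  obtain ⟨b, hb, rfl⟩ := h
  rw [he.apply_eq hφ ((he.mem_source b).1 hθ), ← hb]
  rfl

include hM

/-- The contact relations are linear, so they need to be checked only on the vectors that span the
Cartan plane. These are tangent to graphs of `jetExt`, whose derivative is known. -/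
theorem IsMapChart2.dchart_of_mem_mapCartan {v : TangentSpace 𝓘(ℝ, MapModel2 V F) θ}
    (hv : v ∈ mapCartan θ) :
    (dchart e θ v).2.1 = (e θ).2.2.1 (dchart e θ v).1 ∧
      (dchart e θ v).2.2.1 = (e θ).2.2.2.toBilin (dchart e θ v).1 := by
  induction hv using Submodule.span_induction with
  | zero => simp
  | add v w _ _ hv hw =>
    rw [map_add, Prod.fst_add, Prod.snd_add, Prod.fst_add, Prod.snd_add, Prod.fst_add, map_add,
      map_add, hv.1, hv.2, hw.1, hw.2]
    exact ⟨rfl, rfl⟩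
  | smul r v _ hv =>
    rw [map_smul, Prod.smul_fst, Prod.smul_snd, Prod.smul_fst, Prod.smul_snd, Prod.smul_fst,
      map_smul, map_smul, hv.1, hv.2]
    exact ⟨rfl, rfl⟩
  | mem v hv =>
    obtain ⟨a, rfl, hv⟩ := hv
    have hm := (he.mem_source a).1 hθ
    have hk := a.contDiffAt hφ hm
    have hea := he.apply_eq hφ hm
    have h1 : (ContinuousLinearMap.fst ℝ V (F × (V →L[ℝ] F) × SymBilin V F)) (e a.jet2) = a.pt := by
      rw [hea]
      rfl
    have hnhds : ∀ᶠ θ in 𝓝 a.jet2, θ ∈ e.source := e.open_source.mem_nhds hθ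
    have h2 := dchart_eq_of_mem_tangentVectors hM hθ
      (π := ContinuousLinearMap.fst ℝ V (F × (V →L[ℝ] F) × SymBilin V F))
      (J := jetExt (φ ∘ a.toFun)) (A := a.prolongation2)
      (by rw [h1]; exact contDiffAt_jetExt hk)
      (hnhds.mono fun θ' hθ' h => he.apply_eq_jetExt hφ hθ' h) hv
    rw [h1, ContinuousLinearMap.coe_fst', fderiv_jetExt hk] at h2
    have h3 : (e a.jet2).2.2.2.toBilin = fderiv ℝ (fderiv ℝ (φ ∘ a.toFun)) a.pt := by
      rw [hea, a.toBilin_coord2 hφ hm]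
    rw [h3, hea]
    exact ⟨congrArg (fun c => c.2.1) h2, congrArg (fun c => c.2.2.1) h2⟩

/-- The vector is tangent to the prolongation of a single section, a cubic polynomial through `θ`
whose third derivative contracts with the base component to the prescribed `du_xx`. Requiring a
nonzero base component does no harm, because the induced Cartan plane has no other vector than `0`
over `0`. -/
theorem IsMapChart2.mem_mapCartan_of_dchart {v : TangentSpace 𝓘(ℝ, MapModel2 V F) θ}
    (h1 : (dchart e θ v).2.1 = (e θ).2.2.1 (dchart e θ v).1)
    (h2 : (dchart e θ v).2.2.1 = (e θ).2.2.2.toBilin (dchart e θ v).1)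
    (h0 : (dchart e θ v).1 ≠ 0) : v ∈ mapCartan θ := by
  obtain ⟨S, hS, hS', hSv⟩ := exists_trilinear_apply_eq h0 (dchart e θ v).2.2.2
  have hB := (e θ).2.2.2.symm_apply
  let k := taylor (e θ).1 (e θ).2.1 (e θ).2.2.1 (e θ).2.2.2.toBilin S
  have hk : ContDiff ℝ ∞ k := contDiff_taylor _ _ _
  have hkx : k (e θ).1 = (e θ).2.1 := taylor_self _ _ _
  have hk1 : fderiv ℝ k = _ := fderiv_taylor _ _ _ hB hS hS'
  have hk2 : fderiv ℝ (fderiv ℝ k) = _ := fderiv_fderiv_taylor _ _ _ hB hS hS'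
  have hk3 : fderiv ℝ (fderiv ℝ (fderiv ℝ k)) (e θ).1 = S := by
    have hd : HasFDerivAt (fun y : V => y - (e θ).1) (ContinuousLinearMap.id ℝ V) (e θ).1 :=
      (hasFDerivAt_id _).sub_const _
    rw [hk2]
    exact ((HasFDerivAt.comp (g := S) (g' := S) (e θ).1 S.hasFDerivAt hd).const_add _).fderiv
  have hkx' : k (e θ).1 ∈ φ.target := by
    rw [hkx]
    exact (he.target_iff hφ).1 (e.map_source hθ)
  have hJ : ∀ (u : V) (hu : k u ∈ φ.target), (LocalMap.ofCoord hφ u hk hu).jet2 ∈ e.source ∧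
      e (LocalMap.ofCoord hφ u hk hu).jet2 = jetExt k u := fun u hu => by
    have := LocalMap.ofCoord_mem hφ hk hu
    exact ⟨(he.mem_source _).2 this, by rw [he.apply_eq hφ this, LocalMap.coord2_ofCoord]; rfl⟩
  have hJx : jetExt k (e θ).1 = e θ := by
    refine Prod.ext rfl (Prod.ext hkx (Prod.ext ?_ ?_))
    · simp [jetExt, hk1]
    · simp [jetExt, hk2]
  refine Submodule.subset_span ⟨LocalMap.ofCoord hφ (e θ).1 hk hkx', ?_, ?_⟩
  · exact e.injOn (hJ _ hkx').1 hθ ((hJ _ hkx').2.trans hJx)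
  · refine mem_tangentVectors_of_dchart_eq hM hθ
      (π := ContinuousLinearMap.fst ℝ V (F × (V →L[ℝ] F) × SymBilin V F))
      (contDiffAt_jetExt hk.contDiffAt) hJx ?_ ?_
    · filter_upwards [hk.continuous.continuousAt.eventually_mem (φ.open_target.mem_nhds hkx')]
        with u hu
      obtain ⟨h3, h4⟩ := hJ u hu
      rw [← h4]
      exact ⟨e.map_source h3, by rw [e.left_inv h3]; exact ⟨LocalMap.ofCoord hφ u hk hu, rfl, rfl⟩⟩
    · rw [ContinuousLinearMap.coe_fst', fderiv_jetExt hk.contDiffAt, hk3, hSv, hk2, hk1]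
      refine Prod.ext rfl (Prod.ext ?_ (Prod.ext ?_ ?_))
      · simpa using h1
      · simpa using h2
      · simp

end MapCartan

/-! ### Affine transformations as external symmetries -/

section ExternalSymmetry

variable {V F E : Type*} [NormedAddCommGroup V] [NormedSpace ℝ V] [FiniteDimensional ℝ V]
  [NormedAddCommGroup F] [NormedSpace ℝ F] [TopologicalSpace E] [ChartedSpace F E]
  [IsManifold 𝓘(ℝ, F) ∞ E]
  [TopologicalSpace (MapJet2 V F E)] [ChartedSpace (MapModel2 V F) (MapJet2 V F E)]

omit [IsManifold 𝓘(ℝ, F) ∞ E] [TopologicalSpace (MapJet2 V F E)]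
  [ChartedSpace (MapModel2 V F) (MapJet2 V F E)] in
theorem smul_mem_prolongation2 (g : V ≃ᵃ[ℝ] V) {a : LocalMap V F E} {θ : MapJet2 V F E}
    (h : θ ∈ a.prolongation2) : g • θ ∈ (g • a).prolongation2 := by
  obtain ⟨b, hb, rfl⟩ := h
  exact ⟨g • b, by rw [smul_toFun, smul_toFun, hb], rfl⟩

theorem contMDiff_smul_mapJet2 (hM : IsMapJetManifold2 V F E) (g : V ≃ᵃ[ℝ] V) :
    ContMDiff 𝓘(ℝ, MapModel2 V F) 𝓘(ℝ, MapModel2 V F) ∞ (fun θ : MapJet2 V F E => g • θ) := by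
  intro θ
  obtain ⟨a, rfl⟩ := MapJet2.exists_rep θ
  have hφ := IsManifold.chart_mem_maximalAtlas (I := 𝓘(ℝ, F)) (n := ∞) (a.toFun a.pt)
  obtain ⟨e, he, hec⟩ := hM.2 ⟨_, hφ⟩
  have hm : a.jet2 ∈ e.source := (hec.mem_source a).2 (mem_chart_source F (a.toFun a.pt))
  have hnhds : ∀ᶠ θ in 𝓝 a.jet2, θ ∈ e.source := e.open_source.mem_nhds hm
  refine contMDiffAt_of_coord he he hm (Φ := affCoord2 (linPart g, g 0)) ?_
    (hnhds.mono fun θ hθ => hec.apply_smul hφ g hθ)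
  exact (contDiffAt_affCoord2 (d := ((linPart g, g 0), e a.jet2)) (linPart_isInvertible g)).comp _
    (contDiffAt_const.prodMk contDiffAt_id)

/-- The transformation carries the prolongation of `a` into that of `g • a`. For the reverse
inclusion, tangent vectors are lifted with `g⁻¹` as a global smooth section. -/
theorem map_mapCartan_smul (hM : IsMapJetManifold2 V F E) (g : V ≃ᵃ[ℝ] V) (θ : MapJet2 V F E) :
    (mapCartan θ).map (mfderiv 𝓘(ℝ, MapModel2 V F) 𝓘(ℝ, MapModel2 V F)
      (fun θ : MapJet2 V F E => g • θ) θ).toLinearMap = mapCartan (g • θ) := by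
  have hg := contMDiff_smul_mapJet2 hM g
  refine le_antisymm ?_ ?_
  · rw [mapCartan, Submodule.map_span_le]
    rintro v ⟨a, rfl, hv⟩
    exact Submodule.subset_span ⟨g • a, rfl, mfderiv_mem_tangentVectors hg.contMDiffAt
      (.of_forall fun θ hθ => smul_mem_prolongation2 g hθ) hv⟩
  · refine Submodule.span_le.2 ?_
    rintro w ⟨a, ha, hw⟩
    obtain ⟨v, hv, hvw⟩ := exists_mem_tangentVectors_mfderiv_eq (A := (g⁻¹ • a).prolongation2)
      hg.contMDiffAt (contMDiff_smul_mapJet2 hM g⁻¹).contMDiffAt (inv_smul_smul g θ)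
      (.of_forall fun η hη => ⟨smul_mem_prolongation2 g⁻¹ hη, smul_inv_smul g η⟩) hw
    refine ⟨v, Submodule.subset_span ⟨g⁻¹ • a, ?_, hv⟩, hvw⟩
    rw [← smul_jet2, ha, inv_smul_smul]

theorem isExternalSymmetry_smul [FiniteDimensional ℝ F] [CompleteSpace F] [T2Space E]
    {Γ : CovariantDerivative 𝓘(ℝ, F) F (TangentSpace 𝓘(ℝ, F) : E → Type _)}
    (hM : IsMapJetManifold2 V F E) (hΓ : IsTorsionFreeConnection Γ) (g : V ≃ᵃ[ℝ] V) :
    IsExternalSymmetry (parametrizedEq V Γ)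
      (MulAction.toPermHom (V ≃ᵃ[ℝ] V) (MapJet2 V F E) g) where
  smooth := contMDiff_smul_mapJet2 hM g
  smooth_symm := contMDiff_smul_mapJet2 hM g⁻¹
  contact := map_mapCartan_smul hM g
  preserves := by
    refine Set.Subset.antisymm ?_ fun θ hθ => ?_
    · rintro _ ⟨θ, hθ, rfl⟩
      exact smul_mem_parametrizedEq hΓ g hθ
    · exact ⟨g⁻¹ • θ, smul_mem_parametrizedEq hΓ g⁻¹ hθ, smul_inv_smul g θ⟩

end ExternalSymmetry


/-! ### The Cartan distribution of the jets of submanifolds -/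

section SubCartan

variable {V W E : Type*} [NormedAddCommGroup V] [NormedSpace ℝ V]
  [NormedAddCommGroup W] [NormedSpace ℝ W] [TopologicalSpace E] [ChartedSpace (V × W) E]
  [TopologicalSpace (SubJet2 V W E)] [ChartedSpace (SubModel2 V W) (SubJet2 V W E)]
  [IsManifold 𝓘(ℝ, SubModel2 V W) ∞ (SubJet2 V W E)]
  {φ : OpenPartialHomeomorph E (V × W)}
  {e : OpenPartialHomeomorph (SubJet2 V W E) (SubModel2 V W)}
  (he : IsSubChart2 φ e)

include he

omit [ChartedSpace (SubModel2 V W) (SubJet2 V W E)]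
  [IsManifold 𝓘(ℝ, SubModel2 V W) ∞ (SubJet2 V W E)] in
-- The marked point is a continuous function of the jet. A jet of the prolongation close to that of
-- `b` is therefore marked at a point close to `b.pt`, where the same `f` still describes the
-- submanifold.
theorem IsSubChart2.eventually_eq_jetExt {b : PointedSub V W E} {f : V → W}
    (hf : IsGraphAt φ b.carrier b.pt f) :
    ∀ᶠ η in 𝓝 b.jet2, η ∈ b.prolongation2 → e η = jetExt f (e η).1 := by
  have hη := (he.mem_source b).2 ⟨f, hf⟩
  have hnhds : ∀ᶠ η in 𝓝 b.jet2, η ∈ e.source := e.open_source.mem_nhds hη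
  have hpt : ∀ b' : PointedSub V W E, b'.jet2 ∈ e.source →
      φ.symm ((e b'.jet2).1, (e b'.jet2).2.1) = b'.pt := by
    intro b' hb'
    obtain ⟨f', hf'⟩ := (he.mem_source b').1 hb'
    rw [he.apply_eq ⟨f', hf'⟩, PointedSub.coord2_eq_of_graph hf',
      show ((φ b'.pt).1, f' (φ b'.pt).1) = φ b'.pt from Prod.ext rfl (hf'.snd_eq b'.mem).symm,
      φ.left_inv hf'.mem_source]
  have hc : Filter.Tendsto (fun η => φ.symm ((e η).1, (e η).2.1)) (𝓝 b.jet2) (𝓝 b.pt) := by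
    have h1 := φ.continuousAt_symm (he.mem_target hη)
    rw [ContinuousAt, hpt b hη] at h1
    have h2 : Continuous fun d : SubModel2 V W => (d.1, d.2.1) := by fun_prop
    exact h1.comp (h2.continuousAt.comp (e.continuousAt hη))
  filter_upwards [hnhds, hc.eventually hf.eventually]
  rintro _ hs hg ⟨b', hb', rfl⟩
  rw [hpt b' hs, ← hb'] at hg
  rw [he.apply_eq ⟨f, hg⟩, PointedSub.coord2_eq_of_graph hg]
  rfl

/-- On the jets of submanifolds only this inclusion is needed: the Cartan vectors that occur there
are supplied by the projection. -/
theorem IsSubChart2.dchart_of_mem_subCartan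
    (hM : e ∈ IsManifold.maximalAtlas 𝓘(ℝ, SubModel2 V W) ∞ (SubJet2 V W E))
    {η : SubJet2 V W E} (hη : η ∈ e.source)
    {v : TangentSpace 𝓘(ℝ, SubModel2 V W) η} (hv : v ∈ subCartan η) :
    (dchart e η v).2.1 = (e η).2.2.1 (dchart e η v).1 ∧
      (dchart e η v).2.2.1 = (e η).2.2.2.toBilin (dchart e η v).1 := by
  induction hv using Submodule.span_induction with
  | zero => simp
  | add v w _ _ hv hw =>
    rw [map_add, Prod.fst_add, Prod.snd_add, Prod.fst_add, Prod.snd_add, Prod.fst_add, map_add,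
      map_add, hv.1, hv.2, hw.1, hw.2]
    exact ⟨rfl, rfl⟩
  | smul r v _ hv =>
    rw [map_smul, Prod.smul_fst, Prod.smul_snd, Prod.smul_fst, Prod.smul_snd, Prod.smul_fst,
      map_smul, map_smul, hv.1, hv.2]
    exact ⟨rfl, rfl⟩
  | mem v hv =>
    obtain ⟨b, rfl, hv⟩ := hv
    obtain ⟨f, hf⟩ := (he.mem_source b).1 hη
    have hk := hf.smooth.self_of_nhds
    have heb := he.apply_eq ⟨f, hf⟩
    have hgr := PointedSub.coord2_eq_of_graph hf
    have h1 : (ContinuousLinearMap.fst ℝ V (W × (V →L[ℝ] W) × SymBilin V W)) (e b.jet2) =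
        (φ b.pt).1 := by
      rw [heb]
      rfl
    have h2 := dchart_eq_of_mem_tangentVectors hM hη
      (π := ContinuousLinearMap.fst ℝ V (W × (V →L[ℝ] W) × SymBilin V W))
      (J := jetExt f) (by rw [h1]; exact contDiffAt_jetExt hk) (he.eventually_eq_jetExt hf) hv
    rw [h1, ContinuousLinearMap.coe_fst', fderiv_jetExt hk] at h2
    have h3 : (e b.jet2).2.2.2.toBilin = fderiv ℝ (fderiv ℝ f) (φ b.pt).1 := by
      rw [heb, PointedSub.toBilin_coord2 hf]
    rw [h3, heb, hgr]
    exact ⟨congrArg (fun c => c.2.1) h2, congrArg (fun c => c.2.2.1) h2⟩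

end SubCartan

/-! ### The equations as graphs over the first jets -/

section EquationTangent

variable (V F : Type*) [NormedAddCommGroup V] [NormedSpace ℝ V]
  [NormedAddCommGroup F] [NormedSpace ℝ F]

/-- The projection `(x, u, u_x, u_xx) ↦ (x, u, u_x)`. -/
def truncation : MapModel2 V F →L[ℝ] MapModel1 V F :=
  (ContinuousLinearMap.id ℝ V).prodMap ((ContinuousLinearMap.id ℝ F).prodMap
    (ContinuousLinearMap.fst ℝ (V →L[ℝ] F) (SymBilin V F)))

variable {V F}

theorem truncation_apply (c : MapModel2 V F) : truncation V F c = (c.1, c.2.1, c.2.2.1) := rfl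

/-- The equation of parametrized totally geodesic submanifolds, solved for the second
derivatives. -/
def mapGeodesicSection (G : F → F →L[ℝ] F →L[ℝ] F) (c : MapModel1 V F) : MapModel2 V F :=
  (c.1, c.2.1, c.2.2, SymBilin.symmetrize V F (-pullBilin (G c.2.1) c.2.2))

theorem contDiffAt_mapGeodesicSection {G : F → F →L[ℝ] F →L[ℝ] F} {c : MapModel1 V F}
    (hG : ContDiffAt ℝ ∞ G c.2.1) : ContDiffAt ℝ ∞ (mapGeodesicSection (V := V) G) c := by
  have hu : ContDiffAt ℝ ∞ (fun c : MapModel1 V F => c.2.1) c := by fun_prop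
  have hA : ContDiffAt ℝ ∞ (fun c : MapModel1 V F => c.2.2) c := by fun_prop
  exact contDiffAt_fst.prodMk (hu.prodMk (hA.prodMk
    ((SymBilin.symmetrize V F).contDiff.contDiffAt.comp c
      (contDiffAt_pullBilin (ContDiffAt.comp (g := G) c hG hu) hA).neg)))

theorem mapGeodesicEq_mapGeodesicSection {G : F → F →L[ℝ] F →L[ℝ] F} {c : MapModel1 V F}
    (hG : ∀ v w, G c.2.1 v w = G c.2.1 w v) : MapGeodesicEq G (mapGeodesicSection G c) := by
  intro v w
  rw [mapGeodesicSection, SymBilin.toBilin_symmetrize fun v w => by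
    rw [neg_apply, neg_apply, neg_apply, neg_apply, pullBilin_apply, pullBilin_apply, hG]]
  exact neg_add_cancel _

theorem MapGeodesicEq.eq_section {G : F → F →L[ℝ] F →L[ℝ] F} {c : MapModel2 V F}
    (h : MapGeodesicEq G c) : c = mapGeodesicSection G (truncation V F c) := by
  refine Prod.ext rfl (Prod.ext rfl (Prod.ext rfl ?_))
  rw [← SymBilin.symmetrize_toBilin c.2.2.2, h.toBilin_eq]
  rfl

/-- The section is a right inverse of `truncation`, and this identity is differentiated. Hence every
vector on the first jets lifts to the graph. -/
theorem truncation_fderiv_mapGeodesicSection {G : F → F →L[ℝ] F →L[ℝ] F} {c : MapModel1 V F}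
    (hG : ContDiffAt ℝ ∞ G c.2.1) (w : MapModel1 V F) :
    truncation V F (fderiv ℝ (mapGeodesicSection G) c w) = w := by
  have h := (truncation V F).hasFDerivAt.comp c
    (hasFDerivAt_of_smooth (contDiffAt_mapGeodesicSection hG))
  exact congrArg (fun L : MapModel1 V F →L[ℝ] MapModel1 V F => L w)
    (h.unique (hasFDerivAt_id (𝕜 := ℝ) c))

variable {W : Type*} [NormedAddCommGroup W] [NormedSpace ℝ W]

/-- The equation of unparametrized totally geodesic submanifolds, solved for the second
derivatives. -/
def subGeodesicSection (G : V × W → V × W →L[ℝ] V × W →L[ℝ] V × W) (d : MapModel1 V W) :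
    SubModel2 V W :=
  (d.1, d.2.1, d.2.2, SymBilin.symmetrize V W (-pullBilin (pushBilin
    (ContinuousLinearMap.snd ℝ V W - d.2.2.comp (ContinuousLinearMap.fst ℝ V W)) (G (d.1, d.2.1)))
    ((ContinuousLinearMap.id ℝ V).prod d.2.2)))

theorem contDiffAt_subGeodesicSection {G : V × W → V × W →L[ℝ] V × W →L[ℝ] V × W}
    {d : MapModel1 V W} (hG : ContDiffAt ℝ ∞ G (d.1, d.2.1)) :
    ContDiffAt ℝ ∞ (subGeodesicSection G) d := by
  have hb : ContDiffAt ℝ ∞ (fun d : MapModel1 V W => (d.1, d.2.1)) d := by fun_prop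
  have hu : ContDiffAt ℝ ∞ (fun d : MapModel1 V W => d.2.1) d := by fun_prop
  have hC : ContDiffAt ℝ ∞ (fun d : MapModel1 V W => d.2.2) d := by fun_prop
  have hA : ContDiffAt ℝ ∞
      (fun d : MapModel1 V W => (ContinuousLinearMap.id ℝ V).prod d.2.2) d :=
    ((contDiff_prod_id (V := V) (W := W)).contDiffAt).comp d hC
  have hl : ContDiffAt ℝ ∞ (fun d : MapModel1 V W =>
      ContinuousLinearMap.snd ℝ V W - d.2.2.comp (ContinuousLinearMap.fst ℝ V W)) d :=
    contDiffAt_const.sub (hC.clm_comp contDiffAt_const)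
  have hG' : ContDiffAt ℝ ∞ (fun d : MapModel1 V W => G (d.1, d.2.1)) d :=
    ContDiffAt.comp (g := G) d hG hb
  exact contDiffAt_fst.prodMk (hu.prodMk (hC.prodMk
    ((SymBilin.symmetrize V W).contDiff.contDiffAt.comp d
      (contDiffAt_pullBilin (contDiffAt_pushBilin hl hG') hA).neg)))

theorem SubGeodesicEq.eq_section {G : V × W → V × W →L[ℝ] V × W →L[ℝ] V × W} {d : SubModel2 V W}
    (h : SubGeodesicEq G d) : d = subGeodesicSection G (truncation V W d) := by
  refine Prod.ext rfl (Prod.ext rfl (Prod.ext rfl ?_))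
  have h1 : d.2.2.2.toBilin = -pullBilin (pushBilin
      (ContinuousLinearMap.snd ℝ V W - d.2.2.1.comp (ContinuousLinearMap.fst ℝ V W))
      (G (d.1, d.2.1))) ((ContinuousLinearMap.id ℝ V).prod d.2.2.1) := by
    ext v w
    exact eq_neg_of_add_eq_zero_left (h v w)
  rw [← SymBilin.symmetrize_toBilin d.2.2.2, h1]
  rfl

/-- The first coordinate of the projection is the linear map `c ↦ c.2.1.1`. No other part of the
differential has to be computed, since an induced Cartan vector is determined by its first
coordinate. -/
theorem fderiv_quotCoord2_fst [FiniteDimensional ℝ V] {c : MapModel2 V (V × W)}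
    (hc : ((ContinuousLinearMap.fst ℝ V W).comp c.2.2.1).IsInvertible)
    (w : MapModel2 V (V × W)) : (fderiv ℝ quotCoord2 c w).1 = w.2.1.1 := by
  have h := (hasFDerivAt_of_smooth (contDiffAt_quotCoord2 hc)).fst
  have h' : HasFDerivAt (fun c : MapModel2 V (V × W) => c.2.1.1) _ c :=
    (hasFDerivAt_id (𝕜 := ℝ) c).snd.fst.fst
  exact congrArg (fun L : MapModel2 V (V × W) →L[ℝ] V => L w) (h.unique h')

end EquationTangent

/-! ### The induced Cartan plane of the parametrized equation -/

section InducedCartan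

variable {V F E : Type*} [NormedAddCommGroup V] [NormedSpace ℝ V] [FiniteDimensional ℝ V]
  [NormedAddCommGroup F] [NormedSpace ℝ F] [FiniteDimensional ℝ F] [CompleteSpace F]
  [TopologicalSpace E] [ChartedSpace F E] [IsManifold 𝓘(ℝ, F) ∞ E]
  [TopologicalSpace (MapJet2 V F E)] [ChartedSpace (MapModel2 V F) (MapJet2 V F E)]
  [IsManifold 𝓘(ℝ, MapModel2 V F) ∞ (MapJet2 V F E)]
  {φ : OpenPartialHomeomorph E F} (hφ : φ ∈ IsManifold.maximalAtlas 𝓘(ℝ, F) ∞ E)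
  {e : OpenPartialHomeomorph (MapJet2 V F E) (MapModel2 V F)}
  (hM : e ∈ IsManifold.maximalAtlas 𝓘(ℝ, MapModel2 V F) ∞ (MapJet2 V F E))
  (he : IsMapChart2 φ e) {θ : MapJet2 V F E} (hθ : θ ∈ e.source)
  {Γ : CovariantDerivative 𝓘(ℝ, F) F (TangentSpace 𝓘(ℝ, F) : E → Type _)}
  {G : F → F →L[ℝ] F →L[ℝ] F} (hG : IsChristoffel Γ φ G)

include hφ hM he hθ hG

/-- The vectors of the induced Cartan plane in coordinates. -/
theorem IsMapChart2.dchart_of_mem_inducedCartan {v : TangentSpace 𝓘(ℝ, MapModel2 V F) θ}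
    (hv : v ∈ mapCartan θ) (hv' : v ∈ tangentVectors (MapModel2 V F) (parametrizedEq V Γ) θ) :
    dchart e θ v = fderiv ℝ (mapGeodesicSection G) (truncation V F (e θ))
      ((dchart e θ v).1, (e θ).2.2.1 (dchart e θ v).1,
        (e θ).2.2.2.toBilin (dchart e θ v).1) := by
  have hu : (e θ).2.1 ∈ φ.target := (he.target_iff hφ).1 (e.map_source hθ)
  have hnhds : ∀ᶠ θ in 𝓝 θ, θ ∈ e.source := e.open_source.mem_nhds hθ
  obtain ⟨h1, h2⟩ := he.dchart_of_mem_mapCartan hφ hM hθ hv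
  -- A vector tangent to the graph is determined by its truncation, which the contact relations
  -- express through the base component.
  have h3 := dchart_eq_of_mem_tangentVectors hM hθ (π := truncation V F)
    (contDiffAt_mapGeodesicSection (hG.smooth.contDiffAt (φ.open_target.mem_nhds hu)))
    (hnhds.mono fun θ' hθ' h => ((he.mem_parametrizedEq_iff hφ hG hθ').1 h).2.eq_section) hv'
  rwa [truncation_apply (dchart e θ v), h1, h2] at h3

end InducedCartan


/-! ### The projection of the induced Cartan planes -/

section Projection

variable {V W E : Type*} [NormedAddCommGroup V] [NormedSpace ℝ V] [FiniteDimensional ℝ V]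
  [NormedAddCommGroup W] [NormedSpace ℝ W] [FiniteDimensional ℝ W]
  [TopologicalSpace E] [ChartedSpace (V × W) E] [IsManifold 𝓘(ℝ, V × W) ∞ E]
  [TopologicalSpace (MapJet2 V (V × W) E)] [TopologicalSpace (SubJet2 V W E)]

omit [TopologicalSpace (SubJet2 V W E)] in
-- The restriction to nearby jets keeps the base point in `U`. The prolongation of `a` also contains
-- jets over points outside `U`, whose images need not belong to `b`.
theorem IsImageOf.eventually_proE2_mem_prolongation2 {a : LocalMap V (V × W) E}
    {b : PointedSub V W E} (h : IsImageOf a b) {φ : OpenPartialHomeomorph E (V × W)}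
    {e : OpenPartialHomeomorph (MapJet2 V (V × W) E) (MapModel2 V (V × W))}
    (he : IsMapChart2 φ e) (ha : a.jet2 ∈ e.source) :
    ∀ᶠ θ in 𝓝 a.jet2, θ ∈ a.prolongation2 → proE2 θ ∈ b.prolongation2 := by
  obtain ⟨-, U, hU, hx, hb, hs⟩ := h
  have hc : ContinuousAt (fun θ => (e θ).1) a.jet2 :=
    continuous_fst.continuousAt.comp (e.continuousAt ha)
  have hpt : ∀ a' : LocalMap V (V × W) E, a'.jet2 ∈ e.source → (e a'.jet2).1 = a'.pt :=
    fun a' h' => (he.coord a' ((he.mem_source a').1 h')).1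
  have hnhds : ∀ᶠ θ in 𝓝 a.jet2, θ ∈ e.source := e.open_source.mem_nhds ha
  filter_upwards [hnhds, hc.eventually_mem (hU.mem_nhds (by rw [hpt a ha]; exact hx))]
  rintro _ h1 h2 ⟨a', ha', rfl⟩
  rw [hpt a' h1] at h2
  let b' : PointedSub V W E := ⟨b.carrier, b.isSub, a'.toFun a'.pt, by
    rw [hb, ha']
    exact ⟨a'.pt, h2, rfl⟩⟩
  have hab : IsImageOf a' b' := ⟨rfl, U, hU, h2, by rw [ha']; exact hb, by rw [ha']; exact hs⟩
  exact ⟨b', rfl, hab.proE2_eq.symm⟩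

variable [ChartedSpace (MapModel2 V (V × W)) (MapJet2 V (V × W) E)]
  [ChartedSpace (SubModel2 V W) (SubJet2 V W E)]

/-- By linearity it suffices to treat vectors tangent to the prolongation of a section, and near the
given jet the projection sends that prolongation into the prolongation of the image. -/
theorem mfderiv_proE2_mem_subCartan (hM : IsMapJetManifold2 V (V × W) E)
    (hS : IsSubJetManifold2 V W E) {θ : MapJet2 V (V × W) E} (hθ : θ ∈ ImmJet2 V (V × W) E)
    {v : TangentSpace 𝓘(ℝ, MapModel2 V (V × W)) θ} (hv : v ∈ mapCartan θ) :
    mfderiv 𝓘(ℝ, MapModel2 V (V × W)) 𝓘(ℝ, SubModel2 V W) proE2 θ v ∈ subCartan (proE2 θ) := by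
  have hP := contMDiffAt_proE2 hM hS hθ
  obtain ⟨φ, hφ, hφe⟩ := exists_chart_of_mem_immJet2 hθ
  obtain ⟨e, he, hec⟩ := hM.2 ⟨φ, hφ⟩
  have hs := (hφe e hec).1
  have h : mapCartan θ ≤ (subCartan (proE2 θ)).comap (mfderiv 𝓘(ℝ, MapModel2 V (V × W))
      𝓘(ℝ, SubModel2 V W) proE2 θ).toLinearMap := by
    refine Submodule.span_le.2 ?_
    rintro v ⟨a, rfl, hv⟩
    obtain ⟨b, hb⟩ := (LocalMap.jet2_mem_immJet2.1 hθ).exists_isImageOf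
    exact Submodule.subset_span ⟨b, hb.proE2_eq.symm,
      mfderiv_mem_tangentVectors hP (hb.eventually_proE2_mem_prolongation2 hec hs) hv⟩
  exact h hv

variable [T2Space E] [CompleteSpace (V × W)] [CompleteSpace V] [CompleteSpace W]
  {Γ : CovariantDerivative 𝓘(ℝ, V × W) (V × W) (TangentSpace 𝓘(ℝ, V × W) : E → Type _)}
  {φ : OpenPartialHomeomorph E (V × W)} (hφ : φ ∈ IsManifold.maximalAtlas 𝓘(ℝ, V × W) ∞ E)
  {G : V × W → V × W →L[ℝ] V × W →L[ℝ] V × W} (hG : IsChristoffel Γ φ G)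

include hφ hG

omit [FiniteDimensional ℝ V] [FiniteDimensional ℝ W]
  [TopologicalSpace (MapJet2 V (V × W) E)] [T2Space E] [CompleteSpace (V × W)]
  [ChartedSpace (MapModel2 V (V × W)) (MapJet2 V (V × W) E)] in
/-- The vectors of the induced Cartan plane in coordinates. -/
theorem IsSubChart2.dchart_of_mem_inducedCartan [IsManifold 𝓘(ℝ, SubModel2 V W) ∞ (SubJet2 V W E)]
    {e : OpenPartialHomeomorph (SubJet2 V W E) (SubModel2 V W)}
    (hM : e ∈ IsManifold.maximalAtlas 𝓘(ℝ, SubModel2 V W) ∞ (SubJet2 V W E))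
    (he : IsSubChart2 φ e) {η : SubJet2 V W E} (hη : η ∈ e.source)
    {v : TangentSpace 𝓘(ℝ, SubModel2 V W) η} (hv : v ∈ subCartan η)
    (hv' : v ∈ tangentVectors (SubModel2 V W) (unparametrizedEq Γ) η) :
    dchart e η v = fderiv ℝ (subGeodesicSection G) (truncation V W (e η))
      ((dchart e η v).1, (e η).2.2.1 (dchart e η v).1,
        (e η).2.2.2.toBilin (dchart e η v).1) := by
  have hnhds : ∀ᶠ η in 𝓝 η, η ∈ e.source := e.open_source.mem_nhds hη
  obtain ⟨h1, h2⟩ := he.dchart_of_mem_subCartan hM hη hv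
  have h3 := dchart_eq_of_mem_tangentVectors hM hη (π := truncation V W)
    (contDiffAt_subGeodesicSection
      (hG.smooth.contDiffAt (φ.open_target.mem_nhds (he.mem_target hη))))
    (hnhds.mono fun η' hη' h => ((he.mem_unparametrizedEq_iff hφ hG hη').1 h).eq_section) hv'
  rwa [truncation_apply (dchart e η v), h1, h2] at h3

omit [TopologicalSpace (SubJet2 V W E)] [ChartedSpace (SubModel2 V W) (SubJet2 V W E)]
  [T2Space E] [CompleteSpace W] in
/-- The induced Cartan plane contains a vector over each vector of the parameter space. -/
theorem IsMapChart2.exists_mem_inducedCartan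
    [IsManifold 𝓘(ℝ, MapModel2 V (V × W)) ∞ (MapJet2 V (V × W) E)]
    {e : OpenPartialHomeomorph (MapJet2 V (V × W) E) (MapModel2 V (V × W))}
    (hM : e ∈ IsManifold.maximalAtlas 𝓘(ℝ, MapModel2 V (V × W)) ∞ (MapJet2 V (V × W) E))
    (he : IsMapChart2 φ e) {θ : MapJet2 V (V × W) E} (hθ : θ ∈ e.source)
    (hA : ((ContinuousLinearMap.fst ℝ V W).comp (e θ).2.2.1).IsInvertible)
    (h : θ ∈ parametrizedEq V Γ) (p : V) :
    ∃ v ∈ mapCartan θ, v ∈ tangentVectors (MapModel2 V (V × W)) (parametrizedEq V Γ) θ ∧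
      (dchart e θ v).1 = p ∧ (dchart e θ v).2.1 = (e θ).2.2.1 p := by
  have hgeo := ((he.mem_parametrizedEq_iff hφ hG hθ).1 h).2
  have hu : (e θ).2.1 ∈ φ.target := (he.target_iff hφ).1 (e.map_source hθ)
  have hGu := hG.smooth.contDiffAt (φ.open_target.mem_nhds hu)
  -- The first-jet part of a Cartan vector over `p`, as dictated by the contact relations; the
  -- differential of `mapGeodesicSection` lifts it to a vector tangent to the equation.
  let z : MapModel1 V (V × W) := (p, (e θ).2.2.1 p, (e θ).2.2.2.toBilin p)
  have hdb := dchart_isInvertible hM hθ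
  let v : TangentSpace 𝓘(ℝ, MapModel2 V (V × W)) θ := (dchart e θ).inverse
    (fderiv ℝ (mapGeodesicSection G) (truncation V (V × W) (e θ)) z)
  have hv : dchart e θ v = fderiv ℝ (mapGeodesicSection G) (truncation V (V × W) (e θ)) z :=
    hdb.self_apply_inverse _
  have hvz : truncation V (V × W) (dchart e θ v) = z := by
    rw [hv]
    exact truncation_fderiv_mapGeodesicSection hGu z
  have h1 : (dchart e θ v).1 = p := congrArg (fun c => c.1) hvz
  have h2 : (dchart e θ v).2.1 = (e θ).2.2.1 p := congrArg (fun c => c.2.1) hvz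
  have h3 : (dchart e θ v).2.2.1 = (e θ).2.2.2.toBilin p := congrArg (fun c => c.2.2) hvz
  refine ⟨v, ?_, ?_, h1, h2⟩
  -- The membership criterion for the Cartan plane assumes a nonzero base component; over `p = 0`
  -- the lifted vector is zero.
  · by_cases hp : p = 0
    · have hz : z = 0 := by simp [z, hp]
      have hv0 : v = 0 := hdb.injective (by rw [hv, hz, map_zero, map_zero])
      rw [hv0]
      exact zero_mem _
    · exact he.mem_mapCartan_of_dchart hφ hM hθ (by rw [h2, h1]) (by rw [h3, h1])
        (by rw [h1]; exact hp)
  · refine mem_tangentVectors_of_dchart_eq hM hθ (π := truncation V (V × W))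
      (contDiffAt_mapGeodesicSection hGu) hgeo.eq_section.symm ?_ (by rw [hvz, hv])
    have hc1 : Continuous fun c : MapModel1 V (V × W) => c.2.1 := by fun_prop
    have hc2 : Continuous fun c : MapModel1 V (V × W) =>
        (ContinuousLinearMap.fst ℝ V W).comp c.2.2 :=
      (contDiff_const.clm_comp contDiff_snd.snd : ContDiff ℝ ∞ _).continuous
    -- The nearby values of the section lie in the equation: the first component of `u_x` stays
    -- invertible, so the jets stay immersive.
    filter_upwards [hc1.continuousAt.eventually_mem (φ.open_target.mem_nhds hu),
      hc2.continuousAt.eventually_mem (isOpen_setOf_isInvertible.mem_nhds hA)] with c h4 h5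
    have h6 : mapGeodesicSection G c ∈ e.target := (he.target_iff hφ).2 h4
    refine ⟨h6, (he.mem_parametrizedEq_iff hφ hG (e.map_target h6)).2 ?_⟩
    rw [e.right_inv h6]
    exact ⟨injective_of_isInvertible_fst_comp (A := c.2.2) h5,
      mapGeodesicEq_mapGeodesicSection (hG.symm _ h4)⟩

omit hφ hG in
-- Induced Cartan vectors are determined by the base component `p` for maps and by the first
-- coordinate for submanifolds. In these terms the differential is `p ↦ A₁ p`, with `A₁` invertible.
theorem bijOn_mfderiv_proE2 (hM : IsMapJetManifold2 V (V × W) E) (hS : IsSubJetManifold2 V W E)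
    (hΓ : IsTorsionFreeConnection Γ) {θ : MapJet2 V (V × W) E} (hθ : θ ∈ parametrizedEq V Γ) :
    Set.BijOn (mfderiv 𝓘(ℝ, MapModel2 V (V × W)) 𝓘(ℝ, SubModel2 V W) proE2 θ)
      ((mapCartan θ : Set (TangentSpace 𝓘(ℝ, MapModel2 V (V × W)) θ)) ∩
        tangentVectors (MapModel2 V (V × W)) (parametrizedEq V Γ) θ)
      ((subCartan (proE2 θ) : Set (TangentSpace 𝓘(ℝ, SubModel2 V W) (proE2 θ))) ∩
        tangentVectors (SubModel2 V W) (unparametrizedEq Γ) (proE2 θ)) := by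
  have hi := parametrizedEq_subset_immJet2 hθ
  have := hM.1
  have := hS.1
  obtain ⟨φ, hφ, hφe⟩ := exists_chart_of_mem_immJet2 hi
  obtain ⟨e, he, hec⟩ := hM.2 ⟨φ, hφ⟩
  obtain ⟨e', he', hec'⟩ := hS.2 ⟨φ, hφ⟩
  obtain ⟨G, hG⟩ := exists_isChristoffel hφ Γ hΓ
  obtain ⟨hs, hA⟩ := hφe e hec
  have hs' := (hec.proE2_apply hφ hec' hs hA).1
  have hd : ∀ v : TangentSpace 𝓘(ℝ, MapModel2 V (V × W)) θ, (dchart e' (proE2 θ)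
      (mfderiv 𝓘(ℝ, MapModel2 V (V × W)) 𝓘(ℝ, SubModel2 V W) proE2 θ v)).1 =
        (dchart e θ v).2.1.1 := fun v => by
    rw [dchart_mfderiv he hs he' (contDiffAt_quotCoord2 hA), fderiv_quotCoord2_fst hA]
    filter_upwards [eventually_isInvertible_chart2 hs hA] with θ' hθ'
    exact hec.proE2_apply hφ hec' hθ'.1 hθ'.2
  have hmaps : ∀ v ∈ mapCartan θ, v ∈ tangentVectors (MapModel2 V (V × W)) (parametrizedEq V Γ) θ →
      mfderiv 𝓘(ℝ, MapModel2 V (V × W)) 𝓘(ℝ, SubModel2 V W) proE2 θ v ∈ subCartan (proE2 θ) ∧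
      mfderiv 𝓘(ℝ, MapModel2 V (V × W)) 𝓘(ℝ, SubModel2 V W) proE2 θ v ∈
        tangentVectors (SubModel2 V W) (unparametrizedEq Γ) (proE2 θ) := fun v h1 h2 =>
    ⟨mfderiv_proE2_mem_subCartan hM hS hi h1,
      mfderiv_mem_tangentVectors (contMDiffAt_proE2 hM hS hi) (.of_forall fun θ' h => by
        rw [← (isSmoothQuotient_proE2 hM hS hΓ).image]
        exact ⟨θ', h, rfl⟩) h2⟩
  refine ⟨fun v hv => hmaps v hv.1 hv.2, fun v hv w hw hvw => ?_, fun w hw => ?_⟩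
  · have h1 : (dchart e θ v).2.1.1 = (dchart e θ w).2.1.1 := by rw [← hd, ← hd, hvw]
    rw [(hec.dchart_of_mem_mapCartan hφ he hs hv.1).1,
      (hec.dchart_of_mem_mapCartan hφ he hs hw.1).1] at h1
    have h2 : (dchart e θ v).1 = (dchart e θ w).1 := hA.injective h1
    refine (dchart_isInvertible he hs).injective ?_
    rw [hec.dchart_of_mem_inducedCartan hφ he hs hG hv.1 hv.2, h2,
      ← hec.dchart_of_mem_inducedCartan hφ he hs hG hw.1 hw.2]
  -- The image of the vector over `p` and the given `w` are both induced Cartan vectors with the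
  -- same first coordinate, hence equal.
  · obtain ⟨p, hp⟩ := hA.surjective (dchart e' (proE2 θ) w).1
    obtain ⟨v, hv1, hv2, -, hv3⟩ := hec.exists_mem_inducedCartan hφ hG he hs hA hθ p
    refine ⟨v, ⟨hv1, hv2⟩, ?_⟩
    obtain ⟨h1, h2⟩ := hmaps v hv1 hv2
    have h3 := hd v
    rw [hv3] at h3
    replace h3 := h3.trans hp
    refine (dchart_isInvertible he' hs').injective ?_
    rw [hec'.dchart_of_mem_inducedCartan hφ hG he' hs' h1 h2, h3,
      ← hec'.dchart_of_mem_inducedCartan hφ hG he' hs' hw.1 hw.2]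

end Projection

end GeodesicJets

end

/-! ### The theorem, assembled for `V = ℝⁿ` and `W = ℝᵐ` -/

theorem mainTheorem12 (n m : ℕ) {E : Type*} [TopologicalSpace E] [T2Space E] [Nonempty E]
    [ChartedSpace (Rnm n m) E] [IsManifold 𝓘(ℝ, Rnm n m) ∞ E]
    (Γ : CovariantDerivative 𝓘(ℝ, Rnm n m) (Rnm n m) (TangentSpace 𝓘(ℝ, Rnm n m) : E → Type _))
    (hΓ : IsTorsionFreeConnection Γ) :
    -- the manifold structures of the affine group and of the four jet spaces
    ∃ (_ : TopologicalSpace (Aff n)) (_ : ChartedSpace (AffModel n) (Aff n))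
      (_ : TopologicalSpace (MapJet1 (Rn n) (Rnm n m) E))
      (_ : ChartedSpace (MapModel1 (Rn n) (Rnm n m)) (MapJet1 (Rn n) (Rnm n m) E))
      (_ : TopologicalSpace (MapJet2 (Rn n) (Rnm n m) E))
      (_ : ChartedSpace (MapModel2 (Rn n) (Rnm n m)) (MapJet2 (Rn n) (Rnm n m) E))
      (_ : TopologicalSpace (SubJet1 (Rn n) (Rn m) E))
      (_ : ChartedSpace (SubModel1 (Rn n) (Rn m)) (SubJet1 (Rn n) (Rn m) E))
      (_ : TopologicalSpace (SubJet2 (Rn n) (Rn m) E))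
      (_ : ChartedSpace (SubModel2 (Rn n) (Rn m)) (SubJet2 (Rn n) (Rn m) E)),
      IsAffManifold (Rn n) ∧
      IsMapJetManifold1 (Rn n) (Rnm n m) E ∧ IsMapJetManifold2 (Rn n) (Rnm n m) E ∧
      IsSubJetManifold1 (Rn n) (Rn m) E ∧ IsSubJetManifold2 (Rn n) (Rn m) E ∧
      -- the affine group is a Lie group which acts smoothly and effectively on the parametrized
      -- jets, by external symmetries of the parametrized equation
      LieGroup 𝓘(ℝ, AffModel n) ∞ (Aff n) ∧
      ContMDiffSMul 𝓘(ℝ, AffModel n) 𝓘(ℝ, MapModel1 (Rn n) (Rnm n m)) ∞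
        (Aff n) (MapJet1 (Rn n) (Rnm n m) E) ∧
      ContMDiffSMul 𝓘(ℝ, AffModel n) 𝓘(ℝ, MapModel2 (Rn n) (Rnm n m)) ∞
        (Aff n) (MapJet2 (Rn n) (Rnm n m) E) ∧
      Function.Injective (MulAction.toPermHom (Aff n) (MapJet2 (Rn n) (Rnm n m) E)) ∧
      (∀ g : Aff n, IsExternalSymmetry (parametrizedEq (Rn n) Γ)
        (MulAction.toPermHom (Aff n) (MapJet2 (Rn n) (Rnm n m) E) g)) ∧
      -- the projections from jets of immersions to jets of submanifolds are well defined
      IsOpen (ImmJet1 (Rn n) (Rnm n m) E) ∧ IsOpen (ImmJet2 (Rn n) (Rnm n m) E) ∧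
      (∀ θ ∈ ImmJet1 (Rn n) (Rnm n m) E, ∀ η : SubJet1 (Rn n) (Rn m) E,
        Prolongs1 θ η ↔ proE1 θ = η) ∧
      (∀ θ ∈ ImmJet2 (Rn n) (Rnm n m) E, ∀ η : SubJet2 (Rn n) (Rn m) E,
        Prolongs2 θ η ↔ proE2 θ = η) ∧
      -- the quotient of the first jets of immersions is `J¹(E, n)`
      IsSmoothQuotient (G := Aff n) (BX := MapModel1 (Rn n) (Rnm n m))
        (BY := SubModel1 (Rn n) (Rn m))
        (ImmJet1 (Rn n) (Rnm n m) E) (Set.univ : Set (SubJet1 (Rn n) (Rn m) E)) proE1 ∧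
      -- the quotient of the parametrized equation is the unparametrized one, and the projection
      -- maps the induced Cartan planes isomorphically
      IsSmoothQuotient (G := Aff n) (BX := MapModel2 (Rn n) (Rnm n m))
        (BY := SubModel2 (Rn n) (Rn m))
        (parametrizedEq (Rn n) Γ) (unparametrizedEq Γ) proE2 ∧
      ∀ θ ∈ parametrizedEq (Rn n) Γ,
        Set.BijOn
          (mfderiv 𝓘(ℝ, MapModel2 (Rn n) (Rnm n m)) 𝓘(ℝ, SubModel2 (Rn n) (Rn m)) proE2 θ)
          ((mapCartan θ : Set (TangentSpace 𝓘(ℝ, MapModel2 (Rn n) (Rnm n m)) θ)) ∩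
            tangentVectors (MapModel2 (Rn n) (Rnm n m)) (parametrizedEq (Rn n) Γ) θ)
          ((subCartan (proE2 θ) :
              Set (TangentSpace 𝓘(ℝ, SubModel2 (Rn n) (Rn m)) (proE2 θ))) ∩
            tangentVectors (SubModel2 (Rn n) (Rn m)) (unparametrizedEq Γ) (proE2 θ)) := by
  obtain ⟨tA, cA, hA⟩ := exists_isAffManifold (Rn n)
  obtain ⟨t1, c1, hM1⟩ := exists_isMapJetManifold1 (Rn n) (Rnm n m) E
  obtain ⟨t2, c2, hM2⟩ := exists_isMapJetManifold2 (Rn n) (Rnm n m) E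
  obtain ⟨s1, d1, hS1⟩ := exists_isSubJetManifold1 (Rn n) (Rn m) E
  obtain ⟨s2, d2, hS2⟩ := exists_isSubJetManifold2 (Rn n) (Rn m) E
  exact ⟨tA, cA, t1, c1, t2, c2, s1, d1, s2, d2, hA, hM1, hM2, hS1, hS2, hA.lieGroup,
    hM1.contMDiffSMul hA, hM2.contMDiffSMul hA, toPermHom_mapJet2_injective,
    isExternalSymmetry_smul hM2 hΓ, isOpen_immJet1 hM1, isOpen_immJet2 hM2,
    fun θ hθ η => prolongs1_iff hθ η, fun θ hθ η => prolongs2_iff hθ η,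
    isSmoothQuotient_proE1 hM1 hS1, isSmoothQuotient_proE2 hM2 hS2 hΓ,
    fun θ hθ => bijOn_mfderiv_proE2 hM2 hS2 hΓ hθ⟩
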